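/- Let $k,h>0$, and let $\Omega_b=\{x\in\mathbb{R}^2: x_2>-h\}\setminus\{(x_1,0):x_1\le 0\}$ be the cracked half-plane, with source point $x^*\in\Omega_b$. All square roots are principal (cut along the negative real axis), $\mu(\xi)=\sqrt{k^2-\xi^2}$, and $\operatorname{Log}$ is the principal logarithm. Let $\mathcal L=\{s+\mathrm i\eta(s)\}$ be a path through the origin running from $-\infty+0\mathrm i$ to $+\infty-0\mathrm i$, with $\eta\in C^\infty(\mathbb R)$, $\eta>0$ on $(-\infty,0)$, $\eta<0$ on $(0,\infty)$, $\eta(s)\to0$ as $s\to\pm\infty$ and $\eta'$ bounded. Put $\mu_m=m\pi/h$, let $M$ be the largest integer with $\mu_M\le k$, let $\xi_m=\sqrt{k^2-\mu_m^2}\ge 0$ and $\phi_m(x)=e^{-\mathrm i\xi_mx_1}\sin(\mu_mx_2)$ for $1\le m\le M$. Fix $\varepsilon=0$ if $e^{2\mathrm ikh}\ne1$. If $e^{2\mathrm ikh}=1$, fix $\varepsilon>0$ with $\varepsilon<k$, with $\varepsilon<\xi_m$ whenever $\xi_m>0$, and such that $1-e^{2\mathrm i\mu h}$ has no zero on $\mathcal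 L-\varepsilon$ or on $\mathcal L+\varepsilon$. Above and below $\mathcal L$ respectively, put $$K^\pm(\xi)=\exp\Big\{\pm\frac1{2\pi\mathrm i}\int_{\mathcal L}\frac{\operatorname{Log}(1-e^{2\mathrm i\mu(t)h})}{t-\xi}\,dt\Big\},$$ with values on $\mathcal L$ given by $\sqrt{1-e^{2\mathrm i\mu h}}$ times the exponential of the principal value integral, and continued across $\mathcal L$ by $K^+K^-=1-e^{2\mathrm i\mu h}$. Put $$D(\xi)=\frac{e^{\mathrm i\xi x_1^*}S(\xi)K^-(\xi)}{\sqrt{k-\xi}},\qquad S(\xi)=\begin{cases}e^{\mathrm i\mu x_2^*},&x_2^*\ge0,\\[2pt] \dfrac{e^{\mathrm i\mu(2h+x_2^*)}-e^{-\mathrm i\mu x_2^*}}{e^{2\mathrm i\mu h}-1},&x_2^*<0.\end{cases}$$ Let $H^+(\xi)$ be $\frac1{2\pi\mathrm i}\int_{\mathcal L+\varepsilon}\frac{D(t)}{t-\xi}dt$ for $\xi$ above $\mathcal L+\varepsilon$, $\frac12D(\xi)$ plus the principal value of this integral for $\xi$ on $\mathcal L+\varepsilon$, and $D(\xi)$ plus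 this integral for $\xi$ below $\mathcal L+\varepsilon$. Put $$\hat f^+(\xi)=-\frac{H^+(\xi)K^+(\xi)}{2\mathrm i\sqrt{k+\xi}}.$$ In the strip $-h\le x_2\le0$ the outgoing Dirichlet Green function of $\Delta+k^2$ in $\Omega_b$ (normalised by $\Delta G+k^2G=-\delta_{x^*}$) is $G=G_2$ if $x_2^*\ge0$ and $G=G_2+G^{\rm in}$ if $-h<x_2^*<0$, where $$G_2(x)=\frac1{2\pi}\int_{\mathcal L-\varepsilon}\hat f^+(\xi)\,\frac{e^{-\mathrm i\mu x_2}-e^{\mathrm i\mu(x_2+2h)}}{1-e^{2\mathrm i\mu h}}\,e^{-\mathrm i\xi x_1}\,d\xi,$$ $$G^{\rm in}(x)=\int_{\mathcal L-\varepsilon}\Big[\frac{e^{\mathrm i\mu|x_2-x_2^*|}-e^{\mathrm i\mu(x_2-x_2^*)}}{-4\mathrm i\pi\mu}+\frac{(e^{\mathrm i\mu(2h+x_2^*)}-e^{-\mathrm i\mu x_2^*})(e^{-\mathrm i\mu x_2}-e^{\mathrm i\mu x_2})}{-4\mathrm i\pi(1-e^{2\mathrm i\mu h})\mu}\Big]e^{-\mathrm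 i\xi(x_1-x_1^*)}\,d\xi$$ are improper integrals (limits, as $R\to\infty$, of the integrals over the part of the path with parameter $s\in[-R,R]$). Then the integrals that define $G(x;x^*)$ converge for all $x_1<0$, $-h\le x_2\le 0$ with $x\ne x^*$, and $$G(x;x^*)=\sum_{m=1}^{M}c_m(x^*)\,\phi_m(x)+G^{\rm dec}(x;x^*),$$ where, for every $N\in\mathbb{N}$, $G^{\rm dec}(x;x^*)=O(|x_1|^{-N})$ as $x_1\to-\infty$, uniformly in $x_2\in[-h,0]$. The coefficients are as follows. If $\xi_m>0$, then $$c_m(x^*)=\frac{\mu_m}{\mathrm ih\xi_m}\hat f^+(\xi_m)+\begin{cases}0,&x_2^*\ge0,\\ \dfrac{\mathrm i}{h\xi_m}\sin(\mu_mx_2^*)\,e^{\mathrm i\xi_mx_1^*},&x_2^*<0.\end{cases}$$ If $\xi_M=0$ (a double zero of $1-e^{2\mathrm i\mu h}$ at $\xi=0$), then the limit $d=\lim_{\xi\to0,\,\xi\ne0}(\hat f^+)'(\xi)$ enters through $$c_M(x^*)=\frac{2\mu_M}{\mathrm ih}\,d-\begin{cases}0,&x_2^*\ge0,\\ \dfrac2h\,x_1^*\sin(\mu_Mx_2^*),&x_2^*<0,\end{cases}$$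 where the limit defining $c_M(x^*)$ exists. -/

import Mathlib

open Filter Topology
open scoped ContDiff

noncomputable section

namespace CrackedHalfPlane

/-- The principal square root (branch cut along the negative real axis, nonnegative real part). -/
def csqrt (w : ℂ) : ℂ := w ^ (1 / 2 : ℂ)

/-- The vertical wave number `μ(ξ) = √(k² - ξ²)`. -/
def mu (k : ℝ) (ξ : ℂ) : ℂ := csqrt ((k : ℂ) ^ 2 - ξ ^ 2)

/-- The Wiener-Hopf kernel `1 - exp(2 i μ(ξ) h)`. -/
def kernel (k h : ℝ) (ξ : ℂ) : ℂ := 1 - Complex.exp (2 * Complex.I * mu k ξ * h)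

/-- The background domain: the half plane `x₂ > -h` cut along the half line `x₁ ≤ 0, x₂ = 0`. -/
def domain (h : ℝ) : Set (ℝ × ℝ) := {x | -h < x.2 ∧ (x.2 = 0 → 0 < x.1)}

/-! ### Integration paths

A path is the graph `s ↦ s + i η(s)` of a height function `η`, run from left to right. -/

/-- A smooth path from `-∞ + 0i` to `+∞ - 0i` through the origin, above the negative and below
the positive real axis. -/
structure IsAdmissiblePath (η : ℝ → ℝ) : Prop where
  smooth : ContDiff ℝ ∞ η
  pos_of_neg : ∀ s < 0, 0 < η s
  neg_of_pos : ∀ s > 0, η s < 0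
  tendsto_atTop : Tendsto η atTop (𝓝 0)
  tendsto_atBot : Tendsto η atBot (𝓝 0)
  bounded_deriv : ∃ B : ℝ, ∀ s, |deriv η s| ≤ B

/-- The height function of the path moved to the right by `δ`. -/
def shiftPath (η : ℝ → ℝ) (δ : ℝ) : ℝ → ℝ := fun s => η (s - δ)

/-- The point of the path over `s`. -/
def pathPoint (η : ℝ → ℝ) (s : ℝ) : ℂ := s + Complex.I * η s

/-- The velocity of the path over `s`. -/
def pathVel (η : ℝ → ℝ) (s : ℝ) : ℂ := 1 + Complex.I * deriv η s

/-- `ξ` lies strictly above the path. -/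
def IsAbove (η : ℝ → ℝ) (ξ : ℂ) : Prop := η ξ.re < ξ.im

/-- `ξ` lies on the path. -/
def IsOn (η : ℝ → ℝ) (ξ : ℂ) : Prop := ξ.im = η ξ.re

/-- The integral over the part of the path with `|Re ξ| ≤ R`. -/
def truncatedIntegral (η : ℝ → ℝ) (f : ℂ → ℂ) (R : ℝ) : ℂ :=
  ∫ s in (-R)..R, f (pathPoint η s) * pathVel η s

/-- The improper integral `∫ f(ξ) dξ` over the path converges. -/
def PathIntegralConverges (η : ℝ → ℝ) (f : ℂ → ℂ) : Prop :=
  ∃ l : ℂ, Tendsto (truncatedIntegral η f) atTop (𝓝 l)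

/-- The improper integral `∫ f(ξ) dξ` over the path. -/
def pathIntegral (η : ℝ → ℝ) (f : ℂ → ℂ) : ℂ :=
  limUnder atTop (truncatedIntegral η f)

/-- The Cauchy integral `(1 / 2πi) ∫ g(t) / (t - ξ) dt` over the path, for `ξ` off the path. -/
def cauchyIntegral (η : ℝ → ℝ) (g : ℂ → ℂ) (ξ : ℂ) : ℂ :=
  (1 / (2 * Real.pi * Complex.I)) *
    ∫ s : ℝ, g (pathPoint η s) / (pathPoint η s - ξ) * pathVel η s

/-- The principal value integral `(1 / 2πi) p.v. ∫ g(t) / (t - ξ) dt` over the path, for `ξ` on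
the path. -/
def pvCauchyIntegral (η : ℝ → ℝ) (g : ℂ → ℂ) (ξ : ℂ) : ℂ :=
  (1 / (2 * Real.pi * Complex.I)) *
    limUnder (𝓝[>] (0 : ℝ)) (fun r : ℝ =>
      ∫ s in {s : ℝ | r < ‖pathPoint η s - ξ‖},
        g (pathPoint η s) / (pathPoint η s - ξ) * pathVel η s)

/-! ### The Wiener-Hopf factors -/

open Classical in
/-- The factor `K⁺`: holomorphic above the path by its Cauchy integral, given on the path by the
principal value formula, and continued below the path through `K⁺ K⁻ = 1 - exp(2iμh)`. -/
def Kplus (k h : ℝ) (η : ℝ → ℝ) (ξ : ℂ) : ℂ :=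
  if IsAbove η ξ then
    Complex.exp (cauchyIntegral η (fun t => Complex.log (kernel k h t)) ξ)
  else if IsOn η ξ then
    csqrt (kernel k h ξ) *
      Complex.exp (pvCauchyIntegral η (fun t => Complex.log (kernel k h t)) ξ)
  else
    kernel k h ξ * Complex.exp (cauchyIntegral η (fun t => Complex.log (kernel k h t)) ξ)

open Classical in
/-- The factor `K⁻`: holomorphic below the path by its Cauchy integral, given on the path by the
principal value formula, and continued above the path through `K⁺ K⁻ = 1 - exp(2iμh)`. -/
def Kminus (k h : ℝ) (η : ℝ → ℝ) (ξ : ℂ) : ℂ :=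
  if IsAbove η ξ then
    kernel k h ξ * Complex.exp (-cauchyIntegral η (fun t => Complex.log (kernel k h t)) ξ)
  else if IsOn η ξ then
    csqrt (kernel k h ξ) *
      Complex.exp (-pvCauchyIntegral η (fun t => Complex.log (kernel k h t)) ξ)
  else
    Complex.exp (-cauchyIntegral η (fun t => Complex.log (kernel k h t)) ξ)

/-- The dependence of the source term on the height `y` of the source. -/
def sourceFactor (k h y : ℝ) (ξ : ℂ) : ℂ :=
  if 0 ≤ y then Complex.exp (Complex.I * mu k ξ * y)
  else
    (Complex.exp (Complex.I * mu k ξ * (2 * h + y)) - Complex.exp (-(Complex.I * mu k ξ * y))) /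
      (Complex.exp (2 * Complex.I * mu k ξ * h) - 1)

/-- The function that is split into `H⁺ + H⁻`. -/
def sourceTerm (k h : ℝ) (η : ℝ → ℝ) (xs : ℝ × ℝ) (ξ : ℂ) : ℂ :=
  Complex.exp (Complex.I * ξ * xs.1) * sourceFactor k h xs.2 ξ * Kminus k h η ξ / csqrt (k - ξ)

open Classical in
/-- The function `H⁺`, for the path moved to the right by `ε` (`ε = 0` unless `exp(2ikh) = 1`):
holomorphic above that path by its Cauchy integral, given on the path by the principal value
formula, and continued below it through `H⁺ + H⁻ = sourceTerm`. -/
def Hplus (k h : ℝ) (η : ℝ → ℝ) (ε : ℝ) (xs : ℝ × ℝ) (ξ : ℂ) : ℂ :=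
  if IsAbove (shiftPath η ε) ξ then
    cauchyIntegral (shiftPath η ε) (sourceTerm k h η xs) ξ
  else if IsOn (shiftPath η ε) ξ then
    sourceTerm k h η xs ξ / 2 + pvCauchyIntegral (shiftPath η ε) (sourceTerm k h η xs) ξ
  else
    sourceTerm k h η xs ξ + cauchyIntegral (shiftPath η ε) (sourceTerm k h η xs) ξ

/-- The Fourier transform `∫₀^∞ G((x₁, 0); x*) exp(iξx₁) dx₁` of the field on the aperture, in its
closed form. -/
def fHat (k h : ℝ) (η : ℝ → ℝ) (ε : ℝ) (xs : ℝ × ℝ) (ξ : ℂ) : ℂ :=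
  -(Hplus k h η ε xs ξ * Kplus k h η ξ) / (2 * Complex.I * csqrt (k + ξ))

/-! ### The Green function in the strip `-h ≤ x₂ ≤ 0` -/

/-- The integrand of the scattered wave in the strip. -/
def scatteredIntegrand (k h : ℝ) (η : ℝ → ℝ) (ε : ℝ) (xs x : ℝ × ℝ) (ξ : ℂ) : ℂ :=
  (1 / (2 * Real.pi)) * fHat k h η ε xs ξ *
    ((Complex.exp (-(Complex.I * mu k ξ * x.2)) -
        Complex.exp (Complex.I * mu k ξ * (x.2 + 2 * h))) / kernel k h ξ) *
    Complex.exp (-(Complex.I * ξ * x.1))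

/-- The integrand of the incident wave in the strip, for a source in the strip. -/
def incidentIntegrand (k h : ℝ) (xs x : ℝ × ℝ) (ξ : ℂ) : ℂ :=
  ((Complex.exp (Complex.I * mu k ξ * |x.2 - xs.2|) -
        Complex.exp (Complex.I * mu k ξ * (x.2 - xs.2))) /
      (-(4 * Complex.I * Real.pi * mu k ξ)) +
    (Complex.exp (Complex.I * mu k ξ * (2 * h + xs.2)) -
        Complex.exp (-(Complex.I * mu k ξ * xs.2))) *
      (Complex.exp (-(Complex.I * mu k ξ * x.2)) - Complex.exp (Complex.I * mu k ξ * x.2)) /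
      (-(4 * Complex.I * Real.pi * kernel k h ξ * mu k ξ))) *
    Complex.exp (-(Complex.I * ξ * (x.1 - xs.1)))

/-- The Green function `G(x; x*)` for `x` in the strip `-h ≤ x₂ ≤ 0`. The integrals run over the
path moved to the left by `ε` (`ε = 0` unless `exp(2ikh) = 1`). -/
def green (k h : ℝ) (η : ℝ → ℝ) (ε : ℝ) (xs x : ℝ × ℝ) : ℂ :=
  if 0 ≤ xs.2 then pathIntegral (shiftPath η (-ε)) (scatteredIntegrand k h η ε xs x)
  else pathIntegral (shiftPath η (-ε)) (scatteredIntegrand k h η ε xs x) +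
    pathIntegral (shiftPath η (-ε)) (incidentIntegrand k h xs x)

/-! ### Guided modes -/

/-- `μ_m = mπ/h`. -/
def modeMu (h : ℝ) (m : ℕ) : ℝ := m * Real.pi / h

/-- `ξ_m = √(k² - μ_m²)`. -/
def modeXi (k h : ℝ) (m : ℕ) : ℝ := Real.sqrt (k ^ 2 - modeMu h m ^ 2)

/-- The largest integer `M` with `Mπ/h ≤ k`. -/
def numModes (k h : ℝ) : ℕ := ⌊k * h / Real.pi⌋₊

/-- The guided mode `φ_m(x) = exp(-iξ_m x₁) sin(μ_m x₂)`. -/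
def guidedMode (k h : ℝ) (m : ℕ) (x : ℝ × ℝ) : ℂ :=
  Complex.exp (-(Complex.I * modeXi k h m * x.1)) * (Real.sin (modeMu h m * x.2) : ℝ)

/-- The displacement `ε` used to move the paths off the origin: none if `exp(2ikh) ≠ 1`; otherwise
positive, less than `k` and than all the positive `ξ_m`, and such that `1 - exp(2iμh)` has no zero
on the two displaced paths. -/
structure IsAdmissibleShift (k h : ℝ) (η : ℝ → ℝ) (ε : ℝ) : Prop where
  eq_zero : Complex.exp (2 * Complex.I * k * h) ≠ 1 → ε = 0
  pos : Complex.exp (2 * Complex.I * k * h) = 1 → 0 < ε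
  lt_k : ε < k
  lt_modeXi : ∀ m ∈ Finset.Icc 1 (numModes k h), 0 < modeXi k h m → ε < modeXi k h m
  kernel_left_ne_zero : ∀ s : ℝ, kernel k h (pathPoint (shiftPath η (-ε)) s) ≠ 0
  kernel_right_ne_zero : ∀ s : ℝ, kernel k h (pathPoint (shiftPath η ε) s) ≠ 0

end CrackedHalfPlane

end

noncomputable section

namespace CrackedHalfPlane

/-! The Green function is one contour integral, and the modes are the residues collected when its
path is lifted into the upper half plane. For x₁ < 0 the factor e^{-iξx₁} decays upwards, so a path
lying above height Y leaves a remainder O(e^{-Y|x₁|}), which is stronger than every power.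

To see the poles, both integrands are written through sin(aμ)/μ (`stripSinc`), which is entire in ξ
because it depends only on μ². The addition theorem for the sine then merges scattered and incident
wave (`totalIntegrand_eq`). Up to an entire term the sum is e^{-iξx₁} · sin((h+x₂)μ)/μ times
`modalQuot`, the quotient of f̂⁺ (minus e^{iξx₁*} sin(x₂*μ)/μ if x₂* < 0) by sin(hμ)/μ. Its
singularities in the swept region lie at zeros of sin(hμ)/μ (`stripSinc_zero_cases`). The points ξ_m
give the modes. The zeros on the positive imaginary axis lie above the final path (`exists_gap`),
and the negative real ones lie below the initial one. Zeros on the negative imaginary axis are swept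
only if ε > 0, and there the numerator carries the kernel as a factor and cancels them
(`hasSimplePole_modalQuot_of_neg_im`). The final path is a hyperbola that stays above the initial
path by the slope bound on η (`shiftPath_le_liftedHeight`). The residue theorem between two graphs
is `integral_graph_sub_residues`.

All this needs f̂⁺ to be analytic and O(|ξ|^{-1/2}), although its factors are defined by three
different formulas above, on and below a path. Both K⁺ and H⁺ reduce to one additive splitting,
`plusPart`. In all three cases it is, up to g/2, the limit of integrals of the difference quotient
of g at ξ (`tendsto_slopeIntegral`). Since that quotient has no singularity at ξ, the path can be
moved across ξ (`plusPart_eq_plusPart`). Moving it locally gives analyticity on the path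
(`analyticAt_plusPart_of_isOn`), and moving its tails away from ξ gives uniform bounds
(`exists_bound_plusPart`).

If e^{2ikh} = 1, the logarithm of the kernel is singular at the origin, which lies on 𝓛. Its
singular part is split explicitly into `upLog t + upLog (-t)`, one summand for each side of the
path; hence K⁺ extends analytically to the origin and vanishes there
(`exists_analyticAt_Kplus_zero`). It follows that the numerator of `modalQuot` vanishes at 0, so the
double zero of the denominator leaves a simple pole whose residue involves the derivative of f̂⁺
(`hasSimplePole_modalQuot_zero`).

The defining integrals converge only conditionally in general. Bending the tails of the path into a
half plane of exponential decay makes them absolutely convergent (`pathIntegralConverges_of_decay`).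
-/

/-! ### Cauchy's theorem between two graphs -/

/-- The integral of `f dξ` over the vertical segment from one graph to another. -/
def vert (η₁ η₂ : ℝ → ℝ) (f : ℂ → ℂ) (s : ℝ) : ℂ :=
  Complex.I * ∫ v in (η₁ s)..(η₂ s), f (s + Complex.I * v)

theorem hasDerivAt_pathPoint {η : ℝ → ℝ} {s : ℝ} (h : DifferentiableAt ℝ η s) :
    HasDerivAt (pathPoint η) (pathVel η s) s := by
  unfold pathPoint pathVel
  exact (Complex.ofRealCLM.hasDerivAt (x := s)).add
    ((h.hasDerivAt.ofReal_comp).const_mul Complex.I)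

@[simp] theorem pathPoint_re (η : ℝ → ℝ) (s : ℝ) : (pathPoint η s).re = s := by
  simp [pathPoint]

@[simp] theorem pathPoint_im (η : ℝ → ℝ) (s : ℝ) : (pathPoint η s).im = η s := by
  simp [pathPoint]

@[simp] theorem pathVel_re (η : ℝ → ℝ) (s : ℝ) : (pathVel η s).re = 1 := by
  simp [pathVel]

@[simp] theorem pathVel_im (η : ℝ → ℝ) (s : ℝ) : (pathVel η s).im = deriv η s := by
  simp [pathVel]

theorem continuous_pathPoint {η : ℝ → ℝ} (h : Continuous η) : Continuous (pathPoint η) := by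
  unfold pathPoint; fun_prop

theorem continuous_pathVel {η : ℝ → ℝ} (h : ContDiff ℝ 1 η) : Continuous (pathVel η) := by
  have := h.continuous_deriv le_rfl
  unfold pathVel; fun_prop

theorem norm_pathVel_le (η : ℝ → ℝ) (s : ℝ) : ‖pathVel η s‖ ≤ 1 + |deriv η s| := by
  refine (Complex.norm_le_abs_re_add_abs_im _).trans ?_
  simp

/-- The compact vertical segment has a convex neighbourhood on which f is analytic, so f has a
primitive F there. Near s the vertical integral is the difference of F at the two ends. Cauchy's
theorem between graphs thus becomes the fundamental theorem of calculus in s. -/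
theorem hasDerivAt_vert {f : ℂ → ℂ} {η₁ η₂ : ℝ → ℝ} {s : ℝ}
    (h₁ : DifferentiableAt ℝ η₁ s) (h₂ : DifferentiableAt ℝ η₂ s)
    (hc₁ : Continuous η₁) (hc₂ : Continuous η₂)
    (hf : ∀ v ∈ Set.uIcc (η₁ s) (η₂ s), AnalyticAt ℂ f (s + Complex.I * v)) :
    HasDerivAt (vert η₁ η₂ f)
      (f (pathPoint η₂ s) * pathVel η₂ s - f (pathPoint η₁ s) * pathVel η₁ s) s := by
  set K : Set ℂ := segment ℝ (pathPoint η₁ s) (pathPoint η₂ s) with hK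
  have key : ∀ (x : ℝ) (v : ℝ), v ∈ Set.uIcc (η₁ x) (η₂ x) →
      ((x : ℂ) + Complex.I * v) ∈ segment ℝ (pathPoint η₁ x) (pathPoint η₂ x) := by
    intro x v hv
    rw [← segment_eq_uIcc] at hv
    obtain ⟨a, b, ha, hb, hab, rfl⟩ := hv
    refine ⟨a, b, ha, hb, hab, ?_⟩
    have : (a : ℂ) + b = 1 := by exact_mod_cast hab
    simp only [pathPoint, Complex.real_smul, smul_eq_mul, Complex.ofReal_add, Complex.ofReal_mul]
    linear_combination (x : ℂ) * this
  have hKU : K ⊆ {z | AnalyticAt ℂ f z} := by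
    rintro z ⟨a, b, ha, hb, hab, rfl⟩
    have : (a : ℂ) + b = 1 := by exact_mod_cast hab
    have h := hf (a * η₁ s + b * η₂ s) (by
      rw [← segment_eq_uIcc]; exact ⟨a, b, ha, hb, hab, rfl⟩)
    rw [Set.mem_ofPred_eq, show a • pathPoint η₁ s + b • pathPoint η₂ s =
      (s : ℂ) + Complex.I * ((a * η₁ s + b * η₂ s : ℝ) : ℂ) by
        simp only [pathPoint, Complex.real_smul, Complex.ofReal_add, Complex.ofReal_mul]
        linear_combination (s : ℂ) * this]
    exact h
  have hKc : IsCompact K := by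
    rw [hK, segment_eq_image]
    exact isCompact_Icc.image (by fun_prop)
  obtain ⟨δ, hδ, hsub⟩ := hKc.exists_thickening_subset_open (isOpen_analyticAt ℂ f) hKU
  have hconv : Convex ℝ (Metric.thickening δ K) := (convex_segment _ _).thickening δ
  have hdiff : DifferentiableOn ℂ f (Metric.thickening δ K) := fun z hz =>
    (hsub hz : AnalyticAt ℂ f z).differentiableAt.differentiableWithinAt
  obtain ⟨F, hF⟩ := hconv.exists_forall_hasDerivWithinAt hdiff
  have hopen : IsOpen (Metric.thickening δ K) := Metric.isOpen_thickening
  have hF' : ∀ z ∈ Metric.thickening δ K, HasDerivAt F (f z) z := fun z hz =>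
    (hF z hz).hasDerivAt (hopen.mem_nhds hz)
  have hin : ∀ z ∈ K, z ∈ Metric.thickening δ K := Metric.self_subset_thickening hδ K
  have hm₁ : pathPoint η₁ s ∈ Metric.thickening δ K := hin _ (left_mem_segment ℝ _ _)
  have hm₂ : pathPoint η₂ s ∈ Metric.thickening δ K := hin _ (right_mem_segment ℝ _ _)
  have hev : vert η₁ η₂ f =ᶠ[𝓝 s] fun x => F (pathPoint η₂ x) - F (pathPoint η₁ x) := by
    have e₁ := (continuous_pathPoint hc₁).continuousAt.eventually (hopen.mem_nhds hm₁)
    have e₂ := (continuous_pathPoint hc₂).continuousAt.eventually (hopen.mem_nhds hm₂)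
    filter_upwards [e₁, e₂] with x hx₁ hx₂
    have hmem : ∀ v ∈ Set.uIcc (η₁ x) (η₂ x),
        ((x : ℂ) + Complex.I * v) ∈ Metric.thickening δ K := fun v hv =>
      hconv.segment_subset hx₁ hx₂ (key x v hv)
    have hd : ∀ v ∈ Set.uIcc (η₁ x) (η₂ x), HasDerivAt (fun v : ℝ => F (x + Complex.I * v))
        (Complex.I * f (x + Complex.I * v)) v := by
      intro v hv
      have h1 : HasDerivAt (fun v : ℝ => (x : ℂ) + Complex.I * v) Complex.I v := by
        simpa using ((Complex.ofRealCLM.hasDerivAt (x := v)).const_mul Complex.I).const_add (x : ℂ)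
      exact ((hF' _ (hmem v hv)).comp v h1).congr_deriv (mul_comm _ _)
    have hi := intervalIntegral.integral_eq_sub_of_hasDerivAt hd (by
      apply ContinuousOn.intervalIntegrable
      intro v hv
      have := (hdiff.differentiableAt (hopen.mem_nhds (hmem v hv))).continuousAt
      have h2 : ContinuousAt (fun v : ℝ => f (x + Complex.I * v)) v :=
        ContinuousAt.comp (f := fun v : ℝ => (x : ℂ) + Complex.I * v) this (by fun_prop)
      exact (continuousAt_const.mul h2).continuousWithinAt)
    rw [intervalIntegral.integral_const_mul] at hi
    exact hi
  refine HasDerivAt.congr_of_eventuallyEq ?_ hev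
  exact ((hF' _ hm₂).comp s (hasDerivAt_pathPoint h₂)).sub
    ((hF' _ hm₁).comp s (hasDerivAt_pathPoint h₁))

/-- Cauchy's theorem for the region between two graphs over `[a, b]`. -/
theorem integral_graph_sub {f : ℂ → ℂ} {η₁ η₂ : ℝ → ℝ} (h₁ : ContDiff ℝ 1 η₁)
    (h₂ : ContDiff ℝ 1 η₂) {a b : ℝ} (hab : a ≤ b)
    (hf : ∀ s ∈ Set.Icc a b, η₁ =ᶠ[𝓝 s] η₂ ∨
      ∀ v ∈ Set.uIcc (η₁ s) (η₂ s), AnalyticAt ℂ f (s + Complex.I * v)) :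
    ∫ s in a..b, (f (pathPoint η₂ s) * pathVel η₂ s - f (pathPoint η₁ s) * pathVel η₁ s) =
      vert η₁ η₂ f b - vert η₁ η₂ f a := by
  have d₁ := h₁.differentiable one_ne_zero
  have d₂ := h₂.differentiable one_ne_zero
  -- Where the graphs coincide near s, nothing is required of f: the integrands cancel and the
  -- vertical integral vanishes. Two paths may thus share a stretch on which f is not analytic.
  have heq : ∀ s, η₁ =ᶠ[𝓝 s] η₂ →
      (fun x => f (pathPoint η₂ x) * pathVel η₂ x - f (pathPoint η₁ x) * pathVel η₁ x)
        =ᶠ[𝓝 s] fun _ => 0 := by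
    intro s hs
    filter_upwards [hs.eventuallyEq_nhds] with x hx
    simp only [pathPoint, pathVel, hx.eq_of_nhds, hx.deriv_eq, sub_self]
  apply intervalIntegral.integral_eq_sub_of_hasDerivAt
  · intro s hs
    rw [Set.uIcc_of_le hab] at hs
    rcases hf s hs with h | h
    · rw [(heq s h).eq_of_nhds]
      refine (hasDerivAt_const s (0 : ℂ)).congr_of_eventuallyEq ?_
      filter_upwards [h] with x hx
      simp [vert, hx]
    · exact hasDerivAt_vert (d₁ s) (d₂ s) h₁.continuous h₂.continuous h
  · apply ContinuousOn.intervalIntegrable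
    intro s hs
    rw [Set.uIcc_of_le hab] at hs
    rcases hf s hs with h | h
    · exact (continuousAt_const.congr (heq s h).symm).continuousWithinAt
    · have c₁ := (h _ Set.left_mem_uIcc).continuousAt
      have c₂ := (h _ Set.right_mem_uIcc).continuousAt
      have c₁' : ContinuousAt (fun x => f (pathPoint η₁ x)) s :=
        ContinuousAt.comp (f := pathPoint η₁) c₁ (continuous_pathPoint h₁.continuous).continuousAt
      have c₂' : ContinuousAt (fun x => f (pathPoint η₂ x)) s :=
        ContinuousAt.comp (f := pathPoint η₂) c₂ (continuous_pathPoint h₂.continuous).continuousAt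
      exact ((c₂'.mul (continuous_pathVel h₂).continuousAt).sub
        (c₁'.mul (continuous_pathVel h₁).continuousAt)).continuousWithinAt

theorem norm_vert_le {η₁ η₂ : ℝ → ℝ} {f : ℂ → ℂ} {s C : ℝ}
    (h : ∀ v ∈ Set.uIcc (η₁ s) (η₂ s), ‖f (s + Complex.I * v)‖ ≤ C) :
    ‖vert η₁ η₂ f s‖ ≤ C * |η₂ s - η₁ s| := by
  unfold vert
  rw [norm_mul, Complex.norm_I, one_mul]
  exact intervalIntegral.norm_integral_le_of_norm_le_const fun v hv =>
    h v (Set.uIoc_subset_uIcc hv)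

/-! ### The integral of `1 / (t - p)` over a graph -/

theorem log_I_mul_of_re_pos {z : ℂ} (hz : 0 < z.re) :
    Complex.log (Complex.I * z) = Complex.log z + Real.pi / 2 * Complex.I := by
  have h := abs_lt.1 (Complex.abs_arg_lt_pi_div_two_iff.2 (Or.inl hz))
  rw [Complex.log_mul Complex.I_ne_zero (by rintro rfl; simp at hz), Complex.log_I, add_comm]
  rw [Complex.arg_I]
  constructor <;> linarith [Real.pi_pos]

theorem log_neg_I_mul_of_re_pos {z : ℂ} (hz : 0 < z.re) :
    Complex.log (-Complex.I * z) = Complex.log z - Real.pi / 2 * Complex.I := by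
  have h := abs_lt.1 (Complex.abs_arg_lt_pi_div_two_iff.2 (Or.inl hz))
  rw [Complex.log_mul (neg_ne_zero.2 Complex.I_ne_zero) (by rintro rfl; simp at hz),
    Complex.log_neg_I]
  · ring
  rw [Complex.arg_neg_I]
  constructor <;> linarith [Real.pi_pos]

theorem integral_pathVel_div_of_re_lt {η : ℝ → ℝ} (hη : ContDiff ℝ 1 η) {p : ℂ} {a b : ℝ}
    (ha : p.re < a) (hab : a ≤ b) :
    ∫ s in a..b, pathVel η s / (pathPoint η s - p) =
      Complex.log (pathPoint η b - p) - Complex.log (pathPoint η a - p) := by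
  have hre : ∀ s ∈ Set.uIcc a b, 0 < (pathPoint η s - p).re := by
    intro s hs
    rw [Set.uIcc_of_le hab] at hs
    simp; linarith [hs.1]
  apply intervalIntegral.integral_eq_sub_of_hasDerivAt
    (f := fun s => Complex.log (pathPoint η s - p))
  · intro s hs
    exact ((hasDerivAt_pathPoint (hη.differentiable one_ne_zero s)).sub_const p).clog_real
      (Or.inl (hre s hs))
  · apply ContinuousOn.intervalIntegrable
    refine (continuous_pathVel hη).continuousOn.div
      ((continuous_pathPoint hη.continuous).sub continuous_const).continuousOn fun s hs h => ?_
    have := hre s hs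
    rw [h] at this; simp at this

theorem integral_pathVel_div_of_lt_re {η : ℝ → ℝ} (hη : ContDiff ℝ 1 η) {p : ℂ} {a b : ℝ}
    (hb : b < p.re) (hab : a ≤ b) :
    ∫ s in a..b, pathVel η s / (pathPoint η s - p) =
      Complex.log (p - pathPoint η b) - Complex.log (p - pathPoint η a) := by
  have hre : ∀ s ∈ Set.uIcc a b, 0 < (p - pathPoint η s).re := by
    intro s hs
    rw [Set.uIcc_of_le hab] at hs
    simp; linarith [hs.2]
  apply intervalIntegral.integral_eq_sub_of_hasDerivAt
    (f := fun s => Complex.log (p - pathPoint η s))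
  · intro s hs
    refine (((hasDerivAt_pathPoint (hη.differentiable one_ne_zero s)).const_sub p).clog_real
      (Or.inl (hre s hs))).congr_deriv ?_
    rw [← neg_sub p, div_neg, neg_div]
  · apply ContinuousOn.intervalIntegrable
    refine (continuous_pathVel hη).continuousOn.div
      ((continuous_pathPoint hη.continuous).sub continuous_const).continuousOn fun s hs h => ?_
    have := hre s hs
    rw [← neg_sub, h] at this; simp at this

theorem pathPoint_sub_ne_zero {η : ℝ → ℝ} {p : ℂ} (h : ¬ IsOn η p) (s : ℝ) :
    pathPoint η s - p ≠ 0 := by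
  intro h0
  rw [sub_eq_zero] at h0
  apply h
  rw [← h0]
  simp [IsOn]

theorem intervalIntegrable_pathVel_div {η : ℝ → ℝ} (hη : ContDiff ℝ 1 η) {p : ℂ}
    (h : ¬ IsOn η p) (a b : ℝ) :
    IntervalIntegrable (fun s => pathVel η s / (pathPoint η s - p)) MeasureTheory.volume a b :=
  ((continuous_pathVel hη).div ((continuous_pathPoint hη.continuous).sub continuous_const)
    (pathPoint_sub_ne_zero h)).intervalIntegrable _ _

/-- The path minus p passes below the origin. Multiplication by i turns this crossing onto the
positive real axis, so one branch of the logarithm is a primitive on the whole window. Undoing the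
rotation at the two ends yields the term πi. For p below the path the factor is -i and the sign
changes. -/
theorem integral_pathVel_div_of_isAbove {η : ℝ → ℝ} (hη : ContDiff ℝ 1 η) {p : ℂ} {a b : ℝ}
    (ha : a < p.re) (hb : p.re < b) (h : IsAbove η p) :
    ∫ s in a..b, pathVel η s / (pathPoint η s - p) =
      Complex.log (pathPoint η b - p) - Complex.log (p - pathPoint η a) + Real.pi * Complex.I := by
  have hne : ¬ IsOn η p := fun h' => (lt_irrefl _ (h.trans_eq h'))
  have : ∫ s in a..b, pathVel η s / (pathPoint η s - p) =
      Complex.log (Complex.I * (pathPoint η b - p)) -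
        Complex.log (Complex.I * (pathPoint η a - p)) := by
    apply intervalIntegral.integral_eq_sub_of_hasDerivAt
      (f := fun s => Complex.log (Complex.I * (pathPoint η s - p)))
    · intro s _
      refine ((((hasDerivAt_pathPoint (hη.differentiable one_ne_zero s)).sub_const p).const_mul
        Complex.I).clog_real ?_).congr_deriv ?_
      rotate_left
      · rw [mul_div_mul_left _ _ Complex.I_ne_zero]
      · rw [Complex.mem_slitPlane_iff]
        by_cases hs : s = p.re
        · left
          simp only [Complex.mul_re, Complex.I_re, Complex.I_im, Complex.sub_im, pathPoint_im, hs]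
          have : η p.re < p.im := h
          linarith
        · right
          simp only [Complex.mul_im, Complex.I_re, Complex.I_im, Complex.sub_re, pathPoint_re]
          simpa [sub_eq_zero] using hs
    · exact intervalIntegrable_pathVel_div hη hne _ _
  rw [this, log_I_mul_of_re_pos (by simpa using hb),
    show Complex.I * (pathPoint η a - p) = -Complex.I * (p - pathPoint η a) by ring,
    log_neg_I_mul_of_re_pos (by simpa using ha)]
  ring

theorem integral_pathVel_div_of_below {η : ℝ → ℝ} (hη : ContDiff ℝ 1 η) {p : ℂ} {a b : ℝ}
    (ha : a < p.re) (hb : p.re < b) (h : p.im < η p.re) :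
    ∫ s in a..b, pathVel η s / (pathPoint η s - p) =
      Complex.log (pathPoint η b - p) - Complex.log (p - pathPoint η a) - Real.pi * Complex.I := by
  have hne : ¬ IsOn η p := fun h' => (lt_irrefl _ (h.trans_eq h'.symm))
  have : ∫ s in a..b, pathVel η s / (pathPoint η s - p) =
      Complex.log (-Complex.I * (pathPoint η b - p)) -
        Complex.log (-Complex.I * (pathPoint η a - p)) := by
    apply intervalIntegral.integral_eq_sub_of_hasDerivAt
      (f := fun s => Complex.log (-Complex.I * (pathPoint η s - p)))
    · intro s _
      refine ((((hasDerivAt_pathPoint (hη.differentiable one_ne_zero s)).sub_const p).const_mul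
        (-Complex.I)).clog_real ?_).congr_deriv ?_
      rotate_left
      · rw [mul_div_mul_left _ _ (neg_ne_zero.2 Complex.I_ne_zero)]
      · rw [Complex.mem_slitPlane_iff]
        by_cases hs : s = p.re
        · left
          simp [hs]
          linarith
        · right
          simpa [sub_eq_zero, eq_comm] using hs
    · exact intervalIntegrable_pathVel_div hη hne _ _
  rw [this, log_neg_I_mul_of_re_pos (by simpa using hb),
    show -Complex.I * (pathPoint η a - p) = Complex.I * (p - pathPoint η a) by ring,
    log_I_mul_of_re_pos (by simpa using ha)]
  ring

/-! ### Cauchy integrals over graphs -/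

/-- A bounded `C¹` height function with bounded slope. -/
structure IsGoodPath (η : ℝ → ℝ) : Prop where
  smooth : ContDiff ℝ 1 η
  bounded : ∃ H : ℝ, ∀ s, |η s| ≤ H
  bounded_deriv : ∃ B : ℝ, ∀ s, |deriv η s| ≤ B

/-- The density `g` has absolutely convergent Cauchy integrals over the path. -/
def CauchyIntegrable (η : ℝ → ℝ) (g : ℂ → ℂ) : Prop :=
  MeasureTheory.Integrable fun s : ℝ => g (pathPoint η s) * pathVel η s / ((1 + |s| : ℝ) : ℂ)

theorem one_add_abs_ne_zero (s : ℝ) : ((1 + |s| : ℝ) : ℂ) ≠ 0 := by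
  exact_mod_cast (by positivity : (1 + |s|) ≠ 0)

theorem CauchyIntegrable.aestronglyMeasurable {η : ℝ → ℝ} {g : ℂ → ℂ} (h : CauchyIntegrable η g) :
    MeasureTheory.AEStronglyMeasurable (fun s : ℝ => g (pathPoint η s) * pathVel η s) := by
  have h2 : Continuous fun s : ℝ => ((1 + |s| : ℝ) : ℂ) := by fun_prop
  refine (MeasureTheory.Integrable.aestronglyMeasurable h |>.mul
    h2.aestronglyMeasurable).congr (Eventually.of_forall fun s => ?_)
  exact div_mul_cancel₀ _ (one_add_abs_ne_zero s)

theorem abs_sub_re_le (η : ℝ → ℝ) (ξ : ℂ) (s : ℝ) : |s - ξ.re| ≤ ‖pathPoint η s - ξ‖ := by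
  simpa using Complex.abs_re_le_norm (pathPoint η s - ξ)

/-- On a compact window the quotient of the two sides has a positive minimum; outside it the
horizontal distance suffices. Halving the constant found for ξ₀ serves a whole ball, which is the
uniformity needed to differentiate under the integral. -/
theorem exists_le_norm_sub {η : ℝ → ℝ} (hη : Continuous η) {ξ₀ : ℂ} (h : ¬ IsOn η ξ₀) :
    ∃ c > 0, ∀ ξ ∈ Metric.ball ξ₀ c, ∀ s : ℝ, c * (1 + |s|) ≤ ‖pathPoint η s - ξ‖ := by
  obtain ⟨m, hm, hmle⟩ : ∃ m > 0, ∀ s : ℝ, m * (1 + |s|) ≤ ‖pathPoint η s - ξ₀‖ := by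
    -- Beyond T one has |s - Re ξ₀| ≥ (1 + |s|)/2.
    set T : ℝ := 2 * |ξ₀.re| + 1
    have hc : Continuous fun s : ℝ => ‖pathPoint η s - ξ₀‖ / (1 + |s|) :=
      Continuous.div (by have := continuous_pathPoint hη; fun_prop) (by fun_prop)
        fun s => by positivity
    obtain ⟨s₀, _, hs₀⟩ := isCompact_Icc.exists_isMinOn (s := Set.Icc (-T) T)
      ⟨0, by constructor <;> simp only [T] <;> linarith [abs_nonneg ξ₀.re]⟩ hc.continuousOn
    have hpos : 0 < ‖pathPoint η s₀ - ξ₀‖ / (1 + |s₀|) :=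
      div_pos (norm_pos_iff.2 (pathPoint_sub_ne_zero h s₀)) (by positivity)
    refine ⟨min (1 / 4) (‖pathPoint η s₀ - ξ₀‖ / (1 + |s₀|)), by positivity, fun s => ?_⟩
    by_cases hs : s ∈ Set.Icc (-T) T
    · have h1 := hs₀ hs
      simp only [Set.mem_ofPred_eq] at h1
      rw [← le_div_iff₀ (by positivity)]
      exact (min_le_right _ _).trans h1
    · have h1 := abs_sub_re_le η ξ₀ s
      have h2 : T < |s| := by
        by_contra hcon
        exact hs (abs_le.1 (not_lt.1 hcon))
      have h3 : |s| - |ξ₀.re| ≤ |s - ξ₀.re| := abs_sub_abs_le_abs_sub _ _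
      have h4 : min (1 / 4) (‖pathPoint η s₀ - ξ₀‖ / (1 + |s₀|)) * (1 + |s|) ≤ 1 / 4 * (1 + |s|) :=
        mul_le_mul_of_nonneg_right (min_le_left _ _) (by positivity)
      simp only [T] at h2
      linarith [abs_nonneg s]
  refine ⟨m / 2, by positivity, fun ξ hξ s => ?_⟩
  rw [Metric.mem_ball, dist_eq_norm] at hξ
  have h1 : ‖pathPoint η s - ξ₀‖ ≤ ‖pathPoint η s - ξ‖ + ‖ξ - ξ₀‖ := by
    simpa using norm_add_le (pathPoint η s - ξ) (ξ - ξ₀)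
  have := hmle s
  nlinarith [abs_nonneg s]

theorem CauchyIntegrable.integrableOn_div {η : ℝ → ℝ} {g : ℂ → ℂ} (h : CauchyIntegrable η g)
    (hη : Continuous η) {ξ : ℂ} {c : ℝ} (hc : 0 < c) {A : Set ℝ} (hA : MeasurableSet A)
    (hle : ∀ s ∈ A, c * (1 + |s|) ≤ ‖pathPoint η s - ξ‖) :
    MeasureTheory.IntegrableOn
      (fun s : ℝ => g (pathPoint η s) / (pathPoint η s - ξ) * pathVel η s) A := by
  have hm : Measurable fun s : ℝ => (pathPoint η s - ξ) :=
    ((continuous_pathPoint hη).sub continuous_const).measurable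
  refine ((MeasureTheory.Integrable.norm h).const_mul c⁻¹ |>.integrableOn).mono' ?_ ?_
  · refine ((h.aestronglyMeasurable.mul hm.inv.aestronglyMeasurable).congr
      (Eventually.of_forall fun s => ?_)).restrict
    simp only [Pi.mul_apply, Pi.inv_apply]
    ring
  · refine (MeasureTheory.ae_restrict_iff' hA).2 (Eventually.of_forall fun s hs => ?_)
    have h1 := hle s hs
    have hpos : 0 < c * (1 + |s|) := by positivity
    have h2 : (0 : ℝ) < 1 + |s| := by positivity
    rw [norm_mul, norm_div, norm_div, norm_mul, Complex.norm_of_nonneg h2.le,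
      div_mul_eq_mul_div, div_le_iff₀ (hpos.trans_le h1)]
    calc ‖g (pathPoint η s)‖ * ‖pathVel η s‖
        = c⁻¹ * (‖g (pathPoint η s)‖ * ‖pathVel η s‖ / (1 + |s|)) * (c * (1 + |s|)) := by
          field_simp
      _ ≤ _ := mul_le_mul_of_nonneg_left h1 (by positivity)

theorem CauchyIntegrable.integrable_div {η : ℝ → ℝ} {g : ℂ → ℂ} (h : CauchyIntegrable η g)
    (hη : Continuous η) {ξ : ℂ} (hξ : ¬ IsOn η ξ) :
    MeasureTheory.Integrable
      (fun s : ℝ => g (pathPoint η s) / (pathPoint η s - ξ) * pathVel η s) := by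
  obtain ⟨c, hc, hle⟩ := exists_le_norm_sub hη hξ
  rw [← MeasureTheory.integrableOn_univ]
  exact h.integrableOn_div hη hc MeasurableSet.univ fun s _ =>
    hle ξ (Metric.mem_ball_self hc) s

/-- Differentiation under the integral sign. The squared distance is at least c²(1+|s|)², so the
weight built into `CauchyIntegrable` dominates the derivative with room to spare. -/
theorem differentiableAt_cauchyIntegral {η : ℝ → ℝ} {g : ℂ → ℂ} (h : CauchyIntegrable η g)
    (hη : Continuous η) {ξ₀ : ℂ} (hξ : ¬ IsOn η ξ₀) :
    DifferentiableAt ℂ (cauchyIntegral η g) ξ₀ := by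
  obtain ⟨c, hc, hle⟩ := exists_le_norm_sub hη hξ
  have hm : ∀ ξ : ℂ, Measurable fun s : ℝ => (pathPoint η s - ξ) := fun ξ =>
    ((continuous_pathPoint hη).sub continuous_const).measurable
  have hmeas : ∀ ξ : ℂ, MeasureTheory.AEStronglyMeasurable
      (fun s : ℝ => g (pathPoint η s) / (pathPoint η s - ξ) * pathVel η s) := by
    intro ξ
    refine ((h.aestronglyMeasurable.mul (hm ξ).inv.aestronglyMeasurable).congr
      (Eventually.of_forall fun s => ?_))
    simp only [Pi.mul_apply, Pi.inv_apply]
    ring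
  have hd := hasDerivAt_integral_of_dominated_loc_of_deriv_le (μ := MeasureTheory.volume)
    (F := fun ξ s => g (pathPoint η s) / (pathPoint η s - ξ) * pathVel η s)
    (F' := fun ξ s => g (pathPoint η s) / (pathPoint η s - ξ) ^ 2 * pathVel η s)
    (bound := fun s => (c ^ 2)⁻¹ * ‖g (pathPoint η s) * pathVel η s / ((1 + |s| : ℝ) : ℂ)‖)
    (Metric.ball_mem_nhds ξ₀ hc) (Eventually.of_forall hmeas) (h.integrable_div hη hξ) ?_ ?_ ?_ ?_
  · exact (hd.2.differentiableAt).const_mul _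
  · refine ((h.aestronglyMeasurable.mul ((hm ξ₀).pow_const 2).inv.aestronglyMeasurable).congr
      (Eventually.of_forall fun s => ?_))
    simp only [Pi.mul_apply, Pi.inv_apply]
    ring
  · refine Eventually.of_forall fun s ξ hξ' => ?_
    have h1 := hle ξ hξ' s
    have h2 : (0 : ℝ) < 1 + |s| := by positivity
    have hpos : 0 < c * (1 + |s|) := by positivity
    rw [norm_mul, norm_div, norm_div, norm_mul, Complex.norm_of_nonneg h2.le, norm_pow,
      div_mul_eq_mul_div, div_le_iff₀ (pow_pos (hpos.trans_le h1) 2)]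
    have h3 : (c * (1 + |s|)) ^ 2 ≤ ‖pathPoint η s - ξ‖ ^ 2 := by gcongr
    have h4 : (1 : ℝ) ≤ 1 + |s| := by linarith [abs_nonneg s]
    calc ‖g (pathPoint η s)‖ * ‖pathVel η s‖
        ≤ ‖g (pathPoint η s)‖ * ‖pathVel η s‖ * (1 + |s|) :=
          le_mul_of_one_le_right (by positivity) h4
      _ = (c ^ 2)⁻¹ * (‖g (pathPoint η s)‖ * ‖pathVel η s‖ / (1 + |s|)) * (c * (1 + |s|)) ^ 2 := by
          field_simp
      _ ≤ _ := mul_le_mul_of_nonneg_left h3 (by positivity)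
  · exact (MeasureTheory.Integrable.norm h).const_mul _
  · refine Eventually.of_forall fun s ξ hξ' => ?_
    have h1 := hle ξ hξ' s
    have hne : pathPoint η s - ξ ≠ 0 := by
      rw [← norm_pos_iff]
      exact lt_of_lt_of_le (by positivity) h1
    have h2 : HasDerivAt (fun ξ => pathPoint η s - ξ) (-1) ξ := (hasDerivAt_id ξ).const_sub _
    refine (((hasDerivAt_const ξ (g (pathPoint η s))).div h2 hne).mul_const _).congr_deriv ?_
    field_simp
    ring

/-! ### The regions above and below a graph -/

theorem isOpen_isAbove {η : ℝ → ℝ} (hη : Continuous η) : IsOpen {ξ : ℂ | IsAbove η ξ} :=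
  isOpen_lt (hη.comp Complex.continuous_re) Complex.continuous_im

theorem isOpen_below {η : ℝ → ℝ} (hη : Continuous η) : IsOpen {ξ : ℂ | ξ.im < η ξ.re} :=
  isOpen_lt Complex.continuous_im (hη.comp Complex.continuous_re)

theorem isClosed_isOn {η : ℝ → ℝ} (hη : Continuous η) : IsClosed {ξ : ℂ | IsOn η ξ} :=
  isClosed_eq Complex.continuous_im (hη.comp Complex.continuous_re)

theorem IsAbove.not_isOn {η : ℝ → ℝ} {ξ : ℂ} (h : IsAbove η ξ) : ¬ IsOn η ξ :=
  fun h' => lt_irrefl _ (h.trans_eq h')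

theorem not_isOn_of_below {η : ℝ → ℝ} {ξ : ℂ} (h : ξ.im < η ξ.re) : ¬ IsOn η ξ :=
  fun h' => lt_irrefl _ (h.trans_eq h'.symm)

theorem not_isAbove_of_below {η : ℝ → ℝ} {ξ : ℂ} (h : ξ.im < η ξ.re) : ¬ IsAbove η ξ :=
  fun h' => lt_irrefl _ (h.trans h')

theorem below_of_not {η : ℝ → ℝ} {ξ : ℂ} (h : ¬ IsAbove η ξ) (h' : ¬ IsOn η ξ) :
    ξ.im < η ξ.re :=
  lt_of_le_of_ne (not_lt.1 h) h'

theorem isOn_pathPoint (η : ℝ → ℝ) (s : ℝ) : IsOn η (pathPoint η s) := by simp [IsOn]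

theorem IsOn.eq_pathPoint {η : ℝ → ℝ} {ξ : ℂ} (h : IsOn η ξ) : pathPoint η ξ.re = ξ :=
  Complex.ext (by simp) (by simpa using Eq.symm h)

theorem analyticAt_cauchyIntegral {η : ℝ → ℝ} {g : ℂ → ℂ} (h : CauchyIntegrable η g)
    (hη : Continuous η) {ξ₀ : ℂ} (hξ : ¬ IsOn η ξ₀) :
    AnalyticAt ℂ (cauchyIntegral η g) ξ₀ := by
  rw [Complex.analyticAt_iff_eventually_differentiableAt]
  filter_upwards [(isClosed_isOn hη).isOpen_compl.mem_nhds hξ] with ξ hξ'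
  exact differentiableAt_cauchyIntegral h hη hξ'

/-! ### The additive splitting and its difference quotients -/

open Classical in
/-- The upper part of the additive splitting of `g` along the path: the Cauchy integral above the
path, continued across it by the jump relation. -/
def plusPart (η : ℝ → ℝ) (g : ℂ → ℂ) (ξ : ℂ) : ℂ :=
  if IsAbove η ξ then cauchyIntegral η g ξ
  else if IsOn η ξ then g ξ / 2 + pvCauchyIntegral η g ξ
  else g ξ + cauchyIntegral η g ξ

theorem plusPart_of_isAbove {η : ℝ → ℝ} {g : ℂ → ℂ} {ξ : ℂ} (h : IsAbove η ξ) :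
    plusPart η g ξ = cauchyIntegral η g ξ := if_pos h

theorem plusPart_of_isOn {η : ℝ → ℝ} {g : ℂ → ℂ} {ξ : ℂ} (h : IsOn η ξ) :
    plusPart η g ξ = g ξ / 2 + pvCauchyIntegral η g ξ := by
  rw [plusPart, if_neg (fun h' => h'.not_isOn h), if_pos h]

theorem plusPart_of_below {η : ℝ → ℝ} {g : ℂ → ℂ} {ξ : ℂ} (h : ξ.im < η ξ.re) :
    plusPart η g ξ = g ξ + cauchyIntegral η g ξ := by
  rw [plusPart, if_neg (not_isAbove_of_below h), if_neg (not_isOn_of_below h)]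

/-- The integral of the difference quotient of `g` at `ξ` over a window of the path. -/
def slopeIntegral (η : ℝ → ℝ) (g : ℂ → ℂ) (ξ : ℂ) (R : ℝ) : ℂ :=
  ∫ s in (ξ.re - R)..(ξ.re + R), dslope g ξ (pathPoint η s) * pathVel η s

theorem dslope_mul_eq {g : ℂ → ℂ} {ξ t : ℂ} (h : t - ξ ≠ 0) (w : ℂ) :
    dslope g ξ t * w = g t / (t - ξ) * w - g ξ * (w / (t - ξ)) := by
  rw [dslope_of_ne _ (sub_ne_zero.1 h), slope_def_field]
  field_simp

/-- The window is centred at Re ξ, so both arguments have the form R(1 + iO(1/R)). The real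
logarithms cancel and the rest tends to log 1. Hence the integral of dt/(t - ξ) over growing windows
tends to ±πi for ξ off the path. -/
theorem tendsto_log_sub_log {η : ℝ → ℝ} (hη : IsGoodPath η) (ξ : ℂ) :
    Tendsto (fun R : ℝ => Complex.log (pathPoint η (ξ.re + R) - ξ) -
      Complex.log (ξ - pathPoint η (ξ.re - R))) atTop (𝓝 0) := by
  obtain ⟨H, hH⟩ := hη.bounded
  have aux : ∀ u : ℝ → ℝ, (∀ R, |u R| ≤ H + |ξ.im|) →
      Tendsto (fun R : ℝ => Complex.log (1 + (u R / R : ℝ) * Complex.I)) atTop (𝓝 0) := by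
    intro u hu
    have h1 : Tendsto (fun R : ℝ => u R / R) atTop (𝓝 0) := by
      refine squeeze_zero_norm' (a := fun R : ℝ => (H + |ξ.im|) / R) ?_
        (tendsto_const_nhds.div_atTop tendsto_id)
      filter_upwards [eventually_gt_atTop 0] with R hR
      rw [Real.norm_eq_abs, abs_div, abs_of_pos hR]
      gcongr
      exact hu R
    have h2 : Tendsto (fun R : ℝ => 1 + ((u R / R : ℝ) : ℂ) * Complex.I) atTop (𝓝 1) := by
      have := ((Complex.continuous_ofReal.tendsto 0).comp h1).mul_const Complex.I
      simpa using this.const_add 1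
    have h3 := (continuousAt_clog Complex.one_mem_slitPlane).tendsto.comp h2
    rwa [Complex.log_one] at h3
  have h1 := aux (fun R => η (ξ.re + R) - ξ.im) fun R =>
    (abs_sub _ _).trans (by gcongr; exact hH _)
  have h2 := aux (fun R => ξ.im - η (ξ.re - R)) fun R =>
    (abs_sub _ _).trans (by rw [add_comm]; gcongr; exact hH _)
  have h3 := h1.sub h2
  rw [sub_zero] at h3
  refine h3.congr' ?_
  filter_upwards [eventually_gt_atTop 0] with R hR
  have aux2 : ∀ u : ℝ, Complex.log ((R : ℂ) + u * Complex.I) =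
      Real.log R + Complex.log (1 + (u / R : ℝ) * Complex.I) := by
    intro u
    have hR' : (R : ℂ) ≠ 0 := by exact_mod_cast hR.ne'
    rw [← Complex.log_ofReal_mul hR]
    · congr 1
      push_cast
      field_simp
    · intro h0
      have := congrArg Complex.re h0
      simp at this
  have e1 : pathPoint η (ξ.re + R) - ξ = (R : ℂ) + (η (ξ.re + R) - ξ.im : ℝ) * Complex.I :=
    Complex.ext (by simp) (by simp)
  have e2 : ξ - pathPoint η (ξ.re - R) = (R : ℂ) + (ξ.im - η (ξ.re - R) : ℝ) * Complex.I :=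
    Complex.ext (by simp) (by simp)
  rw [e1, e2, aux2, aux2]
  ring

theorem slopeIntegral_eq_of_not_isOn {η : ℝ → ℝ} (hη : IsGoodPath η) {g : ℂ → ℂ}
    (hg : CauchyIntegrable η g) {ξ : ℂ} (hξ : ¬ IsOn η ξ) (R : ℝ) :
    slopeIntegral η g ξ R =
      (∫ s in (ξ.re - R)..(ξ.re + R), g (pathPoint η s) / (pathPoint η s - ξ) * pathVel η s) -
      g ξ * ∫ s in (ξ.re - R)..(ξ.re + R), pathVel η s / (pathPoint η s - ξ) := by
  rw [slopeIntegral, ← intervalIntegral.integral_const_mul, ← intervalIntegral.integral_sub]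
  · exact intervalIntegral.integral_congr fun s _ => dslope_mul_eq (pathPoint_sub_ne_zero hξ s) _
  · exact (hg.integrable_div hη.smooth.continuous hξ).intervalIntegrable
  · exact (intervalIntegrable_pathVel_div hη.smooth hξ _ _).const_mul _

theorem tendsto_window_integral {f : ℝ → ℂ} (hf : MeasureTheory.Integrable f) (s₀ : ℝ) :
    Tendsto (fun R : ℝ => ∫ s in (s₀ - R)..(s₀ + R), f s) atTop (𝓝 (∫ s, f s)) :=
  MeasureTheory.intervalIntegral_tendsto_integral hf
    (tendsto_atBot_add_const_left _ s₀ tendsto_neg_atTop_atBot)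
    (tendsto_atTop_add_const_left _ s₀ tendsto_id)

theorem two_pi_I_mul_cauchyIntegral (η : ℝ → ℝ) (g : ℂ → ℂ) (ξ : ℂ) :
    2 * Real.pi * Complex.I * cauchyIntegral η g ξ =
      ∫ s : ℝ, g (pathPoint η s) / (pathPoint η s - ξ) * pathVel η s := by
  rw [cauchyIntegral, ← mul_assoc, mul_one_div_cancel Complex.two_pi_I_ne_zero, one_mul]

/-- The difference quotient is the Cauchy integrand minus g(ξ)/(t - ξ), and the latter contributes
±πi g(ξ). Above the path this subtracts half of g, below it adds half of g, and the jump term in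
`plusPart` makes the two results one formula. -/
theorem tendsto_slopeIntegral_of_not_isOn {η : ℝ → ℝ} (hη : IsGoodPath η) {g : ℂ → ℂ}
    (hg : CauchyIntegrable η g) {ξ : ℂ} (hξ : ¬ IsOn η ξ) :
    Tendsto (slopeIntegral η g ξ) atTop
      (𝓝 (2 * Real.pi * Complex.I * (plusPart η g ξ - g ξ / 2))) := by
  have h1 := tendsto_window_integral (hg.integrable_div hη.smooth.continuous hξ) ξ.re
  have h2 : ∀ σ : ℂ, (∀ R : ℝ, 0 < R → ∫ s in (ξ.re - R)..(ξ.re + R),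
      pathVel η s / (pathPoint η s - ξ) = Complex.log (pathPoint η (ξ.re + R) - ξ) -
      Complex.log (ξ - pathPoint η (ξ.re - R)) + σ) →
      Tendsto (slopeIntegral η g ξ) atTop (𝓝 (2 * Real.pi * Complex.I * cauchyIntegral η g ξ
        - g ξ * σ)) := by
    intro σ hσ
    have h3 : Tendsto (fun R : ℝ => ∫ s in (ξ.re - R)..(ξ.re + R),
        pathVel η s / (pathPoint η s - ξ)) atTop (𝓝 σ) := by
      have := (tendsto_log_sub_log hη ξ).add_const σ
      rw [zero_add] at this
      refine this.congr' ?_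
      filter_upwards [eventually_gt_atTop 0] with R hR
      exact (hσ R hR).symm
    rw [two_pi_I_mul_cauchyIntegral]
    exact (h1.sub (h3.const_mul (g ξ))).congr fun R =>
      (slopeIntegral_eq_of_not_isOn hη hg hξ R).symm
  by_cases ha : IsAbove η ξ
  · convert h2 (Real.pi * Complex.I) (fun R hR => integral_pathVel_div_of_isAbove hη.smooth
      (by linarith) (by linarith) ha) using 2
    rw [plusPart_of_isAbove ha]; ring
  · have hb := below_of_not ha hξ
    convert h2 (-(Real.pi * Complex.I)) (fun R hR => by
      rw [integral_pathVel_div_of_below hη.smooth (by linarith) (by linarith) hb]; ring) using 2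
    rw [plusPart_of_below hb]; ring

/-! ### The principal value integral -/

theorem one_le_norm_pathVel (η : ℝ → ℝ) (s : ℝ) : 1 ≤ ‖pathVel η s‖ := by
  simpa using Complex.abs_re_le_norm (pathVel η s)

theorem norm_pathPoint_sub_le {η : ℝ → ℝ} (hη : Differentiable ℝ η) {B : ℝ}
    (hB : ∀ s, |deriv η s| ≤ B) (s t : ℝ) :
    ‖pathPoint η s - pathPoint η t‖ ≤ (1 + B) * |s - t| := by
  have := Convex.norm_image_sub_le_of_norm_hasDerivWithin_le (f := pathPoint η)
    (f' := pathVel η) (s := Set.univ) (C := 1 + B)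
    (fun x _ => (hasDerivAt_pathPoint (hη x)).hasDerivWithinAt)
    (fun x _ => (norm_pathVel_le η x).trans (by gcongr; exact hB x)) convex_univ
    (Set.mem_univ t) (Set.mem_univ s)
  simpa using this

theorem measurable_pathVel_div {η : ℝ → ℝ} (hη : ContDiff ℝ 1 η) (ξ : ℂ) :
    Measurable fun s => pathVel η s / (pathPoint η s - ξ) :=
  (continuous_pathVel hη).measurable.div
    ((continuous_pathPoint hη.continuous).sub continuous_const).measurable

theorem norm_pathVel_div_le {η : ℝ → ℝ} {B : ℝ} (hB : ∀ s, |deriv η s| ≤ B) {s d : ℝ} {ξ : ℂ}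
    (hd : 0 < d) (h : d ≤ ‖pathPoint η s - ξ‖) :
    ‖pathVel η s / (pathPoint η s - ξ)‖ ≤ (1 + B) / d := by
  have h0 : 0 ≤ 1 + B := by linarith [(abs_nonneg _).trans (hB s)]
  rw [norm_div]
  gcongr
  exact (norm_pathVel_le η s).trans (by gcongr; exact hB s)

theorem integrableOn_pathVel_div {η : ℝ → ℝ} (hη : IsGoodPath η) {d : ℝ} {ξ : ℂ} (hd : 0 < d)
    {A : Set ℝ} (hA : MeasurableSet A) (h : ∀ s ∈ A, d ≤ ‖pathPoint η s - ξ‖) (a b : ℝ) :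
    MeasureTheory.IntegrableOn (fun s => pathVel η s / (pathPoint η s - ξ))
      (A ∩ Set.Ioc a b) := by
  obtain ⟨B, hB⟩ := hη.bounded_deriv
  refine MeasureTheory.Measure.integrableOn_of_bounded (M := (1 + B) / d) ?_
    (measurable_pathVel_div hη.smooth ξ).aestronglyMeasurable ?_
  · exact ((MeasureTheory.measure_mono Set.inter_subset_right).trans_lt
      measure_Ioc_lt_top).ne
  · exact (MeasureTheory.ae_restrict_iff' (hA.inter measurableSet_Ioc)).2
      (Eventually.of_forall fun s hs => norm_pathVel_div_le hB hd (h s hs.1))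

theorem measurableSet_far {η : ℝ → ℝ} (hη : Continuous η) (ξ : ℂ) (r : ℝ) :
    MeasurableSet {s : ℝ | r < ‖pathPoint η s - ξ‖} :=
  measurableSet_lt measurable_const
    ((continuous_pathPoint hη).sub continuous_const).norm.measurable

/-- Excluding a disc or the corresponding interval makes no difference in the limit. -/
theorem tendsto_disc_sub_interval {η : ℝ → ℝ} (hη : IsGoodPath η) (s₀ : ℝ) :
    Tendsto (fun r : ℝ =>
      (∫ s in {s : ℝ | r < ‖pathPoint η s - pathPoint η s₀‖} ∩ Set.Ioc (s₀ - 1) (s₀ + 1),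
        pathVel η s / (pathPoint η s - pathPoint η s₀)) -
      ∫ s in {s : ℝ | r / ‖pathVel η s₀‖ < |s - s₀|} ∩ Set.Ioc (s₀ - 1) (s₀ + 1),
        pathVel η s / (pathPoint η s - pathPoint η s₀)) (𝓝[>] 0) (𝓝 0) := by
  obtain ⟨B, hB⟩ := hη.bounded_deriv
  have hdiff := hη.smooth.differentiable one_ne_zero
  have hB0 : 0 ≤ B := (abs_nonneg _).trans (hB 0)
  set ℓ := ‖pathVel η s₀‖
  have hℓ : 1 ≤ ℓ := one_le_norm_pathVel η s₀
  have hℓB : ℓ ≤ 1 + B := (norm_pathVel_le η s₀).trans (by gcongr; exact hB s₀)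
  set m : ℝ → ℂ := fun s => pathVel η s / (pathPoint η s - pathPoint η s₀) with hm
  have hmm : Measurable m := measurable_pathVel_div hη.smooth _
  set W := Set.Ioc (s₀ - 1) (s₀ + 1) with hW
  set A : ℝ → Set ℝ := fun r => {s : ℝ | r < ‖pathPoint η s - pathPoint η s₀‖} with hA
  set D : ℝ → Set ℝ := fun r => {s : ℝ | r / ℓ < |s - s₀|} with hD
  have hAm : ∀ r, MeasurableSet (A r) := fun r => measurableSet_far hη.smooth.continuous _ r
  have hDm : ∀ r, MeasurableSet (D r) := fun r =>
    measurableSet_lt measurable_const (by fun_prop)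
  have hlow : ∀ s, |s - s₀| ≤ ‖pathPoint η s - pathPoint η s₀‖ := fun s => by
    simpa using abs_sub_re_le η (pathPoint η s₀) s
  have hup : ∀ s, ‖pathPoint η s - pathPoint η s₀‖ ≤ (1 + B) * |s - s₀| := fun s =>
    norm_pathPoint_sub_le hdiff hB s s₀
  -- After the substitution s = s₀ + ru the two excluded sets can differ only for 1/(1+B) < |u| ≤ 1.
  -- There the integrand is at most (1+B)/(r|u|), so rΔ stays bounded and dominated convergence
  -- applies.
  set Δ : ℝ → ℝ → ℂ := fun r s => (A r ∩ W).indicator m s - (D r ∩ W).indicator m s with hΔ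
  have hΔm : ∀ r, Measurable (Δ r) := fun r =>
    (hmm.indicator ((hAm r).inter measurableSet_Ioc)).sub
      (hmm.indicator ((hDm r).inter measurableSet_Ioc))
  have key : Tendsto (fun r : ℝ => ∫ u : ℝ, (r : ℂ) * Δ r (s₀ + r * u)) (𝓝[>] 0)
      (𝓝 (∫ u : ℝ, (0 : ℂ))) := by
    refine MeasureTheory.tendsto_integral_filter_of_dominated_convergence
      (bound := (Set.Icc (-1 : ℝ) 1).indicator fun _ => (1 + B) ^ 2) ?_ ?_ ?_ ?_
    · refine Eventually.of_forall fun r => ?_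
      exact (((hΔm r).comp (by fun_prop)).const_mul _).aestronglyMeasurable
    · filter_upwards [self_mem_nhdsWithin] with r (hr : 0 < r)
      refine Eventually.of_forall fun u => ?_
      have hsub : |s₀ + r * u - s₀| = r * |u| := by
        rw [add_sub_cancel_left, abs_mul, abs_of_pos hr]
      have hl := hlow (s₀ + r * u)
      have hu := hup (s₀ + r * u)
      rw [hsub] at hl hu
      have hzero : (s₀ + r * u ∈ A r ↔ s₀ + r * u ∈ D r) → Δ r (s₀ + r * u) = 0 := by
        intro h
        simp only [hΔ, Set.indicator, Set.mem_inter_iff, h, sub_self]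
      by_cases hu1 : u ∈ Set.Icc (-1 : ℝ) 1
      · rw [Set.indicator_of_mem hu1]
        by_cases hu2 : (1 + B) * |u| ≤ 1
        · rw [hzero]
          · simp; positivity
          · have h1 : ¬ s₀ + r * u ∈ A r := by
              simp only [hA, Set.mem_ofPred_eq, not_lt]
              nlinarith
            have h2 : ¬ s₀ + r * u ∈ D r := by
              simp only [hD, Set.mem_ofPred_eq, not_lt, hsub]
              rw [le_div_iff₀ (by linarith)]
              nlinarith [abs_nonneg u, mul_le_mul_of_nonneg_right hℓB (abs_nonneg u)]
            exact iff_of_false h1 h2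
        · have hupos : 0 < |u| := by
            by_contra hc
            have : |u| = 0 := le_antisymm (not_lt.1 hc) (abs_nonneg u)
            rw [this] at hu2; simp at hu2
          have hmle : ‖m (s₀ + r * u)‖ ≤ (1 + B) / (r * |u|) :=
            norm_pathVel_div_le hB (by positivity) hl
          have hΔle : ‖Δ r (s₀ + r * u)‖ ≤ ‖m (s₀ + r * u)‖ := by
            simp only [hΔ, Set.indicator]
            split_ifs <;> simp
          rw [norm_mul, Complex.norm_of_nonneg hr.le]
          calc r * ‖Δ r (s₀ + r * u)‖ ≤ r * ((1 + B) / (r * |u|)) := by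
                gcongr; exact hΔle.trans hmle
            _ = (1 + B) * (1 / |u|) := by field_simp
            _ ≤ (1 + B) * (1 + B) := by
                gcongr
                rw [div_le_iff₀ hupos]
                exact (not_le.1 hu2).le
            _ = (1 + B) ^ 2 := by ring
      · rw [Set.indicator_of_notMem hu1, hzero]
        · simp
        · have hu3 : 1 < |u| := by
            by_contra hc
            exact hu1 (abs_le.1 (not_lt.1 hc))
          have h1 : s₀ + r * u ∈ A r := by
            simp only [hA, Set.mem_ofPred_eq]
            nlinarith
          have h2 : s₀ + r * u ∈ D r := by
            simp only [hD, Set.mem_ofPred_eq, hsub]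
            rw [div_lt_iff₀ (by linarith)]
            exact (lt_mul_of_one_lt_right hr hu3).trans_le
              (le_mul_of_one_le_right (by positivity) hℓ)
          exact iff_of_true h1 h2
    · exact (MeasureTheory.integrable_indicator_iff measurableSet_Icc).2
        (MeasureTheory.integrableOn_const (by simp))
    -- The scaled distance to the base point tends to ℓ|u|, so unless ℓ|u| = 1 the two conditions
    -- agree for all small r.
    · have hne : ∀ᵐ u : ℝ, u ≠ 1 / ℓ ∧ u ≠ -(1 / ℓ) :=
        (MeasureTheory.Measure.ae_ne _ _).and (MeasureTheory.Measure.ae_ne _ _)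
      filter_upwards [hne] with u hu
      have hlim : Tendsto (fun r : ℝ => ‖pathPoint η (s₀ + r * u) - pathPoint η s₀‖ / r)
          (𝓝[>] 0) (𝓝 (ℓ * |u|)) := by
        have h1 : HasDerivAt (fun r : ℝ => s₀ + r * u) u 0 := by
          simpa using ((hasDerivAt_id (0 : ℝ)).mul_const u).const_add s₀
        have h0 : HasDerivAt (pathPoint η) (pathVel η s₀) (s₀ + 0 * u) := by
          simpa using hasDerivAt_pathPoint (hdiff s₀)
        have h2 := (HasDerivAt.scomp (0 : ℝ) h0 h1).tendsto_slope_zero_right.norm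
        simp only [Function.comp_def, zero_add, zero_mul, add_zero, norm_smul, norm_inv,
          Real.norm_eq_abs] at h2
        rw [mul_comm]
        refine h2.congr' ?_
        filter_upwards [self_mem_nhdsWithin] with r (hr : 0 < r)
        rw [abs_of_pos hr, inv_mul_eq_div]
      have hcase : ℓ * |u| ≠ 1 := by
        intro h
        have h3 : |u| = 1 / ℓ := by field_simp; linarith
        rcases abs_choice u with h4 | h4
        · exact hu.1 (by rw [← h3, h4])
        · exact hu.2 (by rw [← h3, h4]; ring)
      refine tendsto_const_nhds.congr' ?_
      have hiff : ∀ᶠ r in 𝓝[>] (0 : ℝ), (s₀ + r * u ∈ A r ↔ s₀ + r * u ∈ D r) := by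
        rcases lt_or_gt_of_ne hcase with h | h
        · filter_upwards [hlim.eventually (gt_mem_nhds h), self_mem_nhdsWithin] with r h1 (hr : 0 < r)
          rw [div_lt_iff₀ hr] at h1
          refine iff_of_false ?_ ?_
          · simp only [hA, Set.mem_ofPred_eq, not_lt]; linarith
          · simp only [hD, Set.mem_ofPred_eq, not_lt, add_sub_cancel_left, abs_mul, abs_of_pos hr]
            rw [le_div_iff₀ (by linarith)]
            nlinarith
        · filter_upwards [hlim.eventually (lt_mem_nhds h), self_mem_nhdsWithin] with r h1 (hr : 0 < r)
          rw [lt_div_iff₀ hr] at h1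
          refine iff_of_true ?_ ?_
          · simp only [hA, Set.mem_ofPred_eq]; linarith
          · simp only [hD, Set.mem_ofPred_eq, add_sub_cancel_left, abs_mul, abs_of_pos hr]
            rw [div_lt_iff₀ (by linarith)]
            nlinarith
      filter_upwards [hiff] with r h
      simp only [hΔ, Set.indicator, Set.mem_inter_iff, h, sub_self, mul_zero]
  rw [MeasureTheory.integral_zero] at key
  refine key.congr' ?_
  filter_upwards [self_mem_nhdsWithin] with r (hr : 0 < r)
  have hscale : ∫ u : ℝ, (r : ℂ) * Δ r (s₀ + r * u) = ∫ s, Δ r s := by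
    rw [MeasureTheory.integral_const_mul]
    have h1 := MeasureTheory.Measure.integral_comp_mul_left (fun x => Δ r (s₀ + x)) r
    rw [h1, MeasureTheory.integral_add_left_eq_self, abs_of_pos (inv_pos.2 hr),
      Complex.real_smul, ← mul_assoc]
    have : (r : ℂ) * ((r⁻¹ : ℝ) : ℂ) = 1 := by
      exact_mod_cast mul_inv_cancel₀ hr.ne'
    rw [this, one_mul]
  rw [hscale]
  have i1 : MeasureTheory.IntegrableOn m (A r ∩ W) :=
    integrableOn_pathVel_div hη hr (hAm r) (fun s hs => le_of_lt hs) _ _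
  have i2 : MeasureTheory.IntegrableOn m (D r ∩ W) :=
    integrableOn_pathVel_div hη (d := r / ℓ) (by positivity) (hDm r)
      (fun s hs => (le_of_lt hs).trans (hlow s)) _ _
  have m1 := (hAm r).inter (measurableSet_Ioc (a := s₀ - 1) (b := s₀ + 1))
  have m2 := (hDm r).inter (measurableSet_Ioc (a := s₀ - 1) (b := s₀ + 1))
  rw [← MeasureTheory.integral_indicator m1, ← MeasureTheory.integral_indicator m2,
    ← MeasureTheory.integral_sub (i1.integrable_indicator m1) (i2.integrable_indicator m2)]

theorem integral_interval_excluded {η : ℝ → ℝ} (hη : ContDiff ℝ 1 η) (s₀ : ℝ) {ρ : ℝ}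
    (h0 : 0 < ρ) (h1 : ρ < 1) :
    ∫ s in {s : ℝ | ρ < |s - s₀|} ∩ Set.Ioc (s₀ - 1) (s₀ + 1),
        pathVel η s / (pathPoint η s - pathPoint η s₀) =
      (Complex.log (pathPoint η (s₀ + 1) - pathPoint η s₀) -
        Complex.log (pathPoint η s₀ - pathPoint η (s₀ - 1))) +
      (Complex.log (pathPoint η s₀ - pathPoint η (s₀ - ρ)) -
        Complex.log (pathPoint η (s₀ + ρ) - pathPoint η s₀)) := by
  have hset : {s : ℝ | ρ < |s - s₀|} ∩ Set.Ioc (s₀ - 1) (s₀ + 1) =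
      Set.Ioo (s₀ - 1) (s₀ - ρ) ∪ Set.Ioc (s₀ + ρ) (s₀ + 1) := by
    ext s
    simp only [Set.mem_inter_iff, Set.mem_ofPred_eq, Set.mem_Ioc, Set.mem_union, Set.mem_Ioo,
      lt_abs]
    constructor
    · rintro ⟨h | h, h2, h3⟩
      · right; constructor <;> linarith
      · left; constructor <;> linarith
    · rintro (⟨h, h2⟩ | ⟨h, h2⟩)
      · exact ⟨Or.inr (by linarith), by linarith, by linarith⟩
      · exact ⟨Or.inl (by linarith), by linarith, by linarith⟩
  have e1 := integral_pathVel_div_of_re_lt hη (p := pathPoint η s₀) (a := s₀ + ρ) (b := s₀ + 1)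
    (by simpa using h0) (by linarith)
  have e2 := integral_pathVel_div_of_lt_re hη (p := pathPoint η s₀) (a := s₀ - 1) (b := s₀ - ρ)
    (by simpa using h0) (by linarith)
  have hcont : ∀ K : Set ℝ, s₀ ∉ K → ContinuousOn
      (fun s => pathVel η s / (pathPoint η s - pathPoint η s₀)) K := by
    intro K hK
    refine (continuous_pathVel hη).continuousOn.div
      ((continuous_pathPoint hη.continuous).sub continuous_const).continuousOn fun s hs h => ?_
    have := congrArg Complex.re h
    simp [sub_eq_zero] at this
    exact hK (this ▸ hs)
  rw [hset, MeasureTheory.setIntegral_union, ← MeasureTheory.integral_Ioc_eq_integral_Ioo,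
    ← intervalIntegral.integral_of_le (by linarith), ← intervalIntegral.integral_of_le (by linarith),
    e1, e2]
  · ring
  · rw [Set.disjoint_left]
    rintro s ⟨_, h⟩ ⟨h', _⟩
    linarith
  · exact measurableSet_Ioc
  · exact ((hcont (Set.Icc (s₀ - 1) (s₀ - ρ)) (fun h => by linarith [h.2])).integrableOn_Icc).mono_set
      Set.Ioo_subset_Icc_self
  · exact ((hcont (Set.Icc (s₀ + ρ) (s₀ + 1)) (fun h => by linarith [h.1])).integrableOn_Icc).mono_set
      Set.Ioc_subset_Icc_self

/-- Each difference is ρ times a quotient tending to the velocity of the path. The velocity has real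
part 1, so the logarithm is continuous there, and log ρ cancels. -/
theorem tendsto_log_bracket {η : ℝ → ℝ} (hη : ContDiff ℝ 1 η) (s₀ : ℝ) :
    Tendsto (fun ρ : ℝ => Complex.log (pathPoint η s₀ - pathPoint η (s₀ - ρ)) -
        Complex.log (pathPoint η (s₀ + ρ) - pathPoint η s₀)) (𝓝[>] 0) (𝓝 0) := by
  have hd := hasDerivAt_pathPoint (hη.differentiable one_ne_zero s₀)
  have hslit : pathVel η s₀ ∈ Complex.slitPlane := Or.inl (by simp)
  have h1 : Tendsto (fun ρ : ℝ => (ρ : ℂ)⁻¹ * (pathPoint η (s₀ + ρ) - pathPoint η s₀)) (𝓝[>] 0)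
      (𝓝 (pathVel η s₀)) := by
    have := hd.tendsto_slope_zero_right
    refine this.congr fun ρ => ?_
    rw [← Complex.ofReal_inv, Complex.real_smul]
  have h2 : Tendsto (fun ρ : ℝ => (ρ : ℂ)⁻¹ * (pathPoint η s₀ - pathPoint η (s₀ - ρ))) (𝓝[>] 0)
      (𝓝 (pathVel η s₀)) := by
    have hneg : Tendsto (fun ρ : ℝ => -ρ) (𝓝[>] 0) (𝓝[<] 0) := by
      simpa using tendsto_neg_nhdsGT (a := (0 : ℝ))
    have := hd.tendsto_slope_zero_left.comp hneg
    refine this.congr fun ρ => ?_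
    simp only [Function.comp_apply, Complex.real_smul, Complex.ofReal_inv, Complex.ofReal_neg,
      ← sub_eq_add_neg, inv_neg]
    ring
  have h3 := ((continuousAt_clog hslit).tendsto.comp h2).sub
    ((continuousAt_clog hslit).tendsto.comp h1)
  rw [sub_self] at h3
  refine h3.congr' ?_
  filter_upwards [self_mem_nhdsWithin] with ρ (hρ : 0 < ρ)
  simp only [Function.comp_apply]
  rw [← Complex.ofReal_inv, Complex.log_ofReal_mul (inv_pos.2 hρ),
    Complex.log_ofReal_mul (inv_pos.2 hρ)]
  · ring
  · intro h
    have := congrArg Complex.re h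
    simp at this; exact hρ.ne' this
  · intro h
    have := congrArg Complex.re h
    simp at this; exact hρ.ne' this

theorem tendsto_pv_pathVel {η : ℝ → ℝ} (hη : IsGoodPath η) (s₀ : ℝ) :
    Tendsto (fun r : ℝ =>
      ∫ s in {s : ℝ | r < ‖pathPoint η s - pathPoint η s₀‖} ∩ Set.Ioc (s₀ - 1) (s₀ + 1),
        pathVel η s / (pathPoint η s - pathPoint η s₀)) (𝓝[>] 0)
      (𝓝 (Complex.log (pathPoint η (s₀ + 1) - pathPoint η s₀) -
        Complex.log (pathPoint η s₀ - pathPoint η (s₀ - 1)))) := by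
  have hℓ : 1 ≤ ‖pathVel η s₀‖ := one_le_norm_pathVel η s₀
  have hℓ0 : 0 < ‖pathVel η s₀‖ := by linarith
  have ht : Tendsto (fun r : ℝ => r / ‖pathVel η s₀‖) (𝓝[>] 0) (𝓝[>] 0) := by
    refine tendsto_nhdsWithin_iff.2 ⟨?_, ?_⟩
    · have : Tendsto (fun r : ℝ => r / ‖pathVel η s₀‖) (𝓝 0) (𝓝 (0 / ‖pathVel η s₀‖)) :=
        (continuous_id.div_const _).tendsto 0
      rw [zero_div] at this
      exact this.mono_left nhdsWithin_le_nhds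
    · filter_upwards [self_mem_nhdsWithin] with r (hr : 0 < r)
      exact div_pos hr hℓ0
  have h1 := (tendsto_disc_sub_interval hη s₀).add
    (((tendsto_log_bracket hη.smooth s₀).comp ht).const_add
      (Complex.log (pathPoint η (s₀ + 1) - pathPoint η s₀) -
        Complex.log (pathPoint η s₀ - pathPoint η (s₀ - 1))))
  rw [add_zero, zero_add] at h1
  refine h1.congr' ?_
  filter_upwards [self_mem_nhdsWithin, Ioo_mem_nhdsGT (zero_lt_one' ℝ)] with r (hr : 0 < r) hr1
  rw [integral_interval_excluded hη.smooth s₀ (div_pos hr hℓ0)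
    (by rw [div_lt_one hℓ0]; exact hr1.2.trans_le hℓ)]
  simp only [Function.comp_apply]
  ring

/-- Near s₀ this is the difference quotient of g times the velocity, which is bounded because g is
analytic at the point; away from s₀ both terms are integrable separately. All that is singular in
the principal value is then an explicit integral of dt/(t - ξ) over a unit window. -/
theorem exists_regular_part {η : ℝ → ℝ} (hη : IsGoodPath η) {g : ℂ → ℂ}
    (hg : CauchyIntegrable η g) {s₀ : ℝ} (ha : AnalyticAt ℂ g (pathPoint η s₀)) :
    MeasureTheory.Integrable fun s =>
      g (pathPoint η s) / (pathPoint η s - pathPoint η s₀) * pathVel η s -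
      g (pathPoint η s₀) * (Set.Ioc (s₀ - 1) (s₀ + 1)).indicator
        (fun s => pathVel η s / (pathPoint η s - pathPoint η s₀)) s := by
  obtain ⟨B, hB⟩ := hη.bounded_deriv
  have hB0 : 0 ≤ B := (abs_nonneg _).trans (hB 0)
  set ξ := pathPoint η s₀ with hξ
  set m : ℝ → ℂ := fun s => pathVel η s / (pathPoint η s - ξ) with hm
  set q : ℝ → ℂ := fun s => g (pathPoint η s) / (pathPoint η s - ξ) * pathVel η s with hq
  set W := Set.Ioc (s₀ - 1) (s₀ + 1) with hW
  have hlow : ∀ s, |s - s₀| ≤ ‖pathPoint η s - ξ‖ := fun s => by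
    simpa [hξ] using abs_sub_re_le η ξ s
  have hcont : ContinuousAt (fun s => dslope g ξ (pathPoint η s)) s₀ :=
    ContinuousAt.comp (f := pathPoint η) (x := s₀)
      (continuousAt_dslope_same.2 ha.differentiableAt)
      (continuous_pathPoint hη.smooth.continuous).continuousAt
  set C := ‖dslope g ξ (pathPoint η s₀)‖ + 1
  have hev : ∀ᶠ s in 𝓝 s₀, ‖dslope g ξ (pathPoint η s)‖ < C :=
    hcont.norm.eventually (gt_mem_nhds (lt_add_one _))
  obtain ⟨δ', hδ', hball⟩ := Metric.eventually_nhds_iff.1 hev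
  set δ := min δ' 1
  have hδ : 0 < δ := lt_min hδ' one_pos
  set N := Set.Ioo (s₀ - δ) (s₀ + δ) with hN
  have hNm : MeasurableSet N := measurableSet_Ioo
  have hmeasm : Measurable m := measurable_pathVel_div hη.smooth ξ
  have hmeasW : Measurable (W.indicator m) := hmeasm.indicator measurableSet_Ioc
  have hmeasq : MeasureTheory.AEStronglyMeasurable q := by
    have : Measurable fun s : ℝ => (pathPoint η s - ξ) :=
      ((continuous_pathPoint hη.smooth.continuous).sub continuous_const).measurable
    refine (hg.aestronglyMeasurable.mul this.inv.aestronglyMeasurable).congr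
      (Eventually.of_forall fun s => ?_)
    simp only [Pi.mul_apply, Pi.inv_apply, hq]
    ring
  have hmeas : MeasureTheory.AEStronglyMeasurable fun s => q s - g ξ * W.indicator m s :=
    hmeasq.sub (hmeasW.const_mul _).aestronglyMeasurable
  have hfar : ∀ s ∈ Nᶜ, δ ≤ |s - s₀| := by
    intro s hs
    by_contra hc
    have := abs_lt.1 (not_le.1 hc)
    exact hs ⟨by linarith, by linarith⟩
  have i1 : MeasureTheory.IntegrableOn (fun s => q s - g ξ * W.indicator m s) N := by
    refine MeasureTheory.Measure.integrableOn_of_bounded (M := C * (1 + B)) (by simp [hN]) hmeas ?_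
    refine (MeasureTheory.ae_restrict_iff' hNm).2 (Eventually.of_forall fun s hs => ?_)
    have hsW : s ∈ W := by
      have : δ ≤ 1 := min_le_right _ _
      exact ⟨by linarith [hs.1], by linarith [hs.2]⟩
    rw [Set.indicator_of_mem hsW]
    by_cases hs0 : s = s₀
    · have : q s - g ξ * m s = 0 := by simp [hq, hm, hs0, hξ]
      rw [this, norm_zero]; positivity
    · have hne : pathPoint η s - ξ ≠ 0 := by
        rw [← norm_pos_iff]
        exact (abs_pos.2 (sub_ne_zero.2 hs0)).trans_le (hlow s)
      rw [← dslope_mul_eq hne, norm_mul]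
      have h1 : dist s s₀ < δ' := by
        rw [Real.dist_eq, abs_lt]
        have : δ ≤ δ' := min_le_left _ _
        constructor <;> linarith [hs.1, hs.2]
      exact mul_le_mul (hball h1).le ((norm_pathVel_le η s).trans (by gcongr; exact hB s))
        (norm_nonneg _) (by positivity)
  have i2 : MeasureTheory.IntegrableOn (fun s => q s - g ξ * W.indicator m s) Nᶜ := by
    have j1 : MeasureTheory.IntegrableOn q Nᶜ := by
      refine hg.integrableOn_div hη.smooth.continuous
        (c := δ / (1 + |s₀| + δ)) (by positivity) hNm.compl fun s hs => ?_
      refine le_trans ?_ (hlow s)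
      have h1 := hfar s hs
      have h2 : |s| ≤ |s₀| + |s - s₀| := by
        simpa using abs_add_le s₀ (s - s₀)
      rw [div_mul_eq_mul_div, div_le_iff₀ (by positivity)]
      nlinarith [abs_nonneg s₀, abs_nonneg s]
    have j2 : MeasureTheory.IntegrableOn (W.indicator m) Nᶜ := by
      rw [MeasureTheory.IntegrableOn, MeasureTheory.integrable_indicator_iff measurableSet_Ioc,
        MeasureTheory.IntegrableOn, MeasureTheory.Measure.restrict_restrict measurableSet_Ioc,
        Set.inter_comm]
      exact integrableOn_pathVel_div hη hδ hNm.compl (fun s hs => (hfar s hs).trans (hlow s)) _ _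
    exact MeasureTheory.Integrable.sub j1 (MeasureTheory.Integrable.const_mul j2 _)
  have := i1.union i2
  rwa [Set.union_compl_self, MeasureTheory.integrableOn_univ] at this

theorem dslope_mul_pathVel_ae_eq {η : ℝ → ℝ} (g : ℂ → ℂ) (s₀ : ℝ) :
    ∀ᵐ s : ℝ, dslope g (pathPoint η s₀) (pathPoint η s) * pathVel η s =
      g (pathPoint η s) / (pathPoint η s - pathPoint η s₀) * pathVel η s -
      g (pathPoint η s₀) * (pathVel η s / (pathPoint η s - pathPoint η s₀)) := by
  filter_upwards [MeasureTheory.Measure.ae_ne MeasureTheory.volume s₀] with s hs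
  refine dslope_mul_eq (fun h => hs ?_) _
  have := congrArg Complex.re h
  simpa [sub_eq_zero] using this

/-- The three pieces of a window around a point of the path. -/
theorem window_pieces {η : ℝ → ℝ} (hη : IsGoodPath η) {g : ℂ → ℂ}
    (hg : CauchyIntegrable η g) {s₀ : ℝ} (ha : AnalyticAt ℂ g (pathPoint η s₀)) {R : ℝ}
    (hR : 1 ≤ R) :
    IntervalIntegrable (fun s => dslope g (pathPoint η s₀) (pathPoint η s) * pathVel η s)
      MeasureTheory.volume (s₀ - R) (s₀ + R) ∧
    slopeIntegral η g (pathPoint η s₀) R =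
      (∫ s in (s₀ - R)..(s₀ + R),
        (g (pathPoint η s) / (pathPoint η s - pathPoint η s₀) * pathVel η s -
        g (pathPoint η s₀) * (Set.Ioc (s₀ - 1) (s₀ + 1)).indicator
          (fun s => pathVel η s / (pathPoint η s - pathPoint η s₀)) s)) -
      g (pathPoint η s₀) * ((Complex.log (pathPoint η (s₀ + R) - pathPoint η s₀) -
          Complex.log (pathPoint η s₀ - pathPoint η (s₀ - R))) -
        (Complex.log (pathPoint η (s₀ + 1) - pathPoint η s₀) -
          Complex.log (pathPoint η s₀ - pathPoint η (s₀ - 1)))) := by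
  have hk := exists_regular_part hη hg ha
  set ξ := pathPoint η s₀ with hξ
  set m : ℝ → ℂ := fun s => pathVel η s / (pathPoint η s - ξ) with hm
  set q : ℝ → ℂ := fun s => g (pathPoint η s) / (pathPoint η s - ξ) * pathVel η s with hq
  set W := Set.Ioc (s₀ - 1) (s₀ + 1) with hW
  set k : ℝ → ℂ := fun s => q s - g ξ * W.indicator m s with hkdef
  have hae := dslope_mul_pathVel_ae_eq (η := η) g s₀
  rw [← hξ] at hae
  have hcont : ∀ K : Set ℝ, s₀ ∉ K → ContinuousOn m K := by
    intro K hK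
    refine (continuous_pathVel hη.smooth).continuousOn.div
      ((continuous_pathPoint hη.smooth.continuous).sub continuous_const).continuousOn
      fun s hs h => ?_
    have := congrArg Complex.re h
    simp [sub_eq_zero, hξ] at this
    exact hK (this ▸ hs)
  have ki : ∀ a b, IntervalIntegrable k MeasureTheory.volume a b := fun a b =>
    hk.intervalIntegrable
  have m1 : IntervalIntegrable m MeasureTheory.volume (s₀ - R) (s₀ - 1) :=
    (hcont _ (fun h => by rw [Set.uIcc_of_le (by linarith)] at h; linarith [h.2])).intervalIntegrable
  have m3 : IntervalIntegrable m MeasureTheory.volume (s₀ + 1) (s₀ + R) :=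
    (hcont _ (fun h => by rw [Set.uIcc_of_le (by linarith)] at h; linarith [h.1])).intervalIntegrable
  have e1 : ∀ᵐ s : ℝ, s ∈ Set.uIoc (s₀ - R) (s₀ - 1) →
      dslope g ξ (pathPoint η s) * pathVel η s = k s - g ξ * m s := by
    filter_upwards [hae, MeasureTheory.Measure.ae_ne MeasureTheory.volume (s₀ - 1)] with s hs _ hmem
    rw [Set.uIoc_of_le (by linarith)] at hmem
    rw [hs]
    simp only [hkdef]
    rw [Set.indicator_of_notMem (fun h => by linarith [h.1, hmem.2])]
    simp [hq, hm]
  have e2 : ∀ᵐ s : ℝ, s ∈ Set.uIoc (s₀ - 1) (s₀ + 1) →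
      dslope g ξ (pathPoint η s) * pathVel η s = k s := by
    filter_upwards [hae] with s hs hmem
    rw [Set.uIoc_of_le (by linarith)] at hmem
    rw [hs]
    simp only [hkdef]
    rw [Set.indicator_of_mem hmem]
  have e3 : ∀ᵐ s : ℝ, s ∈ Set.uIoc (s₀ + 1) (s₀ + R) →
      dslope g ξ (pathPoint η s) * pathVel η s = k s - g ξ * m s := by
    filter_upwards [hae] with s hs hmem
    rw [Set.uIoc_of_le (by linarith)] at hmem
    rw [hs]
    simp only [hkdef]
    rw [Set.indicator_of_notMem (fun h => by linarith [h.2, hmem.1])]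
    simp [hq, hm]
  have toae : ∀ {a b : ℝ} {f₁ f₂ : ℝ → ℂ}, (∀ᵐ s : ℝ, s ∈ Set.uIoc a b → f₁ s = f₂ s) →
      f₂ =ᵐ[MeasureTheory.volume.restrict (Set.uIoc a b)] f₁ := by
    intro a b f₁ f₂ h
    refine (MeasureTheory.ae_restrict_iff' measurableSet_uIoc).2 ?_
    filter_upwards [h] with s hs hm using (hs hm).symm
  have d1 := ((ki (s₀ - R) (s₀ - 1)).sub (m1.const_mul (g ξ))).congr_ae (toae e1)
  have d2 := (ki (s₀ - 1) (s₀ + 1)).congr_ae (toae e2)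
  have d3 := ((ki (s₀ + 1) (s₀ + R)).sub (m3.const_mul (g ξ))).congr_ae (toae e3)
  refine ⟨(d1.trans d2).trans d3, ?_⟩
  have l1 := integral_pathVel_div_of_lt_re hη.smooth (p := ξ) (a := s₀ - R) (b := s₀ - 1)
    (by simp [hξ]) (by linarith)
  have l3 := integral_pathVel_div_of_re_lt hη.smooth (p := ξ) (a := s₀ + 1) (b := s₀ + R)
    (by simp [hξ]) (by linarith)
  have hre : ξ.re = s₀ := by simp [hξ]
  rw [slopeIntegral, hre, ← intervalIntegral.integral_add_adjacent_intervals (d1.trans d2) d3,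
    ← intervalIntegral.integral_add_adjacent_intervals d1 d2,
    intervalIntegral.integral_congr_ae e1, intervalIntegral.integral_congr_ae e2,
    intervalIntegral.integral_congr_ae e3,
    intervalIntegral.integral_sub (ki _ _) (m1.const_mul _),
    intervalIntegral.integral_sub (ki _ _) (m3.const_mul _),
    intervalIntegral.integral_const_mul, intervalIntegral.integral_const_mul, l1, l3,
    ← intervalIntegral.integral_add_adjacent_intervals (ki (s₀ - R) (s₀ + 1)) (ki _ (s₀ + R)),
    ← intervalIntegral.integral_add_adjacent_intervals (ki (s₀ - R) (s₀ - 1)) (ki _ (s₀ + 1))]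
  ring

/-- Two limits are compared: growing windows for the difference quotient, shrinking discs for the
principal value. Both equal the integral of the regular part plus g(ξ)Λ, where Λ is the principal
value of dt/(t - ξ) over the unit window. This brings the formula on the path into the same form as
those off the path. -/
theorem tendsto_slopeIntegral_of_isOn {η : ℝ → ℝ} (hη : IsGoodPath η) {g : ℂ → ℂ}
    (hg : CauchyIntegrable η g) {s₀ : ℝ} (ha : AnalyticAt ℂ g (pathPoint η s₀)) :
    Tendsto (slopeIntegral η g (pathPoint η s₀)) atTop
      (𝓝 (2 * Real.pi * Complex.I *
        (plusPart η g (pathPoint η s₀) - g (pathPoint η s₀) / 2))) := by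
  have hk := exists_regular_part hη hg ha
  have hpieces := fun R hR => (window_pieces hη hg ha (R := R) hR).2
  have hlog := tendsto_log_sub_log hη (pathPoint η s₀)
  rw [plusPart_of_isOn (isOn_pathPoint η s₀), add_sub_cancel_left]
  rw [pathPoint_re] at hlog
  set ξ := pathPoint η s₀ with hξ
  set m : ℝ → ℂ := fun s => pathVel η s / (pathPoint η s - ξ) with hm
  set q : ℝ → ℂ := fun s => g (pathPoint η s) / (pathPoint η s - ξ) * pathVel η s with hq
  set W := Set.Ioc (s₀ - 1) (s₀ + 1) with hW
  set k : ℝ → ℂ := fun s => q s - g ξ * W.indicator m s with hkdef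
  set Λ := Complex.log (pathPoint η (s₀ + 1) - ξ) - Complex.log (ξ - pathPoint η (s₀ - 1)) with hΛ
  have hlow : ∀ s, |s - s₀| ≤ ‖pathPoint η s - ξ‖ := fun s => by
    simpa [hξ] using abs_sub_re_le η ξ s
  have lim1 : Tendsto (slopeIntegral η g ξ) atTop (𝓝 ((∫ s, k s) + g ξ * Λ)) := by
    have h1 := (tendsto_window_integral hk s₀).sub ((hlog.sub_const Λ).const_mul (g ξ))
    rw [show (∫ s, k s) + g ξ * Λ = (∫ s, k s) - g ξ * (0 - Λ) by ring]
    refine h1.congr' ?_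
    filter_upwards [eventually_ge_atTop 1] with R hR
    exact (hpieces R hR).symm
  have lim2 : Tendsto (fun r : ℝ => ∫ s in {s : ℝ | r < ‖pathPoint η s - ξ‖}, q s) (𝓝[>] 0)
      (𝓝 ((∫ s, k s) + g ξ * Λ)) := by
    have h1 : Tendsto (fun r : ℝ => ∫ s in {s : ℝ | r < ‖pathPoint η s - ξ‖}, k s) (𝓝[>] 0)
        (𝓝 (∫ s, k s)) := by
      have : Tendsto (fun r : ℝ => ∫ s, {s : ℝ | r < ‖pathPoint η s - ξ‖}.indicator k s) (𝓝[>] 0)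
          (𝓝 (∫ s, k s)) := by
        refine MeasureTheory.tendsto_integral_filter_of_dominated_convergence (fun s => ‖k s‖)
          ?_ ?_ hk.norm ?_
        · exact Eventually.of_forall fun r => hk.aestronglyMeasurable.indicator
            (measurableSet_far hη.smooth.continuous ξ r)
        · exact Eventually.of_forall fun r => Eventually.of_forall fun s =>
            norm_indicator_le_norm_self _ _
        · filter_upwards [MeasureTheory.Measure.ae_ne MeasureTheory.volume s₀] with s hs
          refine tendsto_const_nhds.congr' ?_
          have hpos : 0 < ‖pathPoint η s - ξ‖ :=
            (abs_pos.2 (sub_ne_zero.2 hs)).trans_le (hlow s)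
          filter_upwards [nhdsWithin_le_nhds (gt_mem_nhds hpos)] with r hr
          exact (Set.indicator_of_mem (s := {s : ℝ | r < ‖pathPoint η s - ξ‖}) hr k).symm
      refine this.congr fun r => ?_
      exact MeasureTheory.integral_indicator (measurableSet_far hη.smooth.continuous ξ r)
    have h2 := h1.add ((tendsto_pv_pathVel hη s₀).const_mul (g ξ))
    refine h2.congr' ?_
    filter_upwards [self_mem_nhdsWithin] with r (hr : 0 < r)
    have hAm := measurableSet_far hη.smooth.continuous ξ r
    have j : MeasureTheory.IntegrableOn m ({s : ℝ | r < ‖pathPoint η s - ξ‖} ∩ W) :=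
      integrableOn_pathVel_div hη hr hAm (fun s hs => le_of_lt hs) _ _
    have j' : MeasureTheory.IntegrableOn (W.indicator m) {s : ℝ | r < ‖pathPoint η s - ξ‖} := by
      rw [MeasureTheory.IntegrableOn, MeasureTheory.integrable_indicator_iff measurableSet_Ioc,
        MeasureTheory.IntegrableOn, MeasureTheory.Measure.restrict_restrict measurableSet_Ioc,
        Set.inter_comm]
      exact j
    rw [← MeasureTheory.setIntegral_indicator measurableSet_Ioc,
      ← MeasureTheory.integral_const_mul,
      ← MeasureTheory.integral_add hk.integrableOn (j'.const_mul _)]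
    refine MeasureTheory.integral_congr_ae (Eventually.of_forall fun s => ?_)
    simp only [hkdef, hm, hq]
    ring
  have hpv : 2 * Real.pi * Complex.I * pvCauchyIntegral η g ξ = (∫ s, k s) + g ξ * Λ := by
    rw [pvCauchyIntegral, ← mul_assoc, mul_one_div_cancel Complex.two_pi_I_ne_zero, one_mul]
    exact lim2.limUnder_eq
  rw [hpv]
  exact lim1

theorem tendsto_slopeIntegral {η : ℝ → ℝ} (hη : IsGoodPath η) {g : ℂ → ℂ}
    (hg : CauchyIntegrable η g) {ξ : ℂ} (ha : IsOn η ξ → AnalyticAt ℂ g ξ) :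
    Tendsto (slopeIntegral η g ξ) atTop
      (𝓝 (2 * Real.pi * Complex.I * (plusPart η g ξ - g ξ / 2))) := by
  by_cases h : IsOn η ξ
  · have h1 := h.eq_pathPoint
    have := tendsto_slopeIntegral_of_isOn hη hg (s₀ := ξ.re) (h1.symm ▸ ha h)
    rwa [h1] at this
  · exact tendsto_slopeIntegral_of_not_isOn hη hg h

theorem intervalIntegrable_slope {η : ℝ → ℝ} (hη : IsGoodPath η) {g : ℂ → ℂ}
    (hg : CauchyIntegrable η g) {ξ : ℂ} (ha : IsOn η ξ → AnalyticAt ℂ g ξ) {R : ℝ} (hR : 1 ≤ R) :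
    IntervalIntegrable (fun s => dslope g ξ (pathPoint η s) * pathVel η s)
      MeasureTheory.volume (ξ.re - R) (ξ.re + R) := by
  by_cases h : IsOn η ξ
  · have h1 := h.eq_pathPoint
    have := (window_pieces hη hg (s₀ := ξ.re) (h1.symm ▸ ha h) hR).1
    rwa [h1] at this
  · have := ((hg.integrable_div hη.smooth.continuous h).intervalIntegrable
      (a := ξ.re - R) (b := ξ.re + R)).sub
      ((intervalIntegrable_pathVel_div hη.smooth h (ξ.re - R) (ξ.re + R)).const_mul (g ξ))
    refine this.congr (fun s _ => ?_)
    exact (dslope_mul_eq (pathPoint_sub_ne_zero h s) _).symm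

/-- The absence of a singularity at ξ is what allows the path of `slopeIntegral` to be moved across
ξ. -/
theorem analyticAt_dslope {g : ℂ → ℂ} {ξ t : ℂ} (h : AnalyticAt ℂ g t) :
    AnalyticAt ℂ (dslope g ξ) t := by
  by_cases ht : t = ξ
  · subst ht
    obtain ⟨p, hp⟩ := h
    exact ⟨_, hp.has_fpower_series_dslope_fslope⟩
  · have h1 : AnalyticAt ℂ (fun z => (z - ξ)⁻¹ * (g z - g ξ)) t :=
      ((analyticAt_id.sub analyticAt_const).inv (sub_ne_zero.2 ht)).mul (h.sub analyticAt_const)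
    refine h1.congr ?_
    filter_upwards [isOpen_ne.mem_nhds ht] with z hz
    rw [dslope_of_ne _ hz, slope_def_field]
    field_simp

/-- Path independence of the splitting. -/
theorem plusPart_eq_plusPart {η η' : ℝ → ℝ} (hη : IsGoodPath η) (hη' : IsGoodPath η') {g : ℂ → ℂ}
    (hg : CauchyIntegrable η g) (hg' : CauchyIntegrable η' g)
    (han : ∀ s, η =ᶠ[𝓝 s] η' ∨ ∀ v ∈ Set.uIcc (η s) (η' s), AnalyticAt ℂ g (s + Complex.I * v))
    (hbd : ∃ G T : ℝ, ∀ s, T ≤ |s| → η s = η' s ∨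
      ∀ v ∈ Set.uIcc (η s) (η' s), ‖g (s + Complex.I * v)‖ ≤ G)
    {ξ : ℂ} (hξ : ¬ IsOn η' ξ) : plusPart η g ξ = plusPart η' g ξ := by
  have ha : IsOn η ξ → AnalyticAt ℂ g ξ := by
    intro h
    rcases han ξ.re with h1 | h1
    · exact absurd (h.trans h1.eq_of_nhds) hξ
    · have := h1 _ Set.left_mem_uIcc
      rwa [show (ξ.re : ℂ) + Complex.I * (η ξ.re) = ξ from h.eq_pathPoint] at this
  obtain ⟨G, T, hG⟩ := hbd
  obtain ⟨H, hH⟩ := hη.bounded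
  obtain ⟨H', hH'⟩ := hη'.bounded
  have l1 := tendsto_slopeIntegral hη hg ha
  have l2 := tendsto_slopeIntegral hη' hg' (fun h => absurd h hξ)
  -- The point ξ may lie between the two paths; only g has to be analytic in between. Both windows
  -- are centred at the same abscissa, so Cauchy's theorem leaves just the two sides.
  have hdiff : ∀ R : ℝ, 1 ≤ R → slopeIntegral η' g ξ R - slopeIntegral η g ξ R =
      vert η η' (dslope g ξ) (ξ.re + R) - vert η η' (dslope g ξ) (ξ.re - R) := by
    intro R hR
    rw [slopeIntegral, slopeIntegral, ← intervalIntegral.integral_sub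
      (intervalIntegrable_slope hη' hg' (fun h => absurd h hξ) hR)
      (intervalIntegrable_slope hη hg ha hR)]
    refine integral_graph_sub hη.smooth hη'.smooth (by linarith) fun s _ => ?_
    rcases han s with h | h
    · exact Or.inl h
    · exact Or.inr fun v hv => analyticAt_dslope (h v hv)
  -- On the sides the difference quotient is O(1/R), and their length is bounded by the heights of
  -- the paths.
  have hside : ∀ (σ : ℝ), |σ| = 1 → Tendsto (fun R : ℝ => vert η η' (dslope g ξ) (ξ.re + σ * R))
      atTop (𝓝 0) := by
    intro σ hσ
    refine squeeze_zero_norm' (a := fun R : ℝ => (|G| + ‖g ξ‖) * (H + H') / R) ?_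
      (tendsto_const_nhds.div_atTop tendsto_id)
    filter_upwards [eventually_gt_atTop (|ξ.re| + |T|), eventually_gt_atTop 0] with R hR hR0
    have hs : T ≤ |ξ.re + σ * R| := by
      have h1 : |σ * R| ≤ |ξ.re + σ * R| + |ξ.re| := by
        simpa using abs_sub (ξ.re + σ * R) ξ.re
      rw [abs_mul, hσ, one_mul, abs_of_pos hR0] at h1
      linarith [le_abs_self T]
    have hHH : 0 ≤ H + H' := add_nonneg ((abs_nonneg _).trans (hH 0)) ((abs_nonneg _).trans (hH' 0))
    rcases hG _ hs with h | h
    · rw [vert, h, intervalIntegral.integral_same, mul_zero, norm_zero]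
      positivity
    · have h1 : ‖vert η η' (dslope g ξ) (ξ.re + σ * R)‖ ≤
          ((|G| + ‖g ξ‖) / R) * |η' (ξ.re + σ * R) - η (ξ.re + σ * R)| := by
        refine norm_vert_le fun v hv => ?_
        set t : ℂ := ((ξ.re + σ * R : ℝ) : ℂ) + Complex.I * v with ht
        have hRt : R ≤ ‖t - ξ‖ := by
          have := Complex.abs_re_le_norm (t - ξ)
          have h2 : (t - ξ).re = σ * R := by simp [ht]
          rwa [h2, abs_mul, hσ, one_mul, abs_of_pos hR0] at this
        have hne : t ≠ ξ := by
          intro h0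
          rw [h0, sub_self, norm_zero] at hRt; linarith
        rw [dslope_of_ne _ hne, slope_def_field, norm_div]
        gcongr
        exact (norm_sub_le _ _).trans (by gcongr; exact (h v hv).trans (le_abs_self G))
      refine h1.trans ?_
      have h2 : |η' (ξ.re + σ * R) - η (ξ.re + σ * R)| ≤ H + H' :=
        (abs_sub _ _).trans (by linarith [hH (ξ.re + σ * R), hH' (ξ.re + σ * R)])
      rw [mul_div_right_comm]
      gcongr
  have hl : Tendsto (fun R => slopeIntegral η' g ξ R - slopeIntegral η g ξ R) atTop (𝓝 0) := by
    have := (hside 1 (by simp)).sub (hside (-1) (by simp))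
    rw [sub_zero] at this
    refine this.congr' ?_
    filter_upwards [eventually_ge_atTop 1] with R hR
    rw [hdiff R hR, one_mul, neg_one_mul, ← sub_eq_add_neg]
  have h0 := tendsto_nhds_unique (l2.sub l1) hl
  have h1 : 2 * Real.pi * Complex.I * (plusPart η' g ξ - plusPart η g ξ) = 0 := by
    rw [← h0]; ring
  have h2 := (mul_eq_zero.1 h1).resolve_left Complex.two_pi_I_ne_zero
  exact (sub_eq_zero.1 h2).symm

/-! ### Analyticity and bounds of the splitting -/

theorem IsGoodPath.add {η ψ : ℝ → ℝ} (hη : IsGoodPath η) (hψ : IsGoodPath ψ) :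
    IsGoodPath fun s => η s + ψ s := by
  obtain ⟨H, hH⟩ := hη.bounded
  obtain ⟨H', hH'⟩ := hψ.bounded
  obtain ⟨B, hB⟩ := hη.bounded_deriv
  obtain ⟨B', hB'⟩ := hψ.bounded_deriv
  refine ⟨hη.smooth.add hψ.smooth, ⟨H + H', fun s => (abs_add_le _ _).trans ?_⟩,
    ⟨B + B', fun s => ?_⟩⟩
  · exact add_le_add (hH s) (hH' s)
  · rw [deriv_fun_add (hη.smooth.differentiable one_ne_zero s)
      (hψ.smooth.differentiable one_ne_zero s)]
    exact (abs_add_le _ _).trans (add_le_add (hB s) (hB' s))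

theorem IsGoodPath.const_mul {η : ℝ → ℝ} (hη : IsGoodPath η) (c : ℝ) :
    IsGoodPath fun s => c * η s := by
  obtain ⟨H, hH⟩ := hη.bounded
  obtain ⟨B, hB⟩ := hη.bounded_deriv
  refine ⟨contDiff_const.mul hη.smooth, ⟨|c| * H, fun s => ?_⟩, ⟨|c| * B, fun s => ?_⟩⟩
  · rw [abs_mul]; gcongr; exact hH s
  · rw [deriv_const_mul _ (hη.smooth.differentiable one_ne_zero s), abs_mul]
    gcongr; exact hB s

theorem IsGoodPath.shift {η : ℝ → ℝ} (hη : IsGoodPath η) (δ : ℝ) : IsGoodPath (shiftPath η δ) := by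
  obtain ⟨H, hH⟩ := hη.bounded
  obtain ⟨B, hB⟩ := hη.bounded_deriv
  refine ⟨hη.smooth.comp (contDiff_id.sub contDiff_const), ⟨H, fun s => hH _⟩, ⟨B, fun s => ?_⟩⟩
  have : deriv (shiftPath η δ) s = deriv η (s - δ) := by
    unfold shiftPath
    exact deriv_comp_sub_const ..
  rw [this]; exact hB _

theorem IsGoodPath.of_hasCompactSupport {φ : ℝ → ℝ} (h : ContDiff ℝ 1 φ)
    (hc : HasCompactSupport φ) : IsGoodPath φ := by
  obtain ⟨H, hH⟩ := h.continuous.bounded_above_of_compact_support hc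
  obtain ⟨B, hB⟩ := (h.continuous_deriv le_rfl).bounded_above_of_compact_support hc.deriv
  exact ⟨h, ⟨H, hH⟩, ⟨B, hB⟩⟩

theorem IsGoodPath.smoothTransition : IsGoodPath Real.smoothTransition := by
  have hd : Continuous (deriv Real.smoothTransition) :=
    (Real.smoothTransition.contDiff (n := 1)).continuous_deriv le_rfl
  refine ⟨Real.smoothTransition.contDiff, ⟨1, fun s => ?_⟩, ?_⟩
  · rw [abs_of_nonneg (Real.smoothTransition.nonneg s)]
    exact Real.smoothTransition.le_one s
  · have hsupp : HasCompactSupport (deriv Real.smoothTransition) := by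
      refine HasCompactSupport.intro (isCompact_Icc (a := (0 : ℝ)) (b := 1)) fun s hs => ?_
      rcases lt_or_ge s 0 with h | h
      · have : Real.smoothTransition =ᶠ[𝓝 s] fun _ => 0 := by
          filter_upwards [gt_mem_nhds h] with x hx
          exact Real.smoothTransition.zero_of_nonpos hx.le
        rw [this.deriv_eq, deriv_const]
      · have h1 : 1 < s := by
          by_contra hc
          exact hs ⟨h, not_lt.1 hc⟩
        have : Real.smoothTransition =ᶠ[𝓝 s] fun _ => 1 := by
          filter_upwards [lt_mem_nhds h1] with x hx
          exact Real.smoothTransition.one_of_one_le hx.le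
        rw [this.deriv_eq, deriv_const]
    exact hd.bounded_above_of_compact_support hsupp

theorem pathVel_congr {η η' : ℝ → ℝ} {s : ℝ} (h : η =ᶠ[𝓝 s] η') : pathVel η s = pathVel η' s := by
  rw [pathVel, pathVel, h.deriv_eq]

theorem pathPoint_congr {η η' : ℝ → ℝ} {s : ℝ} (h : η s = η' s) :
    pathPoint η s = pathPoint η' s := by
  rw [pathPoint, pathPoint, h]

theorem continuousOn_cauchy_integrand {η : ℝ → ℝ} (hη : IsGoodPath η) {g : ℂ → ℂ} {K : Set ℝ}
    (h : ∀ s ∈ K, ContinuousAt g (pathPoint η s)) :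
    ContinuousOn (fun s : ℝ => g (pathPoint η s) * pathVel η s / ((1 + |s| : ℝ) : ℂ)) K := by
  refine ContinuousOn.div (ContinuousOn.mul (fun s hs => ?_)
    (continuous_pathVel hη.smooth).continuousOn) (by fun_prop) fun s _ => one_add_abs_ne_zero s
  exact (ContinuousAt.comp (f := pathPoint η) (h s hs)
    (continuous_pathPoint hη.smooth.continuous).continuousAt).continuousWithinAt

theorem CauchyIntegrable.congr_off {η η' : ℝ → ℝ} (hη' : IsGoodPath η')
    {g : ℂ → ℂ} (hg : CauchyIntegrable η g) {a b : ℝ} (heq : ∀ s, s ∉ Set.Icc a b → η s = η' s)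
    (hc : ∀ s ∈ Set.Icc a b, ContinuousAt g (pathPoint η' s)) : CauchyIntegrable η' g := by
  rw [CauchyIntegrable, ← MeasureTheory.integrableOn_univ, ← Set.union_compl_self (Set.Icc a b)]
  refine MeasureTheory.IntegrableOn.union ?_ ?_
  · exact (continuousOn_cauchy_integrand hη' hc).integrableOn_compact isCompact_Icc
  · refine (MeasureTheory.Integrable.integrableOn hg).congr_fun (fun s hs => ?_)
      measurableSet_Icc.compl
    have h1 : η =ᶠ[𝓝 s] η' := by
      filter_upwards [isClosed_Icc.isOpen_compl.mem_nhds hs] with x hx using heq x hx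
    simp only [pathPoint_congr h1.eq_of_nhds, pathVel_congr h1]

theorem analyticAt_plusPart_of_isAbove {η : ℝ → ℝ} (hη : IsGoodPath η) {g : ℂ → ℂ}
    (hg : CauchyIntegrable η g) {ξ : ℂ} (h : IsAbove η ξ) : AnalyticAt ℂ (plusPart η g) ξ := by
  refine (analyticAt_cauchyIntegral hg hη.smooth.continuous h.not_isOn).congr ?_
  filter_upwards [(isOpen_isAbove hη.smooth.continuous).mem_nhds h] with z hz
  exact (plusPart_of_isAbove hz).symm

theorem analyticAt_plusPart_of_below {η : ℝ → ℝ} (hη : IsGoodPath η) {g : ℂ → ℂ}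
    (hg : CauchyIntegrable η g) {ξ : ℂ} (h : ξ.im < η ξ.re) (ha : AnalyticAt ℂ g ξ) :
    AnalyticAt ℂ (plusPart η g) ξ := by
  refine (ha.add (analyticAt_cauchyIntegral hg hη.smooth.continuous
    (not_isOn_of_below h))).congr ?_
  filter_upwards [(isOpen_below hη.smooth.continuous).mem_nhds h] with z hz
  exact (plusPart_of_below hz).symm

/-- A bump pushes the path down near the point, which then lies above the new path, where the
splitting is a Cauchy integral. Path independence carries analyticity back, without any discussion
of boundary values. -/
theorem analyticAt_plusPart_of_isOn {η : ℝ → ℝ} (hη : IsGoodPath η) {g : ℂ → ℂ}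
    (hg : CauchyIntegrable η g) {s₀ : ℝ} (ha : AnalyticAt ℂ g (pathPoint η s₀)) :
    AnalyticAt ℂ (plusPart η g) (pathPoint η s₀) := by
  have hcγ := continuous_pathPoint hη.smooth.continuous
  obtain ⟨ε, hε, hball⟩ := Metric.isOpen_iff.1 (isOpen_analyticAt ℂ g) _ ha
  obtain ⟨δ, hδ, hδball⟩ := Metric.continuousAt_iff.1 (hcγ.continuousAt (x := s₀)) (ε / 2)
    (by positivity)
  -- Within the support the path stays closer than ε/2 to the base point, and it is lowered by at
  -- most ε/2. The swept area thus lies in the ball on which g is analytic.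
  let φ : ContDiffBump s₀ := ⟨δ / 4, δ / 2, by positivity, by linarith⟩
  have hφ : IsGoodPath fun s => φ s :=
    IsGoodPath.of_hasCompactSupport φ.contDiff φ.hasCompactSupport
  set η' : ℝ → ℝ := fun s => η s + -(ε / 2) * φ s with hη'def
  have hη' : IsGoodPath η' := hη.add (hφ.const_mul _)
  have han : ∀ s, |s - s₀| ≤ δ / 2 → ∀ v ∈ Set.uIcc (η s) (η' s),
      AnalyticAt ℂ g (s + Complex.I * v) := by
    intro s hs v hv
    apply hball
    have hle : η' s ≤ η s := by
      simp only [hη'def]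
      nlinarith [φ.nonneg (x := s)]
    rw [Set.uIcc_of_ge hle] at hv
    have h1 : |v - η s| ≤ ε / 2 := by
      have h2 : η s - η' s ≤ ε / 2 := by
        simp only [hη'def]
        nlinarith [φ.le_one (x := s)]
      rw [abs_le]
      constructor <;> linarith [hv.1, hv.2]
    have h3 : dist (pathPoint η s) (pathPoint η s₀) < ε / 2 :=
      hδball (by rw [Real.dist_eq]; linarith)
    rw [Metric.mem_ball]
    refine lt_of_le_of_lt (dist_triangle _ (pathPoint η s) _) ?_
    have h4 : dist ((s : ℂ) + Complex.I * v) (pathPoint η s) = |v - η s| := by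
      rw [dist_eq_norm, pathPoint, add_sub_add_left_eq_sub, ← mul_sub, norm_mul, Complex.norm_I,
        one_mul, ← Complex.ofReal_sub, Complex.norm_real, Real.norm_eq_abs]
    rw [h4]; linarith
  have hzero : ∀ s, δ / 2 ≤ |s - s₀| → η s = η' s := by
    intro s hs
    have : φ s = 0 := φ.zero_of_le_dist (by rw [Real.dist_eq]; exact hs)
    simp [hη'def, this]
  have hg' : CauchyIntegrable η' g := by
    refine CauchyIntegrable.congr_off hη' hg (a := s₀ - δ / 2) (b := s₀ + δ / 2) (fun s hs => ?_)
      fun s hs => ?_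
    · refine hzero s (le_of_lt ?_)
      by_contra hc
      have := abs_le.1 (not_lt.1 hc)
      exact hs ⟨by linarith, by linarith⟩
    · exact (han s (abs_le.2 ⟨by linarith [hs.1], by linarith [hs.2]⟩) _
        Set.right_mem_uIcc).continuousAt
  have hab : IsAbove η' (pathPoint η s₀) := by
    have : φ s₀ = 1 := φ.one_of_mem_closedBall (Metric.mem_closedBall_self (by positivity))
    simp [IsAbove, hη'def, this, hε]
  refine (analyticAt_plusPart_of_isAbove hη' hg' hab).congr ?_
  filter_upwards [(isOpen_isAbove hη'.smooth.continuous).mem_nhds hab] with z hz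
  refine (plusPart_eq_plusPart hη hη' hg hg' (fun s => ?_) ⟨0, |s₀| + δ, fun s hs => ?_⟩
    hz.not_isOn).symm
  · by_cases hs : |s - s₀| ≤ δ / 2
    · exact Or.inr (han s hs)
    · left
      have : {x : ℝ | δ / 2 < |x - s₀|} ∈ 𝓝 s :=
        (isOpen_lt continuous_const (by fun_prop)).mem_nhds (not_le.1 hs)
      filter_upwards [this] with x hx
      exact hzero x (le_of_lt hx)
  · left
    refine hzero s ?_
    have := abs_sub_abs_le_abs_sub s s₀
    linarith

/-- The density is analytic at the point, unless the point lies above the path. -/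
theorem analyticAt_plusPart {η : ℝ → ℝ} (hη : IsGoodPath η) {g : ℂ → ℂ}
    (hg : CauchyIntegrable η g) {ξ : ℂ} (ha : ¬ IsAbove η ξ → AnalyticAt ℂ g ξ) :
    AnalyticAt ℂ (plusPart η g) ξ := by
  by_cases h : IsAbove η ξ
  · exact analyticAt_plusPart_of_isAbove hη hg h
  · by_cases h' : IsOn η ξ
    · have := analyticAt_plusPart_of_isOn hη hg (s₀ := ξ.re) (h'.eq_pathPoint.symm ▸ ha h)
      rwa [h'.eq_pathPoint] at this
    · exact analyticAt_plusPart_of_below hη hg (below_of_not h h') (ha h)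

/-! ### Uniform bounds of the splitting far from the origin -/

theorem rpow_mul_inv_le {x y : ℝ} (hx : 0 < x) (hy : 0 < y) :
    x ^ (-(1 / 2) : ℝ) * y⁻¹ ≤ x ^ (-(3 / 2) : ℝ) + y ^ (-(3 / 2) : ℝ) := by
  rw [← Real.rpow_neg_one y]
  rcases le_total x y with h | h
  · have : y ^ (-1 : ℝ) ≤ x ^ (-1 : ℝ) := Real.rpow_le_rpow_of_nonpos hx h (by norm_num)
    calc _ ≤ x ^ (-(1 / 2) : ℝ) * x ^ (-1 : ℝ) := by gcongr
      _ = x ^ (-(3 / 2) : ℝ) := by rw [← Real.rpow_add hx]; norm_num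
      _ ≤ _ := le_add_of_nonneg_right (by positivity)
  · have : x ^ (-(1 / 2) : ℝ) ≤ y ^ (-(1 / 2) : ℝ) :=
      Real.rpow_le_rpow_of_nonpos hy h (by norm_num)
    calc _ ≤ y ^ (-(1 / 2) : ℝ) * y ^ (-1 : ℝ) := by gcongr
      _ = y ^ (-(3 / 2) : ℝ) := by rw [← Real.rpow_add hy]; norm_num
      _ ≤ _ := le_add_of_nonneg_left (by positivity)

theorem integrable_rpow_three_halves (a : ℝ) :
    MeasureTheory.Integrable fun s : ℝ => (1 + |s - a|) ^ (-(3 / 2) : ℝ) :=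
  (integrable_one_add_norm (E := ℝ) (μ := MeasureTheory.volume) (r := 3 / 2)
    (by simp; norm_num)).comp_sub_right a

/-- By `rpow_mul_inv_le` the product of the decay of g and the inverse distance is at most a sum of
two translates of one integrable function, whose integrals do not depend on ξ. The part of the path
over |s| < T, where g is merely integrable, is covered by F. -/
theorem exists_bound_cauchyIntegral {η : ℝ → ℝ} (hη : IsGoodPath η) {g : ℂ → ℂ}
    (hg : CauchyIntegrable η g) {c T G : ℝ} (hc : 0 < c) (hT : 0 ≤ T)
    (hG : ∀ s, T ≤ |s| → ‖g (pathPoint η s)‖ ≤ G * (1 + |s|) ^ (-(1 / 2) : ℝ)) :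
    ∃ M, ∀ ξ : ℂ, (∀ s : ℝ, c * (1 + |s - ξ.re|) ≤ ‖pathPoint η s - ξ‖) →
      ‖cauchyIntegral η g ξ‖ ≤ M := by
  obtain ⟨B, hB⟩ := hη.bounded_deriv
  have hB0 : 0 ≤ B := (abs_nonneg _).trans (hB 0)
  have hG0 : 0 ≤ G := by
    have := (norm_nonneg _).trans (hG T (le_abs_self T))
    exact nonneg_of_mul_nonneg_left this (by positivity)
  set F : ℝ → ℝ := fun s => ‖g (pathPoint η s) * pathVel η s / ((1 + |s| : ℝ) : ℂ)‖ * (1 + T) with hF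
  have hFi : MeasureTheory.Integrable F := (MeasureTheory.Integrable.norm hg).mul_const _
  set I₀ := ∫ s : ℝ, (1 + |s|) ^ (-(3 / 2) : ℝ)
  have hI : ∀ a : ℝ, ∫ s : ℝ, (1 + |s - a|) ^ (-(3 / 2) : ℝ) = I₀ := fun a =>
    MeasureTheory.integral_sub_right_eq_self (fun s => (1 + |s|) ^ (-(3 / 2) : ℝ)) a
  refine ⟨‖1 / (2 * Real.pi * Complex.I)‖ * (c⁻¹ * ((∫ s, F s) + G * (1 + B) * (I₀ + I₀))),
    fun ξ hξ => ?_⟩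
  rw [cauchyIntegral, norm_mul]
  gcongr
  have hi0 := integrable_rpow_three_halves 0
  simp only [sub_zero] at hi0
  have hi2 : MeasureTheory.Integrable fun s : ℝ => G * (1 + B) * ((1 + |s|) ^ (-(3 / 2) : ℝ) +
      (1 + |s - ξ.re|) ^ (-(3 / 2) : ℝ)) :=
    (hi0.add (integrable_rpow_three_halves ξ.re)).const_mul _
  have hi := (hFi.add hi2).const_mul c⁻¹
  have hval : ∫ s, c⁻¹ * (F s + G * (1 + B) * ((1 + |s|) ^ (-(3 / 2) : ℝ) +
      (1 + |s - ξ.re|) ^ (-(3 / 2) : ℝ))) = c⁻¹ * ((∫ s, F s) + G * (1 + B) * (I₀ + I₀)) := by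
    have h2 := MeasureTheory.integral_add hi0 (integrable_rpow_three_halves ξ.re)
    rw [MeasureTheory.integral_const_mul, MeasureTheory.integral_add hFi hi2,
      MeasureTheory.integral_const_mul, h2, hI]
  rw [← hval]
  refine MeasureTheory.norm_integral_le_of_norm_le hi (Eventually.of_forall fun s => ?_)
  have hpos : 0 < 1 + |s| := by positivity
  have hpos' : 0 < 1 + |s - ξ.re| := by positivity
  have hcpos : 0 < c * (1 + |s - ξ.re|) := by positivity
  have hξs := hξ s
  have hvel : ‖pathVel η s‖ ≤ 1 + B := (norm_pathVel_le η s).trans (by gcongr; exact hB s)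
  have h1 : ‖g (pathPoint η s) / (pathPoint η s - ξ) * pathVel η s‖ ≤
      c⁻¹ * (‖g (pathPoint η s)‖ * ‖pathVel η s‖ * (1 + |s - ξ.re|)⁻¹) := by
    rw [norm_mul, norm_div, div_mul_eq_mul_div, div_le_iff₀ (hcpos.trans_le hξs)]
    calc ‖g (pathPoint η s)‖ * ‖pathVel η s‖ = c⁻¹ * (‖g (pathPoint η s)‖ * ‖pathVel η s‖ *
          (1 + |s - ξ.re|)⁻¹) * (c * (1 + |s - ξ.re|)) := by field_simp
      _ ≤ _ := by gcongr
  refine h1.trans ?_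
  gcongr
  by_cases hs : T ≤ |s|
  · have h2 : ‖g (pathPoint η s)‖ * ‖pathVel η s‖ * (1 + |s - ξ.re|)⁻¹ ≤
        G * (1 + B) * ((1 + |s|) ^ (-(1 / 2) : ℝ) * (1 + |s - ξ.re|)⁻¹) := by
      calc _ ≤ (G * (1 + |s|) ^ (-(1 / 2) : ℝ)) * (1 + B) * (1 + |s - ξ.re|)⁻¹ := by
            gcongr; exact hG s hs
        _ = _ := by ring
    refine h2.trans (le_add_of_nonneg_of_le (by positivity) ?_)
    gcongr
    exact rpow_mul_inv_le hpos hpos'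
  · have h2 : ‖g (pathPoint η s)‖ * ‖pathVel η s‖ * (1 + |s - ξ.re|)⁻¹ ≤ F s := by
      simp only [hF]
      rw [norm_div, norm_mul, Complex.norm_of_nonneg hpos.le, div_mul_eq_mul_div,
        le_div_iff₀ hpos]
      have h3 : (1 + |s - ξ.re|)⁻¹ ≤ 1 := inv_le_one_of_one_le₀ (by linarith [abs_nonneg (s - ξ.re)])
      have h4 : 1 + |s| ≤ 1 + T := by linarith [not_le.1 hs]
      calc _ ≤ ‖g (pathPoint η s)‖ * ‖pathVel η s‖ * 1 * (1 + T) := by gcongr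
        _ = _ := by ring
    exact h2.trans (le_add_of_nonneg_right (by positivity))

/-- The far parts of the open second and fourth quadrants. -/
def InTail (T : ℝ) (ξ : ℂ) : Prop := (T ≤ ξ.re ∧ ξ.im < 0) ∨ (ξ.re ≤ -T ∧ 0 < ξ.im)

theorem cauchyIntegrable_of_tail {η : ℝ → ℝ} (hη : IsGoodPath η) {g : ℂ → ℂ} {T G : ℝ}
    (hmid : MeasureTheory.IntegrableOn
      (fun s : ℝ => g (pathPoint η s) * pathVel η s / ((1 + |s| : ℝ) : ℂ)) (Set.Ioo (-T) T))
    (hc : ∀ s, T ≤ |s| → ContinuousAt g (pathPoint η s))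
    (hG : ∀ s, T ≤ |s| → ‖g (pathPoint η s)‖ ≤ G * (1 + |s|) ^ (-(1 / 2) : ℝ)) :
    CauchyIntegrable η g := by
  obtain ⟨B, hB⟩ := hη.bounded_deriv
  have hB0 : 0 ≤ B := (abs_nonneg _).trans (hB 0)
  have hTs : ∀ s ∈ (Set.Ioo (-T) T)ᶜ, T ≤ |s| := by
    intro s hs
    by_contra hcon
    exact hs (abs_lt.1 (not_le.1 hcon))
  rw [CauchyIntegrable, ← MeasureTheory.integrableOn_univ, ← Set.union_compl_self (Set.Ioo (-T) T)]
  refine hmid.union ?_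
  have hi0 := integrable_rpow_three_halves 0
  simp only [sub_zero] at hi0
  refine (hi0.const_mul (G * (1 + B))).integrableOn.mono' ?_ ?_
  · exact (continuousOn_cauchy_integrand hη fun s hs => hc s (hTs s hs)).aestronglyMeasurable
      measurableSet_Ioo.compl
  · refine (MeasureTheory.ae_restrict_iff' measurableSet_Ioo.compl).2
      (Eventually.of_forall fun s hs => ?_)
    have hpos : 0 < 1 + |s| := by positivity
    have h1 := hG s (hTs s hs)
    have h0 := (norm_nonneg _).trans h1
    rw [norm_div, norm_mul, Complex.norm_of_nonneg hpos.le, div_le_iff₀ hpos]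
    calc ‖g (pathPoint η s)‖ * ‖pathVel η s‖ ≤ G * (1 + |s|) ^ (-(1 / 2) : ℝ) * (1 + B) := by
          gcongr
          exact (norm_pathVel_le η s).trans (by gcongr; exact hB s)
      _ = G * (1 + B) * ((1 + |s|) ^ (-(3 / 2) : ℝ) * (1 + |s|) ^ (1 : ℝ)) := by
          rw [← Real.rpow_add hpos]; norm_num; ring
      _ = _ := by rw [Real.rpow_one]; ring

/-- The vertical distance is used inside the window and the horizontal one outside; 1/3 is small
enough for both. -/
theorem le_norm_sub_of_gap {η : ℝ → ℝ} {ξ : ℂ}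
    (h : ∀ s, |s - ξ.re| < 3 / 4 → 3 / 4 ≤ |η s - ξ.im|) (s : ℝ) :
    1 / 3 * (1 + |s - ξ.re|) ≤ ‖pathPoint η s - ξ‖ := by
  have h1 := abs_sub_re_le η ξ s
  by_cases hs : |s - ξ.re| < 3 / 4
  · have h2 : |η s - ξ.im| ≤ ‖pathPoint η s - ξ‖ := by
      simpa using Complex.abs_im_le_norm (pathPoint η s - ξ)
    linarith [h s hs]
  · linarith

/-- The transition from `1` for `s ≤ -T - 1` over `0` for `|s| ≤ T` to `-1` for `s ≥ T + 1`. -/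
def sideProfile (T s : ℝ) : ℝ := Real.smoothTransition (-s - T) - Real.smoothTransition (s - T)

theorem isGoodPath_sideProfile (T : ℝ) : IsGoodPath (sideProfile T) := by
  have h1 : IsGoodPath fun s => Real.smoothTransition (s - T) := IsGoodPath.smoothTransition.shift T
  have h2 : IsGoodPath fun s => Real.smoothTransition (-s - T) := by
    refine ⟨h1.smooth.comp contDiff_neg, ?_, ?_⟩
    · obtain ⟨H, hH⟩ := h1.bounded
      exact ⟨H, fun s => hH (-s)⟩
    · obtain ⟨B, hB⟩ := h1.bounded_deriv
      refine ⟨B, fun s => ?_⟩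
      rw [deriv_comp_neg (fun s => Real.smoothTransition (s - T)), abs_neg]
      exact hB _
  have := h2.add (h1.const_mul (-1))
  unfold sideProfile
  simpa [sub_eq_add_neg] using this

theorem sideProfile_mid {T s : ℝ} (h : |s| ≤ T) : sideProfile T s = 0 := by
  have := abs_le.1 h
  rw [sideProfile, Real.smoothTransition.zero_of_nonpos (by linarith),
    Real.smoothTransition.zero_of_nonpos (by linarith), sub_zero]

theorem sideProfile_right {T s : ℝ} (hT : 0 < T) (h : T ≤ s) :
    sideProfile T s = -Real.smoothTransition (s - T) := by
  rw [sideProfile, Real.smoothTransition.zero_of_nonpos (by linarith), zero_sub]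

theorem sideProfile_left {T s : ℝ} (hT : 0 < T) (h : s ≤ -T) :
    sideProfile T s = Real.smoothTransition (-s - T) := by
  rw [sideProfile, Real.smoothTransition.zero_of_nonpos (x := s - T) (by linarith), sub_zero]

/-- Near the path the Cauchy integral admits no direct bound, so the path is moved away from ξ.
Adding j times `sideProfile` raises the left tail and lowers the right one, inside the region where
g is analytic, and path independence preserves the splitting. The choice j = Hd - 1 serves the right
tail and the low points on the left, j = 1 the high points on the left; in each case the vertical
gap is at least 3/4. -/
theorem exists_bound_plusPart {η : ℝ → ℝ} (hη : IsGoodPath η)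
    (htop : Tendsto η atTop (𝓝 0)) (hbot : Tendsto η atBot (𝓝 0)) {g : ℂ → ℂ}
    (hg : CauchyIntegrable η g) {T₀ Hd G : ℝ} (hHd : 4 ≤ Hd)
    (hpos : ∀ s ≤ -T₀, 0 < η s) (hneg : ∀ s ≥ T₀, η s < 0)
    (han : ∀ ξ, InTail T₀ ξ → AnalyticAt ℂ g ξ)
    (hG : ∀ ξ, InTail T₀ ξ → |ξ.im| ≤ Hd → ‖g ξ‖ ≤ G * (1 + |ξ.re|) ^ (-(1 / 2) : ℝ)) :
    ∃ M T₁ : ℝ, ∀ ξ : ℂ, T₁ ≤ |ξ.re| → (0 < ξ.re → -(Hd - 2) ≤ ξ.im) → (ξ.re < 0 → 0 < ξ.im) →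
      ‖plusPart η g ξ‖ ≤ M := by
  obtain ⟨T, hT0, hTT₀, hsmall⟩ : ∃ T > 0, T₀ ≤ T ∧ ∀ s, T ≤ |s| → |η s| ≤ 1 / 4 := by
    have e1 : ∀ᶠ s in atTop, |η s| < 1 / 4 := by
      have := htop.abs
      rw [abs_zero] at this
      exact this.eventually (gt_mem_nhds (by norm_num))
    have e2 : ∀ᶠ s in atBot, |η s| < 1 / 4 := by
      have := hbot.abs
      rw [abs_zero] at this
      exact this.eventually (gt_mem_nhds (by norm_num))
    obtain ⟨a, ha⟩ := eventually_atTop.1 e1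
    obtain ⟨b, hb⟩ := eventually_atBot.1 e2
    refine ⟨max 1 (max T₀ (max a (-b))), by positivity, by simp, fun s hs => ?_⟩
    simp only [max_le_iff] at hs
    obtain ⟨hs1, hs2, hs3, hs4⟩ := hs
    rcases le_total 0 s with h | h
    · rw [abs_of_nonneg h] at hs3
      exact (ha s hs3).le
    · rw [abs_of_nonpos h] at hs4
      exact (hb s (by linarith)).le
  have hcase : ∀ s, T ≤ |s| → T ≤ s ∨ s ≤ -T := by
    intro s hs
    rcases le_abs.1 hs with h | h
    · exact Or.inl h
    · exact Or.inr (by linarith)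
  have hbetween : ∀ j : ℝ, 0 ≤ j → j ≤ Hd - 1 → ∀ s, T ≤ |s| →
      ∀ v ∈ Set.uIcc (η s) (η s + j * sideProfile T s),
        InTail T₀ ((s : ℂ) + Complex.I * v) ∧ |v| ≤ Hd := by
    intro j hj0 hj s hs v hv
    have hsm := abs_le.1 (hsmall s hs)
    rcases hcase s hs with h | h
    · have h1 := Real.smoothTransition.nonneg (s - T)
      have h2 := Real.smoothTransition.le_one (s - T)
      have h3 := mul_nonneg hj0 h1
      have h4 : j * Real.smoothTransition (s - T) ≤ j * 1 := by gcongr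
      rw [sideProfile_right hT0 h, Set.uIcc_of_ge (by linarith)] at hv
      have h5 := hneg s (hTT₀.trans h)
      refine ⟨Or.inl ⟨by simpa using hTT₀.trans h, ?_⟩, abs_le.2 ⟨?_, ?_⟩⟩
      · simpa using lt_of_le_of_lt hv.2 h5
      · linarith [hv.1]
      · linarith [hv.2]
    · have h1 := Real.smoothTransition.nonneg (-s - T)
      have h2 := Real.smoothTransition.le_one (-s - T)
      have h3 := mul_nonneg hj0 h1
      have h4 : j * Real.smoothTransition (-s - T) ≤ j * 1 := by gcongr
      rw [sideProfile_left hT0 h, Set.uIcc_of_le (by linarith)] at hv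
      have h5 := hpos s (h.trans (neg_le_neg hTT₀))
      refine ⟨Or.inr ⟨by simpa using h.trans (neg_le_neg hTT₀), ?_⟩, abs_le.2 ⟨?_, ?_⟩⟩
      · simpa using lt_of_lt_of_le h5 hv.1
      · linarith [hv.1]
      · linarith [hv.2]
  have hmain : ∀ j : ℝ, 0 ≤ j → j ≤ Hd - 1 → ∃ M : ℝ, ∀ ξ : ℂ,
      (∀ s, |s - ξ.re| < 3 / 4 → 3 / 4 ≤ |(η s + j * sideProfile T s) - ξ.im|) →
      ‖cauchyIntegral (fun s => η s + j * sideProfile T s) g ξ‖ ≤ M ∧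
      plusPart η g ξ = plusPart (fun s => η s + j * sideProfile T s) g ξ := by
    intro j hj0 hj
    have hη' : IsGoodPath fun s => η s + j * sideProfile T s :=
      hη.add ((isGoodPath_sideProfile T).const_mul j)
    have hb := hbetween j hj0 hj
    have hGs : ∀ s, T ≤ |s| → ‖g (pathPoint (fun s => η s + j * sideProfile T s) s)‖ ≤
        G * (1 + |s|) ^ (-(1 / 2) : ℝ) := by
      intro s hs
      have h1 := hb s hs _ Set.right_mem_uIcc
      have := hG _ h1.1 (by simpa using h1.2)
      simpa [pathPoint] using this
    have hg' : CauchyIntegrable (fun s => η s + j * sideProfile T s) g := by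
      refine cauchyIntegrable_of_tail hη' (T := T) (G := G) ?_ (fun s hs => ?_) hGs
      · refine (MeasureTheory.Integrable.integrableOn hg).congr_fun (fun s hs => ?_)
          measurableSet_Ioo
        have h1 : η =ᶠ[𝓝 s] fun s => η s + j * sideProfile T s := by
          filter_upwards [isOpen_Ioo.mem_nhds hs] with x hx
          rw [sideProfile_mid (abs_lt.2 hx).le, mul_zero, add_zero]
        beta_reduce
        rw [pathPoint_congr (η' := fun s => η s + j * sideProfile T s) h1.eq_of_nhds,
          pathVel_congr h1]
      · exact (han _ (hb s hs _ Set.right_mem_uIcc).1).continuousAt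
    obtain ⟨M, hM⟩ := exists_bound_cauchyIntegral hη' hg' (c := 1 / 3) (by norm_num) hT0.le hGs
    refine ⟨M, fun ξ hξ => ⟨hM ξ (le_norm_sub_of_gap hξ), ?_⟩⟩
    refine plusPart_eq_plusPart hη hη' hg hg' (fun s => ?_) ⟨|G|, T, fun s hs => Or.inr ?_⟩ ?_
    · by_cases hs : T ≤ |s|
      · exact Or.inr fun v hv => han _ (hb s hs v hv).1
      · left
        have : {x : ℝ | |x| < T} ∈ 𝓝 s :=
          (isOpen_lt (by fun_prop) continuous_const).mem_nhds (not_le.1 hs)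
        filter_upwards [this] with x hx
        rw [sideProfile_mid (le_of_lt hx), mul_zero, add_zero]
    · intro v hv
      have h1 := hb s hs v hv
      refine (hG _ h1.1 (by simpa using h1.2)).trans ?_
      have h2 : (1 + |((s : ℂ) + Complex.I * v).re|) ^ (-(1 / 2) : ℝ) ≤ 1 :=
        Real.rpow_le_one_of_one_le_of_nonpos
          (by linarith [abs_nonneg ((s : ℂ) + Complex.I * v).re]) (by norm_num)
      calc _ ≤ |G| * 1 := mul_le_mul (le_abs_self G) h2 (by positivity) (abs_nonneg G)
        _ = |G| := mul_one _
    · intro hon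
      have := hξ ξ.re (by simp)
      have hon' : ξ.im = η ξ.re + j * sideProfile T ξ.re := hon
      rw [← hon', sub_self, abs_zero] at this
      linarith
  obtain ⟨M₁, hM₁⟩ := hmain 1 zero_le_one (by linarith)
  obtain ⟨M₂, hM₂⟩ := hmain (Hd - 1) (by linarith) le_rfl
  refine ⟨max M₁ (|G| + M₂), T + 2, fun ξ hre hright hleft => ?_⟩
  have hGle : ∀ ξ, InTail T₀ ξ → |ξ.im| ≤ Hd → ‖g ξ‖ ≤ |G| := by
    intro ξ h1 h2
    refine (hG ξ h1 h2).trans ?_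
    have h2 : (1 + |ξ.re|) ^ (-(1 / 2) : ℝ) ≤ 1 :=
      Real.rpow_le_one_of_one_le_of_nonpos (by linarith [abs_nonneg ξ.re]) (by norm_num)
    calc _ ≤ |G| * 1 := mul_le_mul (le_abs_self G) h2 (by positivity) (abs_nonneg G)
      _ = |G| := mul_one _
  rcases le_abs.1 hre with h | h
  · have him := hright (by linarith)
    have hval : ∀ s, |s - ξ.re| < 3 / 4 → η s + (Hd - 1) * sideProfile T s ≤ ξ.im - 3 / 4 := by
      intro s hs
      have hs' := abs_lt.1 hs
      have hsm := abs_le.1 (hsmall s (by rw [le_abs]; left; linarith))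
      rw [sideProfile_right hT0 (by linarith),
        Real.smoothTransition.one_of_one_le (by linarith)]
      linarith
    obtain ⟨h1, h2⟩ := hM₂ ξ fun s hs => by
      rw [abs_sub_comm]
      exact (by linarith [hval s hs] : 3 / 4 ≤ ξ.im - _).trans (le_abs_self _)
    rw [h2, plusPart_of_isAbove (by
      have := hval ξ.re (by simp)
      simp only [IsAbove]; linarith)]
    exact h1.trans ((le_add_of_nonneg_left (abs_nonneg G)).trans (le_max_right _ _))
  · have him := hleft (by linarith)
    -- Low points lie below the left tail raised by Hd - 1 ≥ 3, where the jump term g is added; high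
    -- points lie above the tail raised by 1, which stays below 5/4.
    by_cases h2 : ξ.im ≤ 2
    · have hval : ∀ s, |s - ξ.re| < 3 / 4 →
          ξ.im + 3 / 4 ≤ η s + (Hd - 1) * sideProfile T s := by
        intro s hs
        have hs' := abs_lt.1 hs
        have hps := hpos s (by linarith)
        rw [sideProfile_left hT0 (by linarith),
          Real.smoothTransition.one_of_one_le (by linarith)]
        linarith
      obtain ⟨h3, h4⟩ := hM₂ ξ fun s hs =>
        (by linarith [hval s hs] : 3 / 4 ≤ _ - ξ.im).trans (le_abs_self _)
      rw [h4, plusPart_of_below (by linarith [hval ξ.re (by simp)])]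
      refine (norm_add_le _ _).trans (le_trans ?_ (le_max_right _ _))
      gcongr
      exact hGle ξ (Or.inr ⟨by linarith, him⟩) (by rw [abs_of_pos him]; linarith)
    · have hval : ∀ s, |s - ξ.re| < 3 / 4 → η s + 1 * sideProfile T s ≤ ξ.im - 3 / 4 := by
        intro s hs
        have hs' := abs_lt.1 hs
        have hsm := abs_le.1 (hsmall s (by rw [le_abs]; right; linarith))
        rw [sideProfile_left hT0 (by linarith),
          Real.smoothTransition.one_of_one_le (by linarith)]
        linarith
      obtain ⟨h3, h4⟩ := hM₁ ξ fun s hs => by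
        rw [abs_sub_comm]
        exact (by linarith [hval s hs] : 3 / 4 ≤ ξ.im - _).trans (le_abs_self _)
      rw [h4, plusPart_of_isAbove (by
        have := hval ξ.re (by simp)
        simp only [IsAbove]; linarith)]
      exact h3.trans (le_max_left _ _)

/-! ### The square root and the vertical wave number -/

theorem csqrt_sq (w : ℂ) : csqrt w ^ 2 = w := by
  unfold csqrt
  simp

theorem csqrt_eq_exp {w : ℂ} (hw : w ≠ 0) : csqrt w = Complex.exp (Complex.log w / 2) := by
  rw [csqrt, Complex.cpow_def_of_ne_zero hw]
  ring_nf

theorem csqrt_ne_zero {w : ℂ} (hw : w ≠ 0) : csqrt w ≠ 0 := by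
  rw [csqrt_eq_exp hw]; exact Complex.exp_ne_zero _

theorem csqrt_zero : csqrt 0 = 0 := by simp [csqrt]

theorem norm_csqrt_sq (w : ℂ) : ‖csqrt w‖ ^ 2 = ‖w‖ := by
  rw [← norm_pow, csqrt_sq]

theorem norm_csqrt (w : ℂ) : ‖csqrt w‖ = Real.sqrt ‖w‖ := by
  rw [← norm_csqrt_sq w, Real.sqrt_sq (norm_nonneg _)]

theorem csqrt_re_nonneg (w : ℂ) : 0 ≤ (csqrt w).re := by
  by_cases hw : w = 0
  · simp [hw, csqrt_zero]
  rw [csqrt_eq_exp hw, Complex.exp_re]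
  refine mul_nonneg (Real.exp_nonneg _) (Real.cos_nonneg_of_mem_Icc ?_)
  have h1 := Complex.neg_pi_lt_arg w
  have h2 := Complex.arg_le_pi w
  have h3 : (Complex.log w / 2).im = w.arg / 2 := by
    rw [show (2 : ℂ) = ((2 : ℝ) : ℂ) by norm_num, Complex.div_ofReal_im, Complex.log_im]
  rw [h3]
  constructor <;> linarith

theorem csqrt_re_pos {w : ℂ} (hw : w ∈ Complex.slitPlane) : 0 < (csqrt w).re := by
  rw [csqrt_eq_exp (Complex.slitPlane_ne_zero hw), Complex.exp_re]
  refine mul_pos (Real.exp_pos _) (Real.cos_pos_of_mem_Ioo ?_)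
  have h1 := Complex.neg_pi_lt_arg w
  have h2 := lt_of_le_of_ne (Complex.arg_le_pi w) (Complex.mem_slitPlane_iff_arg.1 hw).1
  have h3 : (Complex.log w / 2).im = w.arg / 2 := by
    rw [show (2 : ℂ) = ((2 : ℝ) : ℂ) by norm_num, Complex.div_ofReal_im, Complex.log_im]
  rw [h3]
  constructor <;> linarith

theorem hasDerivAt_csqrt {w : ℂ} (hw : w ∈ Complex.slitPlane) :
    HasDerivAt csqrt (1 / (2 * csqrt w)) w := by
  have hw0 := Complex.slitPlane_ne_zero hw
  have h1 : HasDerivAt (fun z => Complex.exp (Complex.log z / 2))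
      (Complex.exp (Complex.log w / 2) * (w⁻¹ / 2)) w :=
    ((Complex.hasDerivAt_log hw).div_const 2).cexp
  have h2 : csqrt =ᶠ[𝓝 w] fun z => Complex.exp (Complex.log z / 2) := by
    filter_upwards [isOpen_ne.mem_nhds hw0] with z hz using csqrt_eq_exp hz
  refine (h1.congr_of_eventuallyEq h2).congr_deriv ?_
  rw [← csqrt_eq_exp hw0]
  have h3 := csqrt_sq w
  have h4 := csqrt_ne_zero hw0
  field_simp
  linear_combination h3

theorem analyticAt_csqrt {w : ℂ} (hw : w ∈ Complex.slitPlane) : AnalyticAt ℂ csqrt w := by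
  rw [Complex.analyticAt_iff_eventually_differentiableAt]
  filter_upwards [Complex.isOpen_slitPlane.mem_nhds hw] with z hz
  exact (hasDerivAt_csqrt hz).differentiableAt

theorem csqrt_sq_of_re_pos {w : ℂ} (hw : 0 < w.re) : csqrt (w ^ 2) = w := by
  have h1 : csqrt (w ^ 2) ^ 2 = w ^ 2 := csqrt_sq _
  rcases sq_eq_sq_iff_eq_or_eq_neg.1 h1 with h | h
  · exact h
  · have := csqrt_re_nonneg (w ^ 2)
    rw [h, Complex.neg_re] at this
    linarith

theorem csqrt_ofReal_sq {x : ℝ} (hx : 0 ≤ x) : csqrt ((x : ℂ) ^ 2) = x := by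
  rcases hx.eq_or_lt with h | h
  · subst h; simp [csqrt_zero]
  · exact csqrt_sq_of_re_pos (by simpa using h)

/-- The point is not on the branch cuts of `μ`. -/
def OffCuts (k : ℝ) (ξ : ℂ) : Prop := ξ.im ≠ 0 ∨ |ξ.re| < k

theorem isOpen_offCuts (k : ℝ) : IsOpen {ξ : ℂ | OffCuts k ξ} := by
  have h1 : IsOpen {ξ : ℂ | ξ.im ≠ 0} := isOpen_ne_fun Complex.continuous_im continuous_const
  have h2 : IsOpen {ξ : ℂ | |ξ.re| < k} :=
    isOpen_lt Complex.continuous_re.abs continuous_const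
  exact h1.union h2

theorem mu_sq (k : ℝ) (ξ : ℂ) : mu k ξ ^ 2 = (k : ℂ) ^ 2 - ξ ^ 2 := csqrt_sq _

theorem sq_sub_sq_mem_slitPlane {k : ℝ} (hk : 0 < k) {ξ : ℂ} (h : OffCuts k ξ) :
    (k : ℂ) ^ 2 - ξ ^ 2 ∈ Complex.slitPlane := by
  rw [Complex.mem_slitPlane_iff]
  have hre : ((k : ℂ) ^ 2 - ξ ^ 2).re = k ^ 2 - ξ.re ^ 2 + ξ.im ^ 2 := by
    simp [pow_two]; ring
  have him : ((k : ℂ) ^ 2 - ξ ^ 2).im = -(2 * ξ.re * ξ.im) := by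
    simp [pow_two]; ring
  rw [hre, him]
  by_cases h0 : ξ.re = 0
  · left; rw [h0]; nlinarith [sq_nonneg ξ.im, pow_pos hk 2]
  · rcases h with h | h
    · right
      simp [h0, h]
    · left
      have := sq_lt_sq' (by linarith [(abs_lt.1 h).1]) (abs_lt.1 h).2
      nlinarith [sq_nonneg ξ.im]

theorem analyticAt_mu {k : ℝ} (hk : 0 < k) {ξ : ℂ} (h : OffCuts k ξ) : AnalyticAt ℂ (mu k) ξ := by
  have h1 := analyticAt_csqrt (sq_sub_sq_mem_slitPlane hk h)
  exact AnalyticAt.fun_comp (f := fun ξ : ℂ => (k : ℂ) ^ 2 - ξ ^ 2) h1 (by fun_prop)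

theorem mu_re_pos {k : ℝ} (hk : 0 < k) {ξ : ℂ} (h : OffCuts k ξ) : 0 < (mu k ξ).re :=
  csqrt_re_pos (sq_sub_sq_mem_slitPlane hk h)

theorem mu_ne_zero {k : ℝ} (hk : 0 < k) {ξ : ℂ} (h : OffCuts k ξ) : mu k ξ ≠ 0 := by
  intro h0
  have := mu_re_pos hk h
  rw [h0] at this; simp at this

/-- The imaginary part of μ² is -2 Re ξ Im ξ, and Re μ > 0 fixes the sign of Im μ. -/
theorem mu_im_pos {k : ℝ} (hk : 0 < k) {ξ : ℂ} (h : ξ.re * ξ.im < 0) : 0 < (mu k ξ).im := by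
  have hoff : OffCuts k ξ := Or.inl (by rintro h0; rw [h0] at h; simp at h)
  have h1 := mu_re_pos hk hoff
  have h2 : (mu k ξ ^ 2).im = -(2 * ξ.re * ξ.im) := by
    rw [mu_sq]; simp [pow_two]; ring
  have h3 : (mu k ξ ^ 2).im = 2 * (mu k ξ).re * (mu k ξ).im := by
    simp [pow_two]; ring
  nlinarith

/-- Otherwise (Re μ)² < (Im ξ)² and (Im μ)² < (Re ξ)², against Re μ · Im μ = -Re ξ · Im ξ. The point
is that Im ξ does not occur in the bound: far to the left and right the sine quotients are
controlled at every height. -/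
theorem sq_le_mu_im_sq (k : ℝ) (ξ : ℂ) : ξ.re ^ 2 - k ^ 2 ≤ (mu k ξ).im ^ 2 := by
  set a := (mu k ξ).re
  set b := (mu k ξ).im
  have h1 : a ^ 2 - b ^ 2 = k ^ 2 - ξ.re ^ 2 + ξ.im ^ 2 := by
    have := congrArg Complex.re (mu_sq k ξ)
    simp [pow_two] at this
    simp only [a, b]
    nlinarith
  have h2 : a * b = -(ξ.re * ξ.im) := by
    have := congrArg Complex.im (mu_sq k ξ)
    simp [pow_two] at this
    simp only [a, b]
    linarith
  by_contra hc
  rw [not_le] at hc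
  have h3 : a ^ 2 < ξ.im ^ 2 := by nlinarith
  have h4 : a ^ 2 * b ^ 2 = ξ.re ^ 2 * ξ.im ^ 2 := by
    rw [← mul_pow, h2]; ring
  have h5 : b ^ 2 < ξ.re ^ 2 := by nlinarith [sq_nonneg k]
  have h6 : 0 < ξ.im ^ 2 := (sq_nonneg a).trans_lt h3
  nlinarith [mul_lt_mul_of_pos_right h5 h6, mul_le_mul_of_nonneg_right h3.le (sq_nonneg b)]

theorem norm_exp_I_mul (z : ℂ) : ‖Complex.exp (Complex.I * z)‖ = Real.exp (-z.im) := by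
  rw [Complex.norm_exp]; simp

/-! ### The kernel -/

theorem kernel_eq (k h : ℝ) (ξ : ℂ) :
    kernel k h ξ = 1 - Complex.exp (Complex.I * mu k ξ * h) ^ 2 := by
  rw [kernel, ← Complex.exp_nat_mul]
  congr 2
  push_cast
  ring

theorem analyticAt_kernel {k h : ℝ} (hk : 0 < k) {ξ : ℂ} (hξ : OffCuts k ξ) :
    AnalyticAt ℂ (kernel k h) ξ := by
  have h1 := analyticAt_mu hk hξ
  unfold kernel
  fun_prop

theorem norm_exp_two_I_mu (k h : ℝ) (ξ : ℂ) :
    ‖Complex.exp (2 * Complex.I * mu k ξ * h)‖ = Real.exp (-(2 * h * (mu k ξ).im)) := by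
  rw [show 2 * Complex.I * mu k ξ * h = Complex.I * ((2 * h : ℝ) * mu k ξ) by push_cast; ring,
    norm_exp_I_mul, Complex.im_ofReal_mul]

/-- In the open second and fourth quadrants Im μ > 0, so the exponential has modulus less than 1.
The principal logarithm of the kernel is therefore analytic there and no branch has to be followed.
-/
theorem kernel_re_pos {k h : ℝ} (hk : 0 < k) (hh : 0 < h) {ξ : ℂ} (hξ : ξ.re * ξ.im < 0) :
    0 < (kernel k h ξ).re := by
  have h1 := Complex.re_le_norm (Complex.exp (2 * Complex.I * mu k ξ * h))
  rw [norm_exp_two_I_mu] at h1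
  have h2 : Real.exp (-(2 * h * (mu k ξ).im)) < 1 := by
    rw [Real.exp_lt_one_iff]
    have := mu_im_pos hk hξ
    nlinarith [mul_pos hh this]
  rw [kernel, Complex.sub_re, Complex.one_re]
  linarith

theorem mu_zero {k : ℝ} (hk : 0 < k) : mu k 0 = k := by
  rw [mu, zero_pow two_ne_zero, sub_zero, csqrt_ofReal_sq hk.le]

theorem kernel_zero_re_pos {k h : ℝ} (hk : 0 < k)
    (hne : Complex.exp (2 * Complex.I * k * h) ≠ 1) : 0 < (kernel k h 0).re := by
  rw [kernel, mu_zero hk, Complex.sub_re, Complex.one_re, sub_pos]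
  have hn : ‖Complex.exp (2 * Complex.I * k * h)‖ = 1 := by
    have := Complex.norm_exp_ofReal_mul_I (2 * k * h)
    rw [← this]; congr 2; push_cast; ring
  refine lt_of_le_of_ne (hn ▸ Complex.re_le_norm _) fun h1 => hne ?_
  set z := Complex.exp (2 * Complex.I * k * h)
  have h2 : z.im = 0 := by
    have := Complex.sq_norm z
    rw [hn, Complex.normSq_apply, h1] at this
    nlinarith
  exact Complex.ext (by simpa using h1) (by simpa using h2)

theorem analyticAt_log_kernel {k h : ℝ} (hk : 0 < k) {ξ : ℂ} (hξ : OffCuts k ξ)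
    (hpos : 0 < (kernel k h ξ).re) :
    AnalyticAt ℂ (fun t => Complex.log (kernel k h t)) ξ :=
  (analyticAt_kernel hk hξ).clog (Or.inl hpos)

/-- The exponential equals 1 exactly if μh is an integer multiple of π; Re μ ≥ 0 rules out the
negative multiples. -/
theorem kernel_eq_zero_iff {k h : ℝ} (hh : 0 < h) (ξ : ℂ) :
    kernel k h ξ = 0 ↔ ∃ n : ℕ, mu k ξ = modeMu h n := by
  rw [kernel, sub_eq_zero, eq_comm, Complex.exp_eq_one_iff]
  have hπ : (Real.pi : ℂ) ≠ 0 := by exact_mod_cast Real.pi_ne_zero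
  have hh' : (h : ℂ) ≠ 0 := by exact_mod_cast hh.ne'
  have key : ∀ n : ℤ, 2 * Complex.I * mu k ξ * h = n * (2 * Real.pi * Complex.I) ↔
      mu k ξ = n * Real.pi / h := by
    intro n
    rw [eq_div_iff hh']
    constructor
    · intro h1
      have h2 : (2 * Complex.I) * (mu k ξ * h) = (2 * Complex.I) * (n * Real.pi) := by
        linear_combination h1
      exact mul_left_cancel₀ (by simp) h2
    · intro h1
      linear_combination (2 * Complex.I) * h1
  constructor
  · rintro ⟨n, hn⟩
    rw [key] at hn
    have hre := csqrt_re_nonneg ((k : ℂ) ^ 2 - ξ ^ 2)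
    change 0 ≤ (mu k ξ).re at hre
    have h1 : mu k ξ = ((n * Real.pi / h : ℝ) : ℂ) := by rw [hn]; push_cast; ring
    rw [h1, Complex.ofReal_re] at hre
    have hn0 : 0 ≤ n := by
      by_contra hc
      have h2 : (n : ℝ) < 0 := by exact_mod_cast not_le.1 hc
      have : n * Real.pi / h < 0 := div_neg_of_neg_of_pos (mul_neg_of_neg_of_pos h2 Real.pi_pos) hh
      linarith
    obtain ⟨m, rfl⟩ := Int.eq_ofNat_of_zero_le hn0
    exact ⟨m, by rw [h1, modeMu]; push_cast; rfl⟩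
  · rintro ⟨n, hn⟩
    refine ⟨n, (key n).2 ?_⟩
    rw [hn, modeMu]; push_cast; rfl

theorem mu_ne_zero_of_kernel {k h : ℝ} {ξ : ℂ} (hK : kernel k h ξ ≠ 0) : mu k ξ ≠ 0 := by
  intro h0
  apply hK
  simp [kernel, h0]

/-! ### The entire functions `sin(a√z)/√z` -/

/-- The entire function `sin(a√z)/√z`. -/
def sincSqrt (a : ℝ) (z : ℂ) : ℂ :=
  if z = 0 then (a : ℂ) else Complex.sin (a * csqrt z) / csqrt z

/-- The quotient sin(aw)/w is even in w, so it does not matter which root is taken. -/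
theorem sincSqrt_sq {a : ℝ} {w : ℂ} (hw : w ≠ 0) :
    sincSqrt a (w ^ 2) = Complex.sin (a * w) / w := by
  rw [sincSqrt, if_neg (pow_ne_zero 2 hw)]
  rcases sq_eq_sq_iff_eq_or_eq_neg.1 (csqrt_sq (w ^ 2)) with h | h
  · rw [h]
  · rw [h, mul_neg, Complex.sin_neg, neg_div_neg_eq]

theorem analyticAt_sincSqrt_of_slit {a : ℝ} {z : ℂ} (hz : z ∈ Complex.slitPlane) :
    AnalyticAt ℂ (sincSqrt a) z := by
  have h1 := analyticAt_csqrt hz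
  have h0 := Complex.slitPlane_ne_zero hz
  have h2 : AnalyticAt ℂ (fun z => Complex.sin (a * csqrt z) / csqrt z) z := by
    have h3 : AnalyticAt ℂ (fun z => Complex.sin (a * csqrt z)) z := by fun_prop
    exact h3.div h1 (csqrt_ne_zero h0)
  refine h2.congr ?_
  filter_upwards [isOpen_ne.mem_nhds h0] with w hw
  rw [sincSqrt, if_neg hw]

/-- On the cut of the principal root the other analytic branch i√(-z) is used; evenness makes the
value the same. -/
theorem analyticAt_sincSqrt_of_ne {a : ℝ} {z : ℂ} (hz : z ≠ 0) :
    AnalyticAt ℂ (sincSqrt a) z := by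
  by_cases h : z ∈ Complex.slitPlane
  · exact analyticAt_sincSqrt_of_slit h
  · have h' : -z ∈ Complex.slitPlane := by
      rw [Complex.mem_slitPlane_iff, not_or, not_lt, not_not] at h
      rw [Complex.mem_slitPlane_iff, Complex.neg_re]
      left
      refine lt_of_le_of_ne (by linarith) fun h0 => hz (Complex.ext ?_ ?_)
      · simp; linarith
      · simpa using h.2
    have h1 : AnalyticAt ℂ (fun w => Complex.I * csqrt (-w)) z :=
      analyticAt_const.mul (AnalyticAt.fun_comp (analyticAt_csqrt h') (by fun_prop))
    have h2 : AnalyticAt ℂ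
        (fun w => Complex.sin (a * (Complex.I * csqrt (-w))) / (Complex.I * csqrt (-w))) z := by
      have h3 : AnalyticAt ℂ (fun w => Complex.sin (a * (Complex.I * csqrt (-w)))) z := by
        fun_prop
      exact h3.div h1 (mul_ne_zero Complex.I_ne_zero (csqrt_ne_zero (neg_ne_zero.2 hz)))
    refine h2.congr ?_
    filter_upwards [isOpen_ne.mem_nhds hz] with w hw
    rw [← sincSqrt_sq (mul_ne_zero Complex.I_ne_zero (csqrt_ne_zero (neg_ne_zero.2 hw))), mul_pow,
      csqrt_sq, Complex.I_sq]
    congr 1; ring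

theorem analyticAt_sincSqrt (a : ℝ) (z : ℂ) : AnalyticAt ℂ (sincSqrt a) z := by
  by_cases hz : z = 0
  · subst hz
    refine Complex.analyticAt_of_differentiable_on_punctured_nhds_of_continuousAt ?_ ?_
    · filter_upwards [self_mem_nhdsWithin] with w hw
      exact (analyticAt_sincSqrt_of_ne hw).differentiableAt
    · rw [continuousAt_iff_punctured_nhds]
      have h1 : Tendsto csqrt (𝓝[≠] 0) (𝓝[≠] 0) := by
        refine tendsto_nhdsWithin_iff.2 ⟨?_, ?_⟩
        · rw [tendsto_zero_iff_norm_tendsto_zero]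
          have : Tendsto (fun z : ℂ => Real.sqrt ‖z‖) (𝓝 0) (𝓝 0) := by
            have : Continuous fun z : ℂ => Real.sqrt ‖z‖ := by fun_prop
            simpa using this.tendsto 0
          refine (this.mono_left nhdsWithin_le_nhds).congr fun z => ?_
          rw [norm_csqrt]
        · filter_upwards [self_mem_nhdsWithin] with w hw
          exact csqrt_ne_zero hw
      have h2 : Tendsto (fun w : ℂ => Complex.sin (a * w) / w) (𝓝[≠] 0) (𝓝 (a : ℂ)) := by
        have h3 : HasDerivAt (fun w : ℂ => Complex.sin (a * w)) (a : ℂ) 0 := by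
          have := (((hasDerivAt_id (0 : ℂ)).const_mul (a : ℂ))).csin
          simpa using this
        have := h3.tendsto_slope_zero
        refine this.congr fun w => ?_
        simp [div_eq_inv_mul]
      have h3 : sincSqrt a 0 = a := if_pos rfl
      rw [h3]
      refine (h2.comp h1).congr' ?_
      filter_upwards [self_mem_nhdsWithin] with w hw
      simp only [Function.comp_apply]
      rw [sincSqrt, if_neg (show w ≠ 0 from hw)]
  · exact analyticAt_sincSqrt_of_ne hz

theorem hasDerivAt_sincSqrt {a w : ℝ} (hw : 0 < w) (hsin : Real.sin (a * w) = 0) :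
    HasDerivAt (sincSqrt a) (a * Real.cos (a * w) / (2 * w ^ 2)) ((w : ℂ) ^ 2) := by
  have hsl : (w : ℂ) ^ 2 ∈ Complex.slitPlane := by
    left
    rw [← Complex.ofReal_pow, Complex.ofReal_re]; positivity
  have h0 := Complex.slitPlane_ne_zero hsl
  have hw' : (w : ℂ) ≠ 0 := by exact_mod_cast hw.ne'
  have hc := hasDerivAt_csqrt hsl
  rw [csqrt_ofReal_sq hw.le] at hc
  have h1 := (hc.const_mul (a : ℂ)).csin.div hc (by rw [csqrt_ofReal_sq hw.le]; exact hw')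
  have h2 : sincSqrt a =ᶠ[𝓝 ((w : ℂ) ^ 2)] (fun z => Complex.sin (a * csqrt z)) / csqrt := by
    filter_upwards [isOpen_ne.mem_nhds h0] with z hz
    rw [sincSqrt, if_neg hz]; rfl
  refine (h1.congr_of_eventuallyEq h2).congr_deriv ?_
  rw [csqrt_ofReal_sq hw.le]
  have h3 : Complex.sin (a * w) = 0 := by exact_mod_cast congrArg (fun x : ℝ => (x : ℂ)) hsin
  rw [h3]
  push_cast
  field_simp
  ring

/-! ### Bounds for trigonometric functions -/

theorem norm_sin_le (z : ℂ) : ‖Complex.sin z‖ ≤ Real.exp |z.im| := by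
  have h1 : ‖Complex.exp (z * Complex.I)‖ ≤ Real.exp |z.im| := by
    rw [mul_comm, norm_exp_I_mul]
    exact Real.exp_le_exp.2 (neg_le_abs _)
  have h2 : ‖Complex.exp (-z * Complex.I)‖ ≤ Real.exp |z.im| := by
    rw [mul_comm, norm_exp_I_mul]
    exact Real.exp_le_exp.2 (by simpa using le_abs_self z.im)
  rw [Complex.sin, norm_div, norm_mul, Complex.norm_I, mul_one]
  have := norm_sub_le (Complex.exp (-z * Complex.I)) (Complex.exp (z * Complex.I))
  simp only [Complex.norm_ofNat]
  linarith

/-- For |Im z| ≥ 1 the larger of the two exponentials is at least 2 and the smaller at most 1, so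
half of the larger survives the subtraction. -/
theorem le_norm_sin {z : ℂ} (hz : 1 ≤ |z.im|) : Real.exp |z.im| / 4 ≤ ‖Complex.sin z‖ := by
  have key : Real.exp |z.im| - Real.exp (-|z.im|) ≤
      ‖Complex.exp (-z * Complex.I) - Complex.exp (z * Complex.I)‖ := by
    have e1 : ‖Complex.exp (z * Complex.I)‖ = Real.exp (-z.im) := by
      rw [mul_comm, norm_exp_I_mul]
    have e2 : ‖Complex.exp (-z * Complex.I)‖ = Real.exp z.im := by
      rw [mul_comm, norm_exp_I_mul]; simp
    rcases le_total 0 z.im with h | h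
    · rw [abs_of_nonneg h, ← e1, ← e2]
      exact norm_sub_norm_le _ _
    · rw [abs_of_nonpos h, neg_neg, ← e1, ← e2, norm_sub_rev]
      exact norm_sub_norm_le _ _
  have h1 : Real.exp (-|z.im|) ≤ 1 := Real.exp_le_one_iff.2 (by linarith [abs_nonneg z.im])
  have h2 : 2 ≤ Real.exp |z.im| := by linarith [Real.add_one_le_exp |z.im|]
  rw [Complex.sin, norm_div, norm_mul, Complex.norm_I, mul_one]
  simp only [Complex.norm_ofNat]
  linarith

/-! ### The path and the logarithm of the kernel -/

theorem IsAdmissiblePath.good {η : ℝ → ℝ} (hη : IsAdmissiblePath η) : IsGoodPath η := by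
  refine ⟨hη.smooth.of_le (by exact_mod_cast le_top), ?_, hη.bounded_deriv⟩
  have e1 : ∀ᶠ s in atTop, |η s| < 1 := by
    have := hη.tendsto_atTop.abs
    rw [abs_zero] at this
    exact this.eventually (gt_mem_nhds one_pos)
  have e2 : ∀ᶠ s in atBot, |η s| < 1 := by
    have := hη.tendsto_atBot.abs
    rw [abs_zero] at this
    exact this.eventually (gt_mem_nhds one_pos)
  obtain ⟨a, ha⟩ := eventually_atTop.1 e1
  obtain ⟨b, hb⟩ := eventually_atBot.1 e2
  obtain ⟨C, hC⟩ := (isCompact_Icc (a := b) (b := a)).exists_bound_of_continuousOn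
    hη.smooth.continuous.continuousOn
  refine ⟨max 1 C, fun s => ?_⟩
  by_cases h1 : a ≤ s
  · exact (ha s h1).le.trans (le_max_left _ _)
  · by_cases h2 : s ≤ b
    · exact (hb s h2).le.trans (le_max_left _ _)
    · exact (hC s ⟨(not_le.1 h2).le, (not_le.1 h1).le⟩).trans (le_max_right _ _)

theorem IsAdmissiblePath.zero {η : ℝ → ℝ} (hη : IsAdmissiblePath η) : η 0 = 0 := by
  have hc := hη.smooth.continuous.continuousAt (x := 0)
  apply le_antisymm
  · refine le_of_tendsto (hc.tendsto.mono_left nhdsWithin_le_nhds : Tendsto η (𝓝[>] 0) _) ?_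
    filter_upwards [self_mem_nhdsWithin] with s hs using (hη.neg_of_pos s hs).le
  · refine ge_of_tendsto (hc.tendsto.mono_left nhdsWithin_le_nhds : Tendsto η (𝓝[<] 0) _) ?_
    filter_upwards [self_mem_nhdsWithin] with s hs using (hη.pos_of_neg s hs).le

theorem IsAdmissiblePath.mul_neg {η : ℝ → ℝ} (hη : IsAdmissiblePath η) {s : ℝ} (hs : s ≠ 0) :
    s * η s < 0 := by
  rcases lt_or_gt_of_ne hs with h | h
  · exact mul_neg_of_neg_of_pos h (hη.pos_of_neg s h)
  · exact mul_neg_of_pos_of_neg h (hη.neg_of_pos s h)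

theorem IsOn.re_mul_im_neg {η : ℝ → ℝ} (hη : IsAdmissiblePath η) {ξ : ℂ} (h : IsOn η ξ)
    (h0 : ξ ≠ 0) : ξ.re * ξ.im < 0 := by
  have h1 : ξ.im = η ξ.re := h
  rw [h1]
  refine hη.mul_neg fun hre => h0 (Complex.ext hre ?_)
  rw [h1, hre, hη.zero]; rfl

theorem InTail.re_mul_im_neg {T : ℝ} (hT : 0 < T) {ξ : ℂ} (h : InTail T ξ) :
    ξ.re * ξ.im < 0 := by
  rcases h with h | h
  · exact mul_neg_of_pos_of_neg (hT.trans_le h.1) h.2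
  · exact mul_neg_of_neg_of_pos (by linarith [h.1]) h.2

theorem InTail.le_abs_re {T : ℝ} {ξ : ℂ} (h : InTail T ξ) : T ≤ |ξ.re| := by
  rcases h with h | h
  · exact h.1.trans (le_abs_self _)
  · exact (by linarith [h.1] : T ≤ -ξ.re).trans (neg_le_abs _)

theorem offCuts_of_mul_neg (k : ℝ) {ξ : ℂ} (h : ξ.re * ξ.im < 0) : OffCuts k ξ :=
  Or.inl fun h0 => by rw [h0, mul_zero] at h; exact lt_irrefl _ h

theorem half_abs_re_le_mu_im {k : ℝ} (hk : 0 < k) {ξ : ℂ} (hre : 2 * k ≤ |ξ.re|) :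
    |ξ.re| / 2 ≤ |(mu k ξ).im| := by
  have h1 := sq_le_mu_im_sq k ξ
  rw [← sq_abs ξ.re, ← sq_abs (mu k ξ).im] at h1
  refine abs_le_of_sq_le_sq' ?_ (abs_nonneg _) |>.2
  nlinarith

theorem rpow_neg_half_ge {x : ℝ} (hx : 1 ≤ x) : x⁻¹ ≤ x ^ (-(1 / 2) : ℝ) := by
  rw [← Real.rpow_neg_one]
  exact Real.rpow_le_rpow_of_exponent_le hx (by norm_num)

/-- In the tails |e^{2iμh}| = e^{-2h Im μ} with Im μ ≥ |Re ξ|/2. This exponential decay is weakened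
at once to a power; the exponent -1/2 is the one that also fits the source term. -/
theorem exists_tail_bound_log_kernel {k h : ℝ} (hk : 0 < k) (hh : 0 < h) :
    ∃ T > 0, ∃ G : ℝ, ∀ ξ : ℂ, InTail T ξ →
      ‖Complex.log (kernel k h ξ)‖ ≤ G * (1 + |ξ.re|) ^ (-(1 / 2) : ℝ) := by
  refine ⟨max (2 * k) (1 / h), by positivity, 2 * max 1 (1 / h), fun ξ hξ => ?_⟩
  have hT := hξ.le_abs_re
  have hmul := hξ.re_mul_im_neg (by positivity)
  have him := mu_im_pos hk hmul
  have h1 := half_abs_re_le_mu_im hk ((le_max_left _ _).trans hT)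
  rw [abs_of_pos him] at h1
  have h2 : 1 ≤ h * |ξ.re| := by
    have := (le_max_right _ _).trans hT
    rwa [div_le_iff₀ hh, mul_comm] at this
  set w := Complex.exp (2 * Complex.I * mu k ξ * h) with hw
  have h3 : ‖w‖ ≤ (1 + h * |ξ.re|)⁻¹ := by
    rw [norm_exp_two_I_mu, Real.exp_neg]
    apply inv_anti₀ (by positivity)
    have := Real.add_one_le_exp (2 * h * (mu k ξ).im)
    nlinarith
  have h4 : ‖w‖ ≤ 1 / 2 := by
    refine h3.trans ?_
    rw [one_div]
    exact inv_anti₀ (by norm_num) (by linarith)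
  have h5 : ‖Complex.log (1 + -w)‖ ≤ 3 / 2 * ‖-w‖ :=
    Complex.norm_log_one_add_half_le_self (by rwa [norm_neg])
  have h6 : (1 + h * |ξ.re|)⁻¹ ≤ max 1 (1 / h) * (1 + |ξ.re|)⁻¹ := by
    rw [← div_eq_mul_inv, le_div_iff₀ (by positivity), inv_mul_le_iff₀ (by positivity)]
    have e1 : 1 ≤ max 1 (1 / h) := le_max_left _ _
    have e2 : 1 ≤ h * max 1 (1 / h) := by
      calc 1 = h * (1 / h) := by field_simp
        _ ≤ _ := by gcongr; exact le_max_right _ _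
    nlinarith [abs_nonneg ξ.re]
  have h7 := rpow_neg_half_ge (x := 1 + |ξ.re|) (by linarith [abs_nonneg ξ.re])
  have e0 : 0 ≤ max 1 (1 / h) := zero_le_one.trans (le_max_left _ _)
  rw [norm_neg, ← sub_eq_add_neg] at h5
  calc ‖Complex.log (kernel k h ξ)‖ ≤ 3 / 2 * ‖w‖ := h5
    _ ≤ 2 * ‖w‖ := by gcongr; norm_num
    _ ≤ 2 * (max 1 (1 / h) * (1 + |ξ.re|)⁻¹) := by gcongr; exact h3.trans h6
    _ ≤ 2 * (max 1 (1 / h) * (1 + |ξ.re|) ^ (-(1 / 2) : ℝ)) := by gcongr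
    _ = _ := by ring

theorem InTail.mono {T T' : ℝ} (h : T ≤ T') {ξ : ℂ} (hξ : InTail T' ξ) : InTail T ξ := by
  rcases hξ with h1 | h1
  · exact Or.inl ⟨h.trans h1.1, h1.2⟩
  · exact Or.inr ⟨h1.1.trans (neg_le_neg h), h1.2⟩

theorem IsAdmissiblePath.inTail {η : ℝ → ℝ} (hη : IsAdmissiblePath η) {T : ℝ} (hT : 0 < T) {s : ℝ}
    (hs : T ≤ |s|) : InTail T (pathPoint η s) := by
  rcases le_abs.1 hs with h | h
  · exact Or.inl ⟨by simpa using h, by simpa using hη.neg_of_pos s (hT.trans_le h)⟩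
  · exact Or.inr ⟨by simp; linarith, by simpa using hη.pos_of_neg s (by linarith)⟩

/-- The logarithm of the kernel has absolutely convergent Cauchy integrals. -/
theorem cauchyIntegrable_log_kernel_of_mid {k h : ℝ} (hk : 0 < k) (hh : 0 < h) {η : ℝ → ℝ}
    (hη : IsAdmissiblePath η)
    (hmid : ∀ T : ℝ, 0 < T → MeasureTheory.IntegrableOn
      (fun s : ℝ => Complex.log (kernel k h (pathPoint η s)) * pathVel η s / ((1 + |s| : ℝ) : ℂ))
      (Set.Ioo (-T) T)) :
    CauchyIntegrable η fun t => Complex.log (kernel k h t) := by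
  obtain ⟨T, hT, G, hG⟩ := exists_tail_bound_log_kernel hk hh
  refine cauchyIntegrable_of_tail hη.good (T := T) (G := G) (hmid T hT) (fun s hs => ?_)
    fun s hs => ?_
  · have h1 := (hη.inTail hT hs).re_mul_im_neg hT
    exact (analyticAt_log_kernel hk (offCuts_of_mul_neg k h1)
      (kernel_re_pos hk hh h1)).continuousAt
  · simpa using hG _ (hη.inTail hT hs)

theorem kernel_re_pos_of_isOn {k h : ℝ} (hk : 0 < k) (hh : 0 < h) {η : ℝ → ℝ}
    (hη : IsAdmissiblePath η) {ξ : ℂ} (hξ : IsOn η ξ)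
    (hcrit : ξ = 0 → Complex.exp (2 * Complex.I * k * h) ≠ 1) : 0 < (kernel k h ξ).re := by
  by_cases h0 : ξ = 0
  · rw [h0]; exact kernel_zero_re_pos hk (hcrit h0)
  · exact kernel_re_pos hk hh (hξ.re_mul_im_neg hη h0)

theorem offCuts_zero {k : ℝ} (hk : 0 < k) : OffCuts k 0 := Or.inr (by simpa using hk)

theorem offCuts_of_isOn {k : ℝ} (hk : 0 < k) {η : ℝ → ℝ} (hη : IsAdmissiblePath η) {ξ : ℂ}
    (hξ : IsOn η ξ) : OffCuts k ξ := by
  by_cases h0 : ξ = 0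
  · rw [h0]; exact offCuts_zero hk
  · exact offCuts_of_mul_neg k (hξ.re_mul_im_neg hη h0)

theorem cauchyIntegrable_log_kernel_of_noncritical {k h : ℝ} (hk : 0 < k) (hh : 0 < h) {η : ℝ → ℝ}
    (hη : IsAdmissiblePath η) (hcrit : Complex.exp (2 * Complex.I * k * h) ≠ 1) :
    CauchyIntegrable η fun t => Complex.log (kernel k h t) := by
  refine cauchyIntegrable_log_kernel_of_mid hk hh hη fun T _ => ?_
  refine ((continuousOn_cauchy_integrand hη.good (K := Set.Icc (-T) T)
    (g := fun t => Complex.log (kernel k h t)) fun s _ => ?_).integrableOn_compact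
    isCompact_Icc).mono_set Set.Ioo_subset_Icc_self
  have hon := isOn_pathPoint η s
  exact (analyticAt_log_kernel hk (offCuts_of_isOn hk hη hon)
    (kernel_re_pos_of_isOn hk hh hη hon fun _ => hcrit)).continuousAt

/-! ### The Wiener-Hopf factors -/

theorem Kplus_mul_Kminus (k h : ℝ) (η : ℝ → ℝ) (ξ : ℂ) :
    Kplus k h η ξ * Kminus k h η ξ = kernel k h ξ := by
  unfold Kplus Kminus
  split_ifs with h1 h2
  · rw [mul_left_comm, ← Complex.exp_add, add_neg_cancel, Complex.exp_zero, mul_one]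
  · rw [mul_mul_mul_comm, ← Complex.exp_add, add_neg_cancel, Complex.exp_zero, mul_one, ← pow_two,
      csqrt_sq]
  · rw [mul_assoc, ← Complex.exp_add, add_neg_cancel, Complex.exp_zero, mul_one]

/-- On the path the square root supplies exp(log/2) and below it the kernel supplies exp(log). The
three cases of K⁺ are thus the exponentials of those of `plusPart`, so results on the additive
splitting apply. -/
theorem Kplus_eq_exp {k h : ℝ} {η : ℝ → ℝ} {ξ : ℂ} (hξ : IsAbove η ξ ∨ kernel k h ξ ≠ 0) :
    Kplus k h η ξ = Complex.exp (plusPart η (fun t => Complex.log (kernel k h t)) ξ) := by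
  unfold Kplus plusPart
  split_ifs with h1 h2
  · rfl
  · rw [csqrt_eq_exp (hξ.resolve_left h1), ← Complex.exp_add]
  · rw [Complex.exp_add, Complex.exp_log (hξ.resolve_left h1)]

theorem Kplus_ne_zero {k h : ℝ} {η : ℝ → ℝ} {ξ : ℂ} (hξ : IsAbove η ξ ∨ kernel k h ξ ≠ 0) :
    Kplus k h η ξ ≠ 0 := by
  rw [Kplus_eq_exp hξ]; exact Complex.exp_ne_zero _

theorem Kminus_eq_div {k h : ℝ} {η : ℝ → ℝ} {ξ : ℂ} (hξ : IsAbove η ξ ∨ kernel k h ξ ≠ 0) :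
    Kminus k h η ξ = kernel k h ξ / Kplus k h η ξ := by
  rw [eq_div_iff (Kplus_ne_zero hξ), mul_comm, Kplus_mul_Kminus]

theorem Kplus_of_below {k h : ℝ} {η : ℝ → ℝ} {ξ : ℂ} (hξ : ξ.im < η ξ.re) :
    Kplus k h η ξ =
      kernel k h ξ * Complex.exp (cauchyIntegral η (fun t => Complex.log (kernel k h t)) ξ) := by
  rw [Kplus, if_neg (not_isAbove_of_below hξ), if_neg (not_isOn_of_below hξ)]

theorem Kminus_of_below {k h : ℝ} {η : ℝ → ℝ} {ξ : ℂ} (hξ : ξ.im < η ξ.re) :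
    Kminus k h η ξ =
      Complex.exp (-cauchyIntegral η (fun t => Complex.log (kernel k h t)) ξ) := by
  rw [Kminus, if_neg (not_isAbove_of_below hξ), if_neg (not_isOn_of_below hξ)]

/-- Below the path the kernel may vanish and its principal logarithm need not be analytic, so the
product of the kernel with an exponential is used there. The exponential of the splitting is needed
only above and on the path. -/
theorem analyticAt_Kplus {k h : ℝ} (hk : 0 < k) {η : ℝ → ℝ} (hη : IsGoodPath η)
    (hL : CauchyIntegrable η fun t => Complex.log (kernel k h t)) {ξ : ℂ}
    (hoff : ¬ IsAbove η ξ → OffCuts k ξ) (hon : IsOn η ξ → 0 < (kernel k h ξ).re) :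
    AnalyticAt ℂ (Kplus k h η) ξ := by
  by_cases ha : IsAbove η ξ
  · refine (analyticAt_plusPart_of_isAbove hη hL ha).cexp.congr ?_
    filter_upwards [(isOpen_isAbove hη.smooth.continuous).mem_nhds ha] with z hz
    exact (Kplus_eq_exp (Or.inl hz)).symm
  · have hK := analyticAt_kernel (h := h) hk (hoff ha)
    by_cases ho : IsOn η ξ
    · have hlog := analyticAt_log_kernel hk (hoff ha) (hon ho)
      refine (analyticAt_plusPart hη hL fun _ => hlog).cexp.congr ?_
      have hne : kernel k h ξ ≠ 0 := fun h0 => by have := hon ho; rw [h0] at this; simp at this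
      filter_upwards [hK.continuousAt.eventually_ne hne] with z hz
      exact (Kplus_eq_exp (Or.inr hz)).symm
    · have hb := below_of_not ha ho
      refine (hK.mul (analyticAt_cauchyIntegral hL hη.smooth.continuous ho).cexp).congr ?_
      filter_upwards [(isOpen_below hη.smooth.continuous).mem_nhds hb] with z hz
      exact (Kplus_of_below hz).symm

theorem analyticAt_Kminus {k h : ℝ} (hk : 0 < k) {η : ℝ → ℝ} (hη : IsGoodPath η)
    (hL : CauchyIntegrable η fun t => Complex.log (kernel k h t)) {ξ : ℂ}
    (hoff : OffCuts k ξ) (hon : IsOn η ξ → 0 < (kernel k h ξ).re) :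
    AnalyticAt ℂ (Kminus k h η) ξ := by
  have hK := analyticAt_kernel (h := h) hk hoff
  by_cases hb : ξ.im < η ξ.re
  · refine (analyticAt_cauchyIntegral hL hη.smooth.continuous (not_isOn_of_below hb)).neg.cexp.congr
      ?_
    filter_upwards [(isOpen_below hη.smooth.continuous).mem_nhds hb] with z hz
    exact (Kminus_of_below hz).symm
  · have h1 : IsAbove η ξ ∨ kernel k h ξ ≠ 0 := by
      rcases lt_or_eq_of_le (not_lt.1 hb) with h | h
      · exact Or.inl h
      · refine Or.inr fun h0 => ?_
        have := hon h.symm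
        rw [h0] at this; simp at this
    have hP := analyticAt_Kplus hk hη hL (fun _ => hoff) hon
    refine (hK.div hP (Kplus_ne_zero h1)).congr ?_
    filter_upwards [hP.continuousAt.eventually_ne (Kplus_ne_zero h1)] with z hz
    rw [Pi.div_apply, div_eq_iff hz, mul_comm, Kplus_mul_Kminus]

/-- K⁺ is the exponential of a bounded splitting. In the tails K⁻ is the exponential of log(kernel)
minus that splitting, and the logarithm is bounded there. -/
theorem exists_bound_Kplus {k h : ℝ} (hk : 0 < k) (hh : 0 < h) {η : ℝ → ℝ}
    (hη : IsAdmissiblePath η) (hL : CauchyIntegrable η fun t => Complex.log (kernel k h t))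
    {Hd : ℝ} (hHd : 2 ≤ Hd) :
    ∃ M T : ℝ, 0 < T ∧ ∀ ξ : ℂ, T ≤ |ξ.re| → (0 < ξ.re → -Hd ≤ ξ.im) → (ξ.re < 0 → 0 < ξ.im) →
      ‖Kplus k h η ξ‖ ≤ M ∧ (InTail T ξ → ‖Kminus k h η ξ‖ ≤ M) := by
  obtain ⟨T₀, hT₀, G, hG⟩ := exists_tail_bound_log_kernel hk hh
  obtain ⟨M, T, hM⟩ := exists_bound_plusPart hη.good hη.tendsto_atTop hη.tendsto_atBot hL
    (T₀ := T₀) (Hd := Hd + 2) (G := G) (by linarith) (fun s hs => hη.pos_of_neg s (by linarith))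
    (fun s hs => hη.neg_of_pos s (by linarith))
    (fun ξ hξ => analyticAt_log_kernel hk (offCuts_of_mul_neg k (hξ.re_mul_im_neg hT₀))
      (kernel_re_pos hk hh (hξ.re_mul_im_neg hT₀))) (fun ξ hξ _ => hG ξ hξ)
  refine ⟨Real.exp (|G| + M), max T₀ T, lt_of_lt_of_le hT₀ (le_max_left _ _),
    fun ξ h1 h2 h3 => ?_⟩
  have hP := hM ξ ((le_max_right _ _).trans h1) (by simpa using h2) h3
  have hT₀ξ : 0 < |ξ.re| := hT₀.trans_le ((le_max_left _ _).trans h1)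
  have hab : IsAbove η ξ ∨ kernel k h ξ ≠ 0 := by
    by_cases hm : ξ.re * ξ.im < 0
    · right
      intro h0
      have := kernel_re_pos hk hh hm
      rw [h0] at this; simp at this
    · left
      rcases lt_or_gt_of_ne (abs_pos.1 hT₀ξ) with h | h
      · exact absurd (mul_neg_of_neg_of_pos h (h3 h)) hm
      · have h4 : 0 ≤ ξ.im := by
          by_contra hc
          exact hm (mul_neg_of_pos_of_neg h (not_le.1 hc))
        exact (hη.neg_of_pos _ h).trans_le h4
  have hKp := Kplus_eq_exp hab
  constructor
  · rw [hKp]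
    refine (Complex.norm_exp_le_exp_norm _).trans (Real.exp_le_exp.2 ?_)
    linarith [abs_nonneg G]
  · intro htail
    have htail' := htail.mono (le_max_left T₀ T)
    have hm := htail'.re_mul_im_neg hT₀
    have hne : kernel k h ξ ≠ 0 := fun h0 => by
      have := kernel_re_pos hk hh hm
      rw [h0] at this; simp at this
    rw [Kminus_eq_div hab, hKp]
    nth_rw 1 [← Complex.exp_log hne]
    rw [← Complex.exp_sub]
    refine (Complex.norm_exp_le_exp_norm _).trans (Real.exp_le_exp.2 ?_)
    refine (norm_sub_le _ _).trans (add_le_add ?_ hP)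
    refine (hG ξ htail').trans ?_
    have h5 : (1 + |ξ.re|) ^ (-(1 / 2) : ℝ) ≤ 1 :=
      Real.rpow_le_one_of_one_le_of_nonpos (by linarith [abs_nonneg ξ.re]) (by norm_num)
    calc _ ≤ |G| * 1 := mul_le_mul (le_abs_self G) h5 (by positivity) (abs_nonneg G)
      _ = |G| := mul_one _

/-! ### An explicit splitting of a double zero at the origin -/

/-- A function analytic in the upper half plane with a logarithmic singularity at the origin. -/
def upLog (t : ℂ) : ℂ := Complex.log (-(Complex.I * t)) - Complex.log (1 - Complex.I * t)

/-- Adding 1 does not change the sign of the imaginary part, so the two arguments have the same sign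
and their difference stays in the principal range. For large t the combined quotient is close to 1,
which makes `upLog` small. -/
theorem log_sub_log_one_add {a : ℂ} (ha : a ∈ Complex.slitPlane) :
    Complex.log a - Complex.log (1 + a) = Complex.log (a / (1 + a)) := by
  have ha0 := Complex.slitPlane_ne_zero ha
  have hb0 : 1 + a ≠ 0 := by
    intro h
    have : a = -1 := by linear_combination h
    rw [this, Complex.mem_slitPlane_iff] at ha
    norm_num at ha
  have him : (1 + a).im = a.im := by simp
  have key : -Real.pi < a.arg - (1 + a).arg ∧ a.arg - (1 + a).arg ≤ Real.pi := by
    have e1 := Complex.neg_pi_lt_arg a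
    have e2 := Complex.arg_le_pi a
    have e3 := Complex.neg_pi_lt_arg (1 + a)
    have e4 := Complex.arg_le_pi (1 + a)
    rcases lt_trichotomy a.im 0 with h | h | h
    · have f1 := Complex.arg_neg_iff.2 h
      have f2 := Complex.arg_neg_iff.2 (him.trans_lt h)
      constructor <;> linarith
    · have hre : 0 < a.re := (Complex.mem_slitPlane_iff.1 ha).resolve_right (by simp [h])
      have f1 : a.arg = 0 := Complex.arg_eq_zero_iff.2 ⟨hre.le, h⟩
      have f2 : (1 + a).arg = 0 := Complex.arg_eq_zero_iff.2 ⟨by simp; linarith, him.trans h⟩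
      rw [f1, f2]
      constructor <;> linarith [Real.pi_pos]
    · have f1 := Complex.arg_nonneg_iff.2 h.le
      have f2 := Complex.arg_nonneg_iff.2 (h.le.trans_eq him.symm)
      have f3 : (1 + a).arg ≠ Real.pi := fun hc => by
        have := (Complex.arg_eq_pi_iff.1 hc).2
        linarith
      have f4 : (1 + a).arg < Real.pi := lt_of_le_of_ne e4 f3
      constructor <;> linarith
  rw [← Complex.log_exp (x := Complex.log a - Complex.log (1 + a)), Complex.exp_sub,
    Complex.exp_log ha0, Complex.exp_log hb0]
  · simpa [Complex.log_im] using key.1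
  · simpa [Complex.log_im] using key.2

theorem neg_I_mul_mem_slitPlane {t : ℂ} (ht : t.re ≠ 0 ∨ 0 < t.im) :
    -(Complex.I * t) ∈ Complex.slitPlane := by
  rw [Complex.mem_slitPlane_iff]
  simpa [or_comm] using ht

theorem one_sub_I_mul_mem_slitPlane {t : ℂ} (ht : t.re ≠ 0 ∨ -1 < t.im) :
    1 - Complex.I * t ∈ Complex.slitPlane := by
  rw [Complex.mem_slitPlane_iff]
  rcases ht with h | h
  · right; simpa using h
  · left; simp; linarith

theorem analyticAt_upLog {t : ℂ} (ht : t.re ≠ 0 ∨ 0 < t.im) : AnalyticAt ℂ upLog t := by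
  have h1 := neg_I_mul_mem_slitPlane ht
  have h2 := one_sub_I_mul_mem_slitPlane (ht.imp_right fun h => by linarith : t.re ≠ 0 ∨ -1 < t.im)
  exact (AnalyticAt.clog (f := fun t => -(Complex.I * t)) (by fun_prop) h1).sub
    (AnalyticAt.clog (f := fun t => 1 - Complex.I * t) (by fun_prop) h2)

theorem exp_upLog {t : ℂ} (ht : t ≠ 0) (h1 : 1 - Complex.I * t ≠ 0) :
    Complex.exp (upLog t) = -(Complex.I * t) / (1 - Complex.I * t) := by
  rw [upLog, Complex.exp_sub, Complex.exp_log (by simpa using ht), Complex.exp_log h1]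

theorem norm_upLog_le_of_large {t : ℂ} (ht : t.re ≠ 0 ∨ 0 < t.im) (h3 : 3 ≤ ‖t‖) :
    ‖upLog t‖ ≤ 4 / (1 + ‖t‖) := by
  have h1 := neg_I_mul_mem_slitPlane ht
  have hn : ‖t‖ - 1 ≤ ‖1 + -(Complex.I * t)‖ := by
    have := norm_sub_norm_le (-(Complex.I * t)) (-1)
    simp only [norm_neg, norm_mul, Complex.norm_I, one_mul, norm_one] at this
    rwa [show -(Complex.I * t) - -1 = 1 + -(Complex.I * t) by ring] at this
  have hne : 1 + -(Complex.I * t) ≠ 0 := by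
    rw [← norm_pos_iff]; linarith
  have h4 : -(Complex.I * t) / (1 + -(Complex.I * t)) = 1 + -(1 / (1 + -(Complex.I * t))) := by
    field_simp; ring
  have h5 : ‖-(1 / (1 + -(Complex.I * t)))‖ ≤ 1 / (‖t‖ - 1) := by
    rw [norm_neg, norm_div, norm_one]
    exact one_div_le_one_div_of_le (by linarith) hn
  have h6 : 1 / (‖t‖ - 1) ≤ 1 / 2 := one_div_le_one_div_of_le (by norm_num) (by linarith)
  rw [upLog, sub_eq_add_neg 1, log_sub_log_one_add h1, h4]
  refine (Complex.norm_log_one_add_half_le_self (h5.trans h6)).trans ?_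
  refine (mul_le_mul_of_nonneg_left h5 (by norm_num)).trans ?_
  rw [← mul_div_assoc, div_le_div_iff₀ (by linarith) (by linarith)]
  linarith

theorem norm_log_le (z : ℂ) : ‖Complex.log z‖ ≤ |Real.log ‖z‖| + Real.pi := by
  refine (Complex.norm_le_abs_re_add_abs_im _).trans ?_
  rw [Complex.log_re, Complex.log_im]
  gcongr
  exact Complex.abs_arg_le_pi z

theorem abs_log_le_of_le {s x R : ℝ} (hs : 0 < s) (h1 : s ≤ x) (h2 : x ≤ R) (hR : 1 ≤ R) :
    |Real.log x| ≤ |Real.log s| + Real.log R := by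
  have hx : 0 < x := hs.trans_le h1
  have hR0 : 0 ≤ Real.log R := Real.log_nonneg hR
  rw [abs_le]
  constructor
  · have := Real.log_le_log hs h1
    linarith [neg_abs_le (Real.log s)]
  · have := Real.log_le_log hx h2
    linarith [abs_nonneg (Real.log s)]

/-- An integrable majorant for `upLog` along a path. -/
def upLogMajorant (C s : ℝ) : ℝ :=
  (Set.Ioo (-3) 3).indicator (fun s => 2 * |Real.log s|) s + C * (1 + |s|) ^ (-(3 / 2) : ℝ)

theorem integrable_upLogMajorant (C : ℝ) : MeasureTheory.Integrable (upLogMajorant C) := by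
  refine MeasureTheory.Integrable.add ?_ ?_
  · rw [MeasureTheory.integrable_indicator_iff measurableSet_Ioo]
    have h1 : IntervalIntegrable Real.log MeasureTheory.volume (-3) 3 :=
      intervalIntegral.intervalIntegrable_log'
    exact ((h1.1.mono_set Set.Ioo_subset_Ioc_self).abs).const_mul 2
  · have := (integrable_rpow_three_halves 0).const_mul C
    simpa using this

/-- Near the origin |t| and |1 - it| are at least |Re t|, so the logarithms are controlled by log
|Re t| whatever Im t is. This uniformity permits dominated convergence while the singularity is
moved onto the path. -/
theorem exists_upLog_le_majorant (H : ℝ) : ∃ C : ℝ, ∀ t : ℂ, t.re ≠ 0 → |t.im| ≤ H →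
    ‖upLog t‖ / (1 + |t.re|) ≤ upLogMajorant C t.re := by
  set R : ℝ := 4 + |H|
  have hR : 1 ≤ R := by simp only [R]; linarith [abs_nonneg H]
  set A : ℝ := 2 * Real.log R + 2 * Real.pi
  have hA : 0 ≤ A := by
    have := Real.log_nonneg hR
    have := Real.pi_pos
    positivity
  refine ⟨max 4 (A * 4 ^ (3 / 2 : ℝ)), fun t ht hH => ?_⟩
  have hre : 0 < |t.re| := abs_pos.2 ht
  have hret := Complex.abs_re_le_norm t
  by_cases h3 : t.re ∈ Set.Ioo (-3 : ℝ) 3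
  · rw [upLogMajorant, Set.indicator_of_mem h3]
    have h3' := abs_lt.2 h3
    have hn1 : ‖t‖ ≤ R := by
      have := Complex.norm_le_abs_re_add_abs_im t
      simp only [R]; linarith [le_abs_self H]
    have hn2 : ‖1 - Complex.I * t‖ ≤ R := by
      refine (Complex.norm_le_abs_re_add_abs_im _).trans ?_
      simp only [Complex.sub_re, Complex.sub_im, Complex.one_re, Complex.one_im, Complex.I_mul_re,
        Complex.I_mul_im, sub_neg_eq_add, zero_sub, abs_neg]
      have : |1 + t.im| ≤ 1 + |t.im| := (abs_add_le _ _).trans (by simp)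
      simp only [R]; linarith [le_abs_self H]
    have hn3 : |t.re| ≤ ‖1 - Complex.I * t‖ := by
      have := Complex.abs_im_le_norm (1 - Complex.I * t)
      simpa using this
    have e1 := abs_log_le_of_le hre hret hn1 hR
    have e2 := abs_log_le_of_le hre hn3 hn2 hR
    rw [Real.log_abs] at e1 e2
    have e3 : ‖upLog t‖ ≤ 2 * |Real.log t.re| + A := by
      refine (norm_sub_le _ _).trans ?_
      have f1 := norm_log_le (-(Complex.I * t))
      have f2 := norm_log_le (1 - Complex.I * t)
      rw [norm_neg, norm_mul, Complex.norm_I, one_mul] at f1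
      simp only [A]; linarith
    have e4 : A ≤ max 4 (A * 4 ^ (3 / 2 : ℝ)) * (1 + |t.re|) ^ (-(3 / 2) : ℝ) := by
      have g1 : (4 : ℝ) ^ (-(3 / 2) : ℝ) ≤ (1 + |t.re|) ^ (-(3 / 2) : ℝ) :=
        Real.rpow_le_rpow_of_nonpos (by positivity) (by linarith) (by norm_num)
      have g2 : (4 : ℝ) ^ (3 / 2 : ℝ) * 4 ^ (-(3 / 2) : ℝ) = 1 := by
        rw [← Real.rpow_add (by norm_num)]; norm_num
      calc A = A * 4 ^ (3 / 2 : ℝ) * 4 ^ (-(3 / 2) : ℝ) := by rw [mul_assoc, g2, mul_one]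
        _ ≤ _ := mul_le_mul (le_max_right _ _) g1 (by positivity) (by positivity)
    calc ‖upLog t‖ / (1 + |t.re|) ≤ ‖upLog t‖ := div_le_self (norm_nonneg _) (by linarith)
      _ ≤ _ := by linarith
  · rw [upLogMajorant, Set.indicator_of_notMem h3, zero_add]
    have h3' : 3 ≤ |t.re| := by
      by_contra hc
      exact h3 (abs_lt.1 (not_le.1 hc))
    have h4 := norm_upLog_le_of_large (Or.inl ht) (h3'.trans hret)
    have h5 : 4 / (1 + ‖t‖) ≤ 4 / (1 + |t.re|) := by gcongr
    rw [div_le_iff₀ (by positivity)]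
    refine h4.trans (h5.trans ?_)
    rw [div_le_iff₀ (by positivity), mul_assoc, mul_assoc]
    have g : 1 ≤ (1 + |t.re|) ^ (-(3 / 2) : ℝ) * ((1 + |t.re|) * (1 + |t.re|)) := by
      have : (1 + |t.re|) * (1 + |t.re|) = (1 + |t.re|) ^ (2 : ℝ) := by
        rw [Real.rpow_two, pow_two]
      rw [this, ← Real.rpow_add (by positivity)]
      exact Real.one_le_rpow (by linarith) (by norm_num)
    nlinarith [le_max_left 4 (A * 4 ^ (3 / 2 : ℝ))]

theorem measurable_upLog : Measurable upLog := by
  unfold upLog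
  exact (Complex.measurable_log.comp (by fun_prop)).sub (Complex.measurable_log.comp (by fun_prop))

theorem cauchyIntegrable_upLog {η : ℝ → ℝ} (hη : IsGoodPath η) {d : ℝ} :
    CauchyIntegrable η fun t => upLog (t + Complex.I * d) := by
  obtain ⟨H, hH⟩ := hη.bounded
  obtain ⟨B, hB⟩ := hη.bounded_deriv
  obtain ⟨C, hC⟩ := exists_upLog_le_majorant (H + |d|)
  refine ((integrable_upLogMajorant C).mul_const (1 + B)).mono' ?_ ?_
  · refine Measurable.aestronglyMeasurable (Measurable.div (Measurable.mul ?_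
      (continuous_pathVel hη.smooth).measurable) (by fun_prop))
    exact measurable_upLog.comp (by
      have := continuous_pathPoint hη.smooth.continuous
      fun_prop)
  · filter_upwards [MeasureTheory.compl_mem_ae_iff.2 (MeasureTheory.measure_singleton (0 : ℝ))]
      with s hs
    have h1 := hC (pathPoint η s + Complex.I * d) (by simpa using hs)
      (by simpa using (abs_add_le _ _).trans (add_le_add (hH s) le_rfl))
    simp only [Complex.add_re, pathPoint_re, Complex.I_mul_re, Complex.ofReal_im, neg_zero,
      add_zero] at h1
    have h2 : ‖pathVel η s‖ ≤ 1 + B := (norm_pathVel_le η s).trans (by linarith [hB s])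
    rw [norm_div, norm_mul, Complex.norm_real, Real.norm_of_nonneg (by positivity), mul_div_right_comm]
    exact mul_le_mul h1 h2 (norm_nonneg _) ((by positivity : (0:ℝ) ≤ _).trans h1)

theorem tendsto_cauchyIntegral_upLog {η : ℝ → ℝ} (hη : IsGoodPath η) {ξ : ℂ} (hξ : ¬ IsOn η ξ) :
    Tendsto (fun d : ℝ => cauchyIntegral η (fun t => upLog (t + Complex.I * d)) ξ) (𝓝[>] 0)
      (𝓝 (cauchyIntegral η upLog ξ)) := by
  obtain ⟨H, hH⟩ := hη.bounded
  obtain ⟨B, hB⟩ := hη.bounded_deriv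
  obtain ⟨C, hC⟩ := exists_upLog_le_majorant (H + 1)
  obtain ⟨c, hc, hle⟩ := exists_le_norm_sub hη.smooth.continuous hξ
  unfold cauchyIntegral
  refine Tendsto.const_mul _ ?_
  refine MeasureTheory.tendsto_integral_filter_of_dominated_convergence
    (fun s => upLogMajorant C s * ((1 + B) / c)) ?_ ?_ ((integrable_upLogMajorant C).mul_const _) ?_
  · refine Eventually.of_forall fun d => Measurable.aestronglyMeasurable
      (Measurable.mul (Measurable.div (measurable_upLog.comp ?_) ?_)
      (continuous_pathVel hη.smooth).measurable)
    · have := continuous_pathPoint hη.smooth.continuous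
      fun_prop
    · have := continuous_pathPoint hη.smooth.continuous
      fun_prop
  · filter_upwards [self_mem_nhdsWithin, mem_nhdsWithin_of_mem_nhds (gt_mem_nhds one_pos)]
      with d (hd0 : 0 < d) hd1
    filter_upwards [MeasureTheory.compl_mem_ae_iff.2 (MeasureTheory.measure_singleton (0 : ℝ))]
      with s hs
    have h1 := hC (pathPoint η s + Complex.I * d) (by simpa using hs)
      (by simpa using (abs_add_le _ _).trans (add_le_add (hH s) (by
        rw [abs_of_pos hd0]; exact hd1.le)))
    simp only [Complex.add_re, pathPoint_re, Complex.I_mul_re, Complex.ofReal_im, neg_zero,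
      add_zero] at h1
    have h2 : ‖pathVel η s‖ ≤ 1 + B := (norm_pathVel_le η s).trans (by linarith [hB s])
    have h3 := hle ξ (Metric.mem_ball_self hc) s
    have h4 : 0 < 1 + |s| := by positivity
    rw [norm_mul, norm_div]
    calc _ ≤ ‖upLog (pathPoint η s + Complex.I * d)‖ / (c * (1 + |s|)) * (1 + B) := by gcongr
      _ = ‖upLog (pathPoint η s + Complex.I * d)‖ / (1 + |s|) * ((1 + B) / c) := by field_simp
      _ ≤ _ := by
        gcongr
        exact div_nonneg ((norm_nonneg _).trans h2) hc.le
  · filter_upwards [MeasureTheory.compl_mem_ae_iff.2 (MeasureTheory.measure_singleton (0 : ℝ))]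
      with s hs
    refine Tendsto.mul_const _ (Tendsto.div_const ?_ _)
    have h1 : ContinuousAt upLog (pathPoint η s) :=
      (analyticAt_upLog (Or.inl (by simpa using hs))).continuousAt
    have h2 : Tendsto (fun d : ℝ => pathPoint η s + Complex.I * d) (𝓝[>] 0) (𝓝 (pathPoint η s)) := by
      have : Continuous fun d : ℝ => pathPoint η s + Complex.I * d := by fun_prop
      simpa using (this.tendsto 0).mono_left nhdsWithin_le_nhds
    exact h1.tendsto.comp h2

theorem tendsto_cauchyIntegral_upLog_raised {η : ℝ → ℝ} (hη : IsGoodPath η) (d : ℝ) (ξ : ℂ) :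
    Tendsto (fun N : ℝ => cauchyIntegral (fun s => η s + N)
      (fun t => upLog (t + Complex.I * d)) ξ) atTop (𝓝 0) := by
  obtain ⟨H, hH⟩ := hη.bounded
  obtain ⟨B, hB⟩ := hη.bounded_deriv
  have hvel : ∀ N s, pathVel (fun s => η s + N) s = pathVel η s := by
    intro N s; rw [pathVel, pathVel, deriv_add_const]
  have hcp : ∀ N : ℝ, Continuous (pathPoint fun s => η s + N) := fun N =>
    continuous_pathPoint (by have := hη.smooth.continuous; fun_prop)
  have him : ∀ (N : ℝ) (s : ℝ), N - H ≤ (pathPoint (fun s => η s + N) s).im := by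
    intro N s
    have := (abs_le.1 (hH s)).1
    simp; linarith
  have key : Tendsto (fun N : ℝ => ∫ s : ℝ, upLog (pathPoint (fun s => η s + N) s + Complex.I * d) /
      (pathPoint (fun s => η s + N) s - ξ) * pathVel (fun s => η s + N) s) atTop
      (𝓝 (∫ _ : ℝ, (0 : ℂ))) := by
    refine MeasureTheory.tendsto_integral_filter_of_dominated_convergence
      (fun s => 8 * (1 + B) * ((1 + |s - 0|) ^ (-(3 / 2) : ℝ) + (1 + |s - ξ.re|) ^ (-(3 / 2) : ℝ)))
      ?_ ?_ (((integrable_rpow_three_halves 0).add (integrable_rpow_three_halves ξ.re)).const_mul _)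
      ?_
    · refine Eventually.of_forall fun N => Measurable.aestronglyMeasurable
        (Measurable.mul (Measurable.div (measurable_upLog.comp ?_) ?_) ?_)
      · have := hcp N
        fun_prop
      · have := hcp N
        fun_prop
      · rw [show pathVel (fun s => η s + N) = pathVel η from funext (hvel N)]
        exact (continuous_pathVel hη.smooth).measurable
    · filter_upwards [eventually_ge_atTop (H + |d| + |ξ.im| + 3)] with N hN
      refine Eventually.of_forall fun s => ?_
      set t := pathPoint (fun s => η s + N) s with ht
      have hre : t.re = s := by simp [ht]
      have h1 := him N s
      have h2 : 3 ≤ (t + Complex.I * d).im := by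
        have := neg_abs_le d
        simp only [Complex.add_im, Complex.I_mul_im, Complex.ofReal_re]
        linarith [abs_nonneg ξ.im]
      have h3 : 3 ≤ ‖t + Complex.I * d‖ := h2.trans ((le_abs_self _).trans (Complex.abs_im_le_norm _))
      have h4 := norm_upLog_le_of_large (Or.inr (by linarith)) h3
      have h5 : |s| ≤ ‖t + Complex.I * d‖ := by
        have := Complex.abs_re_le_norm (t + Complex.I * d)
        simpa [hre] using this
      have h6 : |s - ξ.re| ≤ ‖t - ξ‖ := by
        have := Complex.abs_re_le_norm (t - ξ)
        simpa [hre] using this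
      have h7 : 1 ≤ ‖t - ξ‖ := by
        refine le_trans ?_ (Complex.abs_im_le_norm (t - ξ))
        refine le_trans ?_ (le_abs_self _)
        rw [Complex.sub_im]
        linarith [le_abs_self ξ.im, abs_nonneg d]
      have h8 : (1 + |s - ξ.re|) / 2 ≤ ‖t - ξ‖ := by linarith
      have h9 : ‖pathVel (fun s => η s + N) s‖ ≤ 1 + B := by
        rw [hvel]; exact (norm_pathVel_le η s).trans (by linarith [hB s])
      have hB0 : 0 ≤ 1 + B := (norm_nonneg _).trans h9
      have h10 := rpow_mul_inv_le (x := 1 + |s - 0|) (y := 1 + |s - ξ.re|) (by positivity)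
        (by positivity)
      have h11 := rpow_neg_half_ge (x := 1 + |s - 0|) (by linarith [abs_nonneg (s - 0)])
      rw [norm_mul, norm_div]
      calc _ ≤ 4 / (1 + |s - 0|) / ((1 + |s - ξ.re|) / 2) * (1 + B) := by
            have h12 : ‖upLog (t + Complex.I * d)‖ ≤ 4 / (1 + |s - 0|) := by
              rw [sub_zero]
              exact h4.trans (by gcongr)
            gcongr
        _ = 8 * (1 + B) * ((1 + |s - 0|)⁻¹ * (1 + |s - ξ.re|)⁻¹) := by field_simp; ring
        _ ≤ 8 * (1 + B) * ((1 + |s - 0|) ^ (-(1 / 2) : ℝ) * (1 + |s - ξ.re|)⁻¹) := by gcongr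
        _ ≤ _ := by gcongr
    · refine Eventually.of_forall fun s => ?_
      rw [tendsto_zero_iff_norm_tendsto_zero]
      have hT : Tendsto (fun N : ℝ => 4 * (1 + B) * (N - (H + |d| + |ξ.im|))⁻¹) atTop (𝓝 0) := by
        have := (tendsto_inv_atTop_zero.comp
          (tendsto_atTop_add_const_right atTop (-(H + |d| + |ξ.im|)) tendsto_id)).const_mul
          (4 * (1 + B))
        rw [mul_zero] at this
        exact this
      refine squeeze_zero' (Eventually.of_forall fun _ => norm_nonneg _) ?_ hT
      filter_upwards [eventually_ge_atTop (H + |d| + |ξ.im| + 3)] with N hN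
      set t := pathPoint (fun s => η s + N) s with ht
      have h1 := him N s
      have h2 : 3 ≤ (t + Complex.I * d).im := by
        have := neg_abs_le d
        simp only [Complex.add_im, Complex.I_mul_im, Complex.ofReal_re]
        linarith [abs_nonneg ξ.im]
      have h3 : 3 ≤ ‖t + Complex.I * d‖ := h2.trans ((le_abs_self _).trans (Complex.abs_im_le_norm _))
      have h4 := norm_upLog_le_of_large (Or.inr (by linarith)) h3
      have h4' : ‖upLog (t + Complex.I * d)‖ ≤ 4 := h4.trans (div_le_self (by norm_num) (by linarith))
      have h7 : N - (H + |d| + |ξ.im|) ≤ ‖t - ξ‖ := by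
        refine le_trans ?_ (Complex.abs_im_le_norm (t - ξ))
        refine le_trans ?_ (le_abs_self _)
        rw [Complex.sub_im]
        linarith [le_abs_self ξ.im, abs_nonneg d]
      have h9 : ‖pathVel (fun s => η s + N) s‖ ≤ 1 + B := by
        rw [hvel]; exact (norm_pathVel_le η s).trans (by linarith [hB s])
      have hp : 0 < N - (H + |d| + |ξ.im|) := by linarith
      rw [norm_mul, norm_div]
      calc _ ≤ 4 / (N - (H + |d| + |ξ.im|)) * (1 + B) := by gcongr
        _ = _ := by field_simp
  rw [MeasureTheory.integral_zero] at key
  have := key.const_mul (1 / (2 * Real.pi * Complex.I) : ℂ)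
  rwa [mul_zero] at this

/-- The shift by d moves the singularity to -id, below the path, so the function is analytic on and
above the path. The path may then be raised by any N without changing the splitting. Once ξ lies
below it, the splitting is the function itself plus a Cauchy integral that tends to 0 as N → ∞. -/
theorem plusPart_upLog_raised {η : ℝ → ℝ} (hη : IsGoodPath η) (h0 : 0 ≤ η 0) {d : ℝ} (hd : 0 < d)
    (ξ : ℂ) : plusPart η (fun t => upLog (t + Complex.I * d)) ξ = upLog (ξ + Complex.I * d) := by
  have hgood : ∀ N, IsGoodPath fun s => η s + N := by
    intro N
    obtain ⟨H, hH⟩ := hη.bounded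
    obtain ⟨B, hB⟩ := hη.bounded_deriv
    refine ⟨hη.smooth.add contDiff_const, ⟨H + |N|, fun s =>
      (abs_add_le _ _).trans (by linarith [hH s])⟩, ⟨B, fun s => ?_⟩⟩
    rw [deriv_add_const]; exact hB s
  have key : ∀ᶠ N : ℝ in atTop, plusPart η (fun t => upLog (t + Complex.I * d)) ξ =
      upLog (ξ + Complex.I * d) +
        cauchyIntegral (fun s => η s + N) (fun t => upLog (t + Complex.I * d)) ξ := by
    filter_upwards [eventually_gt_atTop (max 0 (ξ.im - η ξ.re))] with N hN
    have hN0 : 0 < N := (le_max_left _ _).trans_lt hN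
    have hb : ξ.im < η ξ.re + N := by linarith [(le_max_right 0 (ξ.im - η ξ.re)).trans_lt hN]
    rw [← plusPart_of_below (η := fun s => η s + N) (g := fun t => upLog (t + Complex.I * d)) hb]
    refine plusPart_eq_plusPart hη (hgood N) (cauchyIntegrable_upLog hη)
      (cauchyIntegrable_upLog (hgood N)) (fun s => Or.inr fun v hv => ?_)
      ⟨4, 3, fun s hs => Or.inr fun v hv => ?_⟩ (not_isOn_of_below hb)
    · rw [Set.uIcc_of_le (by linarith)] at hv
      refine AnalyticAt.fun_comp (analyticAt_upLog ?_) (by fun_prop)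
      by_cases hs : s = 0
      · right
        subst hs
        simp; linarith [hv.1]
      · left; simpa using hs
    · have hre : ((s : ℂ) + Complex.I * v + Complex.I * d).re = s := by simp
      have h1 := Complex.abs_re_le_norm ((s : ℂ) + Complex.I * v + Complex.I * d)
      rw [hre] at h1
      refine (norm_upLog_le_of_large (Or.inl ?_) (hs.trans h1)).trans
        (div_le_self (by norm_num) (by linarith [norm_nonneg ((s : ℂ) + Complex.I * v + Complex.I * d)]))
      rw [hre]
      rintro rfl
      norm_num at hs
  have h1 : Tendsto (fun N : ℝ => upLog (ξ + Complex.I * d) +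
      cauchyIntegral (fun s => η s + N) (fun t => upLog (t + Complex.I * d)) ξ) atTop
      (𝓝 (upLog (ξ + Complex.I * d) + 0)) :=
    tendsto_const_nhds.add (tendsto_cauchyIntegral_upLog_raised hη d ξ)
  rw [add_zero] at h1
  exact tendsto_nhds_unique (tendsto_const_nhds.congr' key) h1

/-- Let d → 0 in `plusPart_upLog_raised`: the singularity returns to the origin, and the logarithmic
majorant justifies the limit even if the path passes through it. -/
theorem cauchyIntegral_upLog_of_isAbove {η : ℝ → ℝ} (hη : IsGoodPath η) (h0 : 0 ≤ η 0) {ξ : ℂ}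
    (hξ : IsAbove η ξ) (h : ξ.re ≠ 0 ∨ 0 < ξ.im) : cauchyIntegral η upLog ξ = upLog ξ := by
  refine tendsto_nhds_unique (tendsto_cauchyIntegral_upLog hη hξ.not_isOn) ?_
  have h1 : Tendsto (fun d : ℝ => ξ + Complex.I * d) (𝓝[>] 0) (𝓝 ξ) := by
    have : Continuous fun d : ℝ => ξ + Complex.I * d := by fun_prop
    simpa using (this.tendsto 0).mono_left nhdsWithin_le_nhds
  refine ((analyticAt_upLog h).continuousAt.tendsto.comp h1).congr' ?_
  filter_upwards [self_mem_nhdsWithin] with d hd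
  rw [← plusPart_of_isAbove hξ, plusPart_upLog_raised hη h0 hd]
  rfl

theorem cauchyIntegral_upLog_of_below {η : ℝ → ℝ} (hη : IsGoodPath η) (h0 : 0 ≤ η 0) {ξ : ℂ}
    (hξ : ξ.im < η ξ.re) : cauchyIntegral η upLog ξ = 0 := by
  refine tendsto_nhds_unique (tendsto_cauchyIntegral_upLog hη (not_isOn_of_below hξ)) ?_
  refine tendsto_const_nhds.congr' ?_
  filter_upwards [self_mem_nhdsWithin] with d hd
  have := plusPart_upLog_raised hη h0 hd ξ
  rw [plusPart_of_below hξ] at this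
  linear_combination -this

/-! ### Reflection of paths in the origin -/

/-- The height function of the path rotated by half a turn about the origin. -/
def rotatePath (η : ℝ → ℝ) : ℝ → ℝ := fun s => -η (-s)

theorem pathVel_rotatePath (η : ℝ → ℝ) (s : ℝ) : pathVel (rotatePath η) s = pathVel η (-s) := by
  rw [pathVel, pathVel]
  congr 3
  unfold rotatePath
  rw [deriv.fun_neg, deriv_comp_neg, neg_neg]

theorem pathPoint_rotatePath (η : ℝ → ℝ) (s : ℝ) :
    pathPoint (rotatePath η) s = -pathPoint η (-s) := by
  simp [pathPoint, rotatePath]; ring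

theorem IsGoodPath.rotatePath {η : ℝ → ℝ} (hη : IsGoodPath η) : IsGoodPath (rotatePath η) := by
  obtain ⟨H, hH⟩ := hη.bounded
  obtain ⟨B, hB⟩ := hη.bounded_deriv
  refine ⟨(hη.smooth.comp contDiff_neg).neg, ⟨H, fun s => ?_⟩, ⟨B, fun s => ?_⟩⟩
  · rw [CrackedHalfPlane.rotatePath, abs_neg]; exact hH _
  · unfold CrackedHalfPlane.rotatePath
    rw [deriv.fun_neg, deriv_comp_neg, neg_neg]; exact hB _

theorem cauchyIntegral_comp_neg (η : ℝ → ℝ) (g : ℂ → ℂ) (ξ : ℂ) :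
    cauchyIntegral η (fun t => g (-t)) ξ = -cauchyIntegral (rotatePath η) g (-ξ) := by
  unfold cauchyIntegral
  rw [← mul_neg, ← MeasureTheory.integral_neg, ← MeasureTheory.integral_neg_eq_self]
  congr 2
  ext s
  rw [pathVel_rotatePath, pathPoint_rotatePath, neg_sub_neg, ← neg_sub ξ, div_neg, neg_mul]

theorem CauchyIntegrable.comp_neg {η : ℝ → ℝ} {g : ℂ → ℂ}
    (hg : CauchyIntegrable (rotatePath η) g) : CauchyIntegrable η fun t => g (-t) := by
  have := MeasureTheory.Integrable.comp_neg hg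
  refine this.congr (Eventually.of_forall fun s => ?_)
  simp only [pathVel_rotatePath, pathPoint_rotatePath, neg_neg, abs_neg]

/-! ### The kernel and its positive factor near a double zero at the origin -/

theorem kernel_eq_sincSqrt (k h : ℝ) (ξ : ℂ) :
    kernel k h ξ = -(2 * Complex.I * Complex.exp (Complex.I * mu k ξ * h) * mu k ξ *
      sincSqrt h ((k : ℂ) ^ 2 - ξ ^ 2)) := by
  by_cases h0 : mu k ξ = 0
  · simp [kernel, h0]
  rw [← mu_sq, sincSqrt_sq h0, mul_assoc _ (mu k ξ), mul_div_cancel₀ _ h0, kernel_eq, Complex.sin]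
  have h1 : Complex.exp (Complex.I * mu k ξ * h) * Complex.exp (-(h * mu k ξ) * Complex.I) = 1 := by
    rw [← Complex.exp_add, ← Complex.exp_zero]; congr 1; ring
  rw [show (h : ℂ) * mu k ξ * Complex.I = Complex.I * mu k ξ * h by ring]
  linear_combination
    (Complex.exp (Complex.I * mu k ξ * h) * Complex.exp (-(h * mu k ξ) * Complex.I) -
      Complex.exp (Complex.I * mu k ξ * h) ^ 2) * Complex.I_sq - h1

/-- At a critical frequency the kernel is this function times `ξ²`. -/
def kernelQuot (k h : ℝ) (ξ : ℂ) : ℂ :=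
  2 * Complex.I * Complex.exp (Complex.I * mu k ξ * h) * mu k ξ *
    dslope (sincSqrt h) ((k : ℂ) ^ 2) ((k : ℂ) ^ 2 - ξ ^ 2)

theorem sin_eq_zero_of_critical {k h : ℝ} (hcrit : Complex.exp (2 * Complex.I * k * h) = 1) :
    Real.sin (h * k) = 0 := by
  obtain ⟨n, hn⟩ := Complex.exp_eq_one_iff.1 hcrit
  rw [Real.sin_eq_zero_iff]
  refine ⟨n, ?_⟩
  have h2 : (2 * Complex.I) * ((n * Real.pi : ℝ) : ℂ) = (2 * Complex.I) * ((h * k : ℝ) : ℂ) := by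
    push_cast
    linear_combination -hn
  exact_mod_cast mul_left_cancel₀ (by simp) h2

theorem sincSqrt_sq_eq_zero {a w : ℝ} (hw : 0 < w) (hs : Real.sin (a * w) = 0) :
    sincSqrt a ((w : ℂ) ^ 2) = 0 := by
  rw [sincSqrt_sq (by exact_mod_cast hw.ne')]
  have : Complex.sin (a * w) = 0 := by exact_mod_cast congrArg (fun x : ℝ => (x : ℂ)) hs
  rw [this, zero_div]

theorem kernel_eq_sq_mul {k h : ℝ} (hk : 0 < k)
    (hcrit : Complex.exp (2 * Complex.I * k * h) = 1) (ξ : ℂ) :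
    kernel k h ξ = ξ ^ 2 * kernelQuot k h ξ := by
  rw [kernel_eq_sincSqrt, kernelQuot]
  have h1 := sub_smul_dslope (sincSqrt h) ((k : ℂ) ^ 2) ((k : ℂ) ^ 2 - ξ ^ 2)
  rw [sincSqrt_sq_eq_zero hk (sin_eq_zero_of_critical hcrit), sub_zero, smul_eq_mul] at h1
  rw [← h1]
  ring

theorem analyticAt_kernelQuot {k h : ℝ} (hk : 0 < k) {ξ : ℂ} (hξ : OffCuts k ξ) :
    AnalyticAt ℂ (kernelQuot k h) ξ := by
  have h1 := analyticAt_mu hk hξ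
  have h2 : AnalyticAt ℂ (fun ξ : ℂ => dslope (sincSqrt h) ((k : ℂ) ^ 2) ((k : ℂ) ^ 2 - ξ ^ 2)) ξ :=
    AnalyticAt.fun_comp (analyticAt_dslope (analyticAt_sincSqrt h _)) (by fun_prop)
  unfold kernelQuot
  fun_prop

/-- Since sin(hk) = 0, both e^{ikh} and the cosine in the derivative are the same sign ±1, and they
multiply to 1. The value lies on the positive imaginary axis, which makes the arguments in
`log_kernel_eq_of_critical` add up. -/
theorem kernelQuot_zero {k h : ℝ} (hk : 0 < k)
    (hcrit : Complex.exp (2 * Complex.I * k * h) = 1) :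
    kernelQuot k h 0 = Complex.I * (h / k : ℝ) := by
  have hs := sin_eq_zero_of_critical hcrit
  have hd := hasDerivAt_sincSqrt hk hs
  have hs' : Complex.sin (h * k) = 0 := by exact_mod_cast congrArg (fun x : ℝ => (x : ℂ)) hs
  have hc : (Complex.cos (h * k)) ^ 2 = 1 := by
    have := Complex.sin_sq_add_cos_sq (h * k)
    rw [hs'] at this
    simpa using this
  have he : Complex.exp (Complex.I * k * h) = Complex.cos (h * k) := by
    rw [show Complex.I * (k : ℂ) * h = h * k * Complex.I by ring, Complex.exp_mul_I, hs']
    simp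
  rw [kernelQuot, mu_zero hk, zero_pow two_ne_zero, sub_zero, dslope_same, hd.deriv, he]
  have hk' : (k : ℂ) ≠ 0 := by exact_mod_cast hk.ne'
  push_cast
  field_simp
  linear_combination (h : ℂ) * hc

/-- Of ±t one, called z, lies in the fourth quadrant, and 2 arg z is in (-π, 0). The quotient has
argument in [0, π], so the sum stays in the principal range and the logarithm of the product splits.
The quarter turns in log(it) and log(-it) cancel. -/
theorem log_kernel_eq_of_critical {k h : ℝ} (hk : 0 < k)
    (hcrit : Complex.exp (2 * Complex.I * k * h) = 1) {t : ℂ} (ht : t.re * t.im < 0)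
    (hu : 0 < (kernelQuot k h t).im) :
    Complex.log (kernel k h t) = Complex.log (kernelQuot k h t) +
      (Complex.log (-(Complex.I * t)) + Complex.log (Complex.I * t)) := by
  obtain ⟨z, hz, hzre, hzim, hlog⟩ : ∃ z : ℂ, z ^ 2 = t ^ 2 ∧ 0 < z.re ∧ z.im < 0 ∧
      Complex.log (-(Complex.I * t)) + Complex.log (Complex.I * t) = 2 * Complex.log z := by
    rcases lt_or_gt_of_ne (fun h0 => by rw [h0, zero_mul] at ht; exact lt_irrefl _ ht : t.re ≠ 0)
      with h1 | h1
    · refine ⟨-t, by ring, by simpa using h1, by simp; nlinarith, ?_⟩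
      have e1 := log_I_mul_of_re_pos (z := -t) (by simpa using h1)
      have e2 := log_neg_I_mul_of_re_pos (z := -t) (by simpa using h1)
      rw [mul_neg] at e1
      rw [neg_mul_neg] at e2
      rw [e1, e2]; ring
    · refine ⟨t, rfl, h1, by nlinarith, ?_⟩
      have e1 := log_I_mul_of_re_pos h1
      have e2 := log_neg_I_mul_of_re_pos h1
      rw [neg_mul] at e2
      rw [e1, e2]; ring
  have hz0 : z ≠ 0 := by rintro rfl; simp at hzre
  have hu0 : kernelQuot k h t ≠ 0 := by intro h0; rw [h0] at hu; simp at hu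
  have a1 := (abs_lt.1 (Complex.abs_arg_lt_pi_div_two_iff.2 (Or.inl hzre))).1
  have a2 := Complex.arg_neg_iff.2 hzim
  have a3 := Complex.arg_nonneg_iff.2 hu.le
  have a4 := Complex.arg_le_pi (kernelQuot k h t)
  have him : (Complex.log (kernelQuot k h t) + 2 * Complex.log z).im =
      (kernelQuot k h t).arg + 2 * z.arg := by
    simp [Complex.log_im]
  rw [hlog, kernel_eq_sq_mul hk hcrit, ← hz,
    ← Complex.log_exp (x := Complex.log (kernelQuot k h t) + 2 * Complex.log z)]
  · rw [Complex.exp_add, two_mul, Complex.exp_add, Complex.exp_log hu0, Complex.exp_log hz0]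
    ring_nf
  · rw [him]; linarith
  · rw [him]; linarith

/-- The logarithm of the kernel with its singularity at the origin split off. -/
def regLog (k h : ℝ) (t : ℂ) : ℂ :=
  if t.re * t.im < 0 then Complex.log (kernel k h t) - upLog t - upLog (-t)
  else Complex.log (kernelQuot k h t) + Complex.log (1 - Complex.I * t) +
    Complex.log (1 + Complex.I * t)

theorem eventually_kernelQuot_im_pos {k h : ℝ} (hk : 0 < k) (hh : 0 < h)
    (hcrit : Complex.exp (2 * Complex.I * k * h) = 1) :
    ∀ᶠ t in 𝓝 (0 : ℂ), 0 < (kernelQuot k h t).im := by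
  have h1 := (analyticAt_kernelQuot (h := h) hk (offCuts_zero hk)).continuousAt
  have h2 : 0 < (kernelQuot k h 0).im := by
    rw [kernelQuot_zero hk hcrit]
    simp; positivity
  exact (Complex.continuous_im.continuousAt.comp h1).eventually (lt_mem_nhds h2)

/-- Near the origin both branches of the definition agree: subtracting `upLog t` and `upLog (-t)`
removes exactly the logarithm of t². -/
theorem regLog_eventuallyEq {k h : ℝ} (hk : 0 < k) (hh : 0 < h)
    (hcrit : Complex.exp (2 * Complex.I * k * h) = 1) :
    regLog k h =ᶠ[𝓝 0] fun t => Complex.log (kernelQuot k h t) + Complex.log (1 - Complex.I * t) +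
      Complex.log (1 + Complex.I * t) := by
  filter_upwards [eventually_kernelQuot_im_pos hk hh hcrit] with t hu
  rw [regLog]
  split_ifs with ht
  · rw [log_kernel_eq_of_critical hk hcrit ht hu, upLog, upLog]
    simp only [mul_neg, neg_neg, sub_neg_eq_add]
    ring
  · rfl

theorem analyticAt_regLog_zero {k h : ℝ} (hk : 0 < k) (hh : 0 < h)
    (hcrit : Complex.exp (2 * Complex.I * k * h) = 1) : AnalyticAt ℂ (regLog k h) 0 := by
  refine AnalyticAt.congr ?_ (regLog_eventuallyEq hk hh hcrit).symm
  have h1 : kernelQuot k h 0 ∈ Complex.slitPlane :=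
    Or.inr (eventually_kernelQuot_im_pos hk hh hcrit).self_of_nhds.ne'
  have h2 : AnalyticAt ℂ (fun t : ℂ => Complex.log (1 - Complex.I * t)) 0 :=
    AnalyticAt.clog (by fun_prop) (by simp)
  have h3 : AnalyticAt ℂ (fun t : ℂ => Complex.log (1 + Complex.I * t)) 0 :=
    AnalyticAt.clog (by fun_prop) (by simp)
  exact (((analyticAt_kernelQuot hk (offCuts_zero hk)).clog h1).add h2).add h3

theorem regLog_of_mul_neg {k h : ℝ} {t : ℂ} (ht : t.re * t.im < 0) :
    regLog k h t = Complex.log (kernel k h t) - upLog t - upLog (-t) := if_pos ht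

theorem eventually_mul_neg {t : ℂ} (ht : t.re * t.im < 0) : ∀ᶠ z : ℂ in 𝓝 t, z.re * z.im < 0 :=
  (isOpen_lt (by fun_prop) continuous_const).mem_nhds ht

theorem analyticAt_regLog {k h : ℝ} (hk : 0 < k) (hh : 0 < h) {t : ℂ} (ht : t.re * t.im < 0) :
    AnalyticAt ℂ (regLog k h) t := by
  have hre : t.re ≠ 0 := fun h0 => by rw [h0, zero_mul] at ht; exact lt_irrefl _ ht
  have h1 := analyticAt_log_kernel hk (offCuts_of_mul_neg k ht) (kernel_re_pos hk hh ht)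
  have h2 := analyticAt_upLog (Or.inl hre)
  have h3 : AnalyticAt ℂ (fun t => upLog (-t)) t :=
    AnalyticAt.fun_comp (analyticAt_upLog (Or.inl (by simpa using hre))) (by fun_prop)
  refine ((h1.sub h2).sub h3).congr ?_
  filter_upwards [eventually_mul_neg ht] with z hz
  exact (regLog_of_mul_neg hz).symm

theorem cauchyIntegrable_regLog {k h : ℝ} (hk : 0 < k) (hh : 0 < h) {η : ℝ → ℝ}
    (hη : IsAdmissiblePath η) (hcrit : Complex.exp (2 * Complex.I * k * h) = 1) :
    CauchyIntegrable η (regLog k h) := by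
  have hc : ∀ s, ContinuousAt (regLog k h) (pathPoint η s) := by
    intro s
    by_cases hs : pathPoint η s = 0
    · rw [hs]; exact (analyticAt_regLog_zero hk hh hcrit).continuousAt
    · exact (analyticAt_regLog hk hh ((isOn_pathPoint η s).re_mul_im_neg hη hs)).continuousAt
  obtain ⟨T, hT, G, hG⟩ := exists_tail_bound_log_kernel hk hh
  have hG0 : 0 ≤ G := by
    have := (norm_nonneg _).trans (hG _ (hη.inTail hT (s := T) (le_abs_self T)))
    exact nonneg_of_mul_nonneg_left this (by positivity)
  refine cauchyIntegrable_of_tail hη.good (T := max T 3) (G := G + 8) ?_ (fun s _ => hc s)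
    fun s hs => ?_
  · exact ((continuousOn_cauchy_integrand hη.good fun s _ => hc s).integrableOn_compact
      (isCompact_Icc (a := -max T 3) (b := max T 3))).mono_set Set.Ioo_subset_Icc_self
  · have h1 := hη.inTail hT ((le_max_left _ _).trans hs)
    have h3 : 3 ≤ |s| := (le_max_right _ _).trans hs
    have hm := h1.re_mul_im_neg hT
    have hs0 : s ≠ 0 := by rintro rfl; norm_num at h3
    have hn : |s| ≤ ‖pathPoint η s‖ := by
      simpa using Complex.abs_re_le_norm (pathPoint η s)
    have e1 := hG _ h1
    rw [pathPoint_re] at e1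
    have e2 := norm_upLog_le_of_large (t := pathPoint η s) (Or.inl (by simpa using hs0))
      (h3.trans hn)
    have e3 := norm_upLog_le_of_large (t := -pathPoint η s) (Or.inl (by simpa using hs0))
      (by rw [norm_neg]; exact h3.trans hn)
    have e4 := rpow_neg_half_ge (x := 1 + |s|) (by linarith)
    have e5 : 4 / (1 + ‖pathPoint η s‖) ≤ 4 * (1 + |s|) ^ (-(1 / 2) : ℝ) := by
      rw [div_eq_mul_inv]
      gcongr
      exact (inv_anti₀ (by positivity) (by linarith)).trans e4
    rw [norm_neg] at e3
    rw [regLog_of_mul_neg hm]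
    refine (norm_sub_le _ _).trans ((add_le_add ((norm_sub_le _ _).trans
      (add_le_add e1 (e2.trans e5))) (e3.trans e5)).trans (le_of_eq ?_))
    ring

theorem log_kernel_ae_eq {k h : ℝ} {η : ℝ → ℝ} (hη : IsAdmissiblePath η) :
    ∀ᵐ s : ℝ, Complex.log (kernel k h (pathPoint η s)) =
      upLog (pathPoint η s) + upLog (-pathPoint η s) + regLog k h (pathPoint η s) := by
  filter_upwards [MeasureTheory.compl_mem_ae_iff.2 (MeasureTheory.measure_singleton (0 : ℝ))]
    with s hs
  have hs' : pathPoint η s ≠ 0 := fun h0 => hs (by simpa using congrArg Complex.re h0)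
  rw [regLog_of_mul_neg ((isOn_pathPoint η s).re_mul_im_neg hη hs')]
  ring

theorem cauchyIntegrable_log_kernel {k h : ℝ} (hk : 0 < k) (hh : 0 < h) {η : ℝ → ℝ}
    (hη : IsAdmissiblePath η) : CauchyIntegrable η fun t => Complex.log (kernel k h t) := by
  by_cases hcrit : Complex.exp (2 * Complex.I * k * h) = 1
  · have h1 : CauchyIntegrable η upLog := by
      simpa using cauchyIntegrable_upLog hη.good (d := 0)
    have h2 : CauchyIntegrable η fun t => upLog (-t) := by
      have := cauchyIntegrable_upLog hη.good.rotatePath (d := 0)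
      exact CauchyIntegrable.comp_neg (by simpa using this)
    refine MeasureTheory.Integrable.congr
      (MeasureTheory.Integrable.add (MeasureTheory.Integrable.add h1 h2)
        (cauchyIntegrable_regLog hk hh hη hcrit)) ?_
    filter_upwards [log_kernel_ae_eq (k := k) (h := h) hη] with s hs
    rw [hs]
    simp only [Pi.add_apply]
    ring
  · exact cauchyIntegrable_log_kernel_of_noncritical hk hh hη hcrit

theorem cauchyIntegral_log_kernel {k h : ℝ} (hk : 0 < k) (hh : 0 < h) {η : ℝ → ℝ}
    (hη : IsAdmissiblePath η) (hcrit : Complex.exp (2 * Complex.I * k * h) = 1) {ξ : ℂ}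
    (hξ : ¬ IsOn η ξ) :
    cauchyIntegral η (fun t => Complex.log (kernel k h t)) ξ =
      cauchyIntegral η upLog ξ + cauchyIntegral η (fun t => upLog (-t)) ξ +
        cauchyIntegral η (regLog k h) ξ := by
  have h1 : CauchyIntegrable η upLog := by
    simpa using cauchyIntegrable_upLog hη.good (d := 0)
  have h2 : CauchyIntegrable η fun t => upLog (-t) := by
    have := cauchyIntegrable_upLog hη.good.rotatePath (d := 0)
    exact CauchyIntegrable.comp_neg (by simpa using this)
  have hcont := hη.good.smooth.continuous
  have i1 := h1.integrable_div hcont hξ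
  have i2 := h2.integrable_div hcont hξ
  have i3 := (cauchyIntegrable_regLog hk hh hη hcrit).integrable_div hcont hξ
  unfold cauchyIntegral
  have i12 : MeasureTheory.Integrable (fun s : ℝ =>
      upLog (pathPoint η s) / (pathPoint η s - ξ) * pathVel η s +
        upLog (-pathPoint η s) / (pathPoint η s - ξ) * pathVel η s) := i1.add i2
  rw [← mul_add, ← mul_add, ← MeasureTheory.integral_add i1 i2,
    ← MeasureTheory.integral_add i12 i3]
  congr 1
  refine MeasureTheory.integral_congr_ae ?_
  filter_upwards [log_kernel_ae_eq (k := k) (h := h) hη] with s hs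
  rw [hs]
  ring

/-- At a critical frequency, `K⁺` has a removable singularity and a zero at the origin. -/
theorem exists_analyticAt_Kplus_zero {k h : ℝ} (hk : 0 < k) (hh : 0 < h) {η : ℝ → ℝ}
    (hη : IsAdmissiblePath η) (hcrit : Complex.exp (2 * Complex.I * k * h) = 1) :
    ∃ F : ℂ → ℂ, AnalyticAt ℂ F 0 ∧ F 0 = 0 ∧ Kplus k h η =ᶠ[𝓝[≠] 0] F := by
  have hw := cauchyIntegrable_regLog hk hh hη hcrit
  set F : ℂ → ℂ := fun ξ =>
    -(Complex.I * ξ) / (1 - Complex.I * ξ) * Complex.exp (plusPart η (regLog k h) ξ) with hF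
  have hFan : ∀ ξ : ℂ, 1 - Complex.I * ξ ≠ 0 → (¬ IsAbove η ξ → AnalyticAt ℂ (regLog k h) ξ) →
      AnalyticAt ℂ F ξ := by
    intro ξ h1 h2
    have h3 := analyticAt_plusPart hη.good hw h2
    have h4 : AnalyticAt ℂ (fun ξ : ℂ => -(Complex.I * ξ) / (1 - Complex.I * ξ)) ξ :=
      AnalyticAt.div (by fun_prop) (by fun_prop) h1
    exact h4.mul h3.cexp
  refine ⟨F, hFan 0 (by simp) fun _ => analyticAt_regLog_zero hk hh hcrit, by simp [hF], ?_⟩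
  have hne1 : ∀ᶠ ξ in 𝓝 (0 : ℂ), 1 - Complex.I * ξ ≠ 0 ∧ 1 + Complex.I * ξ ≠ 0 := by
    refine Filter.Eventually.and ?_ ?_
    · exact ContinuousAt.eventually_ne (by fun_prop) (by simp)
    · exact ContinuousAt.eventually_ne (by fun_prop) (by simp)
  have hrot : rotatePath η 0 = 0 := by simp [rotatePath, hη.zero]
  -- Above the path `upLog` is its own Cauchy integral and the reflected function contributes
  -- nothing. Below, the roles are exchanged: the reflected function produces a factor of order 1/ξ,
  -- and the ξ² in the kernel turns it into the same F.
  have hoff : ∀ᶠ ξ in 𝓝[≠] (0 : ℂ), ¬ IsOn η ξ → Kplus k h η ξ = F ξ := by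
    filter_upwards [mem_nhdsWithin_of_mem_nhds hne1, self_mem_nhdsWithin,
      mem_nhdsWithin_of_mem_nhds (regLog_eventuallyEq hk hh hcrit),
      mem_nhdsWithin_of_mem_nhds (eventually_kernelQuot_im_pos hk hh hcrit)] with ξ hξ hξ0 hreg hu hon
    have hξ0 : ξ ≠ 0 := hξ0
    by_cases ha : IsAbove η ξ
    · have hpos : ξ.re ≠ 0 ∨ 0 < ξ.im := by
        by_cases h0 : ξ.re = 0
        · right
          have : η ξ.re < ξ.im := ha
          rwa [h0, hη.zero] at this
        · exact Or.inl h0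
      have h2 : cauchyIntegral η (fun t => upLog (-t)) ξ = 0 := by
        rw [cauchyIntegral_comp_neg, cauchyIntegral_upLog_of_below hη.good.rotatePath hrot.ge,
          neg_zero]
        have : η ξ.re < ξ.im := ha
        simpa [rotatePath] using this
      rw [Kplus, if_pos ha, cauchyIntegral_log_kernel hk hh hη hcrit hon, h2, add_zero,
        cauchyIntegral_upLog_of_isAbove hη.good hη.zero.ge ha hpos, Complex.exp_add,
        exp_upLog hξ0 hξ.1]
      simp only [hF]
      rw [plusPart_of_isAbove ha]
    · have hb := below_of_not ha hon
      have hneg : -ξ ≠ 0 := neg_ne_zero.2 hξ0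
      have hpos : (-ξ).re ≠ 0 ∨ 0 < (-ξ).im := by
        by_cases h0 : ξ.re = 0
        · right
          rw [h0, hη.zero] at hb
          simpa using hb
        · left; simpa using h0
      have h2 : cauchyIntegral η (fun t => upLog (-t)) ξ = -upLog (-ξ) := by
        rw [cauchyIntegral_comp_neg, cauchyIntegral_upLog_of_isAbove hη.good.rotatePath hrot.ge _ hpos]
        simpa [IsAbove, rotatePath] using hb
      have hu0 : kernelQuot k h ξ ≠ 0 := by intro h0; rw [h0] at hu; simp at hu
      rw [Kplus_of_below hb, cauchyIntegral_log_kernel hk hh hη hcrit hon, h2,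
        cauchyIntegral_upLog_of_below hη.good hη.zero.ge hb, zero_add, Complex.exp_add,
        Complex.exp_neg, exp_upLog hneg (by simpa using hξ.2)]
      simp only [hF]
      rw [plusPart_of_below hb, Complex.exp_add, hreg, Complex.exp_add, Complex.exp_add,
        Complex.exp_log hu0, Complex.exp_log hξ.1, Complex.exp_log hξ.2, kernel_eq_sq_mul hk hcrit]
      have h5 := hξ.1
      have h6 := hξ.2
      have h7 : (-(Complex.I * -ξ) / (1 - Complex.I * -ξ))⁻¹ =
          -(Complex.I * (1 + Complex.I * ξ)) / ξ := by
        rw [mul_neg, neg_neg, sub_neg_eq_add, inv_div,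
          div_eq_div_iff (mul_ne_zero Complex.I_ne_zero hξ0) hξ0]
        linear_combination ξ * (1 + Complex.I * ξ) * Complex.I_sq
      rw [h7]
      obtain ⟨w, hw'⟩ : ∃ w, w = Complex.I * ξ := ⟨_, rfl⟩
      rw [← hw'] at h5 h6 ⊢
      field_simp
      rw [hw']; ring
  -- On the path away from the origin both functions are continuous, so their equality passes over
  -- from the points vertically above.
  have hcont : ∀ᶠ ξ in 𝓝[≠] (0 : ℂ), IsOn η ξ → ContinuousAt F ξ ∧ ContinuousAt (Kplus k h η) ξ := by
    filter_upwards [mem_nhdsWithin_of_mem_nhds hne1, self_mem_nhdsWithin] with ξ hξ hξ0 hon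
    have hm := hon.re_mul_im_neg hη hξ0
    exact ⟨(hFan ξ hξ.1 fun _ => analyticAt_regLog hk hh hm).continuousAt,
      (analyticAt_Kplus hk hη.good (cauchyIntegrable_log_kernel hk hh hη)
        (fun _ => offCuts_of_mul_neg k hm) fun _ => kernel_re_pos hk hh hm).continuousAt⟩
  obtain ⟨ρ, hρ, hball⟩ := Metric.mem_nhdsWithin_iff.1 hoff
  have hmem : Metric.ball (0 : ℂ) ρ ∩ {0}ᶜ ∈ 𝓝[≠] (0 : ℂ) :=
    Filter.inter_mem (mem_nhdsWithin_of_mem_nhds (Metric.ball_mem_nhds _ hρ)) self_mem_nhdsWithin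
  filter_upwards [hcont, hoff, hmem] with ξ h1 h2 h3
  by_cases hon : IsOn η ξ
  · obtain ⟨c1, c2⟩ := h1 hon
    have ht : Tendsto (fun r : ℝ => ξ + Complex.I * r) (𝓝[>] 0) (𝓝 ξ) := by
      have : Continuous fun r : ℝ => ξ + Complex.I * r := by fun_prop
      simpa using (this.tendsto 0).mono_left nhdsWithin_le_nhds
    refine tendsto_nhds_unique (c2.tendsto.comp ht) ((c1.tendsto.comp ht).congr' ?_)
    have hopen : Metric.ball (0 : ℂ) ρ ∩ {0}ᶜ ∈ 𝓝 ξ :=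
      (Metric.isOpen_ball.inter isOpen_compl_singleton).mem_nhds h3
    filter_upwards [ht.eventually hopen, self_mem_nhdsWithin] with r hr (hr0 : 0 < r)
    refine (hball hr fun hc => ?_).symm
    have e1 : ξ.im = η ξ.re := hon
    have e2 : (ξ + Complex.I * r).im = η (ξ + Complex.I * r).re := hc
    simp at e2
    linarith
  · exact h2 hon

/-! ### The source term -/

theorem IsAdmissibleShift.nonneg {k h : ℝ} {η : ℝ → ℝ} {ε : ℝ} (hε : IsAdmissibleShift k h η ε) :
    0 ≤ ε := by
  by_cases hcrit : Complex.exp (2 * Complex.I * k * h) = 1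
  · exact (hε.pos hcrit).le
  · exact (hε.eq_zero hcrit).ge

theorem k_sub_mem_slitPlane {k : ℝ} {ξ : ℂ} (h : OffCuts k ξ) :
    (k : ℂ) - ξ ∈ Complex.slitPlane := by
  rw [Complex.mem_slitPlane_iff]
  rcases h with h | h
  · right; simpa using h
  · left; simp; linarith [(abs_lt.1 h).2]

theorem k_add_mem_slitPlane {k : ℝ} {ξ : ℂ} (h : OffCuts k ξ) :
    (k : ℂ) + ξ ∈ Complex.slitPlane := by
  rw [Complex.mem_slitPlane_iff]
  rcases h with h | h
  · right; simpa using h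
  · left; simp; linarith [(abs_lt.1 h).1]

/-- The two roots have positive real parts and imaginary parts of opposite sign, so their product
has positive real part and is the principal root of the product. -/
theorem csqrt_mul_csqrt {k : ℝ} {ξ : ℂ} (h : OffCuts k ξ) :
    csqrt (k - ξ) * csqrt (k + ξ) = mu k ξ := by
  have h1 := csqrt_re_pos (k_sub_mem_slitPlane h)
  have h2 := csqrt_re_pos (k_add_mem_slitPlane h)
  have i1 : 2 * (csqrt (k - ξ)).re * (csqrt (k - ξ)).im = -ξ.im := by
    have := congrArg Complex.im (csqrt_sq (k - ξ))
    simp [pow_two] at this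
    linarith
  have i2 : 2 * (csqrt (k + ξ)).re * (csqrt (k + ξ)).im = ξ.im := by
    have := congrArg Complex.im (csqrt_sq (k + ξ))
    simp [pow_two] at this
    linarith
  set a := csqrt (k - ξ) with ha
  set b := csqrt (k + ξ) with hb
  have h3 : 0 < (a * b).re := by
    rw [Complex.mul_re]
    have h4 : 4 * (a.re * b.re) * (a.im * b.im) = -(ξ.im ^ 2) := by
      calc _ = (2 * a.re * a.im) * (2 * b.re * b.im) := by ring
        _ = _ := by rw [i1, i2]; ring
    have h5 := mul_pos h1 h2
    have h6 : a.im * b.im ≤ 0 := by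
      by_contra hc
      nlinarith [mul_pos h5 (not_le.1 hc), sq_nonneg ξ.im]
    linarith
  rw [mu, ← csqrt_sq_of_re_pos h3, mul_pow, ha, hb, csqrt_sq, csqrt_sq]
  congr 1; ring

theorem exp_two_sub_one (k h : ℝ) (ξ : ℂ) :
    Complex.exp (2 * Complex.I * mu k ξ * h) - 1 = -kernel k h ξ := by
  rw [kernel]; ring

theorem analyticAt_sourceFactor {k h : ℝ} (hk : 0 < k) (y : ℝ) {ξ : ℂ} (hξ : OffCuts k ξ)
    (hK : kernel k h ξ ≠ 0) : AnalyticAt ℂ (sourceFactor k h y) ξ := by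
  have h1 := analyticAt_mu hk hξ
  unfold sourceFactor
  split_ifs
  · fun_prop
  · refine AnalyticAt.div (by fun_prop) (by fun_prop) ?_
    rw [exp_two_sub_one]
    exact neg_ne_zero.2 hK

theorem analyticAt_sourceTerm {k h : ℝ} (hk : 0 < k) (hh : 0 < h) {η : ℝ → ℝ}
    (hη : IsAdmissiblePath η) (xs : ℝ × ℝ) {ξ : ℂ} (hξ : OffCuts k ξ) (hK : kernel k h ξ ≠ 0)
    (hon : IsOn η ξ → 0 < (kernel k h ξ).re) : AnalyticAt ℂ (sourceTerm k h η xs) ξ := by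
  have h1 := analyticAt_sourceFactor hk xs.2 hξ hK
  have h2 := analyticAt_Kminus hk hη.good (cauchyIntegrable_log_kernel hk hh hη) hξ hon
  have hs := k_sub_mem_slitPlane hξ
  have h3 : AnalyticAt ℂ (fun ξ : ℂ => csqrt (k - ξ)) ξ :=
    AnalyticAt.fun_comp (analyticAt_csqrt hs) (by fun_prop)
  have h4 : AnalyticAt ℂ (fun ξ : ℂ => Complex.exp (Complex.I * ξ * xs.1)) ξ := by fun_prop
  exact ((h4.mul h1).mul h2).div h3 (csqrt_ne_zero (Complex.slitPlane_ne_zero hs))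

theorem exp_sub_exp_eq_sin (m h y : ℂ) :
    Complex.exp (Complex.I * m * (2 * h + y)) - Complex.exp (-(Complex.I * m * y)) =
      2 * Complex.I * Complex.exp (Complex.I * m * h) * Complex.sin (m * (h + y)) := by
  have h1 : Complex.exp (Complex.I * m * (2 * h + y)) =
      Complex.exp (Complex.I * m * h) * Complex.exp (m * (h + y) * Complex.I) := by
    rw [← Complex.exp_add]; congr 1; ring
  have h2 : Complex.exp (-(Complex.I * m * y)) =
      Complex.exp (Complex.I * m * h) * Complex.exp (-(m * (h + y)) * Complex.I) := by
    rw [← Complex.exp_add]; congr 1; ring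
  rw [h1, h2, Complex.sin]
  linear_combination Complex.exp (Complex.I * m * h) * (Complex.exp (m * (h + y) * Complex.I) -
    Complex.exp (-(m * (h + y)) * Complex.I)) * Complex.I_sq

theorem kernel_eq_sin (k h : ℝ) (ξ : ℂ) :
    kernel k h ξ =
      -(2 * Complex.I * Complex.exp (Complex.I * mu k ξ * h) * Complex.sin (mu k ξ * h)) := by
  have := exp_sub_exp_eq_sin (mu k ξ) h 0
  rw [add_zero, mul_zero, neg_zero, Complex.exp_zero, add_zero] at this
  rw [← this, kernel]
  rw [show Complex.I * mu k ξ * (2 * (h : ℂ)) = 2 * Complex.I * mu k ξ * h by ring]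
  ring

theorem sin_ne_zero_of_kernel {k h : ℝ} {ξ : ℂ} (hK : kernel k h ξ ≠ 0) :
    Complex.sin (mu k ξ * h) ≠ 0 := by
  intro h0; apply hK; rw [kernel_eq_sin, h0]; ring

/-- Quotients of sines that occur in the strip are bounded away from the real axis of `μ`. -/
theorem norm_sin_ratio_le {m : ℂ} {h a b : ℝ} (ha : 0 ≤ a) (hb : 0 ≤ b)
    (hm : 1 ≤ h * |m.im|) (hh : 0 < h) :
    ‖Complex.sin (m * a) * Complex.sin (m * b) / Complex.sin (m * h)‖ ≤
      4 * Real.exp (-((h - a - b) * |m.im|)) := by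
  have him : ∀ c : ℝ, 0 ≤ c → |(m * (c : ℂ)).im| = c * |m.im| := by
    intro c hc
    rw [Complex.im_mul_ofReal, abs_mul, abs_of_nonneg hc, mul_comm]
  have e1 := norm_sin_le (m * a)
  have e2 := norm_sin_le (m * b)
  have e3 := le_norm_sin (z := m * h) (by rw [him h hh.le]; exact hm)
  rw [him a ha] at e1
  rw [him b hb] at e2
  rw [him h hh.le] at e3
  have hp : 0 < Real.exp (h * |m.im|) / 4 := by positivity
  rw [norm_div, norm_mul, div_le_iff₀ (hp.trans_le e3)]
  calc _ ≤ Real.exp (a * |m.im|) * Real.exp (b * |m.im|) := by gcongr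
    _ = 4 * Real.exp (-((h - a - b) * |m.im|)) * (Real.exp (h * |m.im|) / 4) := by
      rw [← Real.exp_add, mul_div_assoc', mul_assoc, ← Real.exp_add, mul_div_assoc,
        mul_div_cancel₀ _ (by norm_num)]
      congr 1; ring
    _ ≤ _ := by gcongr

theorem norm_sin_ratio_le' {m : ℂ} {h a : ℝ} (ha : 0 ≤ a) (hah : a ≤ h) (hm : 1 ≤ h * |m.im|)
    (hh : 0 < h) : ‖Complex.sin (m * a) / Complex.sin (m * h)‖ ≤ 4 := by
  have him : ∀ c : ℝ, 0 ≤ c → |(m * (c : ℂ)).im| = c * |m.im| := by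
    intro c hc
    rw [Complex.im_mul_ofReal, abs_mul, abs_of_nonneg hc, mul_comm]
  have e1 := norm_sin_le (m * a)
  have e3 := le_norm_sin (z := m * h) (by rw [him h hh.le]; exact hm)
  rw [him a ha] at e1
  rw [him h hh.le] at e3
  have hp : 0 < Real.exp (h * |m.im|) / 4 := by positivity
  rw [norm_div, div_le_iff₀ (hp.trans_le e3)]
  have : Real.exp (a * |m.im|) ≤ Real.exp (h * |m.im|) := Real.exp_le_exp.2 (by gcongr)
  linarith

theorem kernel_ne_zero_of_mul_neg {k h : ℝ} (hk : 0 < k) (hh : 0 < h) {ξ : ℂ}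
    (hξ : ξ.re * ξ.im < 0) : kernel k h ξ ≠ 0 := fun h0 => by
  have := kernel_re_pos hk hh hξ
  rw [h0] at this; simp at this

theorem sourceFactor_of_neg {k h y : ℝ} (hy : y < 0) {ξ : ℂ} :
    sourceFactor k h y ξ = Complex.sin (mu k ξ * (h + y)) / Complex.sin (mu k ξ * h) := by
  rw [sourceFactor, if_neg (not_le.2 hy), exp_two_sub_one, kernel_eq_sin, neg_neg,
    exp_sub_exp_eq_sin, mul_div_mul_left _ _ (by simp [Complex.exp_ne_zero])]

theorem norm_csqrt_inv_le {k : ℝ} (hk : 0 < k) {ξ w : ℂ} (hξ : 2 * k + 1 ≤ |ξ.re|)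
    (hw : |ξ.re| - k ≤ ‖w‖) : ‖csqrt w‖⁻¹ ≤ 2 * (1 + |ξ.re|) ^ (-(1 / 2) : ℝ) := by
  have h1 : (1 + |ξ.re|) / 4 ≤ ‖w‖ := by linarith
  have h2 : Real.sqrt ((1 + |ξ.re|) / 4) ≤ ‖csqrt w‖ := by
    rw [norm_csqrt]; exact Real.sqrt_le_sqrt h1
  have h3 : Real.sqrt ((1 + |ξ.re|) / 4) = Real.sqrt (1 + |ξ.re|) / 2 := by
    rw [Real.sqrt_div (by positivity), show (4 : ℝ) = 2 ^ 2 by norm_num, Real.sqrt_sq (by norm_num)]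
  have h4 : 0 < Real.sqrt (1 + |ξ.re|) := Real.sqrt_pos.2 (by positivity)
  rw [Real.rpow_neg (by positivity), ← Real.sqrt_eq_rpow, ← div_eq_mul_inv]
  rw [h3] at h2
  calc ‖csqrt w‖⁻¹ ≤ (Real.sqrt (1 + |ξ.re|) / 2)⁻¹ := inv_anti₀ (by positivity) h2
    _ = _ := by rw [inv_div]

theorem norm_exp_I_mul_mul_le {ξ : ℂ} {x Hd : ℝ} (h : |ξ.im| ≤ Hd) :
    ‖Complex.exp (Complex.I * ξ * x)‖ ≤ Real.exp (Hd * |x|) := by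
  rw [mul_assoc, norm_exp_I_mul, Complex.im_mul_ofReal]
  refine Real.exp_le_exp.2 ((neg_le_abs _).trans ?_)
  rw [abs_mul]; gcongr

/-- The rate comes from 1/√(k - ξ) alone: the exponential in x₁* is bounded because Im ξ is, the
source factor is at most 4, and K⁻ is bounded in the tails. -/
theorem exists_tail_bound_sourceTerm {k h : ℝ} (hk : 0 < k) (hh : 0 < h) {η : ℝ → ℝ}
    (hη : IsAdmissiblePath η) {xs : ℝ × ℝ} (hxs : -h < xs.2) {Hd : ℝ} (hHd : 2 ≤ Hd) :
    ∃ T G : ℝ, 0 < T ∧ ∀ ξ : ℂ, InTail T ξ → |ξ.im| ≤ Hd →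
      ‖sourceTerm k h η xs ξ‖ ≤ G * (1 + |ξ.re|) ^ (-(1 / 2) : ℝ) := by
  obtain ⟨M, T, hT, hM⟩ := exists_bound_Kplus hk hh hη (cauchyIntegrable_log_kernel hk hh hη) hHd
  refine ⟨max T (max (2 * k + 1) (2 / h)), Real.exp (Hd * |xs.1|) * 4 * M * 2,
    lt_of_lt_of_le hT (le_max_left _ _), fun ξ hξ him => ?_⟩
  have hre := hξ.le_abs_re
  have hξT := hξ.mono (le_max_left T _)
  have hm := hξT.re_mul_im_neg hT
  have r1 : 2 * k + 1 ≤ |ξ.re| := ((le_max_left _ _).trans (le_max_right _ _)).trans hre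
  have r2 : 2 / h ≤ |ξ.re| := ((le_max_right _ _).trans (le_max_right _ _)).trans hre
  have hmu := half_abs_re_le_mu_im hk (ξ := ξ) (by linarith)
  have hmu1 : 1 ≤ h * |(mu k ξ).im| := by
    rw [div_le_iff₀ hh] at r2
    nlinarith
  have hpos := mu_im_pos hk hm
  have hS : ‖sourceFactor k h xs.2 ξ‖ ≤ 4 := by
    rcases lt_or_ge xs.2 0 with hy | hy
    · rw [sourceFactor_of_neg hy, ← Complex.ofReal_add]
      exact norm_sin_ratio_le' (by linarith) (by linarith) hmu1 hh
    · rw [sourceFactor, if_pos hy, mul_assoc, norm_exp_I_mul, Complex.im_mul_ofReal]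
      have : Real.exp (-((mu k ξ).im * xs.2)) ≤ 1 :=
        Real.exp_le_one_iff.2 (by nlinarith [mul_nonneg hpos.le hy])
      linarith
  have hKm := (hM ξ (hξT.le_abs_re) (fun _ => by linarith [(abs_le.1 him).1])
    (fun hneg => by nlinarith)).2 hξT
  have hM0 : 0 ≤ M := (norm_nonneg _).trans hKm
  have hw : |ξ.re| - k ≤ ‖(k : ℂ) - ξ‖ := by
    have h1 := Complex.abs_re_le_norm ((k : ℂ) - ξ)
    have h2 := abs_sub_abs_le_abs_sub ξ.re k
    rw [abs_of_pos hk, abs_sub_comm] at h2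
    simp at h1
    linarith
  have hc := norm_csqrt_inv_le hk r1 hw
  rw [sourceTerm, norm_div, norm_mul, norm_mul, div_eq_mul_inv]
  calc _ ≤ Real.exp (Hd * |xs.1|) * 4 * M * (2 * (1 + |ξ.re|) ^ (-(1 / 2) : ℝ)) := by
        gcongr
        exact norm_exp_I_mul_mul_le him
    _ = _ := by ring

/-! ### The displaced path and the function `H⁺` -/

/-- The displaced path meets the real axis only at ε, and ε < k. -/
theorem offCuts_of_isOn_shift {k h : ℝ} {η : ℝ → ℝ} (hη : IsAdmissiblePath η)
    {ε : ℝ} (hε : IsAdmissibleShift k h η ε) {ξ : ℂ} (hξ : IsOn (shiftPath η ε) ξ) :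
    OffCuts k ξ := by
  by_cases h0 : ξ.im = 0
  · right
    have h1 : ξ.im = η (ξ.re - ε) := hξ
    have h2 : ξ.re - ε = 0 := by
      by_contra hc
      have := hη.mul_neg hc
      rw [← h1, h0, mul_zero] at this
      exact lt_irrefl _ this
    rw [show ξ.re = ε by linarith, abs_of_nonneg hε.nonneg]
    exact hε.lt_k
  · exact Or.inl h0

theorem kernel_re_pos_of_kernel_ne_zero {k h : ℝ} (hk : 0 < k) (hh : 0 < h) {η : ℝ → ℝ}
    (hη : IsAdmissiblePath η) {ξ : ℂ} (hK : kernel k h ξ ≠ 0) (hξ : IsOn η ξ) :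
    0 < (kernel k h ξ).re := by
  refine kernel_re_pos_of_isOn hk hh hη hξ fun h0 hcrit => hK ?_
  rw [kernel, h0, mu_zero hk, hcrit, sub_self]

theorem analyticAt_sourceTerm_of_kernel {k h : ℝ} (hk : 0 < k) (hh : 0 < h) {η : ℝ → ℝ}
    (hη : IsAdmissiblePath η) (xs : ℝ × ℝ) {ξ : ℂ} (hξ : OffCuts k ξ) (hK : kernel k h ξ ≠ 0) :
    AnalyticAt ℂ (sourceTerm k h η xs) ξ :=
  analyticAt_sourceTerm hk hh hη xs hξ hK (kernel_re_pos_of_kernel_ne_zero hk hh hη hK)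

theorem shiftPath_pos {η : ℝ → ℝ} (hη : IsAdmissiblePath η) {ε s : ℝ} (h : s < ε) :
    0 < shiftPath η ε s := hη.pos_of_neg _ (by linarith)

theorem shiftPath_neg {η : ℝ → ℝ} (hη : IsAdmissiblePath η) {ε s : ℝ} (h : ε < s) :
    shiftPath η ε s < 0 := hη.neg_of_pos _ (by linarith)

theorem cauchyIntegrable_sourceTerm {k h : ℝ} (hk : 0 < k) (hh : 0 < h) {η : ℝ → ℝ}
    (hη : IsAdmissiblePath η) {ε : ℝ} (hε : IsAdmissibleShift k h η ε) {xs : ℝ × ℝ}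
    (hxs : -h < xs.2) : CauchyIntegrable (shiftPath η ε) (sourceTerm k h η xs) := by
  have hgood := hη.good.shift ε
  obtain ⟨H, hH⟩ := hgood.bounded
  have hc : ∀ s, ContinuousAt (sourceTerm k h η xs) (pathPoint (shiftPath η ε) s) := fun s =>
    (analyticAt_sourceTerm_of_kernel hk hh hη xs
      (offCuts_of_isOn_shift hη hε (isOn_pathPoint _ s)) (hε.kernel_right_ne_zero s)).continuousAt
  obtain ⟨T, G, hT, hG⟩ := exists_tail_bound_sourceTerm hk hh hη hxs (le_max_left 2 H)
  refine cauchyIntegrable_of_tail hgood (T := T + ε) (G := G) ?_ (fun s _ => hc s) fun s hs => ?_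
  · exact ((continuousOn_cauchy_integrand hgood fun s _ => hc s).integrableOn_compact
      (isCompact_Icc (a := -(T + ε)) (b := T + ε))).mono_set Set.Ioo_subset_Icc_self
  · have hε0 := hε.nonneg
    have := hG (pathPoint (shiftPath η ε) s) ?_ (by
      rw [pathPoint_im]; exact (hH s).trans (le_max_right _ _))
    · simpa using this
    · rcases le_abs.1 hs with h1 | h1
      · exact Or.inl ⟨by simp; linarith, by
          rw [pathPoint_im]; exact shiftPath_neg hη (by linarith)⟩
      · exact Or.inr ⟨by simp; linarith, by
          rw [pathPoint_im]; exact shiftPath_pos hη (by linarith)⟩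

theorem Hplus_eq_plusPart (k h : ℝ) (η : ℝ → ℝ) (ε : ℝ) (xs : ℝ × ℝ) :
    Hplus k h η ε xs = plusPart (shiftPath η ε) (sourceTerm k h η xs) := rfl

theorem tendsto_shiftPath {η : ℝ → ℝ} (hη : IsAdmissiblePath η) (ε : ℝ) :
    Tendsto (shiftPath η ε) atTop (𝓝 0) ∧ Tendsto (shiftPath η ε) atBot (𝓝 0) :=
  ⟨hη.tendsto_atTop.comp (tendsto_atTop_add_const_right _ (-ε) tendsto_id),
    hη.tendsto_atBot.comp (tendsto_atBot_add_const_right _ (-ε) tendsto_id)⟩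

theorem exists_bound_Hplus {k h : ℝ} (hk : 0 < k) (hh : 0 < h) {η : ℝ → ℝ}
    (hη : IsAdmissiblePath η) {ε : ℝ} (hε : IsAdmissibleShift k h η ε) {xs : ℝ × ℝ}
    (hxs : -h < xs.2) {Hd : ℝ} (hHd : 2 ≤ Hd) :
    ∃ M T : ℝ, ∀ ξ : ℂ, T ≤ |ξ.re| → (0 < ξ.re → -Hd ≤ ξ.im) → (ξ.re < 0 → 0 < ξ.im) →
      ‖Hplus k h η ε xs ξ‖ ≤ M := by
  obtain ⟨T, G, hT, hG⟩ := exists_tail_bound_sourceTerm hk hh hη hxs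
    (show (2 : ℝ) ≤ Hd + 2 by linarith)
  have hε0 := hε.nonneg
  have han : ∀ ξ, InTail (T + ε) ξ → AnalyticAt ℂ (sourceTerm k h η xs) ξ := fun ξ hξ => by
    have hm := hξ.re_mul_im_neg (by linarith)
    exact analyticAt_sourceTerm_of_kernel hk hh hη xs (offCuts_of_mul_neg k hm)
      (kernel_ne_zero_of_mul_neg hk hh hm)
  obtain ⟨M, T₁, h1⟩ := exists_bound_plusPart (hη.good.shift ε) (tendsto_shiftPath hη ε).1
    (tendsto_shiftPath hη ε).2 (cauchyIntegrable_sourceTerm hk hh hη hε hxs)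
    (T₀ := T + ε) (Hd := Hd + 2) (G := G) (by linarith)
    (fun s hs => shiftPath_pos hη (by linarith)) (fun s hs => shiftPath_neg hη (by linarith))
    han (fun ξ hξ him => hG ξ (hξ.mono (by linarith)) him)
  exact ⟨M, T₁, fun ξ e1 e2 e3 => h1 ξ e1 (by simpa using e2) e3⟩

theorem analyticAt_Hplus {k h : ℝ} (hk : 0 < k) (hh : 0 < h) {η : ℝ → ℝ}
    (hη : IsAdmissiblePath η) {ε : ℝ} (hε : IsAdmissibleShift k h η ε) {xs : ℝ × ℝ}
    (hxs : -h < xs.2) {ξ : ℂ}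
    (hξ : ¬ IsAbove (shiftPath η ε) ξ → OffCuts k ξ ∧ kernel k h ξ ≠ 0) :
    AnalyticAt ℂ (Hplus k h η ε xs) ξ := by
  rw [Hplus_eq_plusPart]
  exact analyticAt_plusPart (hη.good.shift ε) (cauchyIntegrable_sourceTerm hk hh hη hε hxs)
    fun ha => analyticAt_sourceTerm_of_kernel hk hh hη xs (hξ ha).1 (hξ ha).2

/-! ### The transform of the aperture field -/

/-- Above both paths H⁺ and K⁺ are plain Cauchy integrals, so neither the cuts of μ nor the zeros of
the kernel matter there. They matter only where one of the two factors is continued across its path.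
-/
theorem analyticAt_fHat {k h : ℝ} (hk : 0 < k) (hh : 0 < h) {η : ℝ → ℝ}
    (hη : IsAdmissiblePath η) {ε : ℝ} (hε : IsAdmissibleShift k h η ε) {xs : ℝ × ℝ}
    (hxs : -h < xs.2) {ξ : ℂ} (hs : (k : ℂ) + ξ ∈ Complex.slitPlane)
    (hξ : ¬ (IsAbove (shiftPath η ε) ξ ∧ IsAbove η ξ) → OffCuts k ξ ∧ kernel k h ξ ≠ 0) :
    AnalyticAt ℂ (fHat k h η ε xs) ξ := by
  have h1 := analyticAt_Hplus hk hh hη hε hxs (ξ := ξ) fun ha => hξ fun h => ha h.1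
  have h2 : AnalyticAt ℂ (Kplus k h η) ξ := by
    refine analyticAt_Kplus hk hη.good (cauchyIntegrable_log_kernel hk hh hη)
      (fun ha => (hξ fun h => ha h.2).1) fun ho => ?_
    exact kernel_re_pos_of_kernel_ne_zero hk hh hη (hξ fun h => h.2.not_isOn ho).2 ho
  have h3 : AnalyticAt ℂ (fun ξ : ℂ => csqrt (k + ξ)) ξ :=
    AnalyticAt.fun_comp (analyticAt_csqrt hs) (by fun_prop)
  have h4 := csqrt_ne_zero (Complex.slitPlane_ne_zero hs)
  exact (h1.mul h2).neg.div (analyticAt_const.mul h3) (mul_ne_zero (by simp) h4)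

theorem exists_bound_fHat {k h : ℝ} (hk : 0 < k) (hh : 0 < h) {η : ℝ → ℝ}
    (hη : IsAdmissiblePath η) {ε : ℝ} (hε : IsAdmissibleShift k h η ε) {xs : ℝ × ℝ}
    (hxs : -h < xs.2) {Hd : ℝ} (hHd : 2 ≤ Hd) :
    ∃ M T : ℝ, 0 ≤ M ∧ ∀ ξ : ℂ, T ≤ |ξ.re| → (0 < ξ.re → -Hd ≤ ξ.im) → (ξ.re < 0 → 0 < ξ.im) →
      ‖fHat k h η ε xs ξ‖ ≤ M * (1 + |ξ.re|) ^ (-(1 / 2) : ℝ) := by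
  obtain ⟨M₁, T₁, h1⟩ := exists_bound_Hplus hk hh hη hε hxs hHd
  obtain ⟨M₂, T₂, -, h2⟩ := exists_bound_Kplus hk hh hη (cauchyIntegrable_log_kernel hk hh hη) hHd
  refine ⟨|M₁| * |M₂|, max T₁ (max T₂ (2 * k + 1)), by positivity, fun ξ e1 e2 e3 => ?_⟩
  have b1 := (h1 ξ ((le_max_left _ _).trans e1) e2 e3).trans (le_abs_self _)
  have b2 := (h2 ξ (((le_max_left _ _).trans (le_max_right _ _)).trans e1) e2 e3).1.trans
    (le_abs_self _)
  have hre : 2 * k + 1 ≤ |ξ.re| := ((le_max_right _ _).trans (le_max_right _ _)).trans e1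
  have hw : |ξ.re| - k ≤ ‖(k : ℂ) + ξ‖ := by
    have h1 := Complex.abs_re_le_norm ((k : ℂ) + ξ)
    have h2 := abs_sub_abs_le_abs_sub ξ.re (-k)
    rw [abs_neg, abs_of_pos hk, sub_neg_eq_add, add_comm ξ.re] at h2
    simp at h1
    linarith
  have hc := norm_csqrt_inv_le hk hre hw
  rw [fHat, norm_div, norm_neg, norm_mul, norm_mul, norm_mul, Complex.norm_I, Complex.norm_ofNat,
    mul_one, div_eq_mul_inv, mul_inv]
  calc _ ≤ |M₁| * |M₂| * (2⁻¹ * (2 * (1 + |ξ.re|) ^ (-(1 / 2) : ℝ))) := by gcongr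
    _ = _ := by ring

/-! ### The modal density and its poles -/

/-- The entire function `sin(aμ)/μ` of the horizontal wave number. -/
def stripSinc (k a : ℝ) (ξ : ℂ) : ℂ := sincSqrt a ((k : ℂ) ^ 2 - ξ ^ 2)

theorem analyticAt_stripSinc (k a : ℝ) (ξ : ℂ) : AnalyticAt ℂ (stripSinc k a) ξ :=
  AnalyticAt.fun_comp (f := fun ξ : ℂ => (k : ℂ) ^ 2 - ξ ^ 2) (analyticAt_sincSqrt a _)
    (by fun_prop)

theorem stripSinc_eq {k a : ℝ} {ξ : ℂ} (h : mu k ξ ≠ 0) :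
    stripSinc k a ξ = Complex.sin (a * mu k ξ) / mu k ξ := by
  rw [stripSinc, ← mu_sq, sincSqrt_sq h]

theorem stripSinc_ne_zero_of_kernel {k h : ℝ} {ξ : ℂ} (hK : kernel k h ξ ≠ 0) :
    stripSinc k h ξ ≠ 0 := by
  intro h0; apply hK
  rw [stripSinc] at h0
  rw [kernel_eq_sincSqrt, h0, mul_zero, neg_zero]

/-- Unlike the kernel, sin(hμ)/μ does not vanish at μ = 0, where its value is h; hence n ≥ 1. -/
theorem exists_modeMu_of_stripSinc_eq_zero {k h : ℝ} (hh : 0 < h) {ξ : ℂ}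
    (h0 : stripSinc k h ξ = 0) : ∃ n : ℕ, 1 ≤ n ∧ (k : ℂ) ^ 2 - ξ ^ 2 = (modeMu h n : ℂ) ^ 2 := by
  have hh' : (h : ℂ) ≠ 0 := by exact_mod_cast hh.ne'
  rw [stripSinc, sincSqrt] at h0
  split_ifs at h0 with hz
  · exact absurd h0 hh'
  · have hc := csqrt_ne_zero hz
    rw [div_eq_zero_iff, or_iff_left hc, Complex.sin_eq_zero_iff] at h0
    obtain ⟨n, hn⟩ := h0
    have h1 : csqrt ((k : ℂ) ^ 2 - ξ ^ 2) = n * Real.pi / h := by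
      rw [eq_div_iff hh', mul_comm]; exact hn
    refine ⟨n.natAbs, ?_, ?_⟩
    · rw [Nat.one_le_iff_ne_zero, Int.natAbs_ne_zero]
      rintro rfl
      apply hc; rw [h1]; simp
    · rw [← csqrt_sq ((k : ℂ) ^ 2 - ξ ^ 2), h1, modeMu]
      push_cast
      rw [div_pow, div_pow, mul_pow, mul_pow]
      congr 2
      have : ((n.natAbs : ℤ) : ℂ) ^ 2 = (n : ℂ) ^ 2 := by exact_mod_cast Int.natAbs_sq n
      simpa using this.symm

theorem mem_modes_iff {k h : ℝ} (hk : 0 < k) (hh : 0 < h) {n : ℕ} :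
    n ∈ Finset.Icc 1 (numModes k h) ↔ 1 ≤ n ∧ modeMu h n ≤ k := by
  rw [Finset.mem_Icc, numModes, Nat.le_floor_iff (by positivity), le_div_iff₀ Real.pi_pos, modeMu,
    div_le_iff₀ hh]

theorem modeMu_pos {h : ℝ} (hh : 0 < h) {n : ℕ} (hn : 1 ≤ n) : 0 < modeMu h n := by
  have : (0 : ℝ) < n := by exact_mod_cast hn
  rw [modeMu]; positivity

theorem modeXi_sq {k h : ℝ} (hh : 0 < h) {n : ℕ} (hn : 1 ≤ n) (hnk : modeMu h n ≤ k) :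
    modeXi k h n ^ 2 = k ^ 2 - modeMu h n ^ 2 := by
  rw [modeXi, Real.sq_sqrt]
  have := modeMu_pos hh hn
  nlinarith

theorem sin_modeMu (h : ℝ) (hh : 0 < h) (n : ℕ) : Real.sin (h * modeMu h n) = 0 := by
  rw [modeMu, mul_div_cancel₀ _ hh.ne', Real.sin_nat_mul_pi]

theorem cos_modeMu (h : ℝ) (hh : 0 < h) (n : ℕ) :
    Real.cos (h * modeMu h n) = Real.cos (n * Real.pi) := by
  rw [modeMu, mul_div_cancel₀ _ hh.ne']

/-- Apart from a simple pole with residue `r`, the function extends analytically to `p`. -/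
def HasSimplePole (f : ℂ → ℂ) (p r : ℂ) : Prop :=
  ∃ F : ℂ → ℂ, AnalyticAt ℂ F p ∧ f =ᶠ[𝓝[≠] p] fun z => F z + r / (z - p)

theorem HasSimplePole.of_analyticAt {f : ℂ → ℂ} {p : ℂ} (h : AnalyticAt ℂ f p) :
    HasSimplePole f p 0 := ⟨f, h, Eventually.of_forall fun z => by simp⟩

theorem HasSimplePole.congr {f g : ℂ → ℂ} {p r : ℂ} (h : HasSimplePole f p r)
    (hfg : g =ᶠ[𝓝[≠] p] f) : HasSimplePole g p r := by
  obtain ⟨F, hF, he⟩ := h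
  exact ⟨F, hF, hfg.trans he⟩

theorem HasSimplePole.div {a s : ℂ → ℂ} {p : ℂ} (ha : AnalyticAt ℂ a p) (hs : AnalyticAt ℂ s p)
    (h0 : s p ≠ 0) : HasSimplePole (fun z => a z / ((z - p) * s z)) p (a p / s p) := by
  have hq : AnalyticAt ℂ (fun z => a z / s z) p := ha.div hs h0
  refine ⟨dslope (fun z => a z / s z) p, analyticAt_dslope hq, ?_⟩
  filter_upwards [self_mem_nhdsWithin] with z hz
  have hz' : z - p ≠ 0 := sub_ne_zero.2 hz
  rw [dslope_of_ne _ hz, slope_def_field]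
  rw [sub_div, sub_add_cancel, div_div, mul_comm]

/-- The numerator of the source factor. -/
def sourceNum (k h y : ℝ) (ξ : ℂ) : ℂ :=
  if 0 ≤ y then Complex.exp (Complex.I * mu k ξ * y) * kernel k h ξ
  else
    -(Complex.exp (Complex.I * mu k ξ * (2 * h + y)) - Complex.exp (-(Complex.I * mu k ξ * y)))

theorem sourceFactor_mul_kernel {k h y : ℝ} {ξ : ℂ} (hK : kernel k h ξ ≠ 0) :
    sourceFactor k h y ξ * kernel k h ξ = sourceNum k h y ξ := by
  rw [sourceFactor, sourceNum]
  split_ifs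
  · rfl
  · rw [exp_two_sub_one, div_neg, neg_mul, div_mul_cancel₀ _ hK]

theorem analyticAt_sourceNum {k : ℝ} (hk : 0 < k) (h y : ℝ) {ξ : ℂ} (hξ : OffCuts k ξ) :
    AnalyticAt ℂ (sourceNum k h y) ξ := by
  have h1 := analyticAt_mu hk hξ
  have h2 := analyticAt_kernel (h := h) hk hξ
  unfold sourceNum
  split_ifs <;> fun_prop

/-- Below the displaced path H⁺ is the source term plus a Cauchy integral. Multiplied by K⁺, the
source term turns K⁻ into the kernel, which clears the denominator of the source factor. -/
theorem fHat_of_below {k h : ℝ} {η : ℝ → ℝ} {ε : ℝ} {xs : ℝ × ℝ} {ξ : ℂ}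
    (hb : ξ.im < shiftPath η ε ξ.re) (hK : kernel k h ξ ≠ 0) :
    fHat k h η ε xs ξ =
      -(Complex.exp (Complex.I * ξ * xs.1) * sourceNum k h xs.2 ξ / csqrt (k - ξ) +
        cauchyIntegral (shiftPath η ε) (sourceTerm k h η xs) ξ * Kplus k h η ξ) /
        (2 * Complex.I * csqrt (k + ξ)) := by
  rw [fHat, Hplus_eq_plusPart, plusPart_of_below hb, add_mul, ← sourceFactor_mul_kernel hK,
    ← Kplus_mul_Kminus k h η ξ]
  congr 3
  nth_rw 1 [sourceTerm]
  ring

/-- The aperture transform with the part that stems from the incident wave removed. -/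
def modalDensity (k h : ℝ) (η : ℝ → ℝ) (ε : ℝ) (xs : ℝ × ℝ) (ξ : ℂ) : ℂ :=
  fHat k h η ε xs ξ -
    if xs.2 < 0 then Complex.exp (Complex.I * ξ * xs.1) * stripSinc k xs.2 ξ else 0

/-- The modal density divided by `sin(hμ)/μ`. -/
def modalQuot (k h : ℝ) (η : ℝ → ℝ) (ε : ℝ) (xs : ℝ × ℝ) (ξ : ℂ) : ℂ :=
  modalDensity k h η ε xs ξ / stripSinc k h ξ

theorem analyticAt_incidentPart (k : ℝ) (xs : ℝ × ℝ) (ξ : ℂ) :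
    AnalyticAt ℂ (fun ξ : ℂ =>
      if xs.2 < 0 then Complex.exp (Complex.I * ξ * xs.1) * stripSinc k xs.2 ξ else 0) ξ := by
  split_ifs
  · have := analyticAt_stripSinc k xs.2 ξ
    fun_prop
  · exact analyticAt_const

/-- The subtracted incident part is exactly what completes the numerator of the source factor to a
multiple of the kernel, and K⁺ carries the kernel below 𝓛. The whole density is then divisible by
the kernel wherever the point lies below both paths. -/
theorem modalDensity_of_below {k h : ℝ} {η : ℝ → ℝ} {ε : ℝ} {xs : ℝ × ℝ} {ξ : ℂ}
    (hξ : OffCuts k ξ) (hb : ξ.im < shiftPath η ε ξ.re) (hb' : ξ.im < η ξ.re)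
    (hK : kernel k h ξ ≠ 0) :
    modalDensity k h η ε xs ξ =
      -(kernel k h ξ * (Complex.exp (Complex.I * ξ * xs.1) *
          Complex.exp (Complex.I * mu k ξ * xs.2) / (2 * Complex.I * mu k ξ) +
        cauchyIntegral (shiftPath η ε) (sourceTerm k h η xs) ξ *
          Complex.exp (cauchyIntegral η (fun t => Complex.log (kernel k h t)) ξ) /
            (2 * Complex.I * csqrt (k + ξ)))) := by
  have hm := mu_ne_zero_of_kernel hK
  have hprod := csqrt_mul_csqrt hξ
  have hp : csqrt (k + ξ) ≠ 0 := fun h0 => hm (by rw [← hprod, h0, mul_zero])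
  have hq : csqrt (k - ξ) ≠ 0 := fun h0 => hm (by rw [← hprod, h0, zero_mul])
  have key : sourceNum k h xs.2 ξ / (2 * Complex.I * mu k ξ) +
      (if xs.2 < 0 then stripSinc k xs.2 ξ else 0) =
      kernel k h ξ * Complex.exp (Complex.I * mu k ξ * xs.2) / (2 * Complex.I * mu k ξ) := by
    rw [sourceNum]
    by_cases hy : xs.2 < 0
    · rw [if_neg (not_le.2 hy), if_pos hy, stripSinc_eq hm, Complex.sin, kernel,
        show Complex.I * mu k ξ * (2 * h + xs.2) =
          2 * Complex.I * mu k ξ * h + Complex.I * mu k ξ * xs.2 by ring, Complex.exp_add,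
        show -(xs.2 * mu k ξ) * Complex.I = -(Complex.I * mu k ξ * xs.2) by ring,
        show (xs.2 : ℂ) * mu k ξ * Complex.I = Complex.I * mu k ξ * xs.2 by ring]
      have hI := Complex.I_ne_zero
      field_simp
      linear_combination (Complex.exp (-(Complex.I * mu k ξ * xs.2)) -
        Complex.exp (Complex.I * mu k ξ * xs.2)) * Complex.I_sq
    · rw [if_pos (not_lt.1 hy), if_neg hy]; ring
  have key2 : Complex.exp (Complex.I * ξ * xs.1) * sourceNum k h xs.2 ξ / csqrt (k - ξ) /
      (2 * Complex.I * csqrt (k + ξ)) =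
      Complex.exp (Complex.I * ξ * xs.1) * (sourceNum k h xs.2 ξ / (2 * Complex.I * mu k ξ)) := by
    rw [← hprod]
    have hI := Complex.I_ne_zero
    field_simp
  have key3 : (if xs.2 < 0 then Complex.exp (Complex.I * ξ * xs.1) * stripSinc k xs.2 ξ else 0) =
      Complex.exp (Complex.I * ξ * xs.1) * (if xs.2 < 0 then stripSinc k xs.2 ξ else 0) := by
    split_ifs <;> simp
  rw [modalDensity, fHat_of_below hb hK, Kplus_of_below hb', neg_div, add_div, key2, key3]
  linear_combination -Complex.exp (Complex.I * ξ * xs.1) * key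

/-! ### The region swept by the deformation -/

/-- The region between the displaced path and a hyperbola in the upper half plane. -/
def sweptRegion (η : ℝ → ℝ) (ε Y B : ℝ) : Set ℂ :=
  {ξ | shiftPath η (-ε) ξ.re ≤ ξ.im ∧ ξ.im ≤ Real.sqrt (Y ^ 2 + (B * ξ.re) ^ 2)}

/-- Left of -ε the point is in the second quadrant, where the kernel cannot vanish. Over [-ε, ε] it
is off the cuts, and nonvanishing is assumed. Right of ε it is either in the fourth quadrant or
above both paths. The last case includes the real points ξ_m > 0 and the cut beyond k. -/
theorem analyticAt_fHat_of_mem {k h : ℝ} (hk : 0 < k) (hh : 0 < h) {η : ℝ → ℝ}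
    (hη : IsAdmissiblePath η) {ε : ℝ} (hε : IsAdmissibleShift k h η ε) {xs : ℝ × ℝ}
    (hxs : -h < xs.2) {ξ : ℂ} (hξ : shiftPath η (-ε) ξ.re ≤ ξ.im)
    (hK : |ξ.re| ≤ ε → kernel k h ξ ≠ 0) : AnalyticAt ℂ (fHat k h η ε xs) ξ := by
  have hεk := hε.lt_k
  have hε0 := hε.nonneg
  rcases lt_or_ge ξ.re (-ε) with h1 | h1
  · have h2 := (shiftPath_pos hη h1).trans_le hξ
    have h3 : ξ.re * ξ.im < 0 := mul_neg_of_neg_of_pos (by linarith) h2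
    exact analyticAt_fHat hk hh hη hε hxs (k_add_mem_slitPlane (offCuts_of_mul_neg k h3))
      fun _ => ⟨offCuts_of_mul_neg k h3, kernel_ne_zero_of_mul_neg hk hh h3⟩
  rcases le_or_gt ξ.re ε with h2 | h2
  · have h3 : |ξ.re| ≤ ε := abs_le.2 ⟨h1, h2⟩
    have h4 : OffCuts k ξ := Or.inr (h3.trans_lt hεk)
    exact analyticAt_fHat hk hh hη hε hxs (k_add_mem_slitPlane h4) fun _ => ⟨h4, hK h3⟩
  · refine analyticAt_fHat hk hh hη hε hxs ?_ fun hcon => ?_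
    · left; simp; linarith
    · rcases lt_or_ge ξ.im 0 with h3 | h3
      · have h4 : ξ.re * ξ.im < 0 := mul_neg_of_pos_of_neg (by linarith) h3
        exact ⟨offCuts_of_mul_neg k h4, kernel_ne_zero_of_mul_neg hk hh h4⟩
      · exact absurd ⟨(shiftPath_neg hη h2).trans_le h3,
          (hη.neg_of_pos _ (by linarith)).trans_le h3⟩ hcon

theorem analyticAt_modalDensity {k h : ℝ} (hk : 0 < k) (hh : 0 < h) {η : ℝ → ℝ}
    (hη : IsAdmissiblePath η) {ε : ℝ} (hε : IsAdmissibleShift k h η ε) {xs : ℝ × ℝ}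
    (hxs : -h < xs.2) {ξ : ℂ} (hξ : shiftPath η (-ε) ξ.re ≤ ξ.im)
    (hK : |ξ.re| ≤ ε → kernel k h ξ ≠ 0) : AnalyticAt ℂ (modalDensity k h η ε xs) ξ :=
  (analyticAt_fHat_of_mem hk hh hη hε hxs hξ hK).sub (analyticAt_incidentPart k xs ξ)

theorem kernel_ne_zero_of_stripSinc {k h : ℝ} (hk : 0 < k) {ξ : ℂ} (hξ : OffCuts k ξ)
    (h0 : stripSinc k h ξ ≠ 0) : kernel k h ξ ≠ 0 := by
  rw [stripSinc] at h0
  rw [kernel_eq_sincSqrt]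
  have := mu_ne_zero hk hξ
  simp [this, h0, Complex.exp_ne_zero]

/-- At a zero k² - ξ² is some μ_n², so ξ is real or purely imaginary. Points on the positive
imaginary axis would come from evanescent modes and lie above the hyperbola, whose height over 0 is
Y. A negative real zero would lie left of -ε, where the path is already above the axis. -/
theorem stripSinc_zero_cases {k h : ℝ} (hk : 0 < k) (hh : 0 < h) {η : ℝ → ℝ}
    (hη : IsAdmissiblePath η) {ε : ℝ} (hε : IsAdmissibleShift k h η ε) {Y B : ℝ} (hY : 0 < Y)
    (hYn : ∀ n : ℕ, k < modeMu h n → k ^ 2 + Y ^ 2 < modeMu h n ^ 2) {ξ : ℂ}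
    (hξ : ξ ∈ sweptRegion η ε Y B) (h0 : stripSinc k h ξ = 0) :
    (∃ n ∈ Finset.Icc 1 (numModes k h), ξ = modeXi k h n) ∨ (ξ.re = 0 ∧ ξ.im < 0) := by
  obtain ⟨n, hn1, hn⟩ := exists_modeMu_of_stripSinc_eq_zero hh h0
  have hε0 := hε.nonneg
  have hmu := modeMu_pos hh hn1
  have hre : k ^ 2 - (ξ.re ^ 2 - ξ.im ^ 2) = modeMu h n ^ 2 := by
    have := congrArg Complex.re hn
    rw [← Complex.ofReal_pow, ← Complex.ofReal_pow] at this
    simpa [pow_two] using this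
  have him : ξ.re * ξ.im = 0 := by
    have := congrArg Complex.im hn
    rw [← Complex.ofReal_pow, ← Complex.ofReal_pow] at this
    simp only [Complex.sub_im, Complex.ofReal_im, pow_two, Complex.mul_im] at this
    linarith
  rcases eq_or_ne ξ.re 0 with hr | hr
  · rcases lt_or_ge ξ.im 0 with hi | hi
    · exact Or.inr ⟨hr, hi⟩
    left
    have hb := hξ.2
    rw [hr, mul_zero, zero_pow two_ne_zero, add_zero, Real.sqrt_sq hY.le] at hb
    rw [hr] at hre
    have hle : modeMu h n ≤ k := by
      by_contra hc
      have := hYn n (not_le.1 hc)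
      nlinarith
    have hi0 : ξ.im = 0 := by nlinarith
    refine ⟨n, (mem_modes_iff hk hh).2 ⟨hn1, hle⟩, Complex.ext ?_ ?_⟩
    · rw [hr, Complex.ofReal_re, modeXi, ← hre, hi0]
      simp
    · rw [hi0, Complex.ofReal_im]
  · left
    have hi : ξ.im = 0 := (mul_eq_zero.1 him).resolve_left hr
    rw [hi] at hre
    have hlt : modeMu h n < k := by
      have := pow_pos (abs_pos.2 hr) 2
      rw [sq_abs] at this
      nlinarith
    have hmem := (mem_modes_iff hk hh).2 ⟨hn1, hlt.le⟩
    have hx : modeXi k h n = |ξ.re| := by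
      rw [modeXi, ← hre, ← Real.sqrt_sq_eq_abs]; congr 1; ring
    have hpos : 0 < modeXi k h n := hx ▸ abs_pos.2 hr
    have hlt2 := hε.lt_modeXi n hmem hpos
    rw [hx] at hlt2
    have hr0 : 0 < ξ.re := by
      by_contra hc
      have h1 : ξ.re < -ε := by
        rw [abs_of_nonpos (not_lt.1 hc)] at hlt2; linarith
      have h2 := (shiftPath_pos hη h1).trans_le hξ.1
      rw [hi] at h2
      exact lt_irrefl _ h2
    refine ⟨n, hmem, Complex.ext ?_ (by simpa using hi)⟩
    rw [hx, abs_of_pos hr0, Complex.ofReal_re]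

theorem critical_of_modeXi_eq_zero {k h : ℝ} (hk : 0 < k) (hh : 0 < h) {m : ℕ}
    (hm : m ∈ Finset.Icc 1 (numModes k h)) (h0 : modeXi k h m = 0) :
    k = modeMu h m ∧ Complex.exp (2 * Complex.I * k * h) = 1 := by
  obtain ⟨h1, h2⟩ := (mem_modes_iff hk hh).1 hm
  have h3 := modeXi_sq hh h1 h2
  rw [h0] at h3
  have h4 := modeMu_pos hh h1
  have h5 : k = modeMu h m := by nlinarith
  refine ⟨h5, Complex.exp_eq_one_iff.2 ⟨m, ?_⟩⟩
  rw [h5, modeMu]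
  have : (h : ℂ) ≠ 0 := by exact_mod_cast hh.ne'
  push_cast
  field_simp

/-- On the negative imaginary axis the zeros of the denominator are compensated. -/
theorem hasSimplePole_modalQuot_of_neg_im {k h : ℝ} (hk : 0 < k) (hh : 0 < h) {η : ℝ → ℝ}
    (hη : IsAdmissiblePath η) {ε : ℝ} (hε : IsAdmissibleShift k h η ε) {xs : ℝ × ℝ}
    (hxs : -h < xs.2) {ξ : ℂ} (hre : ξ.re = 0) (him : ξ.im < 0) :
    HasSimplePole (modalQuot k h η ε xs) ξ 0 := by
  have hoff : OffCuts k ξ := Or.inl him.ne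
  have hb' : ξ.im < η ξ.re := by rw [hre, hη.zero]; exact him
  have hb : ξ.im < shiftPath η ε ξ.re := by
    refine him.trans_le ?_
    rw [hre, shiftPath]
    rcases hε.nonneg.eq_or_lt with h | h
    · rw [← h, sub_zero, hη.zero]
    · exact (hη.pos_of_neg _ (by linarith)).le
  have hm := mu_ne_zero hk hoff
  have hmu := analyticAt_mu hk hoff
  have hC1 := analyticAt_cauchyIntegral (cauchyIntegrable_sourceTerm hk hh hη hε hxs)
    (hη.good.shift ε).smooth.continuous (not_isOn_of_below hb)
  have hC2 := analyticAt_cauchyIntegral (cauchyIntegrable_log_kernel hk hh hη)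
    hη.good.smooth.continuous (not_isOn_of_below hb')
  have hs := k_add_mem_slitPlane hoff
  have h3 : AnalyticAt ℂ (fun ξ : ℂ => csqrt (k + ξ)) ξ :=
    AnalyticAt.fun_comp (analyticAt_csqrt hs) (by fun_prop)
  have h4 := csqrt_ne_zero (Complex.slitPlane_ne_zero hs)
  -- By `modalDensity_of_below` the density is -kernel · A. The kernel contains sin(hμ)/μ as a
  -- factor, which cancels the denominator and leaves an analytic function.
  set A : ℂ → ℂ := fun ξ => Complex.exp (Complex.I * ξ * xs.1) *
          Complex.exp (Complex.I * mu k ξ * xs.2) / (2 * Complex.I * mu k ξ) +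
        cauchyIntegral (shiftPath η ε) (sourceTerm k h η xs) ξ *
          Complex.exp (cauchyIntegral η (fun t => Complex.log (kernel k h t)) ξ) /
            (2 * Complex.I * csqrt (k + ξ)) with hA
  have hAan : AnalyticAt ℂ A ξ := by
    refine AnalyticAt.add (AnalyticAt.div (by fun_prop) (by fun_prop) (by simp [hm]))
      (AnalyticAt.div (hC1.mul hC2.cexp) (by fun_prop) (by simp [h4]))
  have hF : AnalyticAt ℂ (fun ξ => 2 * Complex.I * Complex.exp (Complex.I * mu k ξ * h) *
      mu k ξ * A ξ) ξ := by fun_prop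
  refine (HasSimplePole.of_analyticAt hF).congr ?_
  -- The zeros are isolated because the function is not identically zero: at ξ = k its value is h.
  have hne : ∀ᶠ z in 𝓝[≠] ξ, stripSinc k h z ≠ 0 := by
    rcases (analyticAt_stripSinc k h ξ).eventually_eq_zero_or_eventually_ne_zero with hz | hz
    · exfalso
      have h1 : ∀ z, stripSinc k h z = 0 := by
        have han : AnalyticOnNhd ℂ (stripSinc k h) Set.univ := fun z _ => analyticAt_stripSinc k h z
        have := han.eqOn_zero_of_preconnected_of_eventuallyEq_zero isPreconnected_univ
          (Set.mem_univ ξ) hz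
        exact fun z => this (Set.mem_univ z)
      have h2 := h1 k
      rw [stripSinc, sub_self, sincSqrt, if_pos rfl] at h2
      exact hh.ne' (by exact_mod_cast h2)
    · exact hz
  have hev : ∀ᶠ z in 𝓝 ξ, OffCuts k z ∧ z.im < shiftPath η ε z.re ∧ z.im < η z.re :=
    Filter.Eventually.and ((isOpen_offCuts k).mem_nhds hoff) (Filter.Eventually.and
      ((isOpen_below (hη.good.shift ε).smooth.continuous).mem_nhds hb)
        ((isOpen_below hη.good.smooth.continuous).mem_nhds hb'))
  filter_upwards [hne, mem_nhdsWithin_of_mem_nhds hev] with z hz hz2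
  rw [modalQuot, modalDensity_of_below hz2.1 hz2.2.1 hz2.2.2
    (kernel_ne_zero_of_stripSinc hk hz2.1 hz), div_eq_iff hz]
  nth_rw 1 [kernel_eq_sincSqrt]
  rw [stripSinc]
  simp only [hA]
  ring

theorem stripSinc_eq_sub_mul {k h w : ℝ} (hw : 0 < w) (hs : Real.sin (h * w) = 0) {p : ℂ}
    (hp : (k : ℂ) ^ 2 - p ^ 2 = (w : ℂ) ^ 2) (ξ : ℂ) :
    stripSinc k h ξ = (ξ - p) * (-(ξ + p) *
      dslope (sincSqrt h) ((w : ℂ) ^ 2) ((k : ℂ) ^ 2 - ξ ^ 2)) := by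
  have h1 := sub_smul_dslope (sincSqrt h) ((w : ℂ) ^ 2) ((k : ℂ) ^ 2 - ξ ^ 2)
  rw [sincSqrt_sq_eq_zero hw hs, sub_zero, smul_eq_mul] at h1
  rw [stripSinc, ← h1, ← hp]
  ring

theorem analyticAt_dslope_sincSqrt (k h : ℝ) (w ξ : ℂ) :
    AnalyticAt ℂ (fun ξ : ℂ => dslope (sincSqrt h) w ((k : ℂ) ^ 2 - ξ ^ 2)) ξ :=
  AnalyticAt.fun_comp (analyticAt_dslope (analyticAt_sincSqrt h _)) (by fun_prop)

theorem hasSimplePole_modalQuot_modeXi {k h : ℝ} (hk : 0 < k) (hh : 0 < h) {η : ℝ → ℝ}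
    (hη : IsAdmissiblePath η) {ε : ℝ} (hε : IsAdmissibleShift k h η ε) {xs : ℝ × ℝ}
    (hxs : -h < xs.2) {m : ℕ} (hm : m ∈ Finset.Icc 1 (numModes k h)) (hpos : 0 < modeXi k h m) :
    HasSimplePole (modalQuot k h η ε xs) (modeXi k h m)
      (modalDensity k h η ε xs (modeXi k h m) /
        (-(modeXi k h m * h * Real.cos (m * Real.pi) / modeMu h m ^ 2))) := by
  obtain ⟨h1, h2⟩ := (mem_modes_iff hk hh).1 hm
  have hw := modeMu_pos hh h1
  have hp : (k : ℂ) ^ 2 - (modeXi k h m : ℂ) ^ 2 = (modeMu h m : ℂ) ^ 2 := by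
    have := modeXi_sq hh h1 h2
    exact_mod_cast (by linarith : k ^ 2 - modeXi k h m ^ 2 = modeMu h m ^ 2)
  have hs := sin_modeMu h hh m
  have hlt := hε.lt_modeXi m hm hpos
  -- As ε < ξ_m, the point lies above both paths, so the density is analytic there although the
  -- kernel vanishes.
  have hB : AnalyticAt ℂ (modalDensity k h η ε xs) (modeXi k h m) := by
    refine analyticAt_modalDensity hk hh hη hε hxs ?_ fun hc => ?_
    · rw [Complex.ofReal_re, Complex.ofReal_im]
      exact (shiftPath_neg hη (by linarith [hε.nonneg])).le
    · rw [Complex.ofReal_re, abs_of_pos hpos] at hc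
      exact absurd hlt (not_lt.2 hc)
  have hval : -((modeXi k h m : ℂ) + modeXi k h m) * dslope (sincSqrt h) ((modeMu h m : ℂ) ^ 2)
      ((k : ℂ) ^ 2 - (modeXi k h m : ℂ) ^ 2) =
      -(modeXi k h m * h * Real.cos (m * Real.pi) / modeMu h m ^ 2) := by
    rw [hp, dslope_same, (hasDerivAt_sincSqrt hw hs).deriv, cos_modeMu h hh]
    have : (modeMu h m : ℂ) ≠ 0 := by exact_mod_cast hw.ne'
    field_simp
    ring
  have hcos : Real.cos (m * Real.pi) ≠ 0 := by
    intro h0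
    have := Real.sin_sq_add_cos_sq (m * Real.pi)
    rw [Real.sin_nat_mul_pi, h0] at this
    norm_num at this
  have hne : (-(modeXi k h m * h * Real.cos (m * Real.pi) / modeMu h m ^ 2) : ℂ) ≠ 0 := by
    have : -(modeXi k h m * h * Real.cos (m * Real.pi) / modeMu h m ^ 2) ≠ 0 := by
      have := hpos.ne'; have := hw.ne'; have := hh.ne'
      simp [*]
    exact_mod_cast this
  rw [← hval] at hne ⊢
  have han : AnalyticAt ℂ (fun ξ : ℂ => -(ξ + modeXi k h m) *
      dslope (sincSqrt h) ((modeMu h m : ℂ) ^ 2) ((k : ℂ) ^ 2 - ξ ^ 2)) (modeXi k h m) := by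
    have := analyticAt_dslope_sincSqrt k h ((modeMu h m : ℂ) ^ 2) (modeXi k h m)
    fun_prop
  refine (HasSimplePole.div hB han hne).congr (Eventually.of_forall fun z => ?_)
  simp only [modalQuot]
  rw [stripSinc_eq_sub_mul hw hs hp]

/-- At a critical frequency the aperture transform extends analytically to the origin. -/
theorem exists_analyticAt_fHat_zero {k h : ℝ} (hk : 0 < k) (hh : 0 < h) {η : ℝ → ℝ}
    (hη : IsAdmissiblePath η) {ε : ℝ} (hε : IsAdmissibleShift k h η ε) {xs : ℝ × ℝ}
    (hxs : -h < xs.2) (hcrit : Complex.exp (2 * Complex.I * k * h) = 1) :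
    ∃ F : ℂ → ℂ, AnalyticAt ℂ F 0 ∧ fHat k h η ε xs =ᶠ[𝓝[≠] 0] F ∧
      F 0 = if xs.2 < 0 then stripSinc k xs.2 0 else 0 := by
  obtain ⟨K, hK, hK0, hKe⟩ := exists_analyticAt_Kplus_zero hk hh hη hcrit
  have hεp := hε.pos hcrit
  have hoff := offCuts_zero hk
  -- Because ε > 0 the origin lies strictly below 𝓛 + ε. There H⁺K⁺ consists of an analytic term
  -- without K⁺ and a Cauchy integral times K⁺; the second vanishes at the origin with the extension
  -- of K⁺, which determines F 0.
  have hb : (0 : ℂ).im < shiftPath η ε (0 : ℂ).re := shiftPath_pos hη hεp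
  have hC := analyticAt_cauchyIntegral (cauchyIntegrable_sourceTerm hk hh hη hε hxs)
    (hη.good.shift ε).smooth.continuous (not_isOn_of_below hb)
  have hS := analyticAt_sourceNum hk h xs.2 hoff
  have hsa := k_add_mem_slitPlane hoff
  have hsb := k_sub_mem_slitPlane hoff
  have h3 : AnalyticAt ℂ (fun ξ : ℂ => csqrt (k + ξ)) 0 :=
    AnalyticAt.fun_comp (analyticAt_csqrt hsa) (by fun_prop)
  have h4 : AnalyticAt ℂ (fun ξ : ℂ => csqrt (k - ξ)) 0 :=
    AnalyticAt.fun_comp (analyticAt_csqrt hsb) (by fun_prop)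
  have n3 := csqrt_ne_zero (Complex.slitPlane_ne_zero hsa)
  have n4 := csqrt_ne_zero (Complex.slitPlane_ne_zero hsb)
  refine ⟨fun ξ => -(Complex.exp (Complex.I * ξ * xs.1) * sourceNum k h xs.2 ξ / csqrt (k - ξ) +
        cauchyIntegral (shiftPath η ε) (sourceTerm k h η xs) ξ * K ξ) /
        (2 * Complex.I * csqrt (k + ξ)), ?_, ?_, ?_⟩
  · refine AnalyticAt.div (AnalyticAt.neg (AnalyticAt.add (AnalyticAt.div (by fun_prop) h4 n4)
      (hC.mul hK))) (by fun_prop) (mul_ne_zero (by simp) n3)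
  · have e1 : ∀ᶠ z in 𝓝 (0 : ℂ), kernelQuot k h z ≠ 0 := by
      filter_upwards [eventually_kernelQuot_im_pos hk hh hcrit] with z hz h0
      rw [h0] at hz; simp at hz
    filter_upwards [hKe, mem_nhdsWithin_of_mem_nhds e1, self_mem_nhdsWithin,
      mem_nhdsWithin_of_mem_nhds
        ((isOpen_below (hη.good.shift ε).smooth.continuous).mem_nhds hb)] with z z1 z2 z3 z4
    rw [fHat_of_below z4, z1]
    rw [kernel_eq_sq_mul hk hcrit]
    exact mul_ne_zero (pow_ne_zero 2 z3) z2
  · simp only [mul_zero, zero_mul, Complex.exp_zero, one_mul, hK0, add_zero, sub_zero]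
    have hk' : (k : ℂ) ≠ 0 := by exact_mod_cast hk.ne'
    have hm : mu k 0 ≠ 0 := by rw [mu_zero hk]; exact hk'
    have hkk : csqrt (k : ℂ) * csqrt k = k := by rw [← pow_two, csqrt_sq]
    have hkn : csqrt (k : ℂ) ≠ 0 := csqrt_ne_zero hk'
    rw [neg_div, div_div, mul_left_comm (csqrt (k : ℂ)), hkk, sourceNum, stripSinc_eq hm, mu_zero hk]
    by_cases hy : xs.2 < 0
    · rw [if_neg (not_le.2 hy), if_pos hy, Complex.sin,
        show Complex.I * (k : ℂ) * (2 * h + xs.2) =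
          2 * Complex.I * k * h + Complex.I * k * xs.2 by ring, Complex.exp_add, hcrit, one_mul,
        show -(xs.2 * (k : ℂ)) * Complex.I = -(Complex.I * k * xs.2) by ring,
        show (xs.2 : ℂ) * k * Complex.I = Complex.I * k * xs.2 by ring]
      have hI := Complex.I_ne_zero
      field_simp
      linear_combination (Complex.exp (Complex.I * k * xs.2) -
        Complex.exp (-(Complex.I * k * xs.2))) * Complex.I_sq
    · rw [if_pos (not_lt.1 hy), if_neg hy, kernel, mu_zero hk, hcrit]
      simp

/-- At the origin the extension of f̂⁺ takes the value of the subtracted incident part, so the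
density vanishes there. The denominator has a double zero, hence the pole is simple, and its residue
contains the derivative of the density. -/
theorem hasSimplePole_modalQuot_zero {k h : ℝ} (hk : 0 < k) (hh : 0 < h) {η : ℝ → ℝ}
    (hη : IsAdmissiblePath η) {ε : ℝ} (hε : IsAdmissibleShift k h η ε) {xs : ℝ × ℝ}
    (hxs : -h < xs.2) (hcrit : Complex.exp (2 * Complex.I * k * h) = 1) :
    ∃ d : ℂ, Tendsto (deriv (fHat k h η ε xs)) (𝓝[≠] 0) (𝓝 d) ∧
      HasSimplePole (modalQuot k h η ε xs) 0
        ((d - if xs.2 < 0 then Complex.I * xs.1 * stripSinc k xs.2 0 else 0) /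
          (-(h * Real.cos (h * k) / (2 * k ^ 2)))) := by
  obtain ⟨F, hF, hFe, hF0⟩ := exists_analyticAt_fHat_zero hk hh hη hε hxs hcrit
  have hs := sin_eq_zero_of_critical hcrit
  refine ⟨deriv F 0, ?_, ?_⟩
  · have h1 : deriv (fHat k h η ε xs) =ᶠ[𝓝[≠] 0] deriv F := by
      have := eventually_eventually_nhdsWithin.2 hFe
      filter_upwards [this, self_mem_nhdsWithin] with z hz hz0
      refine Filter.EventuallyEq.deriv_eq ?_
      rwa [(isOpen_compl_singleton (x := (0 : ℂ))).nhdsWithin_eq hz0] at hz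
    exact (hF.deriv.continuousAt.tendsto.mono_left nhdsWithin_le_nhds).congr' h1.symm
  · set P : ℂ → ℂ := fun ξ =>
      if xs.2 < 0 then Complex.exp (Complex.I * ξ * xs.1) * stripSinc k xs.2 ξ else 0 with hP
    have hPan : AnalyticAt ℂ P 0 := analyticAt_incidentPart k xs 0
    have hP0 : P 0 = F 0 := by rw [hF0]; simp [hP]
    have hPd : deriv P 0 = if xs.2 < 0 then Complex.I * xs.1 * stripSinc k xs.2 0 else 0 := by
      simp only [hP]
      split_ifs with hy
      · have h1 : HasDerivAt (fun ξ : ℂ => Complex.exp (Complex.I * ξ * xs.1))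
            (Complex.I * xs.1) 0 := by
          have := (((hasDerivAt_id (0 : ℂ)).const_mul Complex.I).mul_const (xs.1 : ℂ)).cexp
          simpa using this
        -- The function depends on ξ² only.
        have h2 : HasDerivAt (stripSinc k xs.2) 0 0 := by
          have h3 : HasDerivAt (fun ξ : ℂ => (k : ℂ) ^ 2 - ξ ^ 2) 0 0 := by
            have := ((hasDerivAt_id (0 : ℂ)).pow 2).const_sub ((k : ℂ) ^ 2)
            simpa using this
          have h4 := (analyticAt_sincSqrt xs.2 ((k : ℂ) ^ 2 - 0 ^ 2)).differentiableAt.hasDerivAt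
          have := HasDerivAt.comp (0 : ℂ) h4 h3
          rw [mul_zero] at this
          exact this
        have := (h1.mul h2).deriv
        simp only [mul_zero, add_zero] at this
        exact this
      · simp
    have hB : AnalyticAt ℂ (fun z => F z - P z) 0 := hF.sub hPan
    have hd : dslope (fun z => F z - P z) 0 0 =
        deriv F 0 - if xs.2 < 0 then Complex.I * xs.1 * stripSinc k xs.2 0 else 0 := by
      rw [dslope_same, ← hPd]
      exact deriv_fun_sub hF.differentiableAt hPan.differentiableAt
    have hval : -dslope (sincSqrt h) ((k : ℂ) ^ 2) ((k : ℂ) ^ 2 - 0 ^ 2) =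
        -(h * Real.cos (h * k) / (2 * k ^ 2)) := by
      rw [zero_pow two_ne_zero, sub_zero, dslope_same, (hasDerivAt_sincSqrt hk hs).deriv]
    have hcos : Real.cos (h * k) ≠ 0 := by
      intro h0
      have := Real.sin_sq_add_cos_sq (h * k)
      rw [hs, h0] at this
      norm_num at this
    have hne : (-(h * Real.cos (h * k) / (2 * k ^ 2)) : ℂ) ≠ 0 := by
      have : -(h * Real.cos (h * k) / (2 * k ^ 2)) ≠ 0 := by
        have := hk.ne'; have := hh.ne'
        simp [*]
      exact_mod_cast this
    rw [← hval] at hne ⊢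
    rw [← hd]
    refine (HasSimplePole.div (analyticAt_dslope hB)
      (s := fun z => -dslope (sincSqrt h) ((k : ℂ) ^ 2) ((k : ℂ) ^ 2 - z ^ 2))
      (analyticAt_dslope_sincSqrt k h _ 0).neg hne).congr ?_
    filter_upwards [hFe, self_mem_nhdsWithin] with z hz hz0
    have hz0 : z ≠ 0 := hz0
    have h1 : F z - P z = z * dslope (fun z => F z - P z) 0 z := by
      have := sub_smul_dslope (fun z => F z - P z) 0 z
      simp only [hP0, sub_self, sub_zero, smul_eq_mul] at this
      exact this.symm
    rw [modalQuot, modalDensity, hz, stripSinc_eq_sub_mul hk hs (p := 0) (by ring)]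
    change (F z - P z) / _ = _
    rw [h1, sub_zero, add_zero, neg_mul, ← mul_neg, mul_div_mul_left _ _ hz0]

/-! ### The residue theorem between two graphs -/

theorem HasSimplePole.mul_analytic {f g : ℂ → ℂ} {p r : ℂ} (h : HasSimplePole f p r)
    (hg : AnalyticAt ℂ g p) : HasSimplePole (fun z => g z * f z) p (g p * r) := by
  obtain ⟨F, hF, he⟩ := h
  refine ⟨fun z => g z * F z + r * dslope g p z,
    (hg.mul hF).add (analyticAt_const.mul (analyticAt_dslope hg)), ?_⟩
  filter_upwards [he, self_mem_nhdsWithin] with z hz hz0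
  have h1 : z - p ≠ 0 := sub_ne_zero.2 hz0
  rw [hz, dslope_of_ne _ hz0, slope_def_field]
  field_simp
  ring

theorem HasSimplePole.add_analytic {f g : ℂ → ℂ} {p r : ℂ} (h : HasSimplePole f p r)
    (hg : AnalyticAt ℂ g p) : HasSimplePole (fun z => f z + g z) p r := by
  obtain ⟨F, hF, he⟩ := h
  refine ⟨fun z => F z + g z, hF.add hg, ?_⟩
  filter_upwards [he] with z hz
  rw [hz]; ring

theorem limUnder_eq_of_continuousAt {f : ℂ → ℂ} {z : ℂ} (h : ContinuousAt f z) :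
    limUnder (𝓝[≠] z) f = f z :=
  (h.tendsto.mono_left nhdsWithin_le_nhds).limUnder_eq

/-- At a removable singularity the function may carry the arbitrary value of a division by zero.
Replacing every value by the punctured limit repairs this and changes nothing at points of
continuity. -/
theorem analyticAt_limUnder {f : ℂ → ℂ} {q : ℂ} (h : HasSimplePole f q 0) :
    AnalyticAt ℂ (fun z => limUnder (𝓝[≠] z) f) q := by
  obtain ⟨F, hF, he⟩ := h
  simp only [zero_div, add_zero] at he
  refine hF.congr ?_
  have h1 := hF.eventually_analyticAt
  have h2 : ∀ᶠ z in 𝓝 q, f =ᶠ[𝓝[≠] z] F := by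
    have h3 := eventually_eventually_nhdsWithin.2 he
    rw [eventually_nhdsWithin_iff] at h3
    filter_upwards [h3] with z hz
    by_cases hzq : z = q
    · subst hzq; exact he
    · have := hz hzq
      rw [(isOpen_compl_singleton (x := q)).nhdsWithin_eq hzq] at this
      exact mem_nhdsWithin_of_mem_nhds this
  filter_upwards [h1, h2] with z z1 z2
  exact ((z1.continuousAt.tendsto.mono_left nhdsWithin_le_nhds).congr' z2.symm).limUnder_eq.symm

theorem vert_div_of_re_lt {η₁ η₂ : ℝ → ℝ} {p : ℂ} {s : ℝ} (hs : p.re < s) :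
    vert η₁ η₂ (fun z => 1 / (z - p)) s =
      Complex.log (pathPoint η₂ s - p) - Complex.log (pathPoint η₁ s - p) := by
  have hre : ∀ v : ℝ, 0 < ((s : ℂ) + Complex.I * v - p).re := fun v => by simp; linarith
  have hd : ∀ v : ℝ, HasDerivAt (fun v : ℝ => Complex.log ((s : ℂ) + Complex.I * v - p))
      (Complex.I * (1 / ((s : ℂ) + Complex.I * v - p))) v := by
    intro v
    have h1 : HasDerivAt (fun v : ℝ => (s : ℂ) + Complex.I * v - p) Complex.I v := by
      have := (((Complex.ofRealCLM.hasDerivAt (x := v)).const_mul Complex.I).const_add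
        (s : ℂ)).sub_const p
      simpa using this
    exact (h1.clog_real (Or.inl (hre v))).congr_deriv (by rw [mul_one_div])
  rw [vert, ← intervalIntegral.integral_const_mul]
  rw [intervalIntegral.integral_eq_sub_of_hasDerivAt (fun v _ => hd v)]
  · rfl
  · refine Continuous.intervalIntegrable ?_ _ _
    refine continuous_const.mul (continuous_const.div (by fun_prop) fun v h0 => ?_)
    have := hre v
    rw [h0] at this; simp at this

theorem vert_div_of_lt_re {η₁ η₂ : ℝ → ℝ} {p : ℂ} {s : ℝ} (hs : s < p.re) :
    vert η₁ η₂ (fun z => 1 / (z - p)) s =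
      Complex.log (p - pathPoint η₂ s) - Complex.log (p - pathPoint η₁ s) := by
  have hre : ∀ v : ℝ, 0 < (p - ((s : ℂ) + Complex.I * v)).re := fun v => by simp; linarith
  have hd : ∀ v : ℝ, HasDerivAt (fun v : ℝ => Complex.log (p - ((s : ℂ) + Complex.I * v)))
      (Complex.I * (1 / ((s : ℂ) + Complex.I * v - p))) v := by
    intro v
    have h1 : HasDerivAt (fun v : ℝ => p - ((s : ℂ) + Complex.I * v)) (-Complex.I) v := by
      have := (((Complex.ofRealCLM.hasDerivAt (x := v)).const_mul Complex.I).const_add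
        (s : ℂ)).const_sub p
      simpa using this
    exact (h1.clog_real (Or.inl (hre v))).congr_deriv (by
      rw [mul_one_div, ← neg_sub p, div_neg, neg_div])
  rw [vert, ← intervalIntegral.integral_const_mul]
  rw [intervalIntegral.integral_eq_sub_of_hasDerivAt (fun v _ => hd v)]
  · rfl
  · refine Continuous.intervalIntegrable ?_ _ _
    refine continuous_const.mul (continuous_const.div (by fun_prop) fun v h0 => ?_)
    have := hre v
    rw [← neg_sub, h0] at this; simp at this

/-- The two evaluations by logarithms differ by 2πi, since p lies above one graph and below the
other; the remaining logarithms are the vertical integrals at the ends. -/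
theorem integral_graph_sub_pole {η₁ η₂ : ℝ → ℝ} (h₁ : ContDiff ℝ 1 η₁) (h₂ : ContDiff ℝ 1 η₂)
    {a b : ℝ} {p : ℂ} (ha : a < p.re) (hb : p.re < b) (hp₁ : η₁ p.re < p.im)
    (hp₂ : p.im < η₂ p.re) :
    (∫ s in a..b, pathVel η₂ s / (pathPoint η₂ s - p)) -
      (∫ s in a..b, pathVel η₁ s / (pathPoint η₁ s - p)) =
    -(2 * Real.pi * Complex.I) + vert η₁ η₂ (fun z => 1 / (z - p)) b -
      vert η₁ η₂ (fun z => 1 / (z - p)) a := by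
  rw [integral_pathVel_div_of_isAbove h₁ ha hb hp₁, integral_pathVel_div_of_below h₂ ha hb hp₂,
    vert_div_of_re_lt hb, vert_div_of_lt_re ha]
  ring

/-- The residue theorem for the region between two graphs. -/
theorem integral_graph_sub_residues {f : ℂ → ℂ} {η₁ η₂ : ℝ → ℝ} (h₁ : ContDiff ℝ 1 η₁)
    (h₂ : ContDiff ℝ 1 η₂) {a b : ℝ} (hab : a ≤ b) (hle : ∀ s ∈ Set.Icc a b, η₁ s ≤ η₂ s)
    (S : Finset ℂ) (r : ℂ → ℂ)
    (hS : ∀ p ∈ S, a < p.re ∧ p.re < b ∧ η₁ p.re < p.im ∧ p.im < η₂ p.re)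
    (hpole : ∀ ξ : ℂ, ξ.re ∈ Set.Icc a b → η₁ ξ.re ≤ ξ.im → ξ.im ≤ η₂ ξ.re →
      HasSimplePole f ξ (if ξ ∈ S then r ξ else 0))
    (hc₁ : ∀ s ∈ Set.Icc a b, ContinuousAt f (pathPoint η₁ s))
    (hc₂ : ∀ s ∈ Set.Icc a b, ContinuousAt f (pathPoint η₂ s))
    (hca : ∀ v ∈ Set.Icc (η₁ a) (η₂ a), ContinuousAt f (a + Complex.I * v))
    (hcb : ∀ v ∈ Set.Icc (η₁ b) (η₂ b), ContinuousAt f (b + Complex.I * v)) :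
    (∫ s in a..b, f (pathPoint η₂ s) * pathVel η₂ s) -
      (∫ s in a..b, f (pathPoint η₁ s) * pathVel η₁ s) =
    -(2 * Real.pi * Complex.I * ∑ p ∈ S, r p) + vert η₁ η₂ f b - vert η₁ η₂ f a := by
  set Q : ℂ → ℂ := fun z => ∑ p ∈ S, r p * (1 / (z - p)) with hQ
  set g : ℂ → ℂ := fun z => f z - Q z with hg
  -- Subtracting all principal parts leaves only removable singularities, and the limit values make
  -- G analytic in the closed region. Cauchy's theorem handles G, and the principal parts are
  -- integrated one by one.
  set G : ℂ → ℂ := fun z => limUnder (𝓝[≠] z) g with hGdef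
  have hQan : ∀ z, z ∉ S → AnalyticAt ℂ Q z := by
    intro z hz
    have : ∀ p ∈ S, AnalyticAt ℂ (fun z => r p * (1 / (z - p))) z := fun p hp =>
      analyticAt_const.mul (analyticAt_const.div (by fun_prop)
        (sub_ne_zero.2 fun h => hz (h ▸ hp)))
    have h2 := Finset.analyticAt_sum S this
    refine h2.congr (Eventually.of_forall fun w => ?_)
    simp [hQ]
  have hG : ∀ ξ : ℂ, ξ.re ∈ Set.Icc a b → η₁ ξ.re ≤ ξ.im → ξ.im ≤ η₂ ξ.re →
      AnalyticAt ℂ G ξ := by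
    intro ξ e1 e2 e3
    apply analyticAt_limUnder
    have h0 := hpole ξ e1 e2 e3
    by_cases hξ : ξ ∈ S
    · rw [if_pos hξ] at h0
      obtain ⟨F, hF, he⟩ := h0
      have hrest : AnalyticAt ℂ (fun z => ∑ p ∈ S.erase ξ, r p * (1 / (z - p))) ξ := by
        have : ∀ p ∈ S.erase ξ, AnalyticAt ℂ (fun z => r p * (1 / (z - p))) ξ := fun p hp =>
          analyticAt_const.mul (analyticAt_const.div (by fun_prop)
            (sub_ne_zero.2 (Finset.ne_of_mem_erase hp).symm))
        have h2 := Finset.analyticAt_sum _ this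
        refine h2.congr (Eventually.of_forall fun w => ?_)
        simp
      refine ⟨fun z => F z - ∑ p ∈ S.erase ξ, r p * (1 / (z - p)), hF.sub hrest, ?_⟩
      filter_upwards [he] with z hz
      simp only [hg, hQ, hz, zero_div, add_zero]
      rw [← Finset.add_sum_erase S _ hξ]
      ring
    · rw [if_neg hξ] at h0
      have := h0.add_analytic (hQan ξ hξ).neg
      exact this.congr (Eventually.of_forall fun z => by simp [hg, sub_eq_add_neg])
  -- The pole hypothesis concerns punctured neighbourhoods only. The actual values of f on the
  -- contour are recovered from its continuity there.
  have hfG : ∀ z, z ∉ S → ContinuousAt f z → f z = G z + Q z := by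
    intro z hz hf
    have h1 : ContinuousAt g z := hf.sub (hQan z hz).continuousAt
    have h2 : G z = f z - Q z := limUnder_eq_of_continuousAt h1
    rw [h2]; ring
  have hn₁ : ∀ s, pathPoint η₁ s ∉ S := fun s hs => by
    have := (hS _ hs).2.2.1; simp at this
  have hn₂ : ∀ s, pathPoint η₂ s ∉ S := fun s hs => by
    have := (hS _ hs).2.2.2; simp at this
  have hna : ∀ v : ℝ, (a : ℂ) + Complex.I * v ∉ S := fun v hs => by
    have := (hS _ hs).1; simp at this
  have hnb : ∀ v : ℝ, (b : ℂ) + Complex.I * v ∉ S := fun v hs => by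
    have := (hS _ hs).2.1; simp at this
  have hint : ∀ η : ℝ → ℝ, ContDiff ℝ 1 η → (∀ s ∈ Set.Icc a b, ContinuousAt f (pathPoint η s)) →
      (∀ s, pathPoint η s ∉ S) → (∀ s ∈ Set.Icc a b, AnalyticAt ℂ G (pathPoint η s)) →
      IntervalIntegrable (fun s => G (pathPoint η s) * pathVel η s) MeasureTheory.volume a b ∧
      ∫ s in a..b, f (pathPoint η s) * pathVel η s =
        (∫ s in a..b, G (pathPoint η s) * pathVel η s) +
          ∑ p ∈ S, r p * ∫ s in a..b, pathVel η s / (pathPoint η s - p) := by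
    intro η hη hc hn han
    have hi1 : IntervalIntegrable (fun s => G (pathPoint η s) * pathVel η s)
        MeasureTheory.volume a b := by
      refine ContinuousOn.intervalIntegrable (ContinuousOn.mul (fun s hs => ?_)
        (continuous_pathVel hη).continuousOn)
      rw [Set.uIcc_of_le hab] at hs
      exact (ContinuousAt.comp (f := pathPoint η) (han s hs).continuousAt
        (continuous_pathPoint hη.continuous).continuousAt).continuousWithinAt
    have hi2 : ∀ p ∈ S, IntervalIntegrable (fun s => r p * (pathVel η s / (pathPoint η s - p)))
        MeasureTheory.volume a b := by
      intro p hp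
      refine (Continuous.intervalIntegrable ?_ a b).const_mul _
      exact (continuous_pathVel hη).div ((continuous_pathPoint hη.continuous).sub continuous_const)
        fun s => sub_ne_zero.2 fun h0 => hn s (h0 ▸ hp)
    refine ⟨hi1, ?_⟩
    have hsum : IntervalIntegrable (fun s => ∑ p ∈ S, r p * (pathVel η s / (pathPoint η s - p)))
        MeasureTheory.volume a b := by
      have := IntervalIntegrable.sum S hi2
      rwa [Finset.sum_fn] at this
    calc ∫ s in a..b, f (pathPoint η s) * pathVel η s =
        ∫ s in a..b, (G (pathPoint η s) * pathVel η s +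
          ∑ p ∈ S, r p * (pathVel η s / (pathPoint η s - p))) := by
          refine intervalIntegral.integral_congr fun s hs => ?_
          rw [Set.uIcc_of_le hab] at hs
          rw [hfG _ (hn s) (hc s hs), add_mul]
          simp only [hQ, Finset.sum_mul]
          congr 1
          refine Finset.sum_congr rfl fun p _ => ?_
          ring
      _ = _ := by
          rw [intervalIntegral.integral_add hi1 hsum, intervalIntegral.integral_finsetSum hi2]
          simp only [intervalIntegral.integral_const_mul]
  have hvert : ∀ s ∈ Set.Icc a b, (∀ v : ℝ, (s : ℂ) + Complex.I * v ∉ S) →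
      (∀ v ∈ Set.Icc (η₁ s) (η₂ s), ContinuousAt f (s + Complex.I * v)) →
      vert η₁ η₂ f s = vert η₁ η₂ G s + ∑ p ∈ S, r p * vert η₁ η₂ (fun z => 1 / (z - p)) s := by
    intro s hs hn hc
    have hlc : Continuous fun v : ℝ => (s : ℂ) + Complex.I * v := by fun_prop
    have hi1 : IntervalIntegrable (fun v : ℝ => G (s + Complex.I * v)) MeasureTheory.volume
        (η₁ s) (η₂ s) := by
      refine ContinuousOn.intervalIntegrable fun v hv => ?_
      rw [Set.uIcc_of_le (hle s hs)] at hv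
      exact (ContinuousAt.comp (f := fun v : ℝ => (s : ℂ) + Complex.I * v)
        (hG _ (by simpa using hs) (by simpa using hv.1) (by simpa using hv.2)).continuousAt
        hlc.continuousAt).continuousWithinAt
    have hi2 : ∀ p ∈ S, IntervalIntegrable (fun v : ℝ => r p * (1 / ((s : ℂ) + Complex.I * v - p)))
        MeasureTheory.volume (η₁ s) (η₂ s) := by
      intro p hp
      refine (Continuous.intervalIntegrable ?_ _ _).const_mul _
      exact continuous_const.div (hlc.sub continuous_const)
        fun v => sub_ne_zero.2 fun h0 => hn v (h0 ▸ hp)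
    have hsum : IntervalIntegrable (fun v : ℝ => ∑ p ∈ S, r p * (1 / ((s : ℂ) + Complex.I * v - p)))
        MeasureTheory.volume (η₁ s) (η₂ s) := by
      have := IntervalIntegrable.sum S hi2
      rwa [Finset.sum_fn] at this
    have key : ∫ v in (η₁ s)..(η₂ s), f (s + Complex.I * v) =
        ∫ v in (η₁ s)..(η₂ s), (G (s + Complex.I * v) +
          ∑ p ∈ S, r p * (1 / ((s : ℂ) + Complex.I * v - p))) := by
      refine intervalIntegral.integral_congr fun v hv => ?_
      rw [Set.uIcc_of_le (hle s hs)] at hv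
      exact hfG _ (hn v) (hc v hv)
    simp only [vert]
    rw [key, intervalIntegral.integral_add hi1 hsum, intervalIntegral.integral_finsetSum hi2,
      mul_add, Finset.mul_sum]
    congr 1
    refine Finset.sum_congr rfl fun p _ => ?_
    rw [intervalIntegral.integral_const_mul]
    ring
  obtain ⟨j1, e1⟩ := hint η₁ h₁ hc₁ hn₁ fun s hs => hG _ (by simpa using hs) (by simp)
    (by simpa using hle s hs)
  obtain ⟨j2, e2⟩ := hint η₂ h₂ hc₂ hn₂ fun s hs => hG _ (by simpa using hs)
    (by simpa using hle s hs) (by simp)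
  have hgraph := integral_graph_sub (f := G) h₁ h₂ hab fun s hs => Or.inr fun v hv => by
    rw [Set.uIcc_of_le (hle s hs)] at hv
    exact hG _ (by simpa using hs) (by simpa using hv.1) (by simpa using hv.2)
  rw [intervalIntegral.integral_sub j2 j1] at hgraph
  have hpoles : ∑ p ∈ S, r p * (∫ s in a..b, pathVel η₂ s / (pathPoint η₂ s - p)) -
      ∑ p ∈ S, r p * (∫ s in a..b, pathVel η₁ s / (pathPoint η₁ s - p)) =
      -(2 * Real.pi * Complex.I * ∑ p ∈ S, r p) +
        ∑ p ∈ S, r p * vert η₁ η₂ (fun z => 1 / (z - p)) b -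
        ∑ p ∈ S, r p * vert η₁ η₂ (fun z => 1 / (z - p)) a := by
    rw [Finset.mul_sum, ← Finset.sum_neg_distrib, ← Finset.sum_sub_distrib,
      ← Finset.sum_add_distrib, ← Finset.sum_sub_distrib]
    refine Finset.sum_congr rfl fun p hp => ?_
    obtain ⟨i1, i2, i3, i4⟩ := hS p hp
    rw [← mul_sub, integral_graph_sub_pole h₁ h₂ i1 i2 i3 i4]
    ring
  rw [e1, e2, hvert a ⟨le_rfl, hab⟩ hna hca, hvert b ⟨hab, le_rfl⟩ hnb hcb]
  linear_combination hgraph + hpoles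

/-! ### Convergence of the oscillatory integrals -/

theorem integrable_of_mul_sq_le {f : ℝ → ℂ} (hf : Continuous f) {T C : ℝ}
    (h : ∀ s, T ≤ |s| → ‖f s‖ * s ^ 2 ≤ C) : MeasureTheory.Integrable f := by
  set T' := max T 1
  have hi : MeasureTheory.Integrable fun s : ℝ => 4 * C * (1 + ‖s‖) ^ (-2 : ℝ) :=
    (integrable_one_add_norm (E := ℝ) (μ := MeasureTheory.volume) (r := 2) (by simp)).const_mul _
  rw [← MeasureTheory.integrableOn_univ, ← Set.union_compl_self (Set.Icc (-T') T')]
  refine MeasureTheory.IntegrableOn.union (hf.continuousOn.integrableOn_compact isCompact_Icc) ?_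
  refine MeasureTheory.Integrable.mono' hi.integrableOn hf.aestronglyMeasurable ?_
  rw [MeasureTheory.ae_restrict_iff' measurableSet_Icc.compl]
  refine Eventually.of_forall fun s hs => ?_
  have h1 : T' < |s| := by
    by_contra hc
    exact hs (abs_le.1 (not_lt.1 hc))
  have h2 := h s ((le_max_left _ _).trans h1.le)
  have h3 : 1 < |s| := (le_max_right _ _).trans_lt h1
  have h4 : (1 + |s|) ^ 2 ≤ 4 * s ^ 2 := by
    rw [← sq_abs s]; nlinarith
  rw [Real.norm_eq_abs, Real.rpow_neg (by positivity), Real.rpow_two, ← div_eq_mul_inv,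
    le_div_iff₀ (by positivity)]
  calc ‖f s‖ * (1 + |s|) ^ 2 ≤ ‖f s‖ * (4 * s ^ 2) := by gcongr
    _ ≤ _ := by linarith

theorem tendsto_truncatedIntegral {η : ℝ → ℝ} {f : ℂ → ℂ}
    (h : MeasureTheory.Integrable fun s => f (pathPoint η s) * pathVel η s) :
    Tendsto (truncatedIntegral η f) atTop (𝓝 (∫ s, f (pathPoint η s) * pathVel η s)) :=
  MeasureTheory.intervalIntegral_tendsto_integral h tendsto_neg_atTop_atBot tendsto_id

/-- A vertical integral of an exponentially decaying function. -/
theorem norm_vert_le_of_exp {η₁ η₂ : ℝ → ℝ} {f : ℂ → ℂ} {s σ ψ b c : ℝ} (hσ : |σ| = 1) (hc : 0 < c)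
    (hb : 0 ≤ b) (hψ : 0 ≤ ψ) (hη : η₂ s = η₁ s + σ * ψ)
    (hf : ∀ u, 0 ≤ u → u ≤ ψ → ‖f (s + Complex.I * ((η₁ s + σ * u : ℝ) : ℂ))‖ ≤
      b * Real.exp (-(c * u))) : ‖vert η₁ η₂ f s‖ ≤ b / c := by
  have h1 := intervalIntegral.smul_integral_comp_add_mul (a := 0) (b := ψ)
    (fun v : ℝ => f (s + Complex.I * v)) σ (η₁ s)
  rw [mul_zero, add_zero, ← hη] at h1
  rw [vert, norm_mul, Complex.norm_I, one_mul, ← h1, norm_smul, Real.norm_eq_abs, hσ, one_mul]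
  have hi : IntervalIntegrable (fun u : ℝ => b * Real.exp (-(c * u))) MeasureTheory.volume 0 ψ :=
    Continuous.intervalIntegrable (by fun_prop) _ _
  refine (intervalIntegral.norm_integral_le_of_norm_le hψ (Eventually.of_forall fun u hu =>
    hf u hu.1.le hu.2) hi).trans ?_
  have hd : ∀ u ∈ Set.uIcc 0 ψ, HasDerivAt (fun u : ℝ => -(b / c * Real.exp (-(c * u))))
      (b * Real.exp (-(c * u))) u := by
    intro u _
    have := ((((hasDerivAt_id u).const_mul c).neg.exp).const_mul (b / c)).neg
    refine this.congr_deriv ?_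
    simp only [id_eq, mul_one, Pi.neg_apply]
    field_simp
  rw [intervalIntegral.integral_eq_sub_of_hasDerivAt hd hi]
  have : 0 ≤ b / c * Real.exp (-(c * ψ)) := by positivity
  simp only [mul_zero, neg_zero, Real.exp_zero, mul_one]
  linarith

theorem exp_neg_le_inv_sq {x : ℝ} (hx : 0 < x) : Real.exp (-x) ≤ 4 / x ^ 2 := by
  have h1 := Real.add_one_le_exp (x / 2)
  have h2 : Real.exp x = Real.exp (x / 2) ^ 2 := by
    rw [← Real.exp_nat_mul]; congr 1; push_cast; ring
  rw [Real.exp_neg, h2, ← inv_inv (4 / x ^ 2)]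
  refine inv_anti₀ (by positivity) ?_
  rw [inv_div, div_le_iff₀ (by norm_num)]
  nlinarith

/-- A height that vanishes on `[-T, T]` and grows quadratically at infinity. -/
def jordanHeight (T s : ℝ) : ℝ := Real.smoothTransition (s ^ 2 - T ^ 2) * s ^ 2

theorem contDiff_jordanHeight (T : ℝ) : ContDiff ℝ 1 (jordanHeight T) := by
  unfold jordanHeight
  exact (Real.smoothTransition.contDiff.comp (by fun_prop : ContDiff ℝ 1 fun s : ℝ =>
    s ^ 2 - T ^ 2)).mul (by fun_prop)

theorem jordanHeight_nonneg (T s : ℝ) : 0 ≤ jordanHeight T s :=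
  mul_nonneg (Real.smoothTransition.nonneg _) (sq_nonneg s)

theorem jordanHeight_zero {T s : ℝ} (h : |s| ≤ T) : jordanHeight T s = 0 := by
  have : s ^ 2 - T ^ 2 ≤ 0 := by
    rw [← sq_abs s]
    nlinarith [abs_nonneg s]
  rw [jordanHeight, Real.smoothTransition.zero_of_nonpos this, zero_mul]

theorem jordanHeight_large {T s : ℝ} (hT : 0 ≤ T) (h : T + 1 ≤ |s|) : jordanHeight T s = s ^ 2 := by
  have : 1 ≤ s ^ 2 - T ^ 2 := by
    rw [← sq_abs s]
    nlinarith
  rw [jordanHeight, Real.smoothTransition.one_of_one_le this, one_mul]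

/-- Convergence by deformation of the tails of the path into a half plane of decay. -/
theorem pathIntegralConverges_of_decay {η : ℝ → ℝ} (hη : IsGoodPath η) {f : ℂ → ℂ}
    (hc : ∀ s, ContinuousAt f (pathPoint η s)) {T c σ : ℝ} {b : ℝ → ℝ} (hT : 0 ≤ T) (hc0 : 0 < c)
    (hσ : |σ| = 1) (hb0 : ∀ s, 0 ≤ b s) (hbt : Tendsto b atTop (𝓝 0)) (hbb : Tendsto b atBot (𝓝 0))
    (hf : ∀ s u : ℝ, T ≤ |s| → 0 ≤ u →
      AnalyticAt ℂ f (s + Complex.I * ((η s + σ * u : ℝ) : ℂ)) ∧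
      ‖f (s + Complex.I * ((η s + σ * u : ℝ) : ℂ))‖ ≤ b s * Real.exp (-(c * u))) :
    PathIntegralConverges η f := by
  obtain ⟨B, hB⟩ := hη.bounded_deriv
  have hB0 : 0 ≤ B := (abs_nonneg _).trans (hB 0)
  -- Bending the tails by s² makes the integrand O(e^{-cs²}), which outweighs the velocity O(|s|).
  -- The vertical sides cost at most b(s)/c, and this tends to 0 without any integrability of b.
  set η₂ : ℝ → ℝ := fun s => η s + σ * jordanHeight T s with hη₂
  have h₂ : ContDiff ℝ 1 η₂ := hη.smooth.add (contDiff_const.mul (contDiff_jordanHeight T))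
  have hσ2 : σ * σ = 1 := by
    rw [← abs_mul_abs_self, hσ, one_mul]
  have hbet : ∀ s v, v ∈ Set.uIcc (η s) (η₂ s) → ∃ u, 0 ≤ u ∧ v = η s + σ * u := by
    intro s v hv
    have hJ := jordanHeight_nonneg T s
    refine ⟨σ * (v - η s), ?_, by linear_combination (η s - v) * hσ2⟩
    rcases (abs_eq zero_le_one).1 hσ with h | h
    · rw [h] at hη₂ ⊢
      rw [hη₂, Set.uIcc_of_le (by linarith)] at hv
      linarith [hv.1]
    · rw [h] at hη₂ ⊢
      rw [hη₂, Set.uIcc_of_ge (by linarith)] at hv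
      linarith [hv.2]
  have hmid : ∀ s, |s| < T → η =ᶠ[𝓝 s] η₂ := by
    intro s hs
    have : {x : ℝ | |x| < T} ∈ 𝓝 s := (isOpen_lt (by fun_prop) continuous_const).mem_nhds hs
    filter_upwards [this] with x hx
    simp only [hη₂]
    rw [jordanHeight_zero (le_of_lt hx), mul_zero, add_zero]
  have hc₂ : ∀ s, ContinuousAt f (pathPoint η₂ s) := by
    intro s
    rcases lt_or_ge |s| T with hs | hs
    · rw [← pathPoint_congr (hmid s hs).eq_of_nhds]; exact hc s
    · exact (hf s (jordanHeight T s) hs (jordanHeight_nonneg T s)).1.continuousAt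
  have hcont : ∀ η : ℝ → ℝ, ContDiff ℝ 1 η → (∀ s, ContinuousAt f (pathPoint η s)) →
      Continuous fun s => f (pathPoint η s) * pathVel η s := by
    intro η hη hc
    refine Continuous.mul (continuous_iff_continuousAt.2 fun s => ?_) (continuous_pathVel hη)
    exact ContinuousAt.comp (f := pathPoint η) (hc s) (continuous_pathPoint hη.continuous).continuousAt
  have hcf := hcont η hη.smooth hc
  have hcf₂ := hcont η₂ h₂ hc₂
  obtain ⟨T₁, hT₁⟩ : ∃ T₁, ∀ s, T₁ ≤ |s| → b s ≤ 1 := by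
    obtain ⟨a₁, h1⟩ := eventually_atTop.1 (hbt.eventually (gt_mem_nhds one_pos))
    obtain ⟨a₂, h2⟩ := eventually_atBot.1 (hbb.eventually (gt_mem_nhds one_pos))
    refine ⟨max a₁ (-a₂), fun s hs => ?_⟩
    rcases le_abs.1 hs with h | h
    · exact (h1 s ((le_max_left _ _).trans h)).le
    · exact (h2 s (by linarith [le_max_right a₁ (-a₂)])).le
  have hint : MeasureTheory.Integrable fun s => f (pathPoint η₂ s) * pathVel η₂ s := by
    refine integrable_of_mul_sq_le hcf₂ (T := max T₁ (T + 2)) (C := 4 * (3 + B) / c ^ 2)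
      fun s hs => ?_
    have hs1 : T + 2 ≤ |s| := (le_max_right _ _).trans hs
    have hJ := jordanHeight_large (T := T) (s := s) hT (by linarith)
    have hd : deriv η₂ s = deriv η s + σ * (2 * s) := by
      have h1 : jordanHeight T =ᶠ[𝓝 s] fun x => x ^ 2 := by
        have : {x : ℝ | T + 1 < |x|} ∈ 𝓝 s :=
          (isOpen_lt continuous_const (by fun_prop)).mem_nhds (by
            change T + 1 < |s|; linarith)
        filter_upwards [this] with x hx
        exact jordanHeight_large hT (le_of_lt hx)
      have h2 : HasDerivAt (jordanHeight T) (2 * s) s := by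
        refine (HasDerivAt.congr_of_eventuallyEq ?_ h1)
        simpa using hasDerivAt_pow 2 s
      exact ((hη.smooth.differentiable one_ne_zero s).hasDerivAt.add (h2.const_mul σ)).deriv
    have e1 := (hf s (jordanHeight T s) (by linarith) (jordanHeight_nonneg T s)).2
    have e2 : ‖pathVel η₂ s‖ ≤ (3 + B) * |s| := by
      refine (norm_pathVel_le _ _).trans ?_
      rw [hd]
      have := abs_add_le (deriv η s) (σ * (2 * s))
      rw [abs_mul, hσ, abs_mul, abs_two] at this
      nlinarith [hB s]
    have e3 := hT₁ s ((le_max_left _ _).trans hs)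
    rw [hJ] at e1
    have hs0 : 0 < |s| := by linarith
    have hs2 : 0 < s ^ 2 := by rw [← sq_abs]; positivity
    have e4 := exp_neg_le_inv_sq (x := c * s ^ 2) (by positivity)
    have e5 : ‖f (pathPoint η₂ s)‖ ≤ 4 / (c * s ^ 2) ^ 2 := by
      have h6 : pathPoint η₂ s = s + Complex.I * ((η s + σ * s ^ 2 : ℝ) : ℂ) := by
        rw [pathPoint]; simp only [hη₂, hJ]
      rw [h6]
      refine e1.trans (le_trans ?_ e4)
      exact mul_le_of_le_one_left (Real.exp_nonneg _) e3
    rw [norm_mul]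
    calc _ ≤ 4 / (c * s ^ 2) ^ 2 * ((3 + B) * |s|) * s ^ 2 := by gcongr
      _ = 4 * (3 + B) / c ^ 2 * (|s| / s ^ 2) := by field_simp
      _ ≤ 4 * (3 + B) / c ^ 2 * 1 := by
        gcongr
        rw [div_le_one hs2, ← sq_abs]
        nlinarith
      _ = _ := mul_one _
  have hvert : ∀ s, T ≤ |s| → ‖vert η η₂ f s‖ ≤ b s / c := fun s hs =>
    norm_vert_le_of_exp hσ hc0 (hb0 s) (jordanHeight_nonneg T s) rfl fun u hu _ => (hf s u hs hu).2
  have hv1 : Tendsto (fun R => vert η η₂ f R) atTop (𝓝 0) := by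
    rw [tendsto_zero_iff_norm_tendsto_zero]
    have h0 : Tendsto (fun R => b R / c) atTop (𝓝 0) := by simpa using hbt.div_const c
    refine squeeze_zero' (Eventually.of_forall fun _ => norm_nonneg _) ?_ h0
    filter_upwards [eventually_ge_atTop T] with R hR using hvert R (hR.trans (le_abs_self R))
  have hv2 : Tendsto (fun R => vert η η₂ f (-R)) atTop (𝓝 0) := by
    rw [tendsto_zero_iff_norm_tendsto_zero]
    have h0 : Tendsto (fun R => b (-R) / c) atTop (𝓝 0) := by
      simpa using (hbb.comp tendsto_neg_atTop_atBot).div_const c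
    refine squeeze_zero' (Eventually.of_forall fun _ => norm_nonneg _) ?_ h0
    filter_upwards [eventually_ge_atTop T] with R hR
    exact hvert (-R) (by rw [abs_neg]; exact hR.trans (le_abs_self R))
  refine ⟨_, ((tendsto_truncatedIntegral hint).sub (hv1.sub hv2)).congr' ?_⟩
  filter_upwards [eventually_ge_atTop 0] with R hR
  have hg := integral_graph_sub (f := f) (a := -R) (b := R) hη.smooth h₂ (by linarith) fun s _ => by
    rcases lt_or_ge |s| T with hs | hs
    · exact Or.inl (hmid s hs)
    · refine Or.inr fun v hv => ?_
      obtain ⟨u, hu, rfl⟩ := hbet s v hv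
      exact (hf s u hs hu).1
  rw [intervalIntegral.integral_sub (hcf₂.intervalIntegrable _ _) (hcf.intervalIntegrable _ _)] at hg
  unfold truncatedIntegral
  linear_combination hg

/-! ### The integrands in terms of entire functions -/

theorem mode_ratio_eq {k h : ℝ} {ξ : ℂ} (x : ℝ) :
    (Complex.exp (-(Complex.I * mu k ξ * x)) - Complex.exp (Complex.I * mu k ξ * (x + 2 * h))) /
      kernel k h ξ = Complex.sin (mu k ξ * (h + x)) / Complex.sin (mu k ξ * h) := by
  have h1 := exp_sub_exp_eq_sin (mu k ξ) h x
  have h2 : Complex.exp (-(Complex.I * mu k ξ * x)) -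
      Complex.exp (Complex.I * mu k ξ * (x + 2 * h)) =
      -(2 * Complex.I * Complex.exp (Complex.I * mu k ξ * h) * Complex.sin (mu k ξ * (h + x))) := by
    rw [← h1, add_comm (x : ℂ)]; ring
  rw [h2, kernel_eq_sin, neg_div_neg_eq, mul_div_mul_left _ _ (by simp [Complex.exp_ne_zero])]

theorem sin_ratio_eq_stripSinc {k h : ℝ} {ξ : ℂ} (hm : mu k ξ ≠ 0) (x : ℝ) :
    Complex.sin (mu k ξ * (h + x)) / Complex.sin (mu k ξ * h) =
      stripSinc k (h + x) ξ / stripSinc k h ξ := by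
  rw [stripSinc_eq hm, stripSinc_eq hm, div_div_div_cancel_right₀ hm, mul_comm (mu k ξ),
    mul_comm (mu k ξ)]
  push_cast
  rfl

theorem scatteredIntegrand_eq {k h : ℝ} {η : ℝ → ℝ} {ε : ℝ} {xs x : ℝ × ℝ} {ξ : ℂ}
    (hK : kernel k h ξ ≠ 0) :
    scatteredIntegrand k h η ε xs x ξ =
      (1 / (2 * Real.pi)) * fHat k h η ε xs ξ * (stripSinc k (h + x.2) ξ / stripSinc k h ξ) *
        Complex.exp (-(Complex.I * ξ * x.1)) := by
  rw [scatteredIntegrand, mode_ratio_eq, sin_ratio_eq_stripSinc (mu_ne_zero_of_kernel hK)]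

/-- Without the distinction of cases this is the one-dimensional Dirichlet Green function of the
strip, up to a constant: a product of sines in the smaller and the larger of the two heights. In
this form it has no branch cuts, and its decay in the distance of the heights is visible. -/
theorem incident_bracket_eq {k h : ℝ} {ξ : ℂ} (hK : kernel k h ξ ≠ 0) (x y : ℝ) :
    (Complex.exp (Complex.I * mu k ξ * |x - y|) - Complex.exp (Complex.I * mu k ξ * (x - y))) /
      (-(4 * Complex.I * Real.pi * mu k ξ)) +
    (Complex.exp (Complex.I * mu k ξ * (2 * h + y)) - Complex.exp (-(Complex.I * mu k ξ * y))) *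
      (Complex.exp (-(Complex.I * mu k ξ * x)) - Complex.exp (Complex.I * mu k ξ * x)) /
      (-(4 * Complex.I * Real.pi * kernel k h ξ * mu k ξ)) =
    -(1 / (2 * Real.pi)) * (stripSinc k (h + min x y) ξ * stripSinc k (max x y) ξ /
      stripSinc k h ξ) := by
  have hm := mu_ne_zero_of_kernel hK
  have hsin := sin_ne_zero_of_kernel hK
  have hπ : (Real.pi : ℂ) ≠ 0 := by exact_mod_cast Real.pi_ne_zero
  have hI := Complex.I_ne_zero
  have he : ∀ w : ℂ, Complex.exp (-w) - Complex.exp w = 2 * Complex.I * Complex.sin (Complex.I * w) := by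
    intro w
    rw [Complex.sin, show -(Complex.I * w) * Complex.I = w by linear_combination -w * Complex.I_sq,
      show Complex.I * w * Complex.I = -w by linear_combination w * Complex.I_sq]
    linear_combination (-Complex.exp w + Complex.exp (-w)) * Complex.I_sq
  have hx : Complex.exp (-(Complex.I * mu k ξ * x)) - Complex.exp (Complex.I * mu k ξ * x) =
      -(2 * Complex.I * Complex.sin (mu k ξ * x)) := by
    rw [he, ← mul_neg, ← Complex.sin_neg]
    congr 2
    linear_combination mu k ξ * x * Complex.I_sq
  have h2 : (Complex.exp (Complex.I * mu k ξ * (2 * h + y)) -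
        Complex.exp (-(Complex.I * mu k ξ * y))) *
      (Complex.exp (-(Complex.I * mu k ξ * x)) - Complex.exp (Complex.I * mu k ξ * x)) /
      (-(4 * Complex.I * Real.pi * kernel k h ξ * mu k ξ)) =
      -(Complex.sin (mu k ξ * (h + y)) * Complex.sin (mu k ξ * x)) /
        (2 * Real.pi * mu k ξ * Complex.sin (mu k ξ * h)) := by
    rw [exp_sub_exp_eq_sin, hx, kernel_eq_sin]
    have := Complex.exp_ne_zero (Complex.I * mu k ξ * h)
    field_simp
    ring
  rw [h2, stripSinc_eq hm, stripSinc_eq hm, stripSinc_eq hm]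
  push_cast
  rw [mul_comm ((h : ℂ) + _) (mu k ξ), mul_comm (h : ℂ) (mu k ξ)]
  rcases le_total y x with hxy | hxy
  · rw [abs_of_nonneg (sub_nonneg.2 hxy), min_eq_right hxy, max_eq_left hxy,
      mul_comm (x : ℂ) (mu k ξ)]
    push_cast
    rw [sub_self, zero_div, zero_add]
    field_simp
  · rw [abs_of_nonpos (sub_nonpos.2 hxy), min_eq_left hxy, max_eq_right hxy,
      mul_comm (y : ℂ) (mu k ξ)]
    have h3 : Complex.exp (Complex.I * mu k ξ * ((-(x - y) : ℝ) : ℂ)) -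
        Complex.exp (Complex.I * mu k ξ * (x - y)) =
        -(2 * Complex.I * Complex.sin (mu k ξ * (x - y))) := by
      rw [show Complex.I * mu k ξ * ((-(x - y) : ℝ) : ℂ) = -(Complex.I * mu k ξ * (x - y)) by
        push_cast; ring, he, ← mul_neg, ← Complex.sin_neg]
      congr 2
      linear_combination mu k ξ * (x - y) * Complex.I_sq
    rw [h3]
    -- This product identity absorbs the direct wave, which is present only when the observer is
    -- below the source.
    have h4 : Complex.sin (mu k ξ * (h + y)) * Complex.sin (mu k ξ * x) -
        Complex.sin (mu k ξ * (x - y)) * Complex.sin (mu k ξ * h) =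
        Complex.sin (mu k ξ * (h + x)) * Complex.sin (mu k ξ * y) := by
      rw [mul_add, mul_sub, mul_add, Complex.sin_add, Complex.sin_add, Complex.sin_sub]
      ring
    field_simp
    linear_combination -4 * h4

theorem incidentIntegrand_eq {k h : ℝ} {xs x : ℝ × ℝ} {ξ : ℂ} (hK : kernel k h ξ ≠ 0) :
    incidentIntegrand k h xs x ξ =
      -(1 / (2 * Real.pi)) * (stripSinc k (h + min x.2 xs.2) ξ * stripSinc k (max x.2 xs.2) ξ /
        stripSinc k h ξ) * Complex.exp (-(Complex.I * ξ * (x.1 - xs.1))) := by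
  rw [incidentIntegrand, incident_bracket_eq hK]

/-! ### Analyticity of the integrands -/

/-- At a zero ξ² = k² - μ_n² is real and at most k². A nonzero real part forces ξ to be real, with
|ξ| ≤ k. The argument also covers points on the cuts. -/
theorem kernel_ne_zero_of_lt_abs_re {k h : ℝ} (hk : 0 < k) (hh : 0 < h) {ξ : ℂ}
    (hξ : k < |ξ.re|) : kernel k h ξ ≠ 0 := by
  intro h0
  obtain ⟨n, hn⟩ := (kernel_eq_zero_iff hh ξ).1 h0
  have h1 := mu_sq k ξ
  rw [hn] at h1
  have hre : modeMu h n ^ 2 = k ^ 2 - (ξ.re ^ 2 - ξ.im ^ 2) := by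
    have := congrArg Complex.re h1
    rw [← Complex.ofReal_pow, ← Complex.ofReal_pow] at this
    simpa [pow_two] using this
  have him : ξ.re * ξ.im = 0 := by
    have := congrArg Complex.im h1
    rw [← Complex.ofReal_pow, ← Complex.ofReal_pow] at this
    simp only [Complex.sub_im, Complex.ofReal_im, pow_two, Complex.mul_im] at this
    linarith
  have hr : ξ.re ≠ 0 := by
    intro h2; rw [h2, abs_zero] at hξ; linarith
  rw [(mul_eq_zero.1 him).resolve_left hr] at hre
  have := pow_lt_pow_left₀ hξ hk.le two_ne_zero
  rw [sq_abs] at this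
  nlinarith [sq_nonneg (modeMu h n)]

theorem eventually_kernel_ne_zero {k h : ℝ} (hk : 0 < k) (hh : 0 < h) {ξ : ℂ}
    (hξ : k < |ξ.re| ∨ OffCuts k ξ ∧ kernel k h ξ ≠ 0) : ∀ᶠ z in 𝓝 ξ, kernel k h z ≠ 0 := by
  rcases hξ with h1 | h1
  · filter_upwards [(isOpen_lt continuous_const Complex.continuous_re.abs).mem_nhds h1] with z hz
    exact kernel_ne_zero_of_lt_abs_re hk hh hz
  · exact (analyticAt_kernel hk h1.1).continuousAt.eventually_ne h1.2

theorem analyticAt_scatteredIntegrand {k h : ℝ} {η : ℝ → ℝ} {ε : ℝ} {xs : ℝ × ℝ} (x : ℝ × ℝ)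
    {ξ : ℂ} (hf : AnalyticAt ℂ (fHat k h η ε xs) ξ) (hK : ∀ᶠ z in 𝓝 ξ, kernel k h z ≠ 0) :
    AnalyticAt ℂ (scatteredIntegrand k h η ε xs x) ξ := by
  have h1 : AnalyticAt ℂ (fun ξ => stripSinc k (h + x.2) ξ / stripSinc k h ξ) ξ :=
    (analyticAt_stripSinc _ _ ξ).div (analyticAt_stripSinc _ _ ξ)
      (stripSinc_ne_zero_of_kernel hK.self_of_nhds)
  have h2 : AnalyticAt ℂ (fun ξ => (1 / (2 * Real.pi)) * fHat k h η ε xs ξ *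
      (stripSinc k (h + x.2) ξ / stripSinc k h ξ) * Complex.exp (-(Complex.I * ξ * x.1))) ξ := by
    fun_prop
  refine h2.congr ?_
  filter_upwards [hK] with z hz using (scatteredIntegrand_eq hz).symm

theorem analyticAt_incidentIntegrand {k h : ℝ} (xs x : ℝ × ℝ) {ξ : ℂ}
    (hK : ∀ᶠ z in 𝓝 ξ, kernel k h z ≠ 0) :
    AnalyticAt ℂ (incidentIntegrand k h xs x) ξ := by
  have h1 : AnalyticAt ℂ (fun ξ => stripSinc k (h + min x.2 xs.2) ξ * stripSinc k (max x.2 xs.2) ξ /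
      stripSinc k h ξ) ξ :=
    ((analyticAt_stripSinc _ _ ξ).mul (analyticAt_stripSinc _ _ ξ)).div (analyticAt_stripSinc _ _ ξ)
      (stripSinc_ne_zero_of_kernel hK.self_of_nhds)
  have h2 : AnalyticAt ℂ (fun ξ => -(1 / (2 * Real.pi)) *
      (stripSinc k (h + min x.2 xs.2) ξ * stripSinc k (max x.2 xs.2) ξ / stripSinc k h ξ) *
        Complex.exp (-(Complex.I * ξ * (x.1 - xs.1)))) ξ := by
    fun_prop
  refine h2.congr ?_
  filter_upwards [hK] with z hz using (incidentIntegrand_eq hz).symm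

theorem offCuts_of_isOn_left {k h : ℝ} {η : ℝ → ℝ} (hη : IsAdmissiblePath η)
    {ε : ℝ} (hε : IsAdmissibleShift k h η ε) (s : ℝ) :
    OffCuts k (pathPoint (shiftPath η (-ε)) s) := by
  by_cases h0 : s + ε = 0
  · right
    rw [pathPoint_re, show s = -ε by linarith, abs_neg, abs_of_nonneg hε.nonneg]
    exact hε.lt_k
  · left
    rw [pathPoint_im, shiftPath, sub_neg_eq_add]
    intro hc
    have := hη.mul_neg h0
    rw [hc, mul_zero] at this
    exact lt_irrefl _ this

theorem eventually_kernel_ne_zero_left {k h : ℝ} (hk : 0 < k) (hh : 0 < h) {η : ℝ → ℝ}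
    (hη : IsAdmissiblePath η) {ε : ℝ} (hε : IsAdmissibleShift k h η ε) (s : ℝ) :
    ∀ᶠ z in 𝓝 (pathPoint (shiftPath η (-ε)) s), kernel k h z ≠ 0 :=
  eventually_kernel_ne_zero hk hh
    (Or.inr ⟨offCuts_of_isOn_left hη hε s, hε.kernel_left_ne_zero s⟩)

theorem analyticAt_fHat_left {k h : ℝ} (hk : 0 < k) (hh : 0 < h) {η : ℝ → ℝ}
    (hη : IsAdmissiblePath η) {ε : ℝ} (hε : IsAdmissibleShift k h η ε) {xs : ℝ × ℝ}
    (hxs : -h < xs.2) (s : ℝ) :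
    AnalyticAt ℂ (fHat k h η ε xs) (pathPoint (shiftPath η (-ε)) s) :=
  analyticAt_fHat_of_mem hk hh hη hε hxs (by simp) fun _ => hε.kernel_left_ne_zero s

/-! ### Bounds of the integrands -/

theorem norm_exp_neg_I_mul_mul (ξ : ℂ) (x : ℝ) :
    ‖Complex.exp (-(Complex.I * ξ * x))‖ = Real.exp (ξ.im * x) := by
  rw [show -(Complex.I * ξ * x) = Complex.I * -(ξ * x) by ring, norm_exp_I_mul, Complex.neg_im,
    neg_neg, Complex.im_mul_ofReal]

/-- Beyond this abscissa the sine quotients are bounded. -/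
def tailAbscissa (k h : ℝ) : ℝ := max (2 * k + 1) (2 / h)

theorem tailAbscissa_pos {k h : ℝ} (hk : 0 < k) : 0 < tailAbscissa k h :=
  lt_of_lt_of_le (by positivity) (le_max_left _ _)

theorem tail_facts {k h : ℝ} (hk : 0 < k) (hh : 0 < h) {ξ : ℂ} (hξ : tailAbscissa k h ≤ |ξ.re|) :
    k < |ξ.re| ∧ 1 ≤ |ξ.re| ∧ |ξ.re| / 2 ≤ |(mu k ξ).im| ∧ 1 ≤ h * |(mu k ξ).im| := by
  have r1 : 2 * k + 1 ≤ |ξ.re| := (le_max_left _ _).trans hξ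
  have r2 : 2 / h ≤ |ξ.re| := (le_max_right _ _).trans hξ
  have hmu := half_abs_re_le_mu_im hk (ξ := ξ) (by linarith)
  refine ⟨by linarith, by linarith, hmu, ?_⟩
  rw [div_le_iff₀ hh] at r2
  nlinarith

theorem norm_scatteredIntegrand_le {k h : ℝ} (hk : 0 < k) (hh : 0 < h) {η : ℝ → ℝ} {ε : ℝ}
    {xs x : ℝ × ℝ} (hx : x.2 ∈ Set.Icc (-h) 0) {ξ : ℂ} (hξ : tailAbscissa k h ≤ |ξ.re|) :
    ‖scatteredIntegrand k h η ε xs x ξ‖ ≤ ‖fHat k h η ε xs ξ‖ * Real.exp (ξ.im * x.1) := by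
  obtain ⟨h1, h2, h3, h4⟩ := tail_facts hk hh hξ
  have hK := kernel_ne_zero_of_lt_abs_re hk hh h1
  rw [scatteredIntegrand, mode_ratio_eq, norm_mul, norm_mul, norm_mul, norm_exp_neg_I_mul_mul]
  have h5 := norm_sin_ratio_le' (m := mu k ξ) (a := h + x.2) (by linarith [hx.1]) (by linarith [hx.2])
    h4 hh
  push_cast at h5
  -- The factor 1/4 compensates the constant 4 in the bound of the sine quotient.
  have h6 : ‖(1 / (2 * Real.pi) : ℂ)‖ ≤ 1 / 4 := by
    rw [norm_div, norm_mul, Complex.norm_real, Real.norm_of_nonneg Real.pi_pos.le]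
    simp only [norm_one, Complex.norm_ofNat]
    have := Real.two_le_pi
    rw [div_le_div_iff₀ (by positivity) (by norm_num)]
    linarith
  gcongr
  calc _ ≤ 1 / 4 * ‖fHat k h η ε xs ξ‖ * 4 := by gcongr
    _ = _ := by ring

theorem norm_incidentIntegrand_le {k h : ℝ} (hk : 0 < k) (hh : 0 < h)
    {xs x : ℝ × ℝ} (hx : x.2 ∈ Set.Icc (-h) 0) (hy : xs.2 ∈ Set.Icc (-h) 0) {ξ : ℂ}
    (hξ : tailAbscissa k h ≤ |ξ.re|) :
    ‖incidentIntegrand k h xs x ξ‖ ≤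
      Real.exp (-(|x.2 - xs.2| * (|ξ.re| / 2))) * (2 / |ξ.re|) * Real.exp (ξ.im * (x.1 - xs.1)) := by
  obtain ⟨h1, h2, h3, h4⟩ := tail_facts hk hh hξ
  have hK := kernel_ne_zero_of_lt_abs_re hk hh h1
  have hm := mu_ne_zero_of_kernel hK
  have h6 : ‖(-(1 / (2 * Real.pi)) : ℂ)‖ ≤ 1 / 4 := by
    rw [norm_neg, norm_div, norm_mul, Complex.norm_real, Real.norm_of_nonneg Real.pi_pos.le]
    simp only [norm_one, Complex.norm_ofNat]
    have := Real.two_le_pi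
    rw [div_le_div_iff₀ (by positivity) (by norm_num)]
    linarith
  have hmax : max x.2 xs.2 ≤ 0 := max_le hx.2 hy.2
  have hmin : -h ≤ min x.2 xs.2 := le_min hx.1 hy.1
  have h5 := norm_sin_ratio_le (m := mu k ξ) (a := h + min x.2 xs.2) (b := -max x.2 xs.2)
    (by linarith) (by linarith) h4 hh
  have h7 : stripSinc k (h + min x.2 xs.2) ξ * stripSinc k (max x.2 xs.2) ξ / stripSinc k h ξ =
      -(Complex.sin (mu k ξ * ((h + min x.2 xs.2 : ℝ) : ℂ)) *
        Complex.sin (mu k ξ * ((-max x.2 xs.2 : ℝ) : ℂ)) / Complex.sin (mu k ξ * h)) / mu k ξ := by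
    rw [stripSinc_eq hm, stripSinc_eq hm, stripSinc_eq hm, Complex.ofReal_neg, mul_neg,
      Complex.sin_neg, mul_comm _ (mu k ξ), mul_comm _ (mu k ξ), mul_comm (h : ℂ) (mu k ξ)]
    have := sin_ne_zero_of_kernel hK
    field_simp
  have h8 : h - (h + min x.2 xs.2) - -max x.2 xs.2 = |x.2 - xs.2| := by
    rw [← max_sub_min_eq_abs']; ring
  rw [h8] at h5
  have h9 : |ξ.re| / 2 ≤ ‖mu k ξ‖ := h3.trans (Complex.abs_im_le_norm _)
  rw [incidentIntegrand_eq hK, h7, norm_mul, norm_mul, norm_div,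
    ← Complex.ofReal_sub, norm_exp_neg_I_mul_mul]
  refine mul_le_mul_of_nonneg_right ?_ (Real.exp_nonneg _)
  have h10 : Real.exp (-(|x.2 - xs.2| * |(mu k ξ).im|)) ≤
      Real.exp (-(|x.2 - xs.2| * (|ξ.re| / 2))) := by
    apply Real.exp_le_exp.2
    have := mul_le_mul_of_nonneg_left h3 (abs_nonneg (x.2 - xs.2))
    linarith
  calc _ ≤ 1 / 4 * (4 * Real.exp (-(|x.2 - xs.2| * (|ξ.re| / 2))) / (|ξ.re| / 2)) := by
        refine mul_le_mul h6 ?_ (by positivity) (by norm_num)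
        rw [norm_neg]
        refine div_le_div₀ (by positivity) (h5.trans ?_) (by linarith) h9
        exact mul_le_mul_of_nonneg_left h10 (by norm_num)
    _ = _ := by field_simp

/-! ### Convergence of the integrals that define the Green function -/

/-- Along the path the decay is only |s|^{-1/2}, but x₁ < 0 makes the integrand decay exponentially
upwards, and f̂⁺ is analytic and bounded by the same rate above the tails. So both tails are bent
upwards. -/
theorem pathIntegralConverges_scattered {k h : ℝ} (hk : 0 < k) (hh : 0 < h) {η : ℝ → ℝ}
    (hη : IsAdmissiblePath η) {ε : ℝ} (hε : IsAdmissibleShift k h η ε) {xs : ℝ × ℝ}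
    (hxs : -h < xs.2) {x : ℝ × ℝ} (hx1 : x.1 < 0) (hx2 : x.2 ∈ Set.Icc (-h) 0) :
    PathIntegralConverges (shiftPath η (-ε)) (scatteredIntegrand k h η ε xs x) := by
  have hε0 := hε.nonneg
  obtain ⟨H, hH⟩ := (hη.good.shift (-ε)).bounded
  obtain ⟨M, T, hM0, hM⟩ := exists_bound_fHat hk hh hη hε hxs (le_max_left 2 H)
  have hH0 : 0 ≤ H := (abs_nonneg _).trans (hH 0)
  have hlim : Tendsto (fun s : ℝ => (1 + s) ^ (-(1 / 2) : ℝ)) atTop (𝓝 0) :=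
    (tendsto_rpow_neg_atTop (by norm_num : (0 : ℝ) < 1 / 2)).comp
      (tendsto_atTop_add_const_left _ 1 tendsto_id)
  have hcst : ∀ l : Filter ℝ, Tendsto (fun s : ℝ => |s|) l atTop →
      Tendsto (fun s => M * (1 + |s|) ^ (-(1 / 2) : ℝ) * Real.exp (-(x.1 * H))) l (𝓝 0) := by
    intro l hl
    have := ((hlim.comp hl).const_mul M).mul_const (Real.exp (-(x.1 * H)))
    simpa using this
  refine pathIntegralConverges_of_decay (hη.good.shift (-ε)) (fun s => ?_)
    (T := max (max T (tailAbscissa k h)) (ε + 1)) (c := -x.1) (σ := 1)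
    (b := fun s => M * (1 + |s|) ^ (-(1 / 2) : ℝ) * Real.exp (-(x.1 * H))) ?_ (by linarith)
    abs_one (fun s => by positivity) (hcst _ tendsto_abs_atTop_atTop)
    (hcst _ tendsto_abs_atBot_atTop) fun s u hs hu => ?_
  · exact (analyticAt_scatteredIntegrand x (analyticAt_fHat_left hk hh hη hε hxs s)
      (eventually_kernel_ne_zero_left hk hh hη hε s)).continuousAt
  · exact le_trans (by linarith) (le_max_right _ (ε + 1))
  · set ξ : ℂ := s + Complex.I * ((shiftPath η (-ε) s + 1 * u : ℝ) : ℂ) with hξ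
    have hre : ξ.re = s := by simp [hξ]
    have him : ξ.im = shiftPath η (-ε) s + u := by simp [hξ]
    have s1 : T ≤ |ξ.re| := by
      rw [hre]; exact ((le_max_left _ _).trans (le_max_left _ _)).trans hs
    have s2 : tailAbscissa k h ≤ |ξ.re| := by
      rw [hre]; exact ((le_max_right _ _).trans (le_max_left _ _)).trans hs
    have s3 : ε + 1 ≤ |ξ.re| := by rw [hre]; exact (le_max_right _ _).trans hs
    have hH' := abs_le.1 (hH s)
    have b1 := hM ξ s1 (fun _ => by
      rw [him]; linarith [le_max_right 2 H]) (fun hneg => by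
        rw [him]
        have : s < -ε := by
          rw [abs_of_neg hneg, hre] at s3; linarith
        linarith [shiftPath_pos hη this])
    constructor
    · refine analyticAt_scatteredIntegrand x ?_
        (eventually_kernel_ne_zero hk hh (Or.inl (tail_facts hk hh s2).1))
      exact analyticAt_fHat_of_mem hk hh hη hε hxs (by rw [hre, him]; linarith)
        fun hc => absurd s3 (by linarith)
    · refine (norm_scatteredIntegrand_le hk hh hx2 s2).trans ?_
      have e1 : Real.exp (ξ.im * x.1) ≤ Real.exp (-(x.1 * H)) * Real.exp (-(-x.1 * u)) := by
        rw [← Real.exp_add, him]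
        apply Real.exp_le_exp.2
        nlinarith [hH'.1]
      rw [hre] at b1
      calc _ ≤ M * (1 + |s|) ^ (-(1 / 2) : ℝ) * (Real.exp (-(x.1 * H)) * Real.exp (-(-x.1 * u))) := by
            gcongr
        _ = _ := by ring

/-- At different heights the integrand decays exponentially in |s| and converges absolutely. At
equal heights only 1/|s| remains, but then x₁ ≠ x₁*, and the tails are bent up or down according to
the sign of x₁ - x₁*; for |Re ξ| > k there are no singularities in either direction. -/
theorem pathIntegralConverges_incident {k h : ℝ} (hk : 0 < k) (hh : 0 < h) {η : ℝ → ℝ}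
    (hη : IsAdmissiblePath η) {ε : ℝ} (hε : IsAdmissibleShift k h η ε) {xs : ℝ × ℝ}
    (hy : xs.2 ∈ Set.Icc (-h) 0) {x : ℝ × ℝ} (hx2 : x.2 ∈ Set.Icc (-h) 0) (hne : x ≠ xs) :
    PathIntegralConverges (shiftPath η (-ε)) (incidentIntegrand k h xs x) := by
  have hgood := hη.good.shift (-ε)
  obtain ⟨H, hH⟩ := hgood.bounded
  obtain ⟨B, hB⟩ := hgood.bounded_deriv
  have hc : ∀ s, ContinuousAt (incidentIntegrand k h xs x) (pathPoint (shiftPath η (-ε)) s) :=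
    fun s => (analyticAt_incidentIntegrand xs x
      (eventually_kernel_ne_zero_left hk hh hη hε s)).continuousAt
  by_cases h2 : x.2 = xs.2
  · have h1 : x.1 - xs.1 ≠ 0 := fun h0 => hne (Prod.ext (by linarith) h2)
    have hcst : ∀ l : Filter ℝ, Tendsto (fun s : ℝ => |s|) l atTop →
        Tendsto (fun s => 2 / |s| * Real.exp (|x.1 - xs.1| * H)) l (𝓝 0) := by
      intro l hl
      have := ((tendsto_const_nhds (x := (2 : ℝ))).div_atTop hl).mul_const
        (Real.exp (|x.1 - xs.1| * H))
      simpa using this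
    obtain ⟨σ, hσ, hσx⟩ : ∃ σ : ℝ, |σ| = 1 ∧ σ * (x.1 - xs.1) = -|x.1 - xs.1| := by
      rcases lt_or_gt_of_ne h1 with h | h
      · exact ⟨1, abs_one, by rw [abs_of_neg h]; ring⟩
      · exact ⟨-1, by simp, by rw [abs_of_pos h]; ring⟩
    refine pathIntegralConverges_of_decay hgood hc
      (T := tailAbscissa k h) (c := |x.1 - xs.1|) (σ := σ)
      (b := fun s => 2 / |s| * Real.exp (|x.1 - xs.1| * H)) (tailAbscissa_pos hk).le
      (abs_pos.2 h1) hσ (fun s => by positivity) (hcst _ tendsto_abs_atTop_atTop)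
      (hcst _ tendsto_abs_atBot_atTop) fun s u hs hu => ?_
    set ξ : ℂ := s + Complex.I * ((shiftPath η (-ε) s + σ * u : ℝ) : ℂ) with hξ
    have hre : ξ.re = s := by simp [hξ]
    have him : ξ.im = shiftPath η (-ε) s + σ * u := by simp [hξ]
    have s2 : tailAbscissa k h ≤ |ξ.re| := by rwa [hre]
    refine ⟨analyticAt_incidentIntegrand xs x
      (eventually_kernel_ne_zero hk hh (Or.inl (tail_facts hk hh s2).1)),
      (norm_incidentIntegrand_le hk hh hx2 hy s2).trans ?_⟩
    have e1 : Real.exp (ξ.im * (x.1 - xs.1)) ≤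
        Real.exp (|x.1 - xs.1| * H) * Real.exp (-(|x.1 - xs.1| * u)) := by
      rw [← Real.exp_add, him]
      apply Real.exp_le_exp.2
      have e2 : shiftPath η (-ε) s * (x.1 - xs.1) ≤ |x.1 - xs.1| * H := by
        refine (le_abs_self _).trans ?_
        rw [abs_mul, mul_comm]
        gcongr
        exact hH s
      have e3 : σ * u * (x.1 - xs.1) = -|x.1 - xs.1| * u := by
        rw [← hσx]; ring
      rw [add_mul, e3]
      linarith
    rw [h2, sub_self, abs_zero, zero_mul, neg_zero, Real.exp_zero, one_mul, hre]
    calc _ ≤ 2 / |s| * (Real.exp (|x.1 - xs.1| * H) * Real.exp (-(|x.1 - xs.1| * u))) := by gcongr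
      _ = _ := by ring
  · refine ⟨_, tendsto_truncatedIntegral (integrable_of_mul_sq_le ?_ (T := tailAbscissa k h)
      (C := 4 / |x.2 - xs.2| * Real.exp (H * |x.1 - xs.1|) * (1 + B)) fun s hs => ?_)⟩
    · refine Continuous.mul (continuous_iff_continuousAt.2 fun s => ?_)
        (continuous_pathVel hgood.smooth)
      exact ContinuousAt.comp (f := pathPoint (shiftPath η (-ε))) (hc s)
        (continuous_pathPoint hgood.smooth.continuous).continuousAt
    · have hs' : tailAbscissa k h ≤ |(pathPoint (shiftPath η (-ε)) s).re| := by simpa using hs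
      have e0 := norm_incidentIntegrand_le hk hh hx2 hy hs'
      have hs1 : 1 ≤ |s| := by simpa using (tail_facts hk hh hs').2.1
      rw [pathPoint_re, pathPoint_im] at e0
      have hδ : 0 < |x.2 - xs.2| := abs_pos.2 (sub_ne_zero.2 h2)
      have e1 : Real.exp (shiftPath η (-ε) s * (x.1 - xs.1)) ≤ Real.exp (H * |x.1 - xs.1|) := by
        apply Real.exp_le_exp.2
        refine (le_abs_self _).trans ?_
        rw [abs_mul]
        gcongr
        exact hH s
      have e2 : ‖pathVel (shiftPath η (-ε)) s‖ ≤ 1 + B :=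
        (norm_pathVel_le _ s).trans (by linarith [hB s])
      have e3 : Real.exp (-(|x.2 - xs.2| * (|s| / 2))) ≤ 2 / (|x.2 - xs.2| * |s|) := by
        have h5 := Real.add_one_le_exp (|x.2 - xs.2| * (|s| / 2))
        rw [Real.exp_neg, ← inv_inv (2 / (|x.2 - xs.2| * |s|))]
        refine inv_anti₀ (by positivity) ?_
        rw [inv_div]
        linarith
      have hB0 : 0 ≤ 1 + B := (norm_nonneg _).trans e2
      rw [norm_mul]
      calc _ ≤ 2 / (|x.2 - xs.2| * |s|) * (2 / |s|) * Real.exp (H * |x.1 - xs.1|) * (1 + B) * s ^ 2 := by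
            gcongr
            exact e0.trans (by gcongr)
        _ = _ := by
            rw [← sq_abs s]
            field_simp
            ring

/-! ### The combined integrand -/

/-- The part of the combined integrand without poles. -/
def directPart (k : ℝ) (xs : ℝ × ℝ) (y : ℝ) (ξ : ℂ) : ℂ :=
  if xs.2 < 0 ∧ xs.2 ≤ y then stripSinc k (y - xs.2) ξ * Complex.exp (Complex.I * ξ * xs.1) else 0

/-- The combined integrand of scattered and incident wave. -/
def totalIntegrand (k h : ℝ) (η : ℝ → ℝ) (ε : ℝ) (xs x : ℝ × ℝ) (ξ : ℂ) : ℂ :=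
  1 / (2 * Real.pi) * Complex.exp (-(Complex.I * ξ * x.1)) * stripSinc k (h + x.2) ξ *
      modalQuot k h η ε xs ξ +
    -(1 / (2 * Real.pi) * Complex.exp (-(Complex.I * ξ * x.1)) * directPart k xs x.2 ξ)

/-- The addition theorem turns the product of sines in the incident wave into the one with observer
factor sin((h+x₂)μ), at the price of an entire term when the observer is not below the source. All
poles then sit in `modalQuot`, which does not depend on x. -/
theorem totalIntegrand_eq {k h : ℝ} {η : ℝ → ℝ} {ε : ℝ} {xs x : ℝ × ℝ} {ξ : ℂ}
    (hK : kernel k h ξ ≠ 0) :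
    totalIntegrand k h η ε xs x ξ = scatteredIntegrand k h η ε xs x ξ +
      if xs.2 < 0 then incidentIntegrand k h xs x ξ else 0 := by
  have h0 := stripSinc_ne_zero_of_kernel hK
  have hm := mu_ne_zero_of_kernel hK
  have hπ : (Real.pi : ℂ) ≠ 0 := by exact_mod_cast Real.pi_ne_zero
  have hexp : Complex.exp (-(Complex.I * ξ * (x.1 - xs.1))) =
      Complex.exp (-(Complex.I * ξ * x.1)) * Complex.exp (Complex.I * ξ * xs.1) := by
    rw [← Complex.exp_add]; congr 1; ring
  rw [scatteredIntegrand_eq hK, incidentIntegrand_eq hK, totalIntegrand, modalQuot, modalDensity,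
    directPart, hexp]
  by_cases hy : xs.2 < 0
  · simp only [hy, true_and, if_true]
    rcases le_or_gt xs.2 x.2 with hxy | hxy
    · have hid : stripSinc k (h + x.2) ξ * stripSinc k xs.2 ξ +
          stripSinc k (x.2 - xs.2) ξ * stripSinc k h ξ =
          stripSinc k (h + xs.2) ξ * stripSinc k x.2 ξ := by
        simp only [stripSinc_eq hm]
        push_cast
        rw [add_mul, add_mul, sub_mul, Complex.sin_add, Complex.sin_add, Complex.sin_sub]
        ring
      rw [if_pos hxy, min_eq_right hxy, max_eq_left hxy]
      field_simp
      linear_combination -Complex.exp (Complex.I * ξ * xs.1) * hid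
    · rw [if_neg (not_le.2 hxy), min_eq_left hxy.le, max_eq_right hxy.le]
      field_simp
      ring
  · simp only [hy, false_and, if_false]
    field_simp
    ring

theorem analyticAt_directPart (k : ℝ) (xs : ℝ × ℝ) (y : ℝ) (ξ : ℂ) :
    AnalyticAt ℂ (directPart k xs y) ξ := by
  unfold directPart
  split_ifs
  · have := analyticAt_stripSinc k (y - xs.2) ξ
    fun_prop
  · exact analyticAt_const

theorem HasSimplePole.totalIntegrand {k h : ℝ} {η : ℝ → ℝ} {ε : ℝ} {xs : ℝ × ℝ} {p r : ℂ}
    (hp : HasSimplePole (modalQuot k h η ε xs) p r) (x : ℝ × ℝ) :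
    HasSimplePole (totalIntegrand k h η ε xs x) p
      (1 / (2 * Real.pi) * Complex.exp (-(Complex.I * p * x.1)) * stripSinc k (h + x.2) p * r) := by
  have h1 := analyticAt_stripSinc k (h + x.2) p
  have h2 := analyticAt_directPart k xs x.2 p
  exact (hp.mul_analytic (g := fun ξ => 1 / (2 * Real.pi) * Complex.exp (-(Complex.I * ξ * x.1)) *
    stripSinc k (h + x.2) ξ) (by fun_prop)).add_analytic (by fun_prop)

theorem analyticAt_totalIntegrand {k h : ℝ} {η : ℝ → ℝ} {ε : ℝ} {xs : ℝ × ℝ} {p : ℂ}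
    (hp : AnalyticAt ℂ (modalQuot k h η ε xs) p) (x : ℝ × ℝ) :
    AnalyticAt ℂ (totalIntegrand k h η ε xs x) p := by
  have h1 := analyticAt_stripSinc k (h + x.2) p
  have h2 := analyticAt_directPart k xs x.2 p
  unfold CrackedHalfPlane.totalIntegrand
  fun_prop

theorem analyticAt_modalQuot {k h : ℝ} (hk : 0 < k) (hh : 0 < h) {η : ℝ → ℝ}
    (hη : IsAdmissiblePath η) {ε : ℝ} (hε : IsAdmissibleShift k h η ε) {xs : ℝ × ℝ}
    (hxs : -h < xs.2) {ξ : ℂ} (hξ : shiftPath η (-ε) ξ.re ≤ ξ.im) (h0 : stripSinc k h ξ ≠ 0) :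
    AnalyticAt ℂ (modalQuot k h η ε xs) ξ :=
  (analyticAt_modalDensity hk hh hη hε hxs hξ fun hre =>
    kernel_ne_zero_of_stripSinc hk (Or.inr (hre.trans_lt hε.lt_k)) h0).div
    (analyticAt_stripSinc k h ξ) h0

/-! ### The residues -/

theorem cos_nat_mul_pi_sq (m : ℕ) : (Real.cos (m * Real.pi) : ℂ) ^ 2 = 1 := by
  have := Real.sin_sq_add_cos_sq (m * Real.pi)
  rw [Real.sin_nat_mul_pi] at this
  exact_mod_cast (by linarith : Real.cos (m * Real.pi) ^ 2 = 1)

theorem stripSinc_modeXi {k h : ℝ} (hk : 0 < k) (hh : 0 < h) {m : ℕ}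
    (hm : m ∈ Finset.Icc 1 (numModes k h)) (a : ℝ) :
    stripSinc k a (modeXi k h m) = Real.sin (modeMu h m * a) / modeMu h m := by
  obtain ⟨h1, h2⟩ := (mem_modes_iff hk hh).1 hm
  have hw := modeMu_pos hh h1
  have hp : (k : ℂ) ^ 2 - (modeXi k h m : ℂ) ^ 2 = (modeMu h m : ℂ) ^ 2 := by
    have := modeXi_sq hh h1 h2
    exact_mod_cast (by linarith : k ^ 2 - modeXi k h m ^ 2 = modeMu h m ^ 2)
  rw [stripSinc, hp, sincSqrt_sq (by exact_mod_cast hw.ne'), mul_comm]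
  push_cast
  rfl

theorem sin_modeMu_mul_add {h : ℝ} (hh : 0 < h) (m : ℕ) (y : ℝ) :
    Real.sin (modeMu h m * (h + y)) = Real.cos (m * Real.pi) * Real.sin (modeMu h m * y) := by
  rw [mul_add, mul_comm _ h, Real.sin_add, sin_modeMu h hh, cos_modeMu h hh]
  ring

theorem injOn_modeXi {k h : ℝ} (hk : 0 < k) (hh : 0 < h) :
    Set.InjOn (fun m : ℕ => (modeXi k h m : ℂ)) (Finset.Icc 1 (numModes k h)) := by
  intro m hm n hn hmn
  obtain ⟨m1, m2⟩ := (mem_modes_iff hk hh).1 (Finset.mem_coe.1 hm)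
  obtain ⟨n1, n2⟩ := (mem_modes_iff hk hh).1 (Finset.mem_coe.1 hn)
  have h1 : modeXi k h m = modeXi k h n := Complex.ofReal_injective hmn
  have h2 := modeXi_sq hh m1 m2
  have h3 := modeXi_sq hh n1 n2
  have m3 := modeMu_pos hh m1
  have n3 := modeMu_pos hh n1
  have h4 : modeMu h m = modeMu h n := by
    rw [← sq_eq_sq₀ m3.le n3.le]
    rw [h1] at h2
    linarith
  rw [modeMu, modeMu, div_left_inj' hh.ne', mul_left_inj' Real.pi_ne_zero] at h4
  exact_mod_cast h4

/-- The factor i cos(mπ)/μ_m is what 2πi times the residue of the integrand contributes besides r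
and the mode: sin(μ_m(h+x₂)) = cos(mπ) sin(μ_m x₂). As cos²(mπ) = 1, the sign cancels against the
one in the derivative of the denominator. -/
theorem exists_residue_modalQuot {k h : ℝ} (hk : 0 < k) (hh : 0 < h) {η : ℝ → ℝ}
    (hη : IsAdmissiblePath η) {ε : ℝ} (hε : IsAdmissibleShift k h η ε) {xs : ℝ × ℝ}
    (hxs : -h < xs.2) {m : ℕ} (hm : m ∈ Finset.Icc 1 (numModes k h)) :
    ∃ r : ℂ, HasSimplePole (modalQuot k h η ε xs) (modeXi k h m) r ∧
      (0 < modeXi k h m → Complex.I * Real.cos (m * Real.pi) / modeMu h m * r =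
        modeMu h m / (Complex.I * h * modeXi k h m) * fHat k h η ε xs (modeXi k h m) +
          if xs.2 < 0 then
            Complex.I / (h * modeXi k h m) * Real.sin (modeMu h m * xs.2) *
              Complex.exp (Complex.I * modeXi k h m * xs.1)
          else 0) ∧
      (modeXi k h m = 0 → Tendsto
          (fun ξ : ℂ => 2 * modeMu h m / (Complex.I * h) * deriv (fHat k h η ε xs) ξ -
            if xs.2 < 0 then (2 / h * xs.1 * Real.sin (modeMu h m * xs.2) : ℂ) else 0)
          (𝓝[≠] (0 : ℂ)) (𝓝 (Complex.I * Real.cos (m * Real.pi) / modeMu h m * r))) := by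
  have hw := modeMu_pos hh ((mem_modes_iff hk hh).1 hm).1
  have hw' : (modeMu h m : ℂ) ≠ 0 := by exact_mod_cast hw.ne'
  have hh' : (h : ℂ) ≠ 0 := by exact_mod_cast hh.ne'
  have hI := Complex.I_ne_zero
  have hc2 := cos_nat_mul_pi_sq m
  have hc : (Real.cos (m * Real.pi) : ℂ) ≠ 0 := by
    intro h0; rw [h0] at hc2; norm_num at hc2
  have hnn : 0 ≤ modeXi k h m := Real.sqrt_nonneg _
  rcases hnn.eq_or_lt with h0 | h0
  · obtain ⟨hkm, hcrit⟩ := critical_of_modeXi_eq_zero hk hh hm h0.symm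
    obtain ⟨d, hd, hp⟩ := hasSimplePole_modalQuot_zero hk hh hη hε hxs hcrit
    refine ⟨_, by rw [← h0, Complex.ofReal_zero]; exact hp, fun h1 => absurd h0 h1.ne, fun _ => ?_⟩
    have hsy := stripSinc_modeXi hk hh hm xs.2
    rw [← h0, Complex.ofReal_zero] at hsy
    -- Here k = μ_m. The difference -∫ of the incident part enters only through its derivative at 0,
    -- which is i x₁* sin(x₂*k)/k, and this produces the term in x₁*.
    have hval : Complex.I * Real.cos (m * Real.pi) / modeMu h m *
        ((d - if xs.2 < 0 then Complex.I * xs.1 * stripSinc k xs.2 0 else 0) /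
          (-(h * Real.cos (h * k) / (2 * k ^ 2)))) =
        2 * modeMu h m / (Complex.I * h) * d -
          if xs.2 < 0 then (2 / h * xs.1 * Real.sin (modeMu h m * xs.2) : ℂ) else 0 := by
      have hcos : (Real.cos (h * k) : ℂ) = Real.cos (m * Real.pi) := by
        rw [hkm, cos_modeMu h hh]
      have hkC : (k : ℂ) = modeMu h m := by exact_mod_cast hkm
      rw [hsy, hcos, hkC]
      split_ifs
      · field_simp
        linear_combination (Complex.I * xs.1 * Real.sin (modeMu h m * xs.2) - modeMu h m * d) *
          Complex.I_sq
      · field_simp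
        linear_combination -2 * (modeMu h m : ℂ) * d * Complex.I_sq
    rw [hval]
    exact (hd.const_mul _).sub_const _
  · have hx' : (modeXi k h m : ℂ) ≠ 0 := by exact_mod_cast h0.ne'
    refine ⟨_, hasSimplePole_modalQuot_modeXi hk hh hη hε hxs hm h0, fun _ => ?_,
      fun h1 => absurd h1 h0.ne'⟩
    rw [modalDensity, stripSinc_modeXi hk hh hm]
    split_ifs
    · field_simp
      linear_combination -(modeMu h m : ℂ) * fHat k h η ε xs (modeXi k h m) * Complex.I_sq
    · field_simp
      linear_combination -(modeMu h m : ℂ) * fHat k h η ε xs (modeXi k h m) * Complex.I_sq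

/-! ### The lifted path -/

/-- The height of the upper branch of a hyperbola. -/
def liftedHeight (Y B s : ℝ) : ℝ := Real.sqrt (Y ^ 2 + (B * s) ^ 2)

theorem le_liftedHeight (Y B s : ℝ) : Y ≤ liftedHeight Y B s :=
  Real.le_sqrt_of_sq_le (le_add_of_nonneg_right (sq_nonneg _))

theorem abs_le_liftedHeight (Y B s : ℝ) : |B * s| ≤ liftedHeight Y B s :=
  Real.abs_le_sqrt (le_add_of_nonneg_left (sq_nonneg _))

theorem contDiff_liftedHeight {Y : ℝ} (hY : 0 < Y) (B : ℝ) : ContDiff ℝ 1 (liftedHeight Y B) := by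
  unfold liftedHeight
  exact ContDiff.sqrt (by fun_prop) fun s => (by positivity : 0 < Y ^ 2 + (B * s) ^ 2).ne'

theorem abs_deriv_liftedHeight_le {Y B : ℝ} (hY : 0 < Y) (hB : 0 ≤ B) (s : ℝ) :
    |deriv (liftedHeight Y B) s| ≤ B := by
  have hp : 0 < liftedHeight Y B s := hY.trans_le (le_liftedHeight Y B s)
  have h1 : HasDerivAt (fun s : ℝ => Y ^ 2 + (B * s) ^ 2) (2 * (B * s) * B) s := by
    have := (((hasDerivAt_id s).const_mul B).pow 2).const_add (Y ^ 2)
    exact this.congr_deriv (by simp)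
  have h2 := (h1.sqrt (by positivity : 0 < Y ^ 2 + (B * s) ^ 2).ne').deriv
  change deriv (liftedHeight Y B) s = _ / (2 * liftedHeight Y B s) at h2
  rw [h2, abs_div, abs_of_pos (by linarith : 0 < 2 * liftedHeight Y B s), div_le_iff₀ (by linarith),
    abs_mul, abs_mul, abs_of_nonneg hB, abs_two]
  have := mul_le_mul_of_nonneg_left (abs_le_liftedHeight Y B s) hB
  linarith

/-- The displaced path has height η(ε) ≤ 0 at abscissa 0 and slope at most B, so it stays below
B|s|, which is below the hyperbola. -/
theorem shiftPath_le_liftedHeight {k h : ℝ} {η : ℝ → ℝ} (hη : IsAdmissiblePath η) {ε : ℝ}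
    (hε : IsAdmissibleShift k h η ε) {B : ℝ} (hB : ∀ s, |deriv η s| ≤ B) (Y s : ℝ) :
    shiftPath η (-ε) s ≤ liftedHeight Y B s := by
  have h0 : η ε ≤ 0 := by
    rcases hε.nonneg.eq_or_lt with h1 | h1
    · rw [← h1, hη.zero]
    · exact (hη.neg_of_pos _ h1).le
  have h1 := Convex.norm_image_sub_le_of_norm_deriv_le (f := η) (C := B) (s := Set.univ)
    (fun x _ => (hη.smooth.differentiable (by simp)).differentiableAt) (fun x _ => hB x)
    convex_univ (Set.mem_univ ε) (Set.mem_univ (s + ε))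
  rw [add_sub_cancel_right, Real.norm_eq_abs, Real.norm_eq_abs] at h1
  have hB0 : 0 ≤ B := (abs_nonneg _).trans (hB 0)
  have h2 := abs_le_liftedHeight Y B s
  rw [abs_mul, abs_of_nonneg hB0] at h2
  rw [shiftPath, sub_neg_eq_add]
  linarith [le_abs_self (η (s + ε) - η ε)]

/-- The poles of the evanescent modes are at ±i√(μ_n² - k²). Half of the smallest such square,
attained for the first index beyond `numModes`, leaves room for Y. -/
theorem exists_gap {k h : ℝ} (hk : 0 < k) (hh : 0 < h) :
    ∃ Y : ℝ, 0 < Y ∧ ∀ n : ℕ, k < modeMu h n → k ^ 2 + Y ^ 2 < modeMu h n ^ 2 := by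
  set w := modeMu h (numModes k h + 1) with hw
  have h1 : k < w := by
    by_contra hc
    have := (mem_modes_iff hk hh (n := numModes k h + 1)).2 ⟨by omega, not_lt.1 hc⟩
    rw [Finset.mem_Icc] at this
    omega
  have h2 : 0 < w ^ 2 - k ^ 2 := by nlinarith
  refine ⟨Real.sqrt ((w ^ 2 - k ^ 2) / 2), by positivity, fun n hn => ?_⟩
  rw [Real.sq_sqrt (by positivity)]
  have h3 : numModes k h + 1 ≤ n := by
    by_contra hc
    rcases Nat.eq_zero_or_pos n with h0 | h0
    · rw [h0, modeMu] at hn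
      simp at hn
      linarith
    · have := ((mem_modes_iff hk hh).1 (Finset.mem_Icc.2 ⟨h0, by omega⟩)).2
      linarith
  have h4 : w ≤ modeMu h n := by
    rw [hw, modeMu, modeMu]
    gcongr
  nlinarith

/-! ### Bounds of the combined integrand -/

/-- The sine quotients are bounded in terms of Re ξ alone, so the estimate holds at every height
above the path. The factor with |x₁*| allows for the growth of e^{iξx₁*} in the incident wave. -/
theorem exists_bound_totalIntegrand {k h : ℝ} (hk : 0 < k) (hh : 0 < h) {η : ℝ → ℝ}
    (hη : IsAdmissiblePath η) {ε : ℝ} (hε : IsAdmissibleShift k h η ε) {xs : ℝ × ℝ}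
    (hxs : -h < xs.2) :
    ∃ M T : ℝ, 0 ≤ M ∧ 1 ≤ T ∧ k < T ∧ ∀ x : ℝ × ℝ, x.2 ∈ Set.Icc (-h) 0 → ∀ ξ : ℂ, T ≤ |ξ.re| →
      shiftPath η (-ε) ξ.re ≤ ξ.im →
      ‖totalIntegrand k h η ε xs x ξ‖ ≤
        (M * (1 + |ξ.re|) ^ (-(1 / 2) : ℝ) + 2 / |ξ.re|) *
          Real.exp (|xs.1| * |ξ.im| + ξ.im * x.1) := by
  obtain ⟨H, hH⟩ := (hη.good.shift (-ε)).bounded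
  obtain ⟨M, T, hM0, hM⟩ := exists_bound_fHat hk hh hη hε hxs (le_max_left 2 H)
  refine ⟨M, max (max T (tailAbscissa k h)) (ε + 1), hM0, ?_, ?_, fun x hx ξ hξ him => ?_⟩
  · exact le_trans (by linarith [hε.nonneg]) (le_max_right _ (ε + 1))
  · refine lt_of_lt_of_le ?_ ((le_max_left _ _).trans' (le_max_right _ _))
    exact lt_of_lt_of_le (by linarith) (le_max_left _ _)
  have s1 : T ≤ |ξ.re| := ((le_max_left _ _).trans (le_max_left _ _)).trans hξ
  have s2 : tailAbscissa k h ≤ |ξ.re| := ((le_max_right _ _).trans (le_max_left _ _)).trans hξ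
  have s3 : ε + 1 ≤ |ξ.re| := (le_max_right _ _).trans hξ
  have hH' := abs_le.1 (hH ξ.re)
  have b1 := hM ξ s1 (fun _ => by linarith [le_max_right 2 H]) (fun hneg => by
    rw [abs_of_neg hneg] at s3
    linarith [shiftPath_pos hη (by linarith : ξ.re < -ε)])
  have hK := kernel_ne_zero_of_lt_abs_re hk hh (tail_facts hk hh s2).1
  have hr : 0 < |ξ.re| := (tailAbscissa_pos hk).trans_le s2
  rw [totalIntegrand_eq hK, add_mul]
  refine (norm_add_le _ _).trans (add_le_add ?_ ?_)
  · refine (norm_scatteredIntegrand_le hk hh hx s2).trans (mul_le_mul b1 ?_ (Real.exp_nonneg _)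
      (by positivity))
    exact Real.exp_le_exp.2 (le_add_of_nonneg_left (by positivity))
  · split_ifs with hy
    · refine (norm_incidentIntegrand_le hk hh hx ⟨hxs.le, hy.le⟩ s2).trans ?_
      refine mul_le_mul ?_ ?_ (Real.exp_nonneg _) (by positivity)
      · refine mul_le_of_le_one_left (by positivity) (Real.exp_le_one_iff.2 ?_)
        have : 0 ≤ |x.2 - xs.2| * (|ξ.re| / 2) := by positivity
        linarith
      · apply Real.exp_le_exp.2
        rw [mul_sub, mul_comm |xs.1|, ← abs_mul]
        linarith [neg_abs_le (ξ.im * xs.1)]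
    · rw [norm_zero]; positivity

theorem stripSinc_ne_zero_lifted {k h : ℝ} (hk : 0 < k) (hh : 0 < h) {η : ℝ → ℝ}
    (hη : IsAdmissiblePath η) {ε : ℝ} (hε : IsAdmissibleShift k h η ε) {Y B : ℝ} (hY : 0 < Y)
    (hYn : ∀ n : ℕ, k < modeMu h n → k ^ 2 + Y ^ 2 < modeMu h n ^ 2)
    (hB : ∀ s, |deriv η s| ≤ B) (s : ℝ) :
    stripSinc k h (pathPoint (liftedHeight Y B) s) ≠ 0 := by
  intro h0
  have him : 0 < (pathPoint (liftedHeight Y B) s).im := by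
    rw [pathPoint_im]; exact hY.trans_le (le_liftedHeight Y B s)
  have hmem : pathPoint (liftedHeight Y B) s ∈ sweptRegion η ε Y B :=
    ⟨by simpa using shiftPath_le_liftedHeight hη hε hB Y s, by simp [liftedHeight]⟩
  rcases stripSinc_zero_cases hk hh hη hε hY hYn hmem h0 with ⟨n, _, hn⟩ | h1
  · rw [hn] at him; simp at him
  · linarith [h1.2]

theorem analyticAt_modalQuot_lifted {k h : ℝ} (hk : 0 < k) (hh : 0 < h) {η : ℝ → ℝ}
    (hη : IsAdmissiblePath η) {ε : ℝ} (hε : IsAdmissibleShift k h η ε) {xs : ℝ × ℝ}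
    (hxs : -h < xs.2) {Y B : ℝ} (hY : 0 < Y)
    (hYn : ∀ n : ℕ, k < modeMu h n → k ^ 2 + Y ^ 2 < modeMu h n ^ 2)
    (hB : ∀ s, |deriv η s| ≤ B) (s : ℝ) :
    AnalyticAt ℂ (modalQuot k h η ε xs) (pathPoint (liftedHeight Y B) s) :=
  analyticAt_modalQuot hk hh hη hε hxs (by simpa using shiftPath_le_liftedHeight hη hε hB Y s)
    (stripSinc_ne_zero_lifted hk hh hη hε hY hYn hB s)

theorem norm_stripSinc_le {k h a : ℝ} (ha : |a| ≤ h) {ξ : ℂ} (hm : mu k ξ ≠ 0) :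
    ‖stripSinc k a ξ‖ ≤ Real.exp (h * ‖mu k ξ‖) / ‖mu k ξ‖ := by
  rw [stripSinc_eq hm, norm_div]
  refine div_le_div_of_nonneg_right ((norm_sin_le _).trans (Real.exp_le_exp.2 ?_)) (norm_nonneg _)
  rw [Complex.im_ofReal_mul, abs_mul]
  exact mul_le_mul ha (Complex.abs_im_le_norm _) (abs_nonneg _) ((abs_nonneg a).trans ha)

/-- For large |s| this is the previous bound. On the compact middle part `modalQuot` is bounded, and
x enters only through the exponential and sine factors whose arguments are bounded because the
heights differ by at most h. The constant is therefore independent of x. -/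
theorem exists_bound_totalIntegrand_lifted {k h : ℝ} (hk : 0 < k) (hh : 0 < h) {η : ℝ → ℝ}
    (hη : IsAdmissiblePath η) {ε : ℝ} (hε : IsAdmissibleShift k h η ε) {xs : ℝ × ℝ}
    (hxs : -h < xs.2) {Y B : ℝ} (hY : 0 < Y)
    (hYn : ∀ n : ℕ, k < modeMu h n → k ^ 2 + Y ^ 2 < modeMu h n ^ 2)
    (hB : ∀ s, |deriv η s| ≤ B) :
    ∃ C : ℝ, 0 ≤ C ∧ ∀ x : ℝ × ℝ, x.2 ∈ Set.Icc (-h) 0 → ∀ s : ℝ,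
      ‖totalIntegrand k h η ε xs x (pathPoint (liftedHeight Y B) s)‖ ≤
        C * Real.exp ((|xs.1| + x.1) * liftedHeight Y B s) := by
  obtain ⟨M, T, hM0, hT1, -, hM⟩ := exists_bound_totalIntegrand hk hh hη hε hxs
  have hcV := (contDiff_liftedHeight hY B).continuous
  have hpos : ∀ s, 0 < liftedHeight Y B s := fun s => hY.trans_le (le_liftedHeight Y B s)
  have hoff : ∀ s, OffCuts k (pathPoint (liftedHeight Y B) s) := fun s => by
    left; rw [pathPoint_im]; exact (hpos s).ne'
  have hm : ∀ s, mu k (pathPoint (liftedHeight Y B) s) ≠ 0 := fun s => mu_ne_zero hk (hoff s)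
  have hcp := continuous_pathPoint hcV
  have hcmu : Continuous fun s => mu k (pathPoint (liftedHeight Y B) s) :=
    continuous_iff_continuousAt.2 fun s => ContinuousAt.comp (g := mu k)
      (analyticAt_mu hk (hoff s)).continuousAt hcp.continuousAt
  have hcq : Continuous fun s => modalQuot k h η ε xs (pathPoint (liftedHeight Y B) s) :=
    continuous_iff_continuousAt.2 fun s => ContinuousAt.comp
      (analyticAt_modalQuot_lifted hk hh hη hε hxs hY hYn hB s).continuousAt hcp.continuousAt
  obtain ⟨C, hC⟩ := (isCompact_Icc (a := -T) (b := T)).exists_bound_of_continuousOn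
    (f := fun s => Real.exp (h * ‖mu k (pathPoint (liftedHeight Y B) s)‖) /
      ‖mu k (pathPoint (liftedHeight Y B) s)‖ *
        (‖modalQuot k h η ε xs (pathPoint (liftedHeight Y B) s)‖ + 1))
    (Continuous.continuousOn (Continuous.mul (Continuous.div (by fun_prop) (by fun_prop)
      fun s => norm_ne_zero_iff.2 (hm s)) (by fun_prop)))
  have hC0 : 0 ≤ C := (norm_nonneg _).trans (hC 0 ⟨by linarith, by linarith⟩)
  refine ⟨max C (M + 2), hC0.trans (le_max_left _ _), fun x hx s => ?_⟩
  set ξ := pathPoint (liftedHeight Y B) s with hξ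
  have hre : ξ.re = s := by simp [hξ]
  have him : ξ.im = liftedHeight Y B s := by simp [hξ]
  have hexp : |xs.1| * |ξ.im| + ξ.im * x.1 = (|xs.1| + x.1) * liftedHeight Y B s := by
    rw [him, abs_of_pos (hpos s)]; ring
  rcases le_or_gt T |s| with hs | hs
  · have h1 := hM x hx ξ (by rwa [hre]) (by
      rw [hre, him]; exact shiftPath_le_liftedHeight hη hε hB Y s)
    rw [hexp] at h1
    refine h1.trans (mul_le_mul_of_nonneg_right ?_ (Real.exp_nonneg _))
    rw [hre]
    refine le_trans (add_le_add ?_ ?_) (le_max_right _ _)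
    · refine mul_le_of_le_one_right hM0 (Real.rpow_le_one_of_one_le_of_nonpos ?_ (by norm_num))
      linarith [abs_nonneg s]
    · rw [div_le_iff₀ (by linarith)]; linarith
  · have h1 := hC s (Set.mem_Icc.2 (abs_le.1 hs.le))
    rw [Real.norm_of_nonneg (by positivity)] at h1
    refine le_trans ?_ (mul_le_mul_of_nonneg_right (h1.trans (le_max_left _ _))
      (Real.exp_nonneg _))
    rw [← hξ]
    set E := Real.exp (h * ‖mu k ξ‖) / ‖mu k ξ‖ with hE
    have hE0 : 0 ≤ E := by positivity
    have h6 : ‖(1 / (2 * Real.pi) : ℂ)‖ ≤ 1 := by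
      rw [norm_div, norm_mul, Complex.norm_real, Real.norm_of_nonneg Real.pi_pos.le]
      simp only [norm_one, Complex.norm_ofNat]
      have := Real.two_le_pi
      rw [div_le_one (by positivity)]
      linarith
    have e1 : Real.exp (ξ.im * x.1) ≤ Real.exp ((|xs.1| + x.1) * liftedHeight Y B s) := by
      rw [← hexp]
      exact Real.exp_le_exp.2 (le_add_of_nonneg_left (by positivity))
    have a1 : ‖stripSinc k (h + x.2) ξ‖ ≤ E :=
      norm_stripSinc_le (abs_le.2 ⟨by linarith [hx.1], by linarith [hx.2]⟩) (hm s)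
    have a2 : Real.exp (ξ.im * x.1) * ‖directPart k xs x.2 ξ‖ ≤
        E * Real.exp ((|xs.1| + x.1) * liftedHeight Y B s) := by
      rw [directPart]
      split_ifs with hy
      · rw [norm_mul, mul_left_comm, show Complex.I * ξ * xs.1 = -(Complex.I * ξ * ((-xs.1 : ℝ) : ℂ)) by
          push_cast; ring, norm_exp_neg_I_mul_mul, ← Real.exp_add, ← hexp]
        refine mul_le_mul (norm_stripSinc_le (abs_le.2 ⟨by linarith, by linarith [hx.2]⟩) (hm s))
          (Real.exp_le_exp.2 ?_) (Real.exp_nonneg _) hE0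
        have := neg_abs_le (ξ.im * xs.1)
        rw [mul_comm |xs.1|, ← abs_mul]
        linarith
      · rw [norm_zero, mul_zero]; positivity
    rw [totalIntegrand]
    refine (norm_add_le _ _).trans ?_
    rw [norm_neg, norm_mul, norm_mul, norm_mul, norm_mul, norm_mul, norm_exp_neg_I_mul_mul, mul_add,
      add_mul, mul_one]
    refine add_le_add ?_ ?_
    · calc _ ≤ 1 * Real.exp ((|xs.1| + x.1) * liftedHeight Y B s) * E *
            ‖modalQuot k h η ε xs ξ‖ := by
            refine mul_le_mul_of_nonneg_right ?_ (norm_nonneg _)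
            refine mul_le_mul ?_ a1 (norm_nonneg _) (by positivity)
            exact mul_le_mul h6 e1 (Real.exp_nonneg _) zero_le_one
        _ = _ := by ring
    · rw [mul_assoc]
      exact (mul_le_of_le_one_left (by positivity) h6).trans a2

/-! ### The deformation of the path -/

/-- One unit of the exponent pays for integrability along the hyperbola, which rises linearly; the
rest is estimated by the lowest height Y. This is the origin of the condition |x₁*| + x₁ < -1 and of
the decay of the remainder. -/
theorem integrable_totalIntegrand_lifted {k h : ℝ} (hk : 0 < k) (hh : 0 < h) {η : ℝ → ℝ}
    (hη : IsAdmissiblePath η) {ε : ℝ} (hε : IsAdmissibleShift k h η ε) {xs : ℝ × ℝ}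
    (hxs : -h < xs.2) {Y B : ℝ} (hY : 0 < Y) (hB0 : 0 < B)
    (hYn : ∀ n : ℕ, k < modeMu h n → k ^ 2 + Y ^ 2 < modeMu h n ^ 2)
    (hB : ∀ s, |deriv η s| ≤ B) :
    ∃ C : ℝ, 0 ≤ C ∧ ∀ x : ℝ × ℝ, x.2 ∈ Set.Icc (-h) 0 → |xs.1| + x.1 < -1 →
      MeasureTheory.Integrable (fun s => totalIntegrand k h η ε xs x
        (pathPoint (liftedHeight Y B) s) * pathVel (liftedHeight Y B) s) ∧
      ‖∫ s, totalIntegrand k h η ε xs x (pathPoint (liftedHeight Y B) s) *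
        pathVel (liftedHeight Y B) s‖ ≤ C * Real.exp (-(Y * -(|xs.1| + x.1 + 1))) := by
  obtain ⟨C, hC0, hC⟩ := exists_bound_totalIntegrand_lifted hk hh hη hε hxs hY hYn hB
  have hcd := contDiff_liftedHeight hY B
  have hcV := hcd.continuous
  have hint : MeasureTheory.Integrable fun s : ℝ => Real.exp (-liftedHeight Y B s) := by
    have h1 : MeasureTheory.Integrable fun s : ℝ => ((Real.exp (-liftedHeight Y B s) : ℝ) : ℂ) := by
      refine integrable_of_mul_sq_le (T := 1) (C := 4 / B ^ 2) (by fun_prop) fun s hs => ?_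
      rw [Complex.norm_real, Real.norm_of_nonneg (Real.exp_nonneg _)]
      have hs0 : 0 < |B * s| := by
        rw [abs_mul, abs_of_pos hB0]; exact mul_pos hB0 (by linarith)
      have h2 : Real.exp (-liftedHeight Y B s) ≤ 4 / |B * s| ^ 2 :=
        (Real.exp_le_exp.2 (neg_le_neg (abs_le_liftedHeight Y B s))).trans (exp_neg_le_inv_sq hs0)
      refine (mul_le_mul_of_nonneg_right h2 (sq_nonneg s)).trans (le_of_eq ?_)
      have : s ≠ 0 := by
        rintro rfl; simp at hs0
      rw [sq_abs]
      field_simp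
    exact h1.re
  refine ⟨(1 + B) * C * ∫ s : ℝ, Real.exp (-liftedHeight Y B s),
    mul_nonneg (by positivity) (MeasureTheory.integral_nonneg fun s => Real.exp_nonneg _),
    fun x hx hx1 => ?_⟩
  have hcont : Continuous fun s => totalIntegrand k h η ε xs x (pathPoint (liftedHeight Y B) s) *
      pathVel (liftedHeight Y B) s :=
    (continuous_iff_continuousAt.2 fun s => ContinuousAt.comp (g := totalIntegrand k h η ε xs x)
      (analyticAt_totalIntegrand (analyticAt_modalQuot_lifted hk hh hη hε hxs hY hYn hB s)
        x).continuousAt (continuous_pathPoint hcV).continuousAt).mul (continuous_pathVel hcd)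
  have hbd : ∀ s, ‖totalIntegrand k h η ε xs x (pathPoint (liftedHeight Y B) s) *
      pathVel (liftedHeight Y B) s‖ ≤
      (1 + B) * C * Real.exp (-(Y * -(|xs.1| + x.1 + 1))) * Real.exp (-liftedHeight Y B s) := by
    intro s
    rw [norm_mul]
    calc _ ≤ C * Real.exp ((|xs.1| + x.1) * liftedHeight Y B s) * (1 + B) := by
          refine mul_le_mul (hC x hx s) ((norm_pathVel_le _ s).trans ?_) (norm_nonneg _)
            (by positivity)
          linarith [abs_deriv_liftedHeight_le hY hB0.le s]
      _ ≤ C * (Real.exp (-(Y * -(|xs.1| + x.1 + 1))) * Real.exp (-liftedHeight Y B s)) *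
            (1 + B) := by
          refine mul_le_mul_of_nonneg_right (mul_le_mul_of_nonneg_left ?_ hC0) (by positivity)
          rw [← Real.exp_add]
          apply Real.exp_le_exp.2
          -- The coefficient |x₁*| + x₁ + 1 is negative, so the height may be replaced by its
          -- minimum Y.
          have := mul_le_mul_of_nonpos_left (le_liftedHeight Y B s)
            (by linarith : |xs.1| + x.1 + 1 ≤ 0)
          linarith
      _ = _ := by ring
  have hI := hint.const_mul ((1 + B) * C * Real.exp (-(Y * -(|xs.1| + x.1 + 1))))
  refine ⟨hI.mono' hcont.aestronglyMeasurable (Eventually.of_forall hbd), ?_⟩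
  refine (MeasureTheory.norm_integral_le_of_norm_le hI (Eventually.of_forall hbd)).trans
    (le_of_eq ?_)
  rw [MeasureTheory.integral_const_mul]
  ring

theorem hasSimplePole_totalIntegrand {k h : ℝ} (hk : 0 < k) (hh : 0 < h) {η : ℝ → ℝ}
    (hη : IsAdmissiblePath η) {ε : ℝ} (hε : IsAdmissibleShift k h η ε) {xs : ℝ × ℝ}
    (hxs : -h < xs.2) {Y B : ℝ} (hY : 0 < Y)
    (hYn : ∀ n : ℕ, k < modeMu h n → k ^ 2 + Y ^ 2 < modeMu h n ^ 2)
    {r : ℂ → ℂ} (hr : ∀ m ∈ Finset.Icc 1 (numModes k h),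
      HasSimplePole (modalQuot k h η ε xs) (modeXi k h m) (r (modeXi k h m)))
    (x : ℝ × ℝ) {ξ : ℂ} (hξ : ξ ∈ sweptRegion η ε Y B) :
    HasSimplePole (totalIntegrand k h η ε xs x) ξ
      (if ξ ∈ (Finset.Icc 1 (numModes k h)).image (fun m => (modeXi k h m : ℂ)) then
        1 / (2 * Real.pi) * Complex.exp (-(Complex.I * ξ * x.1)) * stripSinc k (h + x.2) ξ * r ξ
      else 0) := by
  split_ifs with hS
  · obtain ⟨m, hm, rfl⟩ := Finset.mem_image.1 hS
    exact (hr m hm).totalIntegrand x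
  · by_cases h0 : stripSinc k h ξ = 0
    · rcases stripSinc_zero_cases hk hh hη hε hY hYn hξ h0 with ⟨n, hn, he⟩ | ⟨h1, h2⟩
      · exact absurd (Finset.mem_image.2 ⟨n, hn, he.symm⟩) hS
      · have := (hasSimplePole_modalQuot_of_neg_im hk hh hη hε hxs h1 h2).totalIntegrand x
        rwa [mul_zero] at this
    · exact HasSimplePole.of_analyticAt
        (analyticAt_totalIntegrand (analyticAt_modalQuot hk hh hη hε hxs hξ.1 h0) x)

/-- For ξ_m = 0 this needs ε > 0: the displacement to the left is what puts the double zero at the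
origin strictly above the path. -/
theorem shiftPath_modeXi_neg {k h : ℝ} (hk : 0 < k) (hh : 0 < h) {η : ℝ → ℝ}
    (hη : IsAdmissiblePath η) {ε : ℝ} (hε : IsAdmissibleShift k h η ε) {m : ℕ}
    (hm : m ∈ Finset.Icc 1 (numModes k h)) : shiftPath η (-ε) (modeXi k h m) < 0 := by
  have hnn : 0 ≤ modeXi k h m := Real.sqrt_nonneg _
  refine shiftPath_neg hη ?_
  rcases hnn.eq_or_lt with h0 | h0
  · have := hε.pos (critical_of_modeXi_eq_zero hk hh hm h0.symm).2
    linarith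
  · linarith [hε.nonneg]

/-- The sides of the deformation rectangle do not contribute in the limit. -/
theorem tendsto_vert_totalIntegrand {k h : ℝ} (hk : 0 < k) (hh : 0 < h) {η : ℝ → ℝ}
    (hη : IsAdmissiblePath η) {ε : ℝ} (hε : IsAdmissibleShift k h η ε) {xs : ℝ × ℝ}
    (hxs : -h < xs.2) {Y B : ℝ} (hB : ∀ s, |deriv η s| ≤ B) {x : ℝ × ℝ}
    (hx : x.2 ∈ Set.Icc (-h) 0) (hx1 : |xs.1| + x.1 < -1) {l : Filter ℝ}
    (hl : Tendsto (fun s : ℝ => |s|) l atTop) :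
    Tendsto (vert (shiftPath η (-ε)) (liftedHeight Y B) (totalIntegrand k h η ε xs x)) l
      (𝓝 0) := by
  obtain ⟨H, hH⟩ := (hη.good.shift (-ε)).bounded
  obtain ⟨M, T, hM0, hT1, -, hM⟩ := exists_bound_totalIntegrand hk hh hη hε hxs
  have hH0 : 0 ≤ H := (abs_nonneg _).trans (hH 0)
  set D := Real.exp (H * (|xs.1| + |x.1|)) with hD
  have hlim1 : Tendsto (fun s : ℝ => (1 + s) ^ (-(1 / 2) : ℝ)) atTop (𝓝 0) :=
    (tendsto_rpow_neg_atTop (by norm_num : (0 : ℝ) < 1 / 2)).comp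
      (tendsto_atTop_add_const_left _ 1 tendsto_id)
  have hlim2 : Tendsto (fun s : ℝ => 2 / s) atTop (𝓝 0) := tendsto_id.const_div_atTop 2
  have hlim : Tendsto (fun s : ℝ => (M * (1 + |s|) ^ (-(1 / 2) : ℝ) + 2 / |s|) * D) l (𝓝 0) := by
    have := ((((hlim1.comp hl).const_mul M).add (hlim2.comp hl)).mul_const D)
    simpa using this
  refine squeeze_zero_norm' ?_ hlim
  filter_upwards [hl.eventually_ge_atTop T] with s hs
  rw [← div_one ((M * (1 + |s|) ^ (-(1 / 2) : ℝ) + 2 / |s|) * D)]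
  have hs0 : 0 < |s| := by linarith
  refine norm_vert_le_of_exp (σ := 1) (ψ := liftedHeight Y B s - shiftPath η (-ε) s) abs_one one_pos
    (by positivity) (sub_nonneg.2 (shiftPath_le_liftedHeight hη hε hB Y s)) (by ring)
    fun u hu _ => ?_
  set ξ : ℂ := s + Complex.I * ((shiftPath η (-ε) s + 1 * u : ℝ) : ℂ) with hξ
  have hre : ξ.re = s := by simp [hξ]
  have him : ξ.im = shiftPath η (-ε) s + u := by simp [hξ]
  have h1 := hM x hx ξ (by rwa [hre]) (by rw [hre, him]; linarith)
  rw [hre] at h1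
  refine h1.trans ?_
  rw [mul_assoc]
  refine mul_le_mul_of_nonneg_left ?_ (by positivity)
  rw [hD, ← Real.exp_add]
  apply Real.exp_le_exp.2
  have hHs := hH s
  have hxneg : x.1 < 0 := by linarith [abs_nonneg xs.1]
  have h2 : |ξ.im| ≤ H + u := by
    rw [him]
    refine (abs_add_le _ _).trans ?_
    rw [abs_of_nonneg hu]; linarith
  have h3 : |xs.1| * |ξ.im| ≤ |xs.1| * (H + u) := mul_le_mul_of_nonneg_left h2 (abs_nonneg _)
  have h4 : shiftPath η (-ε) s * x.1 ≤ H * |x.1| := by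
    rw [abs_of_neg hxneg]
    nlinarith [(abs_le.1 hHs).1]
  have h5 : (|xs.1| + x.1) * u ≤ -1 * u := mul_le_mul_of_nonneg_right hx1.le hu
  rw [him] at h3 ⊢
  rw [add_mul]
  linarith

theorem two_pi_I_mul_residue {k h : ℝ} (hk : 0 < k) (hh : 0 < h) {m : ℕ}
    (hm : m ∈ Finset.Icc 1 (numModes k h)) (x : ℝ × ℝ) (r : ℂ) :
    2 * Real.pi * Complex.I * (1 / (2 * Real.pi) *
      Complex.exp (-(Complex.I * modeXi k h m * x.1)) * stripSinc k (h + x.2) (modeXi k h m) * r) =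
    Complex.I * Real.cos (m * Real.pi) / modeMu h m * r * guidedMode k h m x := by
  have hπ : (Real.pi : ℂ) ≠ 0 := by exact_mod_cast Real.pi_ne_zero
  rw [stripSinc_modeXi hk hh hm, sin_modeMu_mul_add hh, guidedMode, Complex.ofReal_mul]
  field_simp

/-- The residue theorem is applied between the displaced path and the hyperbola over [-R, R]. The
integral over the hyperbola converges absolutely and the sides vanish in the limit. -/
theorem tendsto_truncatedIntegral_totalIntegrand {k h : ℝ} (hk : 0 < k) (hh : 0 < h) {η : ℝ → ℝ}
    (hη : IsAdmissiblePath η) {ε : ℝ} (hε : IsAdmissibleShift k h η ε) {xs : ℝ × ℝ}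
    (hxs : -h < xs.2) {Y B : ℝ} (hY : 0 < Y)
    (hYn : ∀ n : ℕ, k < modeMu h n → k ^ 2 + Y ^ 2 < modeMu h n ^ 2)
    (hB : ∀ s, |deriv η s| ≤ B) {ρ : ℕ → ℂ} (hρ : ∀ m ∈ Finset.Icc 1 (numModes k h),
      HasSimplePole (modalQuot k h η ε xs) (modeXi k h m) (ρ m))
    {x : ℝ × ℝ} (hx : x.2 ∈ Set.Icc (-h) 0) (hx1 : |xs.1| + x.1 < -1)
    (hint : MeasureTheory.Integrable (fun s => totalIntegrand k h η ε xs x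
        (pathPoint (liftedHeight Y B) s) * pathVel (liftedHeight Y B) s)) :
    Tendsto (truncatedIntegral (shiftPath η (-ε)) (totalIntegrand k h η ε xs x)) atTop
      (𝓝 ((∫ s, totalIntegrand k h η ε xs x (pathPoint (liftedHeight Y B) s) *
          pathVel (liftedHeight Y B) s) +
        ∑ m ∈ Finset.Icc 1 (numModes k h),
          Complex.I * Real.cos (m * Real.pi) / modeMu h m * ρ m * guidedMode k h m x)) := by
  set I₀ := Finset.Icc 1 (numModes k h) with hI₀
  have hinj := injOn_modeXi hk hh (h := h)
  -- Residues have to be indexed by poles, while ρ is indexed by modes; the points ξ_m are distinct,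
  -- so the mode can be recovered from the pole.
  set r : ℂ → ℂ := fun p => ρ (Function.invFunOn (fun m : ℕ => (modeXi k h m : ℂ)) I₀ p) with hrdef
  have hr : ∀ m ∈ I₀, r (modeXi k h m) = ρ m := fun m hm => by
    simp only [hrdef]
    rw [hinj.leftInvOn_invFunOn (Finset.mem_coe.2 hm)]
  set S := I₀.image fun m => (modeXi k h m : ℂ) with hS
  set q : ℂ → ℂ := fun ξ =>
    1 / (2 * Real.pi) * Complex.exp (-(Complex.I * ξ * x.1)) * stripSinc k (h + x.2) ξ * r ξ with hq
  have hsum : 2 * Real.pi * Complex.I * ∑ p ∈ S, q p = ∑ m ∈ I₀,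
      Complex.I * Real.cos (m * Real.pi) / modeMu h m * ρ m * guidedMode k h m x := by
    rw [hS, Finset.sum_image hinj, Finset.mul_sum]
    refine Finset.sum_congr rfl fun m hm => ?_
    simp only [hq]
    rw [hr m hm, two_pi_I_mul_residue hk hh hm]
  have hkey : ∀ᶠ R in atTop, truncatedIntegral (shiftPath η (-ε)) (totalIntegrand k h η ε xs x) R =
      truncatedIntegral (liftedHeight Y B) (totalIntegrand k h η ε xs x) R +
        2 * Real.pi * Complex.I * ∑ p ∈ S, q p -
        (vert (shiftPath η (-ε)) (liftedHeight Y B) (totalIntegrand k h η ε xs x) R -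
          vert (shiftPath η (-ε)) (liftedHeight Y B) (totalIntegrand k h η ε xs x) (-R)) := by
    -- With R > k all the ξ_m lie between the sides, and no zero of the denominator lies on them.
    filter_upwards [eventually_gt_atTop k] with R hR
    have hR0 : 0 < R := hk.trans hR
    have hside : ∀ s v : ℝ, |s| = R → shiftPath η (-ε) s ≤ v →
        ContinuousAt (totalIntegrand k h η ε xs x) (s + Complex.I * v) := by
      intro s v hs hv
      have hre : ((s : ℂ) + Complex.I * v).re = s := by simp
      refine (analyticAt_totalIntegrand (analyticAt_modalQuot hk hh hη hε hxs ?_ ?_) x).continuousAt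
      · simpa using hv
      · exact stripSinc_ne_zero_of_kernel (kernel_ne_zero_of_lt_abs_re hk hh (by rw [hre, hs]; exact hR))
    have := integral_graph_sub_residues (f := totalIntegrand k h η ε xs x)
      (hη.good.shift (-ε)).smooth (contDiff_liftedHeight hY B) (by linarith : -R ≤ R)
      (fun s _ => shiftPath_le_liftedHeight hη hε hB Y s) S q ?_ ?_ ?_ ?_ ?_ ?_
    · rw [truncatedIntegral, truncatedIntegral]
      linear_combination -this
    · intro p hp
      obtain ⟨m, hm, rfl⟩ := Finset.mem_image.1 hp
      have hnn : 0 ≤ modeXi k h m := Real.sqrt_nonneg _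
      obtain ⟨m1, m2⟩ := (mem_modes_iff hk hh).1 hm
      have hle : modeXi k h m ≤ k := by
        have := modeXi_sq hh m1 m2
        nlinarith [sq_nonneg (modeMu h m)]
      rw [Complex.ofReal_re, Complex.ofReal_im]
      exact ⟨by linarith, by linarith, shiftPath_modeXi_neg hk hh hη hε hm,
        hY.trans_le (le_liftedHeight Y B _)⟩
    · intro ξ _ h1 h2
      exact hasSimplePole_totalIntegrand hk hh hη hε hxs hY hYn (B := B)
        (fun m hm => by rw [hr m hm]; exact hρ m hm) x ⟨h1, h2⟩
    · exact fun s _ => (analyticAt_totalIntegrand (analyticAt_modalQuot hk hh hη hε hxs (by simp)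
        (stripSinc_ne_zero_of_kernel (hε.kernel_left_ne_zero s))) x).continuousAt
    · exact fun s _ => (analyticAt_totalIntegrand
        (analyticAt_modalQuot_lifted hk hh hη hε hxs hY hYn hB s) x).continuousAt
    · exact fun v hv => hside (-R) v (by rw [abs_neg, abs_of_pos hR0]) hv.1
    · exact fun v hv => hside R v (abs_of_pos hR0) hv.1
  have hv1 := tendsto_vert_totalIntegrand hk hh hη hε hxs (Y := Y) hB hx hx1
    tendsto_abs_atTop_atTop
  have hv2 := (tendsto_vert_totalIntegrand hk hh hη hε hxs (Y := Y) hB hx hx1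
    tendsto_abs_atBot_atTop).comp tendsto_neg_atTop_atBot
  have hlim := ((tendsto_truncatedIntegral hint).add_const
    (2 * Real.pi * Complex.I * ∑ p ∈ S, q p)).sub (hv1.sub hv2)
  rw [sub_zero, sub_zero, hsum] at hlim
  refine hlim.congr' ?_
  filter_upwards [hkey] with R hR
  rw [hR, hsum]
  rfl

/-- Each integral is a limit over symmetric truncations, so the limits add although the integrals
need not converge absolutely. On the path the kernel does not vanish, and the merged integrand is
the sum of the two. -/
theorem tendsto_green {k h : ℝ} (hk : 0 < k) (hh : 0 < h) {η : ℝ → ℝ}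
    (hη : IsAdmissiblePath η) {ε : ℝ} (hε : IsAdmissibleShift k h η ε) {xs : ℝ × ℝ}
    (hxs : -h < xs.2) {x : ℝ × ℝ} (hx : x.2 ∈ Set.Icc (-h) 0) (hx1 : x.1 < 0) (hne : x ≠ xs) :
    Tendsto (truncatedIntegral (shiftPath η (-ε)) (totalIntegrand k h η ε xs x)) atTop
      (𝓝 (green k h η ε xs x)) := by
  have hs := pathIntegralConverges_scattered hk hh hη hε hxs hx1 hx
  have hs' := tendsto_nhds_limUnder hs
  have heq : ∀ s, totalIntegrand k h η ε xs x (pathPoint (shiftPath η (-ε)) s) =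
      scatteredIntegrand k h η ε xs x (pathPoint (shiftPath η (-ε)) s) +
      if xs.2 < 0 then incidentIntegrand k h xs x (pathPoint (shiftPath η (-ε)) s) else 0 :=
    fun s => totalIntegrand_eq (hε.kernel_left_ne_zero s)
  by_cases hy : xs.2 < 0
  · have hi := pathIntegralConverges_incident hk hh hη hε ⟨hxs.le, hy.le⟩ hx hne
    have hi' := tendsto_nhds_limUnder hi
    rw [green, if_neg (not_le.2 hy)]
    refine (hs'.add hi').congr fun R => ?_
    rw [truncatedIntegral, truncatedIntegral, truncatedIntegral]
    have hη' := hη.good.shift (-ε)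
    have hc : ∀ f : ℂ → ℂ, (∀ s, ContinuousAt f (pathPoint (shiftPath η (-ε)) s)) →
        IntervalIntegrable (fun s => f (pathPoint (shiftPath η (-ε)) s) *
          pathVel (shiftPath η (-ε)) s) MeasureTheory.volume (-R) R := fun f hf =>
      ((continuous_iff_continuousAt.2 fun s => ContinuousAt.comp (g := f) (hf s)
        (continuous_pathPoint hη'.smooth.continuous).continuousAt).mul
          (continuous_pathVel hη'.smooth)).intervalIntegrable _ _
    rw [← intervalIntegral.integral_add
      (hc _ fun s => (analyticAt_scatteredIntegrand x (analyticAt_fHat_left hk hh hη hε hxs s)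
        (eventually_kernel_ne_zero_left hk hh hη hε s)).continuousAt)
      (hc _ fun s => (analyticAt_incidentIntegrand xs x
        (eventually_kernel_ne_zero_left hk hh hη hε s)).continuousAt)]
    refine intervalIntegral.integral_congr fun s _ => ?_
    simp only [heq s, if_pos hy]
    ring
  · rw [green, if_pos (not_lt.1 hy)]
    refine hs'.congr fun R => ?_
    rw [truncatedIntegral, truncatedIntegral]
    refine intervalIntegral.integral_congr fun s _ => ?_
    simp only [heq s, if_neg hy, add_zero]

theorem exp_neg_le_pow {Y : ℝ} (hY : 0 < Y) (N : ℕ) {t : ℝ} (ht : 0 < t) :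
    Real.exp (-(Y * t)) ≤ N.factorial / Y ^ N * t ^ (-(N : ℤ)) := by
  have h1 := Real.pow_div_factorial_le_exp (Y * t) (by positivity) N
  rw [div_le_iff₀ (by positivity), mul_pow] at h1
  rw [Real.exp_neg, zpow_neg, zpow_natCast, div_mul_eq_mul_div, le_div_iff₀ (by positivity),
    inv_mul_le_iff₀ (Real.exp_pos _), ← div_eq_mul_inv, ← mul_div_assoc, le_div_iff₀ (by positivity)]
  linarith

/-- The remainder decays exponentially, with a rate that does not depend on the height. -/
theorem exists_bound_green_sub {k h : ℝ} (hk : 0 < k) (hh : 0 < h) {η : ℝ → ℝ}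
    (hη : IsAdmissiblePath η) {ε : ℝ} (hε : IsAdmissibleShift k h η ε) {xs : ℝ × ℝ}
    (hxs : -h < xs.2) {ρ : ℕ → ℂ} (hρ : ∀ m ∈ Finset.Icc 1 (numModes k h),
      HasSimplePole (modalQuot k h η ε xs) (modeXi k h m) (ρ m)) :
    ∃ C Y : ℝ, 0 ≤ C ∧ 0 < Y ∧ ∀ x : ℝ × ℝ, x.2 ∈ Set.Icc (-h) 0 → |xs.1| + x.1 < -1 →
      ‖green k h η ε xs x - ∑ m ∈ Finset.Icc 1 (numModes k h),
        Complex.I * Real.cos (m * Real.pi) / modeMu h m * ρ m * guidedMode k h m x‖ ≤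
      C * Real.exp (-(Y * |x.1|)) := by
  obtain ⟨Y, hY, hYn⟩ := exists_gap hk hh
  obtain ⟨B, hB⟩ := hη.bounded_deriv
  -- A strictly positive slope makes the hyperbola rise, also when the slope bound of η alone would
  -- not ensure it.
  have hB' : ∀ s, |deriv η s| ≤ max B 1 := fun s => (hB s).trans (le_max_left _ _)
  obtain ⟨C, hC0, hC⟩ := integrable_totalIntegrand_lifted hk hh hη hε hxs hY
    (lt_max_of_lt_right one_pos) hYn hB'
  refine ⟨C * Real.exp (Y * (|xs.1| + 1)), Y, by positivity, hY, fun x hx hx1 => ?_⟩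
  obtain ⟨hi, hb⟩ := hC x hx hx1
  have hxneg : x.1 < 0 := by linarith [abs_nonneg xs.1]
  have hne : x ≠ xs := by
    rintro rfl
    linarith [neg_abs_le x.1, abs_nonneg x.1]
  have hlim := tendsto_truncatedIntegral_totalIntegrand hk hh hη hε hxs hY hYn hB' hρ hx hx1 hi
  rw [tendsto_nhds_unique (tendsto_green hk hh hη hε hxs hx hxneg hne) hlim, add_sub_cancel_right]
  refine hb.trans (le_of_eq ?_)
  rw [mul_assoc, ← Real.exp_add, abs_of_neg hxneg]
  congr 2
  ring

end CrackedHalfPlane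

end

/-! ### The theorem -/

open CrackedHalfPlane in
theorem mainTheorem8 (k h : ℝ) (hk : 0 < k) (hh : 0 < h)
    (η : ℝ → ℝ) (hη : IsAdmissiblePath η) (ε : ℝ) (hε : IsAdmissibleShift k h η ε)
    (xs : ℝ × ℝ) (hxs : xs ∈ domain h) :
    (∀ x₁ < (0 : ℝ), ∀ x₂ ∈ Set.Icc (-h) 0, (x₁, x₂) ≠ xs →
      PathIntegralConverges (shiftPath η (-ε)) (scatteredIntegrand k h η ε xs (x₁, x₂)) ∧
      (xs.2 < 0 →
        PathIntegralConverges (shiftPath η (-ε)) (incidentIntegrand k h xs (x₁, x₂)))) ∧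
    ∃ c : ℕ → ℂ,
      (∀ m ∈ Finset.Icc 1 (numModes k h), 0 < modeXi k h m →
        c m = modeMu h m / (Complex.I * h * modeXi k h m) * fHat k h η ε xs (modeXi k h m) +
          if xs.2 < 0 then
            Complex.I / (h * modeXi k h m) * Real.sin (modeMu h m * xs.2) *
              Complex.exp (Complex.I * modeXi k h m * xs.1)
          else 0) ∧
      (∀ m ∈ Finset.Icc 1 (numModes k h), modeXi k h m = 0 →
        Tendsto
          (fun ξ : ℂ => 2 * modeMu h m / (Complex.I * h) * deriv (fHat k h η ε xs) ξ -
            if xs.2 < 0 then (2 / h * xs.1 * Real.sin (modeMu h m * xs.2) : ℂ) else 0)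
          (𝓝[≠] (0 : ℂ)) (𝓝 (c m))) ∧
      ∀ N : ℕ, ∃ C X : ℝ, 0 < X ∧ ∀ x₁ < -X, ∀ x₂ ∈ Set.Icc (-h) 0,
        ‖green k h η ε xs (x₁, x₂) -
            ∑ m ∈ Finset.Icc 1 (numModes k h), c m * guidedMode k h m (x₁, x₂)‖ ≤
          C * |x₁| ^ (-(N : ℤ)) := by
  have hy : -h < xs.2 := hxs.1
  refine ⟨fun x₁ hx₁ x₂ hx₂ hne => ⟨pathIntegralConverges_scattered hk hh hη hε hy hx₁ hx₂,
    fun hneg => pathIntegralConverges_incident hk hh hη hε ⟨hy.le, hneg.le⟩ hx₂ hne⟩, ?_⟩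
  -- The residues are chosen once for all modes, independently of x and of the power N.
  choose! ρ hρ hpos hzero using
    fun m (hm : m ∈ Finset.Icc 1 (numModes k h)) => exists_residue_modalQuot hk hh hη hε hy hm
  refine ⟨fun m => Complex.I * Real.cos (m * Real.pi) / modeMu h m * ρ m, hpos, hzero,
    fun N => ?_⟩
  obtain ⟨C, Y, hC, hY, hbound⟩ := exists_bound_green_sub hk hh hη hε hy hρ
  -- The abscissa guarantees |x₁*| + x₁ < -1; the constant comes from (Yt)^N / N! ≤ e^{Yt}.
  refine ⟨C * (N.factorial / Y ^ N), |xs.1| + 1, by positivity, fun x₁ hx₁ x₂ hx₂ => ?_⟩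
  have hx₁0 : x₁ < 0 := by linarith [abs_nonneg xs.1]
  refine (hbound (x₁, x₂) hx₂ (by linarith)).trans ?_
  rw [mul_assoc]
  exact mul_le_mul_of_nonneg_left (exp_neg_le_pow hY N (abs_pos.2 hx₁0.ne)) hC
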